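/- Let $n\in\{2,3\}$ and $m=n-1$. On open sets of $\mathbb R^{n}$ use coordinates $z=(x,u)$ if $n=2$ and $z=(x,y,u)$ if $n=3$, with $u$ the dependent variable. A *simply transitive realization* of an $n$-dimensional real Lie algebra $\mathfrak g$ on an open set $Z\subseteq\mathbb R^n$ is a family of smooth vector fields $X_1,\dots,X_n$ on $Z$ that are linearly independent at every point and satisfy $[X_i,X_j]=C_{ij}^kX_k$, where $C_{ij}^k$ are the structure constants of $\mathfrak g$. Let $X^{(1)},X^{(2)}$ denote the first and second prolongations of $X$ to the jet spaces with coordinates $(z,u_i)$ and $(z,u_i,u_{ij})$. A *differential invariant* of order at most $k\in\{1,2\}$ is a smooth function $F$ on an open set of $k$-jets with $X_i^{(k)}F=0$ for all $i$. A *quasi-linear second-order equation* over an open set $D$ of first-order jets is $E=\sum_{i\le j}A^{ij}(z,u_k)u_{ij}+c(z,u_k)=0$ with $A^{ij},c$ smooth on $D$ and the $A^{ij}$ not all zero at any point of $D$. It is *invariant* under the $X_i$ if $X_i^{(2)}E=0$ wherever $E=0$. Consider the following rows. Each lists the non-zero brackets; the generators $X_i$; the invariants $v_a$; the invariants $v_{ij}$;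 the equation. Unless stated otherwise the domain is all of $\mathbb R^n$. **$n=2$.** * $2\mathfrak g^1$: abelian; $X_1=\partial_x$, $X_2=\partial_u$; $u_x$; $u_{xx}$; $a_0u_{xx}+b=0$. * $\mathfrak g^2$: $[e_1,e_2]=e_1$; $X_1=\partial_x$, $X_2=x\partial_x+\partial_u$; $e^uu_x$; $e^{2u}u_{xx}$; $a_0u_{xx}+e^{-2u}b=0$. **$n=3$.** * $3\mathfrak g^1$: abelian; $\partial_x,\partial_y,\partial_u$; $u_x,u_y$; $u_{xx},u_{xy},u_{yy}$; $a_0u_{xx}+a_1u_{xy}+a_2u_{yy}+b=0$. * $\mathfrak g^1+\mathfrak g^2$: $[e_1,e_2]=e_1$; $\partial_x$, $x\partial_x+\partial_y$, $\partial_u$; $e^yu_x,u_y$; $e^{2y}u_{xx},e^yu_{xy},u_{yy}$; $a_0u_{xx}+e^{-y}a_1u_{xy}+e^{-2y}a_2u_{yy}+e^{-2y}b=0$. * $\mathfrak g^3_1$: $[e_2,e_3]=e_1$; $\partial_u$, $\partial_x$, $\partial_y+x\partial_u$; $u_x-y,u_y$; $u_{xx},u_{xy},u_{yy}$; $a_0u_{xx}+a_1u_{xy}+a_2u_{yy}+b=0$.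 * $\mathfrak g^3_2$: $[e_1,e_3]=e_1$, $[e_2,e_3]=e_1+e_2$; $\partial_u$, $\partial_y$, $\partial_x+y\partial_y+(y+u)\partial_u$; $e^{-x}u_x,u_y-x$; $e^{-x}u_{xx},u_{xy},e^xu_{yy}$; $a_0e^{-x}u_{xx}+a_1u_{xy}+a_2e^{x}u_{yy}+b=0$. * $\mathfrak g^3_3$: $[e_1,e_3]=e_1$, $[e_2,e_3]=e_2$; $\partial_x$, $\partial_y$, $x\partial_x+y\partial_y+\partial_u$; $e^uu_x,e^uu_y$; $e^{2u}u_{xx},e^{2u}u_{xy},e^{2u}u_{yy}$; $a_0u_{xx}+a_1u_{xy}+a_2u_{yy}+e^{-2u}b=0$. * $\mathfrak g^3_4$ ($|h|\le1$, $h\ne0,1$): $[e_1,e_3]=e_1$, $[e_2,e_3]=he_2$; $\partial_x$, $\partial_y$, $x\partial_x+hy\partial_y+\partial_u$; $e^uu_x,e^{hu}u_y$; $e^{2u}u_{xx},e^{(1+h)u}u_{xy},e^{2hu}u_{yy}$; $a_0u_{xx}+e^{(h-1)u}a_1u_{xy}+e^{2(h-1)u}a_2u_{yy}+e^{-2u}b=0$.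 * $\mathfrak g^3_5$ ($p\ge0$): $[e_1,e_3]=pe_1-e_2$, $[e_2,e_3]=pe_2+e_1$; $\partial_x$, $\partial_y$, $(px+y)\partial_x+(py-x)\partial_y+\partial_u$; $e^{pu}(u_x\cos u-u_y\sin u)$, $e^{pu}(u_x\sin u+u_y\cos u)$; $e^{2pu}(u_{xx}+u_{yy})$, $e^{2pu}\big((u_{xx}-u_{yy})\cos2u-2u_{xy}\sin2u\big)$, $e^{2pu}\big((u_{xx}-u_{yy})\sin2u+2u_{xy}\cos2u\big)$; $a_0(u_{xx}+u_{yy})+e^{-2pu}b+a_1\big((u_{xx}-u_{yy})\cos2u-2u_{xy}\sin2u\big)+a_2\big((u_{xx}-u_{yy})\sin2u+2u_{xy}\cos2u\big)=0$. * $\mathfrak g^3_6$: $[e_1,e_2]=e_1$, $[e_1,e_3]=2e_2$, $[e_2,e_3]=e_3$; $\partial_x$, $x\partial_x+\partial_y$, $x^2\partial_x+2x\partial_y+e^y\partial_u$; $e^yu_x+u_y^2$, $u_y-u$; $u_{yy}-u$, $e^yu_{xy}+2uu_{yy}-u^2$, $e^{2y}u_{xx}+2u\big[u(2u_{yy}+u_y-u)+e^y(u_x+2u_{xy})\big]$;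 $a_0\big(e^{2y}u_{xx}+4ue^yu_{xy}+4u^2u_{yy}+2e^yu_xu_y+4uu_y^2-4u^2u_y\big)+a_1(e^yu_{xy}+2uu_{yy}-u^2)+a_2(u_{yy}-u)+b=0$. * $\mathfrak g^3_7$ (domain $\cos y\ne0$): $[e_1,e_2]=e_3$, $[e_2,e_3]=e_1$, $[e_3,e_1]=e_2$; $\partial_x$, $\sin x\tan y\,\partial_x+\cos x\,\partial_y+\frac{\sin x}{\cos y}\partial_u$, $\cos x\tan y\,\partial_x-\sin x\,\partial_y+\frac{\cos x}{\cos y}\partial_u$; $u_x\frac{\cos u}{\cos y}-u_y\sin u-\cos u\tan y$, $u_x\frac{\sin u}{\cos y}+u_y\cos u-\sin u\tan y$; $L$, $M\cos2u+N\sin2u$, $-M\sin2u+N\cos2u$; $a_0L+b+(a_1\cos2u-a_2\sin2u)M+(a_1\sin2u+a_2\cos2u)N=0$, where $L=\frac{u_{xx}}{\cos^2y}+u_{yy}-u_y\tan y$, $M=\frac{u_{xx}}{\cos^2y}-u_{yy}-\frac{2u_xu_y}{\cos y}+u_y\tan y$, $N=-\frac{2u_{xy}}{\cos y}+u_y^2+\frac{1-u_x^2}{\cos^2y}$.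 In each equation the $a_i$ and $b$ are smooth functions of the $v_a$ on an open set of values of the $v_a$, with the $a_i$ not all zero at any point. Then: 1. Every real Lie algebra of dimension $n$ has, in a suitable basis, the brackets of exactly one row (with exactly one value of the parameter, where there is one). 2. In every row: * the $X_i$ form a simply transitive realization of the Lie algebra of the row on the domain of the row; * the $v_a$ are differential invariants of first order and the $v_{ij}$ of second order, the $v_a$ alone and all the $v_a,v_{ij}$ together have linearly independent differentials at every jet over the domain, and near every jet every first-order invariant is a smooth function of the $v_a$ and every invariant of order at most two is a smooth function of the $v_a,v_{ij}$; * every equation of the row is a quasi-linear second-order equation invariant under the $X_i$; * conversely, every quasi-linear second-order equation invariant under the $X_i$ coincides, near every first-order jet at which it is defined, with an equation of the row for suitable $a_i,b$. If $a_0\ne0$ at that jet, it can be taken with $a_0=1$. 3. Let $X_1,\dots,X_n$ be any simply transitive realization of an $n$-dimensional real Lie algebra on a non-empty open set $Z\subseteq\mathbb R^n$. There is exactly one row such that every point of $Z$ has a neighbourhood with a diffeomorphism $\psi$ onto an open subset of the domain of the row with the following two properties. First, $\psi$ takes the span of the $X_i$ onto the span of the generators of the row. Second, let a quasi-linear second-order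 equation over an open set $D$ of first-order jets based in this neighbourhood be invariant under the $X_i$. Then the jets in $D$ at which $\psi$, as a change of dependent and independent variables, takes graphs of functions to graphs of functions are dense in $D$, and near each of them $\psi$ takes the equation to an equation of the row, with $a_0=1$ if $a_0\ne0$ at the image of that jet. -/

import Mathlib

open Real Set Filter Topology
open scoped ContDiff

universe u

noncomputable section

namespace InvPDE

/-! ### Jets of scalar functions of `m` independent variables -/

/-- The space `Z` of independent and dependent variables: points `z = (x, u)`, `dim Z = m + 1`. -/
abbrev Pt (m : ℕ) : Type := (Fin m → ℝ) × ℝ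

/-- First-order jets `((x, u), u_i)`. -/
abbrev J1 (m : ℕ) : Type := Pt m × (Fin m → ℝ)

/-- Second-order jets `(((x, u), u_i), u_{ij})`; the second derivatives are indexed by unordered
pairs, so that `u_{ij}` and `u_{ji}` are one coordinate. -/
abbrev J2 (m : ℕ) : Type := J1 m × (Sym2 (Fin m) → ℝ)

variable {m : ℕ}

/-- The second-order jet `J` is the jet of the function `f` at the point `J.1.1.1`. -/
def HasJet (f : (Fin m → ℝ) → ℝ) (J : J2 m) : Prop :=
  ContDiffAt ℝ ∞ f J.1.1.1 ∧
  f J.1.1.1 = J.1.1.2 ∧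
  (∀ i, fderiv ℝ f J.1.1.1 (Pi.single i 1) = J.1.2 i) ∧
  ∀ i j, fderiv ℝ (fun x => fderiv ℝ f x (Pi.single j 1)) J.1.1.1 (Pi.single i 1) = J.2 s(i, j)

/-- The change of dependent and independent variables `ψ` takes the jet `J` to the jet `J'`: it
takes the graph of a function with jet `J`, near the base point, into the graph of a function
with jet `J'`. -/
def JetTransforms (ψ : Pt m → Pt m) (J J' : J2 m) : Prop :=
  ∃ f g : (Fin m → ℝ) → ℝ, HasJet f J ∧ HasJet g J' ∧ ψ J.1.1 = J'.1.1 ∧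
    ∀ᶠ x in 𝓝 J.1.1.1, (ψ (x, f x)).2 = g (ψ (x, f x)).1

/-! ### Prolongation of vector fields -/

/-- The total derivative `D_i f = ∂f/∂x^i + u_i ∂f/∂u` of a (vector-valued) function on `Z`. -/
def totalD (f : Pt m → Pt m) (i : Fin m) (P : J1 m) : Pt m :=
  fderiv ℝ f P.1 (Pi.single i 1, P.2 i)

/-- The second total derivative `D_i D_j f` of a (vector-valued) function on `Z`. -/
def totalD2 (f : Pt m → Pt m) (i j : Fin m) (J : J2 m) : Pt m :=
  fderiv ℝ (fderiv ℝ f) J.1.1 (Pi.single i 1, J.1.2 i) (Pi.single j 1, J.1.2 j) +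
    J.2 s(i, j) • fderiv ℝ f J.1.1 (0, 1)

/-- First prolongation of `X = ξ^k ∂/∂x^k + θ ∂/∂u`, where `ξ = (X ·).1` and `θ = (X ·).2`:
the coefficient of `∂/∂u_i` is `D_i θ - u_k D_i ξ^k`. -/
def prolong1 (X : Pt m → Pt m) (P : J1 m) : J1 m :=
  (X P.1, fun i => (totalD X i P).2 - ∑ k, P.2 k * (totalD X i P).1 k)

/-- The expression `D_i D_j θ - u_k D_i D_j ξ^k - u_{jk} D_i ξ^k - u_{ik} D_j ξ^k`. -/
def prolongCoeff (X : Pt m → Pt m) (J : J2 m) (i j : Fin m) : ℝ :=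
  (totalD2 X i j J).2 - ∑ k, J.1.2 k * (totalD2 X i j J).1 k
    - ∑ k, J.2 s(j, k) * (totalD X i J.1).1 k
    - ∑ k, J.2 s(i, k) * (totalD X j J.1).1 k

/-- Second prolongation of a vector field. The coefficient of `∂/∂u_{ij}` is `prolongCoeff X J i j`;
that expression is symmetric in `i, j` for a `C^2` field, and it is symmetrized here only to
make it a function of the unordered pair in all cases. -/
def prolong2 (X : Pt m → Pt m) (J : J2 m) : J2 m :=
  (prolong1 X J.1, fun s => Sym2.lift
    ⟨fun i j => (prolongCoeff X J i j + prolongCoeff X J j i) / 2,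
      fun i j => by beta_reduce; rw [add_comm]⟩ s)

/-! ### Lie algebras of vector fields, invariants, invariant equations -/

/-- `[X_i, X_j] = C_{ij}^k X_k` on `Z`. -/
def HasStructure (C : Fin (m + 1) → Fin (m + 1) → Fin (m + 1) → ℝ) (Z : Set (Pt m))
    (X : Fin (m + 1) → Pt m → Pt m) : Prop :=
  ∀ i j, ∀ z ∈ Z, VectorField.lieBracket ℝ (X i) (X j) z = ∑ k, C i j k • X k z

/-- The smooth fields `X_1, …, X_{m+1}` are a basis of the tangent space at each point of the
`(m+1)`-dimensional domain `Z`: they generate a (locally) simply transitive action as soon as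
their span is a Lie algebra. -/
def IsFrame (Z : Set (Pt m)) (X : Fin (m + 1) → Pt m → Pt m) : Prop :=
  (∀ i, ContDiffOn ℝ ∞ (X i) Z) ∧ ∀ z ∈ Z, LinearIndependent ℝ (fun i => X i z)

/-- `F` is a first-order differential invariant of the algebra spanned by the `X_i`. -/
def IsInvariant1 (X : Fin (m + 1) → Pt m → Pt m) (D : Set (J1 m)) (F : J1 m → ℝ) : Prop :=
  ContDiffOn ℝ ∞ F D ∧ ∀ i, ∀ P ∈ D, fderiv ℝ F P (prolong1 (X i) P) = 0

/-- `F` is a second-order differential invariant of the algebra spanned by the `X_i`. -/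
def IsInvariant2 (X : Fin (m + 1) → Pt m → Pt m) (Ω : Set (J2 m)) (F : J2 m → ℝ) : Prop :=
  ContDiffOn ℝ ∞ F Ω ∧ ∀ i, ∀ J ∈ Ω, fderiv ℝ F J (prolong2 (X i) J) = 0

/-- Over the set `D` of first-order jets, `E = 0` is a quasi-linear equation
`∑ A^{ij}(x,u,u_k) u_{ij} + c(x,u,u_k) = 0` with smooth coefficients, genuinely of second order
at each point of `D`. -/
def IsQuasiLinear (D : Set (J1 m)) (E : J2 m → ℝ) : Prop :=
  ∃ (A : J1 m → Sym2 (Fin m) → ℝ) (c : J1 m → ℝ),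
    ContDiffOn ℝ ∞ A D ∧ ContDiffOn ℝ ∞ c D ∧ (∀ P ∈ D, A P ≠ 0) ∧
    ∀ J : J2 m, J.1 ∈ D → E J = ∑ s, A J.1 s * J.2 s + c J.1

/-- The equation `E = 0` over `D` admits the algebra spanned by the `X_i`: the prolonged fields
annihilate `E` on the surface `E = 0`. -/
def IsInvariantEq (X : Fin (m + 1) → Pt m → Pt m) (D : Set (J1 m)) (E : J2 m → ℝ) : Prop :=
  ∀ i, ∀ J : J2 m, J.1 ∈ D → E J = 0 → fderiv ℝ E J (prolong2 (X i) J) = 0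

/-- Arbitrary elements of an invariant equation: smooth functions `a_0, a_1, …` (not all zero at
any point) and `b`, of the first-order invariants, on an open set `V`. -/
def IsCoeffs (V : Set (Fin m → ℝ)) (a : (Fin m → ℝ) → Sym2 (Fin m) → ℝ)
    (b : (Fin m → ℝ) → ℝ) : Prop :=
  IsOpen V ∧ ContDiffOn ℝ ∞ a V ∧ ContDiffOn ℝ ∞ b V ∧ ∀ v ∈ V, a v ≠ 0

/-! ### The tables -/

/-- The rows of the tables: the real Lie algebras of dimension `m + 1 = 2` and `m + 1 = 3`. -/
inductive Row : ℕ → Type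
  /-- `2g¹` -/
  | abelian2 : Row 1
  /-- `g²` -/
  | affine : Row 1
  /-- `3g¹` -/
  | abelian3 : Row 2
  /-- `g¹ + g²` -/
  | g1g2 : Row 2
  /-- `g³₁` -/
  | g31 : Row 2
  /-- `g³₂` -/
  | g32 : Row 2
  /-- `g³₃` -/
  | g33 : Row 2
  /-- `g³₄`, with its parameter `h` -/
  | g34 (h : ℝ) (hh : |h| ≤ 1 ∧ h ≠ 0 ∧ h ≠ 1) : Row 2
  /-- `g³₅`, with its parameter `p` -/
  | g35 (p : ℝ) (hp : 0 ≤ p) : Row 2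
  /-- `g³₆ = sl(2, ℝ)` -/
  | g36 : Row 2
  /-- `g³₇ = so(3)` -/
  | g37 : Row 2

/-- Structure constants in dimension two from `[e₁,e₂]`. -/
def bracket2 (c₁₂ : Fin 2 → ℝ) : Fin 2 → Fin 2 → Fin 2 → ℝ :=
  ![![0, c₁₂], ![-c₁₂, 0]]

/-- Structure constants in dimension three from `[e₁,e₂]`, `[e₁,e₃]`, `[e₂,e₃]`. -/
def bracket3 (c₁₂ c₁₃ c₂₃ : Fin 3 → ℝ) : Fin 3 → Fin 3 → Fin 3 → ℝ :=
  ![![0, c₁₂, c₁₃], ![-c₁₂, 0, c₂₃], ![-c₁₃, -c₂₃, 0]]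

/-- The commutation relations `[e_i, e_j] = C_{ij}^k e_k`. -/
def Row.structConst : {m : ℕ} → Row m → Fin (m + 1) → Fin (m + 1) → Fin (m + 1) → ℝ
  | _, .abelian2 => bracket2 0
  | _, .affine => bracket2 ![1, 0]
  | _, .abelian3 => bracket3 0 0 0
  | _, .g1g2 => bracket3 ![1, 0, 0] 0 0
  | _, .g31 => bracket3 0 0 ![1, 0, 0]
  | _, .g32 => bracket3 0 ![1, 0, 0] ![1, 1, 0]
  | _, .g33 => bracket3 0 ![1, 0, 0] ![0, 1, 0]
  | _, .g34 h _ => bracket3 0 ![1, 0, 0] ![0, h, 0]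
  | _, .g35 p _ => bracket3 0 ![p, -1, 0] ![1, p, 0]
  | _, .g36 => bracket3 ![1, 0, 0] ![0, 2, 0] ![0, 0, 1]
  | _, .g37 => bracket3 ![0, 0, 1] ![0, -1, 0] ![1, 0, 0]

/-- The domain of the realization in the space of the variables `(x, u)` or `(x, y, u)`. -/
def Row.dom : {m : ℕ} → Row m → Set (Pt m)
  | _, .g37 => {z | cos (z.1 1) ≠ 0}
  | _, _ => univ

/-- A vector field `ξ(x,u) ∂_x + θ(x,u) ∂_u`, from its coefficients. -/
def field2 (F : (x u : ℝ) → ℝ × ℝ) (z : Pt 1) : Pt 1 :=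
  let c := F (z.1 0) z.2
  (![c.1], c.2)

/-- A vector field `ξ ∂_x + η ∂_y + θ ∂_u` with coefficients depending on `(x, y, u)`. -/
def field3 (F : (x y u : ℝ) → ℝ × ℝ × ℝ) (z : Pt 2) : Pt 2 :=
  let c := F (z.1 0) (z.1 1) z.2
  (![c.1, c.2.1], c.2.2)

/-- The generators `X_i`. -/
def Row.gen : {m : ℕ} → Row m → Fin (m + 1) → Pt m → Pt m
  | _, .abelian2 => ![field2 fun _ _ => (1, 0), field2 fun _ _ => (0, 1)]
  | _, .affine => ![field2 fun _ _ => (1, 0), field2 fun x _ => (x, 1)]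
  | _, .abelian3 => ![field3 fun _ _ _ => (1, 0, 0), field3 fun _ _ _ => (0, 1, 0),
      field3 fun _ _ _ => (0, 0, 1)]
  | _, .g1g2 => ![field3 fun _ _ _ => (1, 0, 0), field3 fun x _ _ => (x, 1, 0),
      field3 fun _ _ _ => (0, 0, 1)]
  | _, .g31 => ![field3 fun _ _ _ => (0, 0, 1), field3 fun _ _ _ => (1, 0, 0),
      field3 fun x _ _ => (0, 1, x)]
  | _, .g32 => ![field3 fun _ _ _ => (0, 0, 1), field3 fun _ _ _ => (0, 1, 0),
      field3 fun _ y u => (1, y, y + u)]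
  | _, .g33 => ![field3 fun _ _ _ => (1, 0, 0), field3 fun _ _ _ => (0, 1, 0),
      field3 fun x y _ => (x, y, 1)]
  | _, .g34 h _ => ![field3 fun _ _ _ => (1, 0, 0), field3 fun _ _ _ => (0, 1, 0),
      field3 fun x y _ => (x, h * y, 1)]
  | _, .g35 p _ => ![field3 fun _ _ _ => (1, 0, 0), field3 fun _ _ _ => (0, 1, 0),
      field3 fun x y _ => (p * x + y, p * y - x, 1)]
  | _, .g36 => ![field3 fun _ _ _ => (1, 0, 0), field3 fun x _ _ => (x, 1, 0),
      field3 fun x y _ => (x ^ 2, 2 * x, exp y)]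
  | _, .g37 => ![field3 fun _ _ _ => (1, 0, 0),
      field3 fun x y _ => (sin x * tan y, cos x, sin x / cos y),
      field3 fun x y _ => (cos x * tan y, -sin x, cos x / cos y)]

/-- A function of `(x, u, u_x)`. -/
def onJ1₂ {β : Type} (F : (x u ux : ℝ) → β) (P : J1 1) : β :=
  F (P.1.1 0) P.1.2 (P.2 0)

/-- A function of `(x, u, u_x, u_xx)`. -/
def onJ2₂ {β : Type} (F : (x u ux uxx : ℝ) → β) (J : J2 1) : β :=
  F (J.1.1.1 0) J.1.1.2 (J.1.2 0) (J.2 s(0, 0))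

/-- A function of `(x, y, u, u_x, u_y)`. -/
def onJ1₃ {β : Type} (F : (x y u ux uy : ℝ) → β) (P : J1 2) : β :=
  F (P.1.1 0) (P.1.1 1) P.1.2 (P.2 0) (P.2 1)

/-- A function of `(x, y, u, u_x, u_y, u_xx, u_xy, u_yy)`. -/
def onJ2₃ {β : Type} (F : (x y u ux uy uxx uxy uyy : ℝ) → β) (J : J2 2) : β :=
  F (J.1.1.1 0) (J.1.1.1 1) J.1.1.2 (J.1.2 0) (J.1.2 1)
    (J.2 s(0, 0)) (J.2 s(0, 1)) (J.2 s(1, 1))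

/-- A triple of numbers as a family indexed by the unordered pairs `{0,0}, {0,1}, {1,1}`. -/
def triple (r₁ r₂ r₃ : ℝ) : Sym2 (Fin 2) → ℝ :=
  fun s => if s = s(0, 0) then r₁ else if s = s(0, 1) then r₂ else r₃

/-- The first-order invariants `v_a`. -/
def Row.inv1 : {m : ℕ} → Row m → J1 m → Fin m → ℝ
  | _, .abelian2 => onJ1₂ fun _ _ ux => ![ux]
  | _, .affine => onJ1₂ fun _ u ux => ![exp u * ux]
  | _, .abelian3 => onJ1₃ fun _ _ _ ux uy => ![ux, uy]
  | _, .g1g2 => onJ1₃ fun _ y _ ux uy => ![exp y * ux, uy]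
  | _, .g31 => onJ1₃ fun _ y _ ux uy => ![ux - y, uy]
  | _, .g32 => onJ1₃ fun x _ _ ux uy => ![exp (-x) * ux, uy - x]
  | _, .g33 => onJ1₃ fun _ _ u ux uy => ![exp u * ux, exp u * uy]
  | _, .g34 h _ => onJ1₃ fun _ _ u ux uy => ![exp u * ux, exp (h * u) * uy]
  | _, .g35 p _ => onJ1₃ fun _ _ u ux uy =>
      ![exp (p * u) * (ux * cos u - uy * sin u), exp (p * u) * (ux * sin u + uy * cos u)]
  | _, .g36 => onJ1₃ fun _ y u ux uy => ![exp y * ux + uy ^ 2, uy - u]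
  | _, .g37 => onJ1₃ fun _ y u ux uy =>
      ![ux * (cos u / cos y) - uy * sin u - cos u * tan y,
        ux * (sin u / cos y) + uy * cos u - sin u * tan y]

/-- The second-order invariants `v_{ij}`. -/
def Row.inv2 : {m : ℕ} → Row m → J2 m → Sym2 (Fin m) → ℝ
  | _, .abelian2 => onJ2₂ fun _ _ _ uxx => fun _ => uxx
  | _, .affine => onJ2₂ fun _ u _ uxx => fun _ => exp (2 * u) * uxx
  | _, .abelian3 => onJ2₃ fun _ _ _ _ _ uxx uxy uyy => triple uxx uxy uyy
  | _, .g1g2 => onJ2₃ fun _ y _ _ _ uxx uxy uyy =>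
      triple (exp (2 * y) * uxx) (exp y * uxy) uyy
  | _, .g31 => onJ2₃ fun _ _ _ _ _ uxx uxy uyy => triple uxx uxy uyy
  | _, .g32 => onJ2₃ fun x _ _ _ _ uxx uxy uyy =>
      triple (exp (-x) * uxx) uxy (exp x * uyy)
  | _, .g33 => onJ2₃ fun _ _ u _ _ uxx uxy uyy =>
      triple (exp (2 * u) * uxx) (exp (2 * u) * uxy) (exp (2 * u) * uyy)
  | _, .g34 h _ => onJ2₃ fun _ _ u _ _ uxx uxy uyy =>
      triple (exp (2 * u) * uxx) (exp ((1 + h) * u) * uxy) (exp (2 * h * u) * uyy)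
  | _, .g35 p _ => onJ2₃ fun _ _ u _ _ uxx uxy uyy =>
      triple (exp (2 * p * u) * (uxx + uyy))
        (exp (2 * p * u) * ((uxx - uyy) * cos (2 * u) - 2 * uxy * sin (2 * u)))
        (exp (2 * p * u) * ((uxx - uyy) * sin (2 * u) + 2 * uxy * cos (2 * u)))
  | _, .g36 => onJ2₃ fun _ y u ux uy uxx uxy uyy =>
      triple (uyy - u)
        (exp y * uxy + 2 * u * uyy - u ^ 2)
        (exp (2 * y) * uxx
          + 2 * u * (u * (2 * uyy + uy - u) + exp y * (ux + 2 * uxy)))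
  | _, .g37 => onJ2₃ fun _ y u ux uy uxx uxy uyy =>
      triple (uxx / cos y ^ 2 + uyy - uy * tan y)
        (cos (2 * u) * (uxx / cos y ^ 2 - uyy - 2 * ux * uy / cos y + uy * tan y)
          + sin (2 * u) * (-(2 * uxy / cos y) + uy ^ 2 + (1 - ux ^ 2) / cos y ^ 2))
        (-sin (2 * u) * (uxx / cos y ^ 2 - uyy - 2 * ux * uy / cos y + uy * tan y)
          + cos (2 * u) * (-(2 * uxy / cos y) + uy ^ 2 + (1 - ux ^ 2) / cos y ^ 2))

/-- The left-hand side of the quasi-linear equation, for given values of the arbitrary elements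
`a₀ = a s(0,0)`, `a₁ = a s(0,1)`, `a₂ = a s(1,1)` and `b`. The equations are tabulated with
`a₀ = 1`. -/
def Row.eqn : {m : ℕ} → Row m → (Sym2 (Fin m) → ℝ) → ℝ → J2 m → ℝ
  | _, .abelian2, a, b => onJ2₂ fun _ _ _ uxx => a s(0, 0) * uxx + b
  | _, .affine, a, b => onJ2₂ fun _ u _ uxx => a s(0, 0) * uxx + exp (-2 * u) * b
  | _, .abelian3, a, b => onJ2₃ fun _ _ _ _ _ uxx uxy uyy =>
      a s(0, 0) * uxx + a s(0, 1) * uxy + a s(1, 1) * uyy + b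
  | _, .g1g2, a, b => onJ2₃ fun _ y _ _ _ uxx uxy uyy =>
      a s(0, 0) * uxx + exp (-y) * a s(0, 1) * uxy + exp (-2 * y) * a s(1, 1) * uyy
        + exp (-2 * y) * b
  | _, .g31, a, b => onJ2₃ fun _ _ _ _ _ uxx uxy uyy =>
      a s(0, 0) * uxx + a s(0, 1) * uxy + a s(1, 1) * uyy + b
  | _, .g32, a, b => onJ2₃ fun x _ _ _ _ uxx uxy uyy =>
      a s(0, 0) * (exp (-x) * uxx) + a s(0, 1) * uxy + a s(1, 1) * (exp x * uyy) + b
  | _, .g33, a, b => onJ2₃ fun _ _ u _ _ uxx uxy uyy =>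
      a s(0, 0) * uxx + a s(0, 1) * uxy + a s(1, 1) * uyy + exp (-2 * u) * b
  | _, .g34 h _, a, b => onJ2₃ fun _ _ u _ _ uxx uxy uyy =>
      a s(0, 0) * uxx + exp ((h - 1) * u) * a s(0, 1) * uxy
        + exp (2 * (h - 1) * u) * a s(1, 1) * uyy + exp (-2 * u) * b
  | _, .g35 p _, a, b => onJ2₃ fun _ _ u _ _ uxx uxy uyy =>
      a s(0, 0) * (uxx + uyy) + exp (-2 * p * u) * b
        + a s(0, 1) * (uxx - uyy) * cos (2 * u) - 2 * a s(0, 1) * uxy * sin (2 * u)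
        + a s(1, 1) * (uxx - uyy) * sin (2 * u) + 2 * a s(1, 1) * uxy * cos (2 * u)
  | _, .g36, a, b => onJ2₃ fun _ y u ux uy uxx uxy uyy =>
      a s(0, 0) * (exp (2 * y) * uxx + 4 * u * exp y * uxy + 4 * u ^ 2 * uyy
          + 2 * exp y * ux * uy + 4 * u * uy ^ 2 - 4 * u ^ 2 * uy)
        + a s(0, 1) * (exp y * uxy + 2 * u * uyy - u ^ 2)
        + a s(1, 1) * (uyy - u) + b
  | _, .g37, a, b => onJ2₃ fun _ y u ux uy uxx uxy uyy =>
      a s(0, 0) * (uxx / cos y ^ 2 + uyy - uy * tan y) + b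
        + (a s(0, 1) * cos (2 * u) - a s(1, 1) * sin (2 * u))
          * (uxx / cos y ^ 2 - uyy - 2 * ux * uy / cos y + uy * tan y)
        + (a s(0, 1) * sin (2 * u) + a s(1, 1) * cos (2 * u))
          * (-(2 * uxy / cos y) + uy ^ 2 + (1 - ux ^ 2) / cos y ^ 2)

/-- The tabulated equation with arbitrary elements `a`, `b` evaluated at the first-order
invariants. -/
def Row.equation (r : Row m) (a : (Fin m → ℝ) → Sym2 (Fin m) → ℝ) (b : (Fin m → ℝ) → ℝ)
    (J : J2 m) : ℝ :=
  r.eqn (a (r.inv1 J.1)) (b (r.inv1 J.1)) J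

/-- `ψ` is a local diffeomorphism from an open part of `Z` to an open part of the domain of the
row `r` which takes the span of the fields `X_i` onto the span of the generators of `r`. -/
def IsLocalEquiv (Z : Set (Pt m)) (X : Fin (m + 1) → Pt m → Pt m) (r : Row m)
    (ψ : OpenPartialHomeomorph (Pt m) (Pt m)) : Prop :=
  ψ.source ⊆ Z ∧ ψ.target ⊆ r.dom ∧
  ContDiffOn ℝ ∞ ψ ψ.source ∧ ContDiffOn ℝ ∞ ψ.symm ψ.target ∧
  ∃ A : Matrix (Fin (m + 1)) (Fin (m + 1)) ℝ, IsUnit A.det ∧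
    ∀ z ∈ ψ.source, ∀ i, fderiv ℝ ψ z (X i z) = ∑ j, A i j • r.gen j (ψ z)

end InvPDE

end

open InvPDE

/-! The statement splits into three independent pieces, namely local geometry of frames,
prolongation theory, and algebra of small Lie algebras, together with a verification for the
tabulated rows.

Geometry of frames. If two frames have the same structure constants, the condition dψ(X_i) = Y_i ∘ ψ
is a total differential system dψ = G(z, ψ), whose integrability condition is exactly the equality
of the brackets. Such a system is solved by integrating along rays from a point, and a Gronwall
estimate shows that the endpoints of the rays depend differentiably on the direction
(`exists_hasFDerivAt_of_integrable_of_bounded`). Hence any two simply transitive realizations of the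
same algebra are locally diffeomorphic (`exists_openPartialHomeomorph_of_hasStructure`), and the
realizations need not be classified separately from the algebras.

Prolongation. The coefficients of a prolonged field are values of the contact form on total
derivatives. Where the new independent variables have invertible derivative along the jet, ψ acts on
jets by `trans1` and `trans2`, and differentiating the chain-rule relations shows that this action
takes prolonged fields to prolonged fields (`fderiv_trans1_prolong1`, `fderiv_trans2_prolong2`). A
jet that has a transform at all is of this kind, and such jets are dense.

Invariants. On jet space the base point and a set of invariants with injective fibre derivative form
local coordinates. In these coordinates the prolonged frame spans the base directions, so a function
it annihilates depends on the invariants alone (`exists_eventuallyEq_comp_of_frame`). An invariant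
quasi-linear equation is affine in the second-order invariants. Invariance on its zero set forces
its coefficients to be invariant up to a common factor, so dividing by a non-zero coefficient leaves
functions of the first-order invariants (`AdaptedInvariants.exists_normal_form`). This applies both
to the invariants of a row and to their pullbacks along ψ.

Rows. Generators and invariants are encoded as syntax trees `Ex` with a formal derivative, so that
invariance, brackets and independence in each row become algebraic identities collected in `ExRow`.

Algebra. In dimension three the trace of the adjoint representation decides the method. If it is not
zero, its kernel is an abelian ideal of dimension two, and the algebra is governed by the normal
form of a 2×2 matrix up to scaling. If it is zero, the bracket is M(u × v) with M symmetric, and an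
orthonormal eigenbasis makes it diagonal. A zero eigenvalue again gives an abelian ideal, and
otherwise the signs of the eigenvalues leave only so(3) and sl(2). The rows are told apart by the
trace form and the Killing form, except for two pairs that need a separate argument
(`Realizes.unique_three`). -/

noncomputable section
namespace InvPDE

/-! ### Total differential systems with globally bounded data -/

section Frobenius

open Metric
open scoped NNReal

variable {E F : Type*} [NormedAddCommGroup E] [NormedSpace ℝ E]
  [NormedAddCommGroup F] [NormedSpace ℝ F]

/-- Homogeneity in the defect: the defect met below is quadratic in an increment, and the resulting
estimate has to be of the same order. -/
lemma gronwallBound_zero_eq_mul (K ε x : ℝ) :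
    gronwallBound 0 K ε x = ε * gronwallBound 0 K 1 x := by
  by_cases hK : K = 0
  · subst hK; simp [gronwallBound_K0]
  · simp only [gronwallBound_of_K_ne_0 hK]; ring

/-- Total differential systems `dψ = G(z, ψ)` with globally bounded data are solvable near a point
around which the integrability condition holds. -/
theorem exists_hasFDerivAt_of_integrable_of_bounded [CompleteSpace F]
    {G : E × F → E →L[ℝ] F} {G' : E × F → (E × F) →L[ℝ] E →L[ℝ] F} {M K Λ : ℝ≥0}
    (hG' : ∀ p, HasFDerivAt G (G' p) p) (hM : ∀ p, ‖G p‖ ≤ M) (hK : ∀ p, ‖G' p‖ ≤ K)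
    (hΛ : LipschitzWith Λ G') (p₀ : E × F) {ρ : ℝ} (hρ : 0 < ρ)
    (hsymm : ∀ p ∈ ball p₀ ρ, ∀ v w, G' p (v, G p v) w = G' p (w, G p w) v) :
    ∃ ψ : E → F, ψ p₀.1 = p₀.2 ∧ ∃ r > 0, ∀ z ∈ ball p₀.1 r,
      (z, ψ z) ∈ ball p₀ ρ ∧ HasFDerivAt ψ (G (z, ψ z)) z := by
  obtain ⟨z₀, y₀⟩ := p₀
  have hGc : Continuous G := continuous_iff_continuousAt.2 fun p => (hG' p).continuousAt
  have hGL : LipschitzWith K G := by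
    refine lipschitzWith_of_nnnorm_fderiv_le (𝕜 := ℝ) (fun p => (hG' p).differentiableAt) fun p => ?_
    rw [(hG' p).fderiv]; exact hK p
  -- On the ray t ↦ z₀ + t w the system is an ODE with speed at most M‖w‖. A solution therefore
  -- stays within M‖w‖ of y₀ up to time 1, and Picard–Lindelöf on the ball of that radius covers the
  -- whole of [0, 1].
  have hcurve : ∀ w : E, ∃ γ : ℝ → F, γ 0 = y₀ ∧ ∀ t ∈ Icc (0 : ℝ) 1,
      HasDerivWithinAt γ (G (z₀ + t • w, γ t) w) (Icc 0 1) t := by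
    intro w
    have : IsPicardLindelof (fun t y => G (z₀ + t • w, y) w) (tmin := 0) (tmax := 1)
        ⟨0, by simp⟩ y₀ (M * ‖w‖₊) 0 (M * ‖w‖₊) (K * ‖w‖₊) := by
      refine ⟨fun t _ => LipschitzWith.lipschitzOnWith ?_, fun x _ => ?_, fun t _ x _ => ?_, ?_⟩
      · refine LipschitzWith.of_dist_le_mul fun x y => ?_
        rw [dist_eq_norm, ← sub_apply]
        refine (ContinuousLinearMap.le_opNorm _ _).trans ?_
        have := hGL.dist_le_mul (z₀ + t • w, x) (z₀ + t • w, y)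
        rw [dist_eq_norm, Prod.dist_eq, dist_self, max_eq_right dist_nonneg] at this
        calc _ ≤ K * dist x y * ‖w‖ := by gcongr
          _ = _ := by push_cast; ring
      · fun_prop
      · exact (ContinuousLinearMap.le_opNorm _ _).trans (by push_cast; gcongr; exact hM _)
      · simp
    obtain ⟨γ, h0, h1⟩ := this.exists_eq_forall_mem_Icc_hasDerivWithinAt₀
    exact ⟨γ, h0, h1⟩
  choose γ hγ0 hγ using hcurve
  have hγb : ∀ w, ∀ t ∈ Icc (0 : ℝ) 1, ‖γ w t - y₀‖ ≤ M * ‖w‖ := by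
    intro w t ht
    have := norm_image_sub_le_of_norm_deriv_le_segment' (hγ w) (C := M * ‖w‖)
      (fun x _ => (ContinuousLinearMap.le_opNorm _ _).trans (by gcongr; exact hM _)) t ht
    rw [hγ0] at this
    refine this.trans ?_
    have : (M : ℝ) * ‖w‖ * (t - 0) ≤ M * ‖w‖ * 1 := by gcongr; linarith [ht.2]
    linarith
  -- The second entry keeps the trajectories in the ball where integrability holds, and the first
  -- gives ‖w + h‖ ≤ 1 in the estimates.
  set r : ℝ := min 1 (ρ / (M + 1)) with hr
  have hr0 : 0 < r := by positivity
  have hmem : ∀ w, ‖w‖ < r → ∀ t ∈ Icc (0 : ℝ) 1, (z₀ + t • w, γ w t) ∈ ball (z₀, y₀) ρ := by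
    intro w hw t ht
    have h1 : ‖w‖ * (M + 1) < ρ := by
      have : ‖w‖ < ρ / (M + 1) := hw.trans_le (min_le_right _ _)
      rwa [lt_div_iff₀ (by positivity)] at this
    have h2 := hγb w t ht
    have h3 : ‖t • w‖ ≤ ‖w‖ := by
      rw [norm_smul, Real.norm_of_nonneg ht.1]
      exact mul_le_of_le_one_left (norm_nonneg _) ht.2
    rw [mem_ball, Prod.dist_eq, max_lt_iff, dist_eq_norm, dist_eq_norm]
    have := norm_nonneg w
    have := mul_nonneg M.2 this
    simp only [NNReal.val_eq_coe] at this
    constructor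
    · simp only [add_sub_cancel_left]; nlinarith
    · nlinarith
  -- The first summand bounds the Taylor remainder of G in the direction k, where ‖k‖ ≤ (1 + M)‖h‖,
  -- and the second bounds the leftover term G'(k) h.
  set C : ℝ := Λ * (1 + M) ^ 2 + K * (1 + M) with hC
  -- comparison of neighbouring trajectories
  have key : ∀ w h : E, ‖w‖ < r → ‖w + h‖ < r →
      ‖γ (w + h) 1 - γ w 1 - G (z₀ + w, γ w 1) h‖ ≤ C * gronwallBound 0 K 1 1 * ‖h‖ ^ 2 := by
    intro w h hw hwh
    set P : ℝ → E × F := fun t => (z₀ + t • w, γ w t) with hP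
    set k : ℝ → E × F := fun t => (h, G (P t) h) with hk
    have hkn : ∀ t, ‖k t‖ ≤ (1 + M) * ‖h‖ := by
      intro t
      rw [Prod.norm_def, max_le_iff]
      have h1 : ‖G (P t) h‖ ≤ M * ‖h‖ :=
        (ContinuousLinearMap.le_opNorm _ _).trans (by gcongr; exact hM _)
      have := norm_nonneg h
      have := mul_nonneg M.2 this
      simp only [NNReal.val_eq_coe] at this
      constructor
      · show ‖h‖ ≤ _
        linarith
      · show ‖G (P t) h‖ ≤ _
        linarith
    -- The curve that the solution for w + h should follow to first order in h; at t = 1 its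
    -- correction is the expected derivative applied to h.
    set c : ℝ → F := fun t => γ w t + t • G (P t) h with hc
    set c' : ℝ → F := fun t => G (P t) w + (t • G' (P t) (w, G (P t) w) h + G (P t) h) with hc'
    have hPd : ∀ t ∈ Icc (0 : ℝ) 1, HasDerivWithinAt P (w, G (P t) w) (Icc 0 1) t := by
      intro t ht
      refine HasDerivWithinAt.prodMk ?_ (hγ w t ht)
      have h1 : HasDerivAt (fun t : ℝ => z₀ + t • w) ((1 : ℝ) • w) t :=
        ((hasDerivAt_id t).smul_const w).const_add z₀
      simpa using h1.hasDerivWithinAt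
    have hcd : ∀ t ∈ Icc (0 : ℝ) 1, HasDerivWithinAt c (c' t) (Icc 0 1) t := by
      intro t ht
      have h1 : HasDerivWithinAt (fun t => G (P t) h) (G' (P t) (w, G (P t) w) h) (Icc 0 1) t := by
        have := (hG' (P t)).comp_hasDerivWithinAt t (hPd t ht)
        exact (ContinuousLinearMap.apply ℝ F h).hasFDerivAt.comp_hasDerivWithinAt t this
      have h2 := (hasDerivWithinAt_id t (Icc (0:ℝ) 1)).smul h1
      simp only [id, one_smul] at h2
      exact (hγ w t ht).add h2
    have hIci : ∀ {f : ℝ → F} {f' : ℝ → F}, (∀ t ∈ Icc (0 : ℝ) 1, HasDerivWithinAt f (f' t) (Icc 0 1) t) →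
        ∀ t ∈ Ico (0 : ℝ) 1, HasDerivWithinAt f (f' t) (Ici t) t := fun H t ht =>
      (H t (Ico_subset_Icc_self ht)).mono_of_mem_nhdsWithin (Icc_mem_nhdsGE_of_mem ht)
    have hwh1 : ‖w + h‖ ≤ 1 := hwh.le.trans (min_le_left _ _)
    have hLip : ∀ t : ℝ, LipschitzWith K (fun y => G (z₀ + t • (w + h), y) (w + h)) := by
      intro t
      refine LipschitzWith.of_dist_le_mul fun x y => ?_
      rw [dist_eq_norm, ← sub_apply]
      refine (ContinuousLinearMap.le_opNorm _ _).trans ?_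
      have := hGL.dist_le_mul (z₀ + t • (w + h), x) (z₀ + t • (w + h), y)
      rw [dist_eq_norm, Prod.dist_eq, dist_self, max_eq_right dist_nonneg] at this
      calc _ ≤ K * dist x y * 1 := by gcongr
        _ = _ := by ring
    have happrox : ∀ t ∈ Ico (0 : ℝ) 1,
        dist (c' t) (G (z₀ + t • (w + h), c t) (w + h)) ≤ C * ‖h‖ ^ 2 := by
      intro t ht
      have hPt : (z₀ + t • (w + h), c t) = P t + t • k t := by
        simp only [hP, hk, hc, Prod.smul_mk, Prod.mk_add_mk, smul_add, add_assoc]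
      -- Integrability enters only here. Exchanging w and h turns the derivative of the correction
      -- into G'(P t)(k t) w, which is the linear Taylor term of G(P t + t k t) w, so the defect
      -- becomes quadratic in h.
      have hint := hsymm (P t) (hmem w hw t (Ico_subset_Icc_self ht)) w h
      have e1 : c' t - G (z₀ + t • (w + h), c t) (w + h)
          = -((G (P t + t • k t) - G (P t) - G' (P t) (t • k t)) (w + h))
            - t • (G' (P t) (k t) h) := by
        rw [hPt]
        simp only [hc', hint, sub_apply, map_add, map_smul, smul_apply]
        simp only [hk, smul_add]
        abel
      have htk : ‖t • k t‖ ≤ ‖k t‖ := by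
        rw [norm_smul, Real.norm_of_nonneg ht.1]
        exact mul_le_of_le_one_left (norm_nonneg _) ht.2.le
      have e2 : ‖G (P t + t • k t) - G (P t) - G' (P t) (t • k t)‖ ≤ Λ * ‖k t‖ ^ 2 := by
        have := Convex.norm_image_sub_le_of_norm_hasFDerivWithin_le' (f := G) (f' := G')
          (φ := G' (P t)) (C := Λ * ‖k t‖) (s := closedBall (P t) ‖k t‖) (x := P t)
          (y := P t + t • k t) (fun x _ => (hG' x).hasFDerivWithinAt) (fun x hx => by
            rw [← dist_eq_norm]
            exact (hΛ.dist_le_mul _ _).trans (by gcongr; exact hx))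
          (convex_closedBall _ _) (mem_closedBall_self (norm_nonneg _))
          (by simpa [mem_closedBall, dist_eq_norm] using htk)
        rw [add_sub_cancel_left] at this
        refine this.trans ?_
        calc _ ≤ Λ * ‖k t‖ * ‖k t‖ := by gcongr
          _ = _ := by ring
      rw [dist_eq_norm, e1]
      refine (norm_sub_le _ _).trans ?_
      rw [norm_neg]
      have b1 := (ContinuousLinearMap.le_opNorm
        (G (P t + t • k t) - G (P t) - G' (P t) (t • k t)) (w + h))
      have b2 : ‖t • (G' (P t) (k t) h)‖ ≤ K * ‖k t‖ * ‖h‖ := by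
        rw [norm_smul, Real.norm_of_nonneg ht.1]
        refine (mul_le_of_le_one_left (norm_nonneg _) ht.2.le).trans ?_
        refine (ContinuousLinearMap.le_opNorm _ _).trans ?_
        gcongr
        exact (ContinuousLinearMap.le_opNorm _ _).trans (by gcongr; exact hK _)
      calc _ ≤ Λ * ‖k t‖ ^ 2 * 1 + K * ‖k t‖ * ‖h‖ := by
            refine add_le_add (b1.trans ?_) b2
            gcongr
        _ ≤ Λ * ((1 + M) * ‖h‖) ^ 2 * 1 + K * ((1 + M) * ‖h‖) * ‖h‖ := by
            gcongr
            · exact hkn t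
            · exact hkn t
        _ = _ := by rw [hC]; ring
    -- Both curves start at y₀, and only the approximate one has a defect.
    have := dist_le_of_approx_trajectories_ODE (a := 0) (b := 1) (δ := 0) (εg := 0) hLip
      (fun t ht => (hcd t ht).continuousWithinAt) (hIci hcd) happrox
      (fun t ht => (hγ (w + h) t ht).continuousWithinAt) (hIci (hγ (w + h)))
      (fun t _ => by simp) (by simp [hc, hγ0]) 1 (by simp)
    rw [dist_comm, dist_eq_norm, add_zero, sub_zero, gronwallBound_zero_eq_mul] at this
    simp only [hc, hP, one_smul] at this
    rw [sub_sub]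
    refine this.trans (le_of_eq (by ring))
  -- The solution at z is the endpoint of the trajectory along the segment from z₀ to z.
  refine ⟨fun z => γ (z - z₀) 1, ?_, r, hr0, fun z hz => ?_⟩
  · have := hγb 0 1 (by simp)
    simp only [norm_zero, mul_zero] at this
    simpa [sub_eq_zero] using norm_le_zero_iff.1 this
  have hw : ‖z - z₀‖ < r := by rwa [mem_ball, dist_eq_norm] at hz
  constructor
  · simpa using hmem _ hw 1 (by simp)
  rw [hasFDerivAt_iff_isLittleO_nhds_zero]
  refine Asymptotics.IsBigO.trans_isLittleO (g := fun h : E => ‖h‖ ^ 2) ?_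
    (Asymptotics.isLittleO_norm_pow_id one_lt_two)
  refine Asymptotics.IsBigO.of_bound (C * gronwallBound 0 K 1 1) ?_
  have : ∀ᶠ h : E in 𝓝 0, ‖z - z₀ + h‖ < r := by
    have hc : ContinuousAt (fun h : E => ‖z - z₀ + h‖) 0 := by fun_prop
    exact hc.eventually_lt_const (by simpa using hw)
  filter_upwards [this] with h hh
  have := key (z - z₀) h hw hh
  rw [norm_pow, norm_norm]
  rw [show z + h - z₀ = z - z₀ + h by abel]
  simpa using this

end Frobenius
end InvPDE
end

noncomputable section
namespace InvPDE

/-! ### Smooth total differential systems on open sets -/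

section Frobenius

open Metric
open scoped NNReal

variable {E F : Type*} [NormedAddCommGroup E] [NormedSpace ℝ E]
  [NormedAddCommGroup F] [NormedSpace ℝ F]

/-- A smooth function on an open set agrees near a given point with a globally smooth function with
compact support. -/
lemma exists_contDiff_hasCompactSupport_eventuallyEq [FiniteDimensional ℝ E] {f : E → F} {U : Set E}
    (hU : IsOpen U) (hf : ContDiffOn ℝ ∞ f U) {x : E} (hx : x ∈ U) :
    ∃ g : E → F, ContDiff ℝ ∞ g ∧ HasCompactSupport g ∧ g =ᶠ[𝓝 x] f := by
  obtain ⟨ε, hε, hεU⟩ := Metric.isOpen_iff.1 hU x hx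
  let χ : ContDiffBump x := ⟨ε / 4, ε / 2, by linarith, by linarith⟩
  have hsub : tsupport χ ⊆ U := by
    rw [χ.tsupport_eq]
    exact (closedBall_subset_ball (by show ε / 2 < ε; linarith)).trans hεU
  refine ⟨fun y => χ y • f y, ?_, ?_, ?_⟩
  · rw [contDiff_iff_contDiffAt]
    intro y
    by_cases hy : y ∈ U
    · exact χ.contDiff.contDiffAt.smul (hf.contDiffAt (hU.mem_nhds hy))
    · have : (fun y => χ y • f y) =ᶠ[𝓝 y] fun _ => 0 := by
        have h1 : (tsupport χ)ᶜ ∈ 𝓝 y :=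
          (isClosed_tsupport _).isOpen_compl.mem_nhds fun h => hy (hsub h)
        filter_upwards [h1] with z hz
        rw [image_eq_zero_of_notMem_tsupport hz, zero_smul]
      exact contDiffAt_const.congr_of_eventuallyEq this
  · exact χ.hasCompactSupport.smul_right
  · filter_upwards [χ.eventuallyEq_one] with y hy
    simp [hy]

/-- Solutions of a smooth total differential system are smooth. -/
lemma contDiffOn_of_hasFDerivAt_comp {H : E × F → E →L[ℝ] F} (hH : ContDiff ℝ ∞ H) {ψ : E → F}
    {s : Set E} (hs : IsOpen s) (hψ : ∀ z ∈ s, HasFDerivAt ψ (H (z, ψ z)) z) :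
    ContDiffOn ℝ ∞ ψ s := by
  rw [contDiffOn_infty]
  intro n
  -- Bootstrapping: if ψ is of class Cⁿ, then so is z ↦ H(z, ψ z), which is its derivative.
  induction n with
  | zero => exact contDiffOn_zero.2 fun z hz => (hψ z hz).continuousAt.continuousWithinAt
  | succ n ih =>
    push_cast
    rw [contDiffOn_succ_iff_fderiv_of_isOpen hs]
    refine ⟨fun z hz => (hψ z hz).differentiableAt.differentiableWithinAt, by simp, ?_⟩
    have : ContDiffOn ℝ n (fun z => H (z, ψ z)) s :=
      (hH.of_le (by exact_mod_cast le_top)).comp_contDiffOn (contDiffOn_id.prodMk ih)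
    exact this.congr fun z hz => (hψ z hz).fderiv

/-- Local solvability of an integrable total differential system `dψ = G(z, ψ)`. -/
theorem exists_contDiffOn_hasFDerivAt_of_integrable [FiniteDimensional ℝ E] [FiniteDimensional ℝ F]
    {G : E × F → E →L[ℝ] F} {U : Set (E × F)} (hU : IsOpen U) (hG : ContDiffOn ℝ ∞ G U)
    (hsymm : ∀ p ∈ U, ∀ v w, fderiv ℝ G p (v, G p v) w = fderiv ℝ G p (w, G p w) v)
    {p₀ : E × F} (hp₀ : p₀ ∈ U) :
    ∃ ψ : E → F, ψ p₀.1 = p₀.2 ∧ ∃ r > 0, ContDiffOn ℝ ∞ ψ (ball p₀.1 r) ∧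
      ∀ z ∈ ball p₀.1 r, (z, ψ z) ∈ U ∧ HasFDerivAt ψ (G (z, ψ z)) z := by
  have : CompleteSpace F := FiniteDimensional.complete ℝ F
  -- Compact support provides the global bounds. The integrability condition may fail for the
  -- cut-off system, but it persists on a ball where H and G have the same germs, which is all the
  -- bounded version asks for.
  obtain ⟨H, hH, hHc, hHG⟩ := exists_contDiff_hasCompactSupport_eventuallyEq hU hG hp₀
  obtain ⟨ρ, hρ, hρs⟩ := Metric.eventually_nhds_iff_ball.1
    (hHG.eventually_nhds.and (hU.eventually_mem hp₀))
  have hH'' : ContDiff ℝ ∞ (fderiv ℝ H) := (contDiff_infty_iff_fderiv.1 hH).2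
  have hH' : ContDiff ℝ 1 (fderiv ℝ H) := hH''.of_le (by simp)
  have hHc' : HasCompactSupport (fderiv ℝ H) := hHc.fderiv ℝ
  obtain ⟨M, hM⟩ := hHc.exists_bound_of_continuous hH.continuous
  lift M to ℝ≥0 using (norm_nonneg _).trans (hM p₀)
  obtain ⟨K, hKL⟩ : ∃ K, LipschitzWith K H :=
    hH.lipschitzWith_of_hasCompactSupport hHc (by simp)
  have hK : ∀ p, ‖fderiv ℝ H p‖ ≤ K := fun p => norm_fderiv_le_of_lipschitz ℝ hKL
  obtain ⟨Λ, hΛ⟩ : ∃ Λ, LipschitzWith Λ (fderiv ℝ H) :=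
    hH'.lipschitzWith_of_hasCompactSupport hHc' one_ne_zero
  obtain ⟨ψ, h0, r, hr, hψ⟩ := exists_hasFDerivAt_of_integrable_of_bounded (G := H)
    (G' := fderiv ℝ H) (M := M) (K := K) (Λ := Λ)
    (fun p => (hH.differentiable (by simp) p).hasFDerivAt) hM hK hΛ p₀ hρ (fun p hp v w => by
      have h1 := (hρs p hp).1
      rw [h1.self_of_nhds, Filter.EventuallyEq.fderiv_eq h1]
      exact hsymm p (hρs p hp).2 v w)
  refine ⟨ψ, h0, r, hr, contDiffOn_of_hasFDerivAt_comp hH isOpen_ball fun z hz => (hψ z hz).2,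
    fun z hz => ⟨(hρs _ (hψ z hz).1).2, ?_⟩⟩
  · have := (hψ z hz).2
    rwa [(hρs _ (hψ z hz).1).1.self_of_nhds] at this

end Frobenius

/-! ### Local equivalence of frames with equal structure constants -/

section Frames

variable {m : ℕ}

/-- The linear map `c ↦ ∑ cᵢ Xᵢ(z)`. -/
def frameMap (X : Fin (m + 1) → Pt m → Pt m) (z : Pt m) : (Fin (m + 1) → ℝ) →L[ℝ] Pt m :=
  ∑ i, (ContinuousLinearMap.proj i : (Fin (m + 1) → ℝ) →L[ℝ] ℝ).smulRight (X i z)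

lemma frameMap_apply (X : Fin (m + 1) → Pt m → Pt m) (z : Pt m) (c : Fin (m + 1) → ℝ) :
    frameMap X z c = ∑ i, c i • X i z := by
  simp [frameMap, sum_apply]

lemma frameMap_single (X : Fin (m + 1) → Pt m → Pt m) (z : Pt m) (i : Fin (m + 1)) :
    frameMap X z (Pi.single i 1) = X i z := by
  simp [frameMap_apply, Pi.single_apply]

lemma frameMap_isInvertible {X : Fin (m + 1) → Pt m → Pt m} {z : Pt m}
    (h : LinearIndependent ℝ fun i => X i z) : (frameMap X z).IsInvertible := by
  have hinj : Function.Injective (frameMap X z).toLinearMap := by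
    rw [← LinearMap.ker_eq_bot, LinearMap.ker_eq_bot']
    intro c hc
    funext i
    exact Fintype.linearIndependent_iff.1 h c
      (by rw [← frameMap_apply]; exact hc) i
  refine ⟨(LinearEquiv.ofInjectiveOfFinrankEq _ hinj (by simp)).toContinuousLinearEquiv, ?_⟩
  ext c <;> rfl

lemma contDiffOn_frameMap {X : Fin (m + 1) → Pt m → Pt m} {Z : Set (Pt m)}
    (h : ∀ i, ContDiffOn ℝ ∞ (X i) Z) : ContDiffOn ℝ ∞ (frameMap X) Z := by
  unfold InvPDE.frameMap
  exact ContDiffOn.sum fun i _ => contDiffOn_const.smulRight (h i)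

lemma exists_eq_frameMap {X : Fin (m + 1) → Pt m → Pt m} {z : Pt m}
    (h : LinearIndependent ℝ fun i => X i z) (v : Pt m) : ∃ c : Fin (m + 1) → ℝ, 
      v = ∑ i, c i • X i z := by
  obtain ⟨e, he⟩ := frameMap_isInvertible h
  refine ⟨e.symm v, ?_⟩
  rw [← frameMap_apply, ← he]; simp

/-- Two frames with the same constant structure functions are locally equivalent. -/
theorem exists_openPartialHomeomorph_of_hasStructure
    {C : Fin (m + 1) → Fin (m + 1) → Fin (m + 1) → ℝ} {Z Z' : Set (Pt m)}
    {X Y : Fin (m + 1) → Pt m → Pt m} (hZ : IsOpen Z) (hZ' : IsOpen Z')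
    (hX : IsFrame Z X) (hY : IsFrame Z' Y) (hXC : HasStructure C Z X) (hYC : HasStructure C Z' Y)
    {z₀ y₀ : Pt m} (hz₀ : z₀ ∈ Z) (hy₀ : y₀ ∈ Z') :
    ∃ ψ : OpenPartialHomeomorph (Pt m) (Pt m), z₀ ∈ ψ.source ∧ ψ.source ⊆ Z ∧ ψ.target ⊆ Z' ∧
      ContDiffOn ℝ ∞ ψ ψ.source ∧ ContDiffOn ℝ ∞ ψ.symm ψ.target ∧
      ∀ z ∈ ψ.source, ∀ i, fderiv ℝ ψ z (X i z) = Y i (ψ z) := by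
  -- The linear map determined by X_i(z) ↦ Y_i(y), so that dψ = G(z, ψ) says exactly that ψ carries
  -- one frame to the other.
  set G : Pt m × Pt m → Pt m →L[ℝ] Pt m :=
    fun p => (frameMap Y p.2).comp (frameMap X p.1).inverse with hGdef
  have hU : IsOpen (Z ×ˢ Z') := hZ.prod hZ'
  have hG : ContDiffOn ℝ ∞ G (Z ×ˢ Z') := by
    refine ContDiffOn.clm_comp ?_ ?_
    · exact (contDiffOn_frameMap hY.1).comp contDiffOn_snd fun p hp => hp.2
    · intro p hp
      exact ((frameMap_isInvertible (hX.2 p.1 hp.1)).contDiffAt_map_inverse.comp_contDiffWithinAt p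
        (((contDiffOn_frameMap hX.1).comp contDiffOn_fst fun p hp => hp.1) p hp))
  have hGX : ∀ p ∈ Z ×ˢ Z', ∀ i, G p (X i p.1) = Y i p.2 := by
    intro p hp i
    obtain ⟨e, he⟩ := frameMap_isInvertible (hX.2 p.1 hp.1)
    have h1 : X i p.1 = e (Pi.single i 1) := by
      rw [← frameMap_single X p.1 i, ← he]; rfl
    show frameMap Y p.2 ((frameMap X p.1).inverse (X i p.1)) = _
    rw [h1, ← he, ContinuousLinearMap.inverse_equiv]
    simp [frameMap_single]
  have hsymm : ∀ p ∈ Z ×ˢ Z', ∀ v w,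
      fderiv ℝ G p (v, G p v) w = fderiv ℝ G p (w, G p w) v := by
    intro p hp
    have hpn := hU.mem_nhds hp
    have hXd : ∀ i, DifferentiableAt ℝ (X i) p.1 := fun i =>
      ((hX.1 i).contDiffAt (hZ.mem_nhds hp.1)).differentiableAt (by simp)
    have hYd : ∀ i, DifferentiableAt ℝ (Y i) p.2 := fun i =>
      ((hY.1 i).contDiffAt (hZ'.mem_nhds hp.2)).differentiableAt (by simp)
    have hGd : DifferentiableAt ℝ G p := (hG.contDiffAt hpn).differentiableAt (by simp)
    have hder : ∀ i (v : Pt m × Pt m), fderiv ℝ G p v (X i p.1) + G p (fderiv ℝ (X i) p.1 v.1)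
        = fderiv ℝ (Y i) p.2 v.2 := by
      intro i v
      have h1 : (fun q : Pt m × Pt m => G q (X i q.1)) =ᶠ[𝓝 p] fun q => Y i q.2 := by
        filter_upwards [hpn] with q hq using hGX q hq i
      have h2 := hGd.hasFDerivAt.clm_apply
        ((hXd i).hasFDerivAt.comp p (hasFDerivAt_fst (p := p)))
      have h3 := (hYd i).hasFDerivAt.comp p (hasFDerivAt_snd (p := p))
      have h4 := (h2.congr_of_eventuallyEq h1.symm).unique h3
      have := DFunLike.congr_fun h4 v
      simp at this
      rw [add_comm]
      exact this
    -- Antisymmetrizing the derivative of G(X_j) = Y_j along (X_i, Y_i) leaves the difference of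
    -- [Y_i, Y_j] and G[X_i, X_j]. It is zero because both brackets have the same constant
    -- coefficients.
    have hbr : ∀ i j, fderiv ℝ G p (X i p.1, Y i p.2) (X j p.1)
        = fderiv ℝ G p (X j p.1, Y j p.2) (X i p.1) := by
      intro i j
      have h1 := hder j (X i p.1, Y i p.2)
      have h2 := hder i (X j p.1, Y j p.2)
      have h3 := hXC i j p.1 hp.1
      have h4 := hYC i j p.2 hp.2
      simp only [VectorField.lieBracket] at h3 h4
      have h5 := congrArg (G p) h3
      simp only [map_sub, map_sum, map_smul, hGX p hp] at h5
      rw [← h4, ← h1, ← h2] at h5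
      have := sub_eq_zero.2 h5
      rw [← sub_eq_zero, ← neg_eq_zero]
      rw [← this]
      simp only
      abel
    -- The condition is bilinear in v and w, so it may be tested on the frame.
    intro v w
    obtain ⟨c, rfl⟩ := exists_eq_frameMap (hX.2 p.1 hp.1) v
    obtain ⟨d, rfl⟩ := exists_eq_frameMap (hX.2 p.1 hp.1) w
    have hlin : ∀ c : Fin (m + 1) → ℝ, ((∑ i, c i • X i p.1, G p (∑ i, c i • X i p.1)) : Pt m × Pt m)
        = ∑ i, c i • (X i p.1, Y i p.2) := by
      intro c
      simp only [map_sum, map_smul, hGX p hp]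
      ext1
      · simp [Prod.fst_sum]
      · simp [Prod.snd_sum]
    rw [hlin, hlin]
    simp only [map_sum, map_smul, sum_apply, smul_apply]
    simp only [Finset.smul_sum]
    rw [Finset.sum_comm]
    refine Finset.sum_congr rfl fun i _ => Finset.sum_congr rfl fun j _ => ?_
    rw [hbr j i, smul_comm]
  obtain ⟨ψ, h0, r, hr, hψs, hψ⟩ :=
    exists_contDiffOn_hasFDerivAt_of_integrable hU hG hsymm (p₀ := (z₀, y₀)) ⟨hz₀, hy₀⟩
  simp only at h0 hψs hψ
  have hinv : ∀ z ∈ Metric.ball z₀ r, (G (z, ψ z)).IsInvertible := by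
    intro z hz
    obtain ⟨e, he⟩ := frameMap_isInvertible (hX.2 z (hψ z hz).1.1)
    obtain ⟨e', he'⟩ := frameMap_isInvertible (hY.2 (ψ z) (hψ z hz).1.2)
    refine ⟨e.symm.trans e', ?_⟩
    simp only [hGdef, ← he, ← he', ContinuousLinearMap.inverse_equiv]
    rfl
  obtain ⟨e, he⟩ := hinv z₀ (Metric.mem_ball_self hr)
  have hd : HasFDerivAt ψ (e : Pt m →L[ℝ] Pt m) z₀ := he ▸ (hψ z₀ (Metric.mem_ball_self hr)).2
  have hc : ContDiffAt ℝ ∞ ψ z₀ := hψs.contDiffAt (Metric.ball_mem_nhds _ hr)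
  set φ := (hc.toOpenPartialHomeomorph ψ hd (by simp)).restrOpen (Metric.ball z₀ r)
    Metric.isOpen_ball with hφ
  have hφψ : ∀ z, φ z = ψ z := fun z => rfl
  have hφψ' : (φ : Pt m → Pt m) = ψ := rfl
  have hsrc : φ.source ⊆ Metric.ball z₀ r := fun z hz => hz.2
  refine ⟨φ, ⟨hc.mem_toOpenPartialHomeomorph_source hd (by simp), Metric.mem_ball_self hr⟩,
    fun z hz => (hψ z (hsrc hz)).1.1, fun y hy => ?_, ?_, fun y hy => ?_, fun z hz i => ?_⟩
  · have := (hψ _ (hsrc (φ.map_target hy))).1.2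
    rwa [← hφψ, φ.right_inv hy] at this
  · rw [hφψ']; exact hψs.mono hsrc
  · have hz := hsrc (φ.map_target hy)
    obtain ⟨e, he⟩ := hinv _ hz
    refine (φ.contDiffAt_symm hy (f₀' := e) ?_ ?_).contDiffWithinAt
    · rw [he]; exact (hψ _ hz).2
    · exact hψs.contDiffAt (Metric.isOpen_ball.mem_nhds hz)
  · rw [hφψ', (hψ z (hsrc hz)).2.fderiv]
    exact hGX (z, ψ z) (hψ z (hsrc hz)).1 i

end Frames
end InvPDE
end

noncomputable section
namespace InvPDE

/-! ### Prolongation in terms of the contact form -/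

section Prolongation

variable {m : ℕ}

/-- The horizontal vector `∂/∂xⁱ + uᵢ ∂/∂u` of a first-order jet. -/
def hor (i : Fin m) (P : J1 m) : Pt m := (Pi.single i 1, P.2 i)

/-- The contact form `du - ∑ pₖ dxᵏ`. -/
def cform (p : Fin m → ℝ) : Pt m →L[ℝ] ℝ :=
  ContinuousLinearMap.snd ℝ _ _ -
    ∑ k, p k • (ContinuousLinearMap.proj (R := ℝ) (φ := fun _ : Fin m => ℝ) k).comp
      (ContinuousLinearMap.fst ℝ _ _)

lemma cform_apply (p : Fin m → ℝ) (v : Pt m) : cform p v = v.2 - ∑ k, p k * v.1 k := by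
  simp [cform, sum_apply]

lemma cform_hor (i : Fin m) (P : J1 m) : cform P.2 (hor i P) = 0 := by
  simp [cform_apply, hor, Pi.single_apply]

@[simp] lemma cform_vert (p : Fin m → ℝ) (t : ℝ) : cform p (0, t) = t := by
  simp [cform_apply]

/-- The horizontal vectors span the kernel of the contact form, and the vertical vector is dual to
that form. -/
lemma eq_sum_hor_add (P : J1 m) (v : Pt m) :
    v = ∑ k, v.1 k • hor k P + cform P.2 v • ((0, 1) : Pt m) := by
  have h1 : (∑ k, v.1 k • hor k P).1 = v.1 := by
    rw [Prod.fst_sum]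
    funext i
    simp [hor, Finset.sum_apply, Pi.single_apply]
  have h2 : (∑ k, v.1 k • hor k P).2 = ∑ k, P.2 k * v.1 k := by
    rw [Prod.snd_sum]
    simp [hor, mul_comm]
  ext1
  · rw [Prod.fst_add, h1]; simp
  · rw [Prod.snd_add, h2]; simp [cform_apply]

lemma totalD_eq (f : Pt m → Pt m) (i : Fin m) (P : J1 m) :
    totalD f i P = fderiv ℝ f P.1 (hor i P) := rfl

lemma totalD2_eq (f : Pt m → Pt m) (i j : Fin m) (J : J2 m) :
    totalD2 f i j J = fderiv ℝ (fderiv ℝ f) J.1.1 (hor i J.1) (hor j J.1) +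
      J.2 s(i, j) • fderiv ℝ f J.1.1 (0, 1) := rfl

/-- With this reading the behaviour of prolongations under ψ becomes linear algebra of the
decomposition into contact plane and vertical line. -/
lemma prolong1_snd (X : Pt m → Pt m) (P : J1 m) (i : Fin m) :
    (prolong1 X P).2 i = cform P.2 (totalD X i P) := by
  rw [cform_apply]; rfl

lemma prolongCoeff_eq (X : Pt m → Pt m) (J : J2 m) (i j : Fin m) :
    prolongCoeff X J i j = cform J.1.2 (totalD2 X i j J)
      - ∑ k, J.2 s(j, k) * (totalD X i J.1).1 k - ∑ k, J.2 s(i, k) * (totalD X j J.1).1 k := by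
  rw [cform_apply]; rfl

variable {U : Set (Pt m)} {ψ : Pt m → Pt m}

lemma contDiffOn_fderiv {E F : Type*} [NormedAddCommGroup E] [NormedSpace ℝ E]
    [NormedAddCommGroup F] [NormedSpace ℝ F] {f : E → F} {U : Set E} (hU : IsOpen U)
    (hf : ContDiffOn ℝ ∞ f U) : ContDiffOn ℝ ∞ (fderiv ℝ f) U :=
  ((contDiffOn_infty_iff_fderiv_of_isOpen hU).1 hf).2

lemma contDiff_hor (i : Fin m) : ContDiff ℝ ∞ (hor i : J1 m → Pt m) := by
  unfold hor; fun_prop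

lemma contDiffOn_totalD (hU : IsOpen U) (hψ : ContDiffOn ℝ ∞ ψ U) (i : Fin m) :
    ContDiffOn ℝ ∞ (totalD ψ i) {P | P.1 ∈ U} := by
  have h1 := (contDiffOn_fderiv hU hψ).comp
    (contDiffOn_fst (s := {P : J1 m | P.1 ∈ U})) fun P hP => hP
  exact h1.clm_apply (contDiff_hor i).contDiffOn

lemma contDiffOn_totalD2 (hU : IsOpen U) (hψ : ContDiffOn ℝ ∞ ψ U) (i j : Fin m) :
    ContDiffOn ℝ ∞ (totalD2 ψ i j) {J | J.1.1 ∈ U} := by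
  have hf : ContDiff ℝ ∞ (fun J : J2 m => J.1.1) := by fun_prop
  have h1 := (contDiffOn_fderiv hU hψ).comp
    (hf.contDiffOn (s := {J : J2 m | J.1.1 ∈ U})) fun P hP => hP
  have h2 := (contDiffOn_fderiv hU (contDiffOn_fderiv hU hψ)).comp
    (hf.contDiffOn (s := {J : J2 m | J.1.1 ∈ U})) fun P hP => hP
  have hh : ∀ i : Fin m, ContDiff ℝ ∞ (fun J : J2 m => hor i J.1) := fun i =>
    (contDiff_hor i).comp contDiff_fst
  have hq : ContDiff ℝ ∞ (fun J : J2 m => J.2 s(i, j)) := by fun_prop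
  exact ((h2.clm_apply (hh i).contDiffOn).clm_apply (hh j).contDiffOn).add
    (hq.contDiffOn.smul (h1.clm_apply contDiffOn_const))

lemma hasFDerivAt_hor (i : Fin m) (P : J1 m) :
    ∃ L : J1 m →L[ℝ] Pt m, HasFDerivAt (hor i) L P ∧ ∀ V, L V = (0, V.2 i) := by
  have : (hor i : J1 m → Pt m) = fun P => (Pi.single i 1, 0) +
      (ContinuousLinearMap.inr ℝ (Fin m → ℝ) ℝ).comp
        ((ContinuousLinearMap.proj (R := ℝ) (φ := fun _ : Fin m => ℝ) i).comp
          (ContinuousLinearMap.snd ℝ _ _)) P := by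
    funext P; simp [hor]
  rw [this]
  exact ⟨_, (ContinuousLinearMap.hasFDerivAt _).const_add _, fun V => by simp⟩

lemma fderiv_totalD (hU : IsOpen U) (hψ : ContDiffOn ℝ ∞ ψ U) (i : Fin m) {P : J1 m}
    (hP : P.1 ∈ U) (V : J1 m) :
    fderiv ℝ (totalD ψ i) P V = fderiv ℝ (fderiv ℝ ψ) P.1 V.1 (hor i P) +
      fderiv ℝ ψ P.1 (0, V.2 i) := by
  obtain ⟨L, hL, hLV⟩ := hasFDerivAt_hor i P
  have h1 : DifferentiableAt ℝ (fderiv ℝ ψ) P.1 :=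
    ((contDiffOn_fderiv hU hψ).contDiffAt (hU.mem_nhds hP)).differentiableAt (by simp)
  have h2 := (h1.hasFDerivAt.comp P (hasFDerivAt_fst (p := P))).clm_apply hL
  have h3 : HasFDerivAt (totalD ψ i) _ P := h2
  rw [h3.fderiv]
  simp [hLV, add_comm]

lemma fderiv_totalD2 (hU : IsOpen U) (hψ : ContDiffOn ℝ ∞ ψ U) (i j : Fin m) {J : J2 m}
    (hJ : J.1.1 ∈ U) (W : J2 m) :
    fderiv ℝ (totalD2 ψ i j) J W =
      fderiv ℝ (fderiv ℝ (fderiv ℝ ψ)) J.1.1 W.1.1 (hor i J.1) (hor j J.1) +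
      fderiv ℝ (fderiv ℝ ψ) J.1.1 (0, W.1.2 i) (hor j J.1) +
      fderiv ℝ (fderiv ℝ ψ) J.1.1 (hor i J.1) (0, W.1.2 j) +
      (W.2 s(i, j) • fderiv ℝ ψ J.1.1 (0, 1) +
        J.2 s(i, j) • fderiv ℝ (fderiv ℝ ψ) J.1.1 W.1.1 (0, 1)) := by
  obtain ⟨L, hL, hLV⟩ := hasFDerivAt_hor i J.1
  obtain ⟨L', hL', hLV'⟩ := hasFDerivAt_hor j J.1
  have h1 : DifferentiableAt ℝ (fderiv ℝ ψ) J.1.1 :=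
    ((contDiffOn_fderiv hU hψ).contDiffAt (hU.mem_nhds hJ)).differentiableAt (by simp)
  have h2 : DifferentiableAt ℝ (fderiv ℝ (fderiv ℝ ψ)) J.1.1 :=
    ((contDiffOn_fderiv hU (contDiffOn_fderiv hU hψ)).contDiffAt
      (hU.mem_nhds hJ)).differentiableAt (by simp)
  have hfst : HasFDerivAt (fun J : J2 m => J.1) _ J := hasFDerivAt_fst (𝕜 := ℝ)
  have hff : HasFDerivAt (fun J : J2 m => J.1.1) _ J :=
    (hasFDerivAt_fst (p := J.1)).comp J hfst
  set Lq : J2 m →L[ℝ] ℝ :=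
    (ContinuousLinearMap.proj (R := ℝ) (φ := fun _ : Sym2 (Fin m) => ℝ) s(i, j)).comp
      (ContinuousLinearMap.snd ℝ (J1 m) (Sym2 (Fin m) → ℝ)) with hLq
  have hq : HasFDerivAt (fun J : J2 m => J.2 s(i, j)) Lq J := Lq.hasFDerivAt
  have h3 := (((h2.hasFDerivAt.comp J hff).clm_apply (hL.comp J hfst)).clm_apply
    (hL'.comp J hfst)).add (hq.smul ((h1.hasFDerivAt.comp J hff).clm_apply
      (hasFDerivAt_const ((0, 1) : Pt m) J)))
  have h4 : HasFDerivAt (totalD2 ψ i j) _ J := h3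
  rw [h4.fderiv]
  simp [hLV, hLV', hLq]
  abel

/-- Differentiating `dψ(X) = X' ∘ ψ` once. -/
lemma fderiv_intertwine (hU : IsOpen U) (hψ : ContDiffOn ℝ ∞ ψ U) {X X' : Pt m → Pt m}
    (hX : ContDiffOn ℝ ∞ X U) {U' : Set (Pt m)} (hU' : IsOpen U') (hX' : ContDiffOn ℝ ∞ X' U')
    (hUU' : MapsTo ψ U U') (h : ∀ z ∈ U, fderiv ℝ ψ z (X z) = X' (ψ z)) {z : Pt m} (hz : z ∈ U)
    (v : Pt m) :
    fderiv ℝ (fderiv ℝ ψ) z v (X z) + fderiv ℝ ψ z (fderiv ℝ X z v) =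
      fderiv ℝ X' (ψ z) (fderiv ℝ ψ z v) := by
  have hn := hU.mem_nhds hz
  have h1 := (((contDiffOn_fderiv hU hψ).contDiffAt hn).differentiableAt (by simp)).hasFDerivAt
  have h2 := ((hX.contDiffAt hn).differentiableAt (by simp)).hasFDerivAt
  have h3 := ((hψ.contDiffAt hn).differentiableAt (by simp)).hasFDerivAt
  have h4 := ((hX'.contDiffAt (hU'.mem_nhds (hUU' hz))).differentiableAt (by simp)).hasFDerivAt
  have e : (fun z => fderiv ℝ ψ z (X z)) =ᶠ[𝓝 z] X' ∘ ψ := by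
    filter_upwards [hn] with y hy using h y hy
  have := ((h1.clm_apply h2).congr_of_eventuallyEq e.symm).unique (h4.comp z h3)
  have := DFunLike.congr_fun this v
  simp at this
  rw [add_comm]
  exact this

/-- Differentiating `dψ(X) = X' ∘ ψ` twice. -/
lemma fderiv_fderiv_intertwine (hU : IsOpen U) (hψ : ContDiffOn ℝ ∞ ψ U) {X X' : Pt m → Pt m}
    (hX : ContDiffOn ℝ ∞ X U) {U' : Set (Pt m)} (hU' : IsOpen U') (hX' : ContDiffOn ℝ ∞ X' U')
    (hUU' : MapsTo ψ U U') (h : ∀ z ∈ U, fderiv ℝ ψ z (X z) = X' (ψ z)) {z : Pt m} (hz : z ∈ U)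
    (w v : Pt m) :
    fderiv ℝ (fderiv ℝ (fderiv ℝ ψ)) z w v (X z) + fderiv ℝ (fderiv ℝ ψ) z v (fderiv ℝ X z w) +
      fderiv ℝ (fderiv ℝ ψ) z w (fderiv ℝ X z v) +
      fderiv ℝ ψ z (fderiv ℝ (fderiv ℝ X) z w v) =
      fderiv ℝ (fderiv ℝ X') (ψ z) (fderiv ℝ ψ z w) (fderiv ℝ ψ z v) +
        fderiv ℝ X' (ψ z) (fderiv ℝ (fderiv ℝ ψ) z w v) := by
  have hn := hU.mem_nhds hz
  have hd1 := contDiffOn_fderiv hU hψ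
  have hdX := contDiffOn_fderiv hU hX
  have hdX' := contDiffOn_fderiv hU' hX'
  have h0 := (((contDiffOn_fderiv hU hd1).contDiffAt hn).differentiableAt (by simp)).hasFDerivAt
  have h1 := ((hd1.contDiffAt hn).differentiableAt (by simp)).hasFDerivAt
  have h2 := ((hX.contDiffAt hn).differentiableAt (by simp)).hasFDerivAt
  have h2' := ((hdX.contDiffAt hn).differentiableAt (by simp)).hasFDerivAt
  have h3 := ((hψ.contDiffAt hn).differentiableAt (by simp)).hasFDerivAt
  have h4' := ((hdX'.contDiffAt (hU'.mem_nhds (hUU' hz))).differentiableAt (by simp)).hasFDerivAt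
  have e : (fun z => fderiv ℝ (fderiv ℝ ψ) z v (X z) + fderiv ℝ ψ z (fderiv ℝ X z v)) =ᶠ[𝓝 z]
      fun z => fderiv ℝ X' (ψ z) (fderiv ℝ ψ z v) := by
    filter_upwards [hn] with y hy using fderiv_intertwine hU hψ hX hU' hX' hUU' h hy v
  have hv := hasFDerivAt_const (𝕜 := ℝ) v z
  have l := ((h0.clm_apply hv).clm_apply h2).add (h1.clm_apply (h2'.clm_apply hv))
  have r := (h4'.comp z h3).clm_apply (h1.clm_apply hv)
  have := (l.congr_of_eventuallyEq e.symm).unique r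
  have := DFunLike.congr_fun this w
  simp at this
  rw [add_comm (fderiv ℝ (fderiv ℝ X') (ψ z) (fderiv ℝ ψ z w) (fderiv ℝ ψ z v)), ← this]
  abel

lemma fderiv_fderiv_symm {E F : Type*} [NormedAddCommGroup E] [NormedSpace ℝ E]
    [NormedAddCommGroup F] [NormedSpace ℝ F] {f : E → F} {U : Set E} (hU : IsOpen U)
    (hf : ContDiffOn ℝ ∞ f U) {z : E} (hz : z ∈ U) (v w : E) :
    fderiv ℝ (fderiv ℝ f) z v w = fderiv ℝ (fderiv ℝ f) z w v :=
  (hf.contDiffAt (hU.mem_nhds hz)).isSymmSndFDerivAt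
    (by
      simp only [minSmoothness_of_isRCLikeNormedField]
      exact WithTop.coe_le_coe.2 (le_top (a := (2 : ℕ∞)))) v w

/-- A product of two adjacent transpositions: the outer pair is exchanged by symmetry for the map
`fderiv ℝ f`, the inner pair by differentiating the symmetry of the second derivative. -/
lemma fderiv3_rotate {E F : Type*} [NormedAddCommGroup E] [NormedSpace ℝ E]
    [NormedAddCommGroup F] [NormedSpace ℝ F] {f : E → F} {U : Set E} (hU : IsOpen U)
    (hf : ContDiffOn ℝ ∞ f U) {z : E} (hz : z ∈ U) (x v w : E) :
    fderiv ℝ (fderiv ℝ (fderiv ℝ f)) z v w x = fderiv ℝ (fderiv ℝ (fderiv ℝ f)) z x v w := by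
  rw [fderiv_fderiv_symm hU (contDiffOn_fderiv hU hf) hz x v]
  have hn := hU.mem_nhds hz
  have h0 := (((contDiffOn_fderiv hU (contDiffOn_fderiv hU hf)).contDiffAt hn).differentiableAt
    (by simp)).hasFDerivAt
  have e : (fun z => fderiv ℝ (fderiv ℝ f) z w x) =ᶠ[𝓝 z] fun z => fderiv ℝ (fderiv ℝ f) z x w := by
    filter_upwards [hn] with y hy using fderiv_fderiv_symm hU hf hy w x
  have hl := (h0.clm_apply (hasFDerivAt_const w z)).clm_apply (hasFDerivAt_const x z)
  have hr := (h0.clm_apply (hasFDerivAt_const x z)).clm_apply (hasFDerivAt_const w z)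
  have := (hl.congr_of_eventuallyEq e.symm).unique hr
  simpa using DFunLike.congr_fun this v

/-- The derivative of the total derivatives of `ψ` along a prolonged field. -/
lemma fderiv_totalD_prolong1 (hU : IsOpen U) (hψ : ContDiffOn ℝ ∞ ψ U) {X X' : Pt m → Pt m}
    (hX : ContDiffOn ℝ ∞ X U) {U' : Set (Pt m)} (hU' : IsOpen U') (hX' : ContDiffOn ℝ ∞ X' U')
    (hUU' : MapsTo ψ U U') (h : ∀ z ∈ U, fderiv ℝ ψ z (X z) = X' (ψ z)) {P : J1 m} (hP : P.1 ∈ U)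
    (i : Fin m) :
    fderiv ℝ (totalD ψ i) P (prolong1 X P) = fderiv ℝ X' (ψ P.1) (totalD ψ i P) -
      ∑ k, (totalD X i P).1 k • totalD ψ k P := by
  rw [fderiv_totalD hU hψ i hP, prolong1_snd]
  have h1 := fderiv_intertwine hU hψ hX hU' hX' hUU' h hP (hor i P)
  -- The vertical part of D_i X is the fibre component of the prolonged field, so what survives is
  -- the horizontal part. This is the commutation rule of X⁽¹⁾ with D_i.
  have h2 := congrArg (fderiv ℝ ψ P.1) (eq_sum_hor_add P (totalD X i P))
  simp only [map_add, map_sum, map_smul] at h2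
  rw [totalD_eq ψ i, ← h1, ← totalD_eq X i, h2, fderiv_fderiv_symm hU hψ hP (hor i P)]
  have : ((0, cform P.2 (totalD X i P)) : Pt m) = cform P.2 (totalD X i P) • (0, 1) := by simp
  rw [this, map_smul]
  simp only [totalD_eq ψ]
  show fderiv ℝ (fderiv ℝ ψ) P.1 (X P.1) (hor i P) + _ = _
  abel

/-- The derivative of the second total derivatives of `ψ` along a prolonged field. -/
lemma fderiv_totalD2_prolong2 (hU : IsOpen U) (hψ : ContDiffOn ℝ ∞ ψ U) {X X' : Pt m → Pt m}
    (hX : ContDiffOn ℝ ∞ X U) {U' : Set (Pt m)} (hU' : IsOpen U') (hX' : ContDiffOn ℝ ∞ X' U')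
    (hUU' : MapsTo ψ U U') (h : ∀ z ∈ U, fderiv ℝ ψ z (X z) = X' (ψ z)) {J : J2 m}
    (hJ : J.1.1 ∈ U) (i j : Fin m) {W : J2 m} (hW1 : W.1 = prolong1 X J.1)
    (hW2 : W.2 s(i, j) = prolongCoeff X J i j) :
    fderiv ℝ (totalD2 ψ i j) J W =
      fderiv ℝ (fderiv ℝ X') (ψ J.1.1) (totalD ψ i J.1) (totalD ψ j J.1) +
      fderiv ℝ X' (ψ J.1.1) (totalD2 ψ i j J) -
      ∑ k, (totalD X i J.1).1 k • totalD2 ψ j k J - ∑ k, (totalD X j J.1).1 k • totalD2 ψ i k J -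
      ∑ k, (totalD2 X i j J).1 k • totalD ψ k J.1 := by
  set D := fderiv ℝ ψ J.1.1 with hD
  set D2 := fderiv ℝ (fderiv ℝ ψ) J.1.1 with hD2
  rw [fderiv_totalD2 hU hψ i j hJ, hW1, hW2]
  have hX1 : (prolong1 X J.1).1 = X J.1.1 := rfl
  rw [hX1, prolong1_snd, prolong1_snd]
  have i1 := fderiv_intertwine hU hψ hX hU' hX' hUU' h hJ (0, 1)
  have i2 := fderiv_fderiv_intertwine hU hψ hX hU' hX' hUU' h hJ (hor i J.1) (hor j J.1)
  have c : ∀ i, ((0, cform J.1.2 (totalD X i J.1)) : Pt m) =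
      totalD X i J.1 - ∑ k, (totalD X i J.1).1 k • hor k J.1 := by
    intro i
    have := eq_sum_hor_add J.1 (totalD X i J.1)
    rw [eq_sub_iff_add_eq]
    conv_rhs => rw [this]
    rw [add_comm]; simp
  -- The prolongation formula solved for its vertical vector, so that dψ can be applied termwise.
  have c2 : prolongCoeff X J i j • ((0, 1) : Pt m) = totalD2 X i j J
      - ∑ k, (totalD2 X i j J).1 k • hor k J.1
      - ∑ k, (totalD X i J.1).1 k • J.2 s(j, k) • ((0, 1) : Pt m)
      - ∑ k, (totalD X j J.1).1 k • J.2 s(i, k) • ((0, 1) : Pt m) := by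
    rw [prolongCoeff_eq, sub_smul, sub_smul]
    have := eq_sum_hor_add J.1 (totalD2 X i j J)
    have e1 : cform J.1.2 (totalD2 X i j J) • ((0, 1) : Pt m) = totalD2 X i j J
        - ∑ k, (totalD2 X i j J).1 k • hor k J.1 := by
      rw [eq_sub_iff_add_eq]
      conv_rhs => rw [this]
      rw [add_comm]
    rw [e1, Finset.sum_smul, Finset.sum_smul]
    simp only [smul_smul, mul_comm]
  have c3 := congrArg D c2
  rw [map_smul] at c3
  rw [c3, c i, c j]
  simp only [← hD, ← hD2] at i1 i2 ⊢
  simp only [map_sub, map_sum, map_smul, sub_apply, sum_apply, smul_apply]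
  have t1 : totalD ψ i J.1 = D (hor i J.1) := rfl
  have t2 : totalD ψ j J.1 = D (hor j J.1) := rfl
  have t3 : ∀ i j, totalD2 ψ i j J = D2 (hor i J.1) (hor j J.1) + J.2 s(i, j) • D (0, 1) :=
    fun _ _ => rfl
  have t4 : totalD2 X i j J = fderiv ℝ (fderiv ℝ X) J.1.1 (hor i J.1) (hor j J.1) +
      J.2 s(i, j) • fderiv ℝ X J.1.1 (0, 1) := rfl
  have t5 : ∀ k, totalD ψ k J.1 = D (hor k J.1) := fun _ => rfl
  rw [fderiv3_rotate hU hψ hJ] at i2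
  have s1 : ∀ v w, D2 v w = D2 w v := fun v w => fderiv_fderiv_symm hU hψ hJ v w
  have i1' := congrArg (fun v => J.2 s(i, j) • v) i1
  simp only [smul_add] at i1'
  have e0 : D (totalD2 X i j J) = D (fderiv ℝ (fderiv ℝ X) J.1.1 (hor i J.1) (hor j J.1)) +
      J.2 s(i, j) • D (fderiv ℝ X J.1.1 (0, 1)) := by rw [t4, map_add, map_smul]
  have e1 : fderiv ℝ X' (ψ J.1.1) (totalD2 ψ i j J)
      = fderiv ℝ X' (ψ J.1.1) (D2 (hor i J.1) (hor j J.1))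
        + J.2 s(i, j) • fderiv ℝ X' (ψ J.1.1) (D (0, 1)) := by rw [t3, map_add, map_smul]
  have t6 : ∀ k, totalD X k J.1 = fderiv ℝ X J.1.1 (hor k J.1) := fun _ => rfl
  rw [e1, e0, ← i1', t1, t2]
  rw [← sub_eq_zero] at i2 ⊢
  rw [← i2]
  simp only [t3, t5, smul_add, Finset.sum_add_distrib]
  rw [s1 (X J.1.1) (0, 1), s1 (totalD X i J.1) (hor j J.1), ← t6, ← t6]
  simp only [s1 _ (hor j J.1)]
  abel

/-- By symmetry of second derivatives the symmetrization in `prolong2` has no effect on smooth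
fields. -/
lemma prolong2_snd {X : Pt m → Pt m} (hU : IsOpen U) (hX : ContDiffOn ℝ ∞ X U) {J : J2 m}
    (hJ : J.1.1 ∈ U) (i j : Fin m) : (prolong2 X J).2 s(i, j) = prolongCoeff X J i j := by
  have hs : prolongCoeff X J j i = prolongCoeff X J i j := by
    rw [prolongCoeff_eq, prolongCoeff_eq, totalD2_eq, totalD2_eq,
      fderiv_fderiv_symm hU hX hJ (hor j J.1), Sym2.eq_swap]
    ring
  show (prolongCoeff X J i j + prolongCoeff X J j i) / 2 = _
  rw [hs]; ring

end Prolongation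
end InvPDE
end

noncomputable section
namespace InvPDE

/-! ### The action of a local diffeomorphism on jets -/

section JetTransformation

variable {m : ℕ}

/-- The derivative of the new independent variables along the graph. -/
def slope (ψ : Pt m → Pt m) (P : J1 m) : (Fin m → ℝ) →L[ℝ] (Fin m → ℝ) :=
  ∑ i, (ContinuousLinearMap.proj i : (Fin m → ℝ) →L[ℝ] ℝ).smulRight (totalD ψ i P).1

/-- The action of `ψ` on first-order jets. -/
def trans1 (ψ : Pt m → Pt m) (P : J1 m) : J1 m :=
  (ψ P.1, fun k => ∑ i, (slope ψ P).inverse (Pi.single k 1) i * (totalD ψ i P).2)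

/-- The action of `ψ` on second-order jets. -/
def trans2 (ψ : Pt m → Pt m) (J : J2 m) : J2 m :=
  (trans1 ψ J.1, fun s => ∑ i, ∑ j, (slope ψ J.1).inverse (Pi.single (Quot.out s).1 1) i *
    ((slope ψ J.1).inverse (Pi.single (Quot.out s).2 1) j *
      cform (trans1 ψ J.1).2 (totalD2 ψ i j J)))

/-- The algebraic relations between the jets of a function and of its transform under `ψ`. -/
structure JetRel (ψ : Pt m → Pt m) (J J' : J2 m) : Prop where
  base : ψ J.1.1 = J'.1.1
  first : ∀ i, cform J'.1.2 (totalD ψ i J.1) = 0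
  second : ∀ i j, cform J'.1.2 (totalD2 ψ i j J) =
    ∑ k, ∑ l, J'.2 s(k, l) * ((totalD ψ i J.1).1 k * (totalD ψ j J.1).1 l)

variable {U : Set (Pt m)} {ψ : Pt m → Pt m}

lemma slope_apply (P : J1 m) (c : Fin m → ℝ) (l : Fin m) :
    slope ψ P c l = ∑ i, c i * (totalD ψ i P).1 l := by
  simp [slope, sum_apply, Finset.sum_apply]

lemma inverse_mul_slope {P : J1 m} (h : (slope ψ P).IsInvertible) (k l : Fin m) :
    ∑ i, (slope ψ P).inverse (Pi.single k 1) i * (totalD ψ i P).1 l = if k = l then 1 else 0 := by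
  rw [← slope_apply]
  obtain ⟨e, he⟩ := h
  rw [← he, ContinuousLinearMap.inverse_equiv]
  simp [Pi.single_apply, eq_comm]

lemma slope_mul_inverse {P : J1 m} (h : (slope ψ P).IsInvertible) (i j : Fin m) :
    ∑ k, (totalD ψ i P).1 k * (slope ψ P).inverse (Pi.single k 1) j = if i = j then 1 else 0 := by
  have h1 : (slope ψ P).inverse (slope ψ P (Pi.single i 1)) = Pi.single i 1 := by
    obtain ⟨e, he⟩ := h
    rw [← he, ContinuousLinearMap.inverse_equiv]
    simp
  have h2 : slope ψ P (Pi.single i 1) = ∑ k, (totalD ψ i P).1 k • (Pi.single k 1 : Fin m → ℝ) := by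
    funext l
    rw [slope_apply]
    simp [Pi.single_apply, Finset.sum_apply]
  rw [h2, map_sum] at h1
  have := congrFun h1 j
  simpa [Finset.sum_apply, Pi.single_apply, eq_comm] using this

/-- This and the next three contractions express that the slope matrix and its inverse cancel. They
allow identities between new jet coordinates to be tested against the vectors D_iψ. -/
lemma inverse_contract {P : J1 m} (h : (slope ψ P).IsInvertible) (f : Fin m → ℝ) (k : Fin m) :
    ∑ i, (slope ψ P).inverse (Pi.single k 1) i * ∑ l, f l * (totalD ψ i P).1 l = f k := by
  simp only [Finset.mul_sum]
  rw [Finset.sum_comm]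
  have : ∀ l, ∑ i, (slope ψ P).inverse (Pi.single k 1) i * (f l * (totalD ψ i P).1 l)
      = f l * if k = l then 1 else 0 := fun l => by
    rw [← inverse_mul_slope h, Finset.mul_sum]
    exact Finset.sum_congr rfl fun i _ => by ring
  simp [this]

lemma slope_contract {P : J1 m} (h : (slope ψ P).IsInvertible) (g : Fin m → ℝ) (i : Fin m) :
    ∑ k, (totalD ψ i P).1 k * ∑ j, (slope ψ P).inverse (Pi.single k 1) j * g j = g i := by
  simp only [Finset.mul_sum]
  rw [Finset.sum_comm]
  have : ∀ j, ∑ k, (totalD ψ i P).1 k * ((slope ψ P).inverse (Pi.single k 1) j * g j)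
      = (if i = j then 1 else 0) * g j := fun l => by
    rw [← slope_mul_inverse h, Finset.sum_mul]
    exact Finset.sum_congr rfl fun i _ => by ring
  simp [this]

lemma inverse_contract2 {P : J1 m} (h : (slope ψ P).IsInvertible) (f : Fin m → Fin m → ℝ)
    (k l : Fin m) :
    ∑ i, ∑ j, (slope ψ P).inverse (Pi.single k 1) i * ((slope ψ P).inverse (Pi.single l 1) j *
      ∑ k', ∑ l', f k' l' * ((totalD ψ i P).1 k' * (totalD ψ j P).1 l')) = f k l := by
  have h1 : ∀ i, ∑ j, (slope ψ P).inverse (Pi.single l 1) j *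
      ∑ k', ∑ l', f k' l' * ((totalD ψ i P).1 k' * (totalD ψ j P).1 l')
      = ∑ k', f k' l * (totalD ψ i P).1 k' := fun i => by
    have := inverse_contract h (fun l' => ∑ k', f k' l' * (totalD ψ i P).1 k') l
    rw [← this]
    refine Finset.sum_congr rfl fun j _ => ?_
    rw [Finset.sum_comm]
    congr 1
    refine Finset.sum_congr rfl fun l' _ => ?_
    rw [Finset.sum_mul]
    exact Finset.sum_congr rfl fun k' _ => by ring
  simp only [← Finset.mul_sum, h1]
  exact inverse_contract h (fun k' => f k' l) k

lemma slope_contract2 {P : J1 m} (h : (slope ψ P).IsInvertible) (g : Fin m → Fin m → ℝ)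
    (i j : Fin m) :
    ∑ k, ∑ l, (∑ i', ∑ j', (slope ψ P).inverse (Pi.single k 1) i' *
      ((slope ψ P).inverse (Pi.single l 1) j' * g i' j')) *
        ((totalD ψ i P).1 k * (totalD ψ j P).1 l) = g i j := by
  have h1 : ∀ k, ∑ l, (∑ i', ∑ j', (slope ψ P).inverse (Pi.single k 1) i' *
      ((slope ψ P).inverse (Pi.single l 1) j' * g i' j')) *
        ((totalD ψ i P).1 k * (totalD ψ j P).1 l)
      = (totalD ψ i P).1 k * ∑ i', (slope ψ P).inverse (Pi.single k 1) i' * g i' j := fun k => by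
    have : ∀ i', g i' j = _ := fun i' => (slope_contract h (g i') j).symm
    simp only [this]
    simp only [Finset.mul_sum, Finset.sum_mul]
    rw [Finset.sum_comm]
    refine Finset.sum_congr rfl fun i' _ => Finset.sum_congr rfl fun l _ =>
      Finset.sum_congr rfl fun j' _ => by ring
  simp only [h1]
  exact slope_contract h (fun i' => g i' j) i

lemma totalD2_symm (hU : IsOpen U) (hψ : ContDiffOn ℝ ∞ ψ U) {J : J2 m} (hJ : J.1.1 ∈ U)
    (i j : Fin m) : totalD2 ψ i j J = totalD2 ψ j i J := by
  rw [totalD2_eq, totalD2_eq, fderiv_fderiv_symm hU hψ hJ, Sym2.eq_swap]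

/-- The representative of the unordered pair chosen by `Quot.out` is irrelevant because D_iD_jψ is
symmetric. -/
lemma trans2_snd (hU : IsOpen U) (hψ : ContDiffOn ℝ ∞ ψ U) {J : J2 m} (hJ : J.1.1 ∈ U)
    (k l : Fin m) : (trans2 ψ J).2 s(k, l) = ∑ i, ∑ j, (slope ψ J.1).inverse (Pi.single k 1) i *
    ((slope ψ J.1).inverse (Pi.single l 1) j * cform (trans1 ψ J.1).2 (totalD2 ψ i j J)) := by
  have h : s((Quot.out s(k, l)).1, (Quot.out s(k, l)).2) = s(k, l) := Quot.out_eq s(k, l)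
  show (∑ i, ∑ j, (slope ψ J.1).inverse (Pi.single (Quot.out s(k, l)).1 1) i *
    ((slope ψ J.1).inverse (Pi.single (Quot.out s(k, l)).2 1) j *
      cform (trans1 ψ J.1).2 (totalD2 ψ i j J))) = _
  rcases Sym2.eq_iff.1 h with ⟨h1, h2⟩ | ⟨h1, h2⟩
  · rw [h1, h2]
  · rw [h1, h2, Finset.sum_comm]
    refine Finset.sum_congr rfl fun j _ => Finset.sum_congr rfl fun i _ => ?_
    rw [totalD2_symm hU hψ hJ i j]; ring

lemma jetRel_trans1_first {P : J1 m} (h : (slope ψ P).IsInvertible) (i : Fin m) :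
    cform (trans1 ψ P).2 (totalD ψ i P) = 0 := by
  rw [cform_apply, sub_eq_zero, ← slope_contract h (fun j => (totalD ψ j P).2) i]
  exact Finset.sum_congr rfl fun k _ => mul_comm _ _

lemma jetRel_trans2 (hU : IsOpen U) (hψ : ContDiffOn ℝ ∞ ψ U) {J : J2 m} (hJ : J.1.1 ∈ U)
    (h : (slope ψ J.1).IsInvertible) : JetRel ψ J (trans2 ψ J) where
  base := rfl
  first := jetRel_trans1_first h
  second i j := by
    simp only [trans2_snd hU hψ hJ]
    exact (slope_contract2 h (fun i j => cform (trans1 ψ J.1).2 (totalD2 ψ i j J)) i j).symm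

/-- Once the first derivatives are found, the relations are linear in the second derivatives of the
new jet. At each order the slope can be inverted. -/
lemma JetRel.eq_trans2 (hU : IsOpen U) (hψ : ContDiffOn ℝ ∞ ψ U) {J J' : J2 m} (hJ : J.1.1 ∈ U)
    (h : (slope ψ J.1).IsInvertible) (hJJ' : JetRel ψ J J') : J' = trans2 ψ J := by
  have h1 : J'.1 = trans1 ψ J.1 := by
    refine Prod.ext hJJ'.base.symm (funext fun k => ?_)
    show _ = ∑ i, (slope ψ J.1).inverse (Pi.single k 1) i * (totalD ψ i J.1).2
    rw [← inverse_contract h J'.1.2 k]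
    refine Finset.sum_congr rfl fun i _ => ?_
    have := hJJ'.first i
    rw [cform_apply, sub_eq_zero] at this
    rw [this]
  refine Prod.ext h1 (funext fun s => ?_)
  induction s using Sym2.ind with
  | _ k l =>
    rw [trans2_snd hU hψ hJ, ← h1]
    simp only [hJJ'.second]
    exact (inverse_contract2 h (fun k l => J'.2 s(k, l)) k l).symm

/-- A vector in the kernel of the slope gives a horizontal combination whose image under dψ is
vertical and lies in a contact plane, hence is zero. Invertibility is thus automatic for jets that
have a transform. -/
lemma slope_isInvertible_of_first {P P' : J1 m} (hψ : Function.Injective (fderiv ℝ ψ P.1))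
    (h : ∀ i, cform P'.2 (totalD ψ i P) = 0) : (slope ψ P).IsInvertible := by
  have hinj : Function.Injective (slope ψ P).toLinearMap := by
    rw [← LinearMap.ker_eq_bot, LinearMap.ker_eq_bot']
    intro c hc
    have hc' : slope ψ P c = 0 := hc
    have h1 : fderiv ℝ ψ P.1 (∑ i, c i • hor i P) = 0 := by
      simp only [map_sum, map_smul]
      have e1 : (∑ i, c i • fderiv ℝ ψ P.1 (hor i P)).1 = 0 := by
        rw [← hc', Prod.fst_sum]
        funext l
        rw [slope_apply]; simp [Finset.sum_apply, totalD_eq]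
      have e2 : cform P'.2 (∑ i, c i • fderiv ℝ ψ P.1 (hor i P)) = 0 := by
        simp only [map_sum, map_smul, ← totalD_eq, h]; simp
      rw [cform_apply, e1] at e2
      exact Prod.ext e1 (by simpa using e2)
    have h2 := hψ (h1.trans (map_zero _).symm)
    have h3 := congrArg Prod.fst h2
    rw [Prod.fst_sum] at h3
    funext i
    have := congrFun h3 i
    simpa [Finset.sum_apply, hor, Pi.single_apply] using this
  exact ⟨(LinearEquiv.ofInjectiveOfFinrankEq _ hinj rfl).toContinuousLinearEquiv, by ext c; rfl⟩

/-- Otherwise the new contact form would vanish on the whole image of dψ. -/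
lemma cform_fderiv_vert_ne_zero {P : J1 m} (hψ : Function.Surjective (fderiv ℝ ψ P.1))
    {p' : Fin m → ℝ} (h : ∀ i, cform p' (totalD ψ i P) = 0) :
    cform p' (fderiv ℝ ψ P.1 (0, 1)) ≠ 0 := by
  intro h0
  obtain ⟨v, hv⟩ := hψ (0, 1)
  have h1 : cform p' (fderiv ℝ ψ P.1 v) = 1 := by rw [hv]; simp
  rw [eq_sum_hor_add P v] at h1
  simp only [map_add, map_sum, map_smul, ← totalD_eq, h, h0] at h1
  simp at h1

/-! ### Smoothness and derivatives of the transformation of jets -/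

lemma eventually_slope_isInvertible (hU : IsOpen U) (hψ : ContDiffOn ℝ ∞ ψ U) {P : J1 m}
    (hP : P.1 ∈ U) (h : (slope ψ P).IsInvertible) :
    ∀ᶠ P' in 𝓝 P, P'.1 ∈ U ∧ (slope ψ P').IsInvertible := by
  have hV : IsOpen {P : J1 m | P.1 ∈ U} := hU.preimage continuous_fst
  have hc : ContinuousAt (slope ψ) P := by
    unfold slope
    refine tendsto_finsetSum _ fun i _ => ?_
    have h1 := ((contDiffOn_totalD hU hψ i).contDiffAt (hV.mem_nhds hP)).continuousAt
    exact ((ContinuousLinearMap.smulRightL ℝ (Fin m → ℝ) (Fin m → ℝ)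
      (ContinuousLinearMap.proj i)).continuous.continuousAt).comp
        (continuous_fst.continuousAt.comp h1)
  obtain ⟨e, he⟩ := h
  have := hc.eventually (he ▸ ContinuousLinearEquiv.nhds e)
  filter_upwards [hV.mem_nhds hP, this] with P' h1 ⟨e', h2⟩ using ⟨h1, ⟨e', h2⟩⟩

lemma contDiffAt_slope (hU : IsOpen U) (hψ : ContDiffOn ℝ ∞ ψ U) {P : J1 m} (hP : P.1 ∈ U) :
    ContDiffAt ℝ ∞ (slope ψ) P := by
  have hV : IsOpen {P : J1 m | P.1 ∈ U} := hU.preimage continuous_fst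
  unfold slope
  exact ContDiffAt.sum fun i _ => contDiffAt_const.smulRight
    ((contDiffOn_totalD hU hψ i).contDiffAt (hV.mem_nhds hP)).fst

lemma contDiffAt_inverse_slope (hU : IsOpen U) (hψ : ContDiffOn ℝ ∞ ψ U) {P : J1 m} (hP : P.1 ∈ U)
    (h : (slope ψ P).IsInvertible) (k i : Fin m) :
    ContDiffAt ℝ ∞ (fun P => (slope ψ P).inverse (Pi.single k 1) i) P := by
  have h1 := (h.contDiffAt_map_inverse.comp P (contDiffAt_slope hU hψ hP)).clm_apply
    (contDiffAt_const (c := (Pi.single k 1 : Fin m → ℝ)))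
  exact contDiffAt_pi.1 h1 i

lemma contDiffAt_trans1 (hU : IsOpen U) (hψ : ContDiffOn ℝ ∞ ψ U) {P : J1 m} (hP : P.1 ∈ U)
    (h : (slope ψ P).IsInvertible) : ContDiffAt ℝ ∞ (trans1 ψ) P := by
  have hV : IsOpen {P : J1 m | P.1 ∈ U} := hU.preimage continuous_fst
  refine ContDiffAt.prodMk ((hψ.contDiffAt (hU.mem_nhds hP)).comp P contDiffAt_fst) ?_
  refine contDiffAt_pi.2 fun k => ContDiffAt.sum fun i _ => ?_
  exact (contDiffAt_inverse_slope hU hψ hP h k i).mul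
    ((contDiffOn_totalD hU hψ i).contDiffAt (hV.mem_nhds hP)).snd

lemma contDiffAt_cform {E : Type*} [NormedAddCommGroup E] [NormedSpace ℝ E] {p : E → Fin m → ℝ}
    {v : E → Pt m} {x : E} (hp : ContDiffAt ℝ ∞ p x) (hv : ContDiffAt ℝ ∞ v x) :
    ContDiffAt ℝ ∞ (fun x => cform (p x) (v x)) x := by
  simp only [cform_apply]
  exact hv.snd.sub (ContDiffAt.sum fun k _ => (contDiffAt_pi.1 hp k).mul (contDiffAt_pi.1 hv.fst k))

lemma contDiffAt_trans2 (hU : IsOpen U) (hψ : ContDiffOn ℝ ∞ ψ U) {J : J2 m} (hJ : J.1.1 ∈ U)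
    (h : (slope ψ J.1).IsInvertible) : ContDiffAt ℝ ∞ (trans2 ψ) J := by
  have hV : IsOpen {J : J2 m | J.1.1 ∈ U} := hU.preimage (continuous_fst.comp continuous_fst)
  have h1 := (contDiffAt_trans1 hU hψ hJ h).comp J contDiffAt_fst
  refine ContDiffAt.prodMk h1 ?_
  refine contDiffAt_pi.2 fun s => ContDiffAt.sum fun i _ => ContDiffAt.sum fun j _ => ?_
  refine ((contDiffAt_inverse_slope hU hψ hJ h _ i).comp J contDiffAt_fst).mul
    (((contDiffAt_inverse_slope hU hψ hJ h _ j).comp J contDiffAt_fst).mul ?_)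
  exact contDiffAt_cform h1.snd ((contDiffOn_totalD2 hU hψ i j).contDiffAt (hV.mem_nhds hJ))

lemma fderiv_cform {E : Type*} [NormedAddCommGroup E] [NormedSpace ℝ E] {p : E → Fin m → ℝ}
    {v : E → Pt m} {x : E} (hp : DifferentiableAt ℝ p x) (hv : DifferentiableAt ℝ v x) (V : E) :
    fderiv ℝ (fun x => cform (p x) (v x)) x V =
      cform (p x) (fderiv ℝ v x V) - ∑ k, fderiv ℝ p x V k * (v x).1 k := by
  have hp' : ∀ k, HasFDerivAt (fun x => p x k)
      ((ContinuousLinearMap.proj (R := ℝ) (φ := fun _ : Fin m => ℝ) k).comp (fderiv ℝ p x)) x :=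
    fun k => hasFDerivAt_pi'.1 hp.hasFDerivAt k
  have hv1 : ∀ k, HasFDerivAt (fun x => (v x).1 k)
      ((ContinuousLinearMap.proj (R := ℝ) (φ := fun _ : Fin m => ℝ) k).comp
        ((ContinuousLinearMap.fst ℝ (Fin m → ℝ) ℝ).comp (fderiv ℝ v x))) x :=
    fun k => hasFDerivAt_pi'.1 hv.hasFDerivAt.fst k
  have h := hv.hasFDerivAt.snd.fun_sub
    (HasFDerivAt.fun_sum (u := Finset.univ) fun k _ => (hp' k).fun_mul (hv1 k))
  have e : (fun x => cform (p x) (v x)) = fun x => (v x).2 - ∑ k, p x k * (v x).1 k :=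
    funext fun x => cform_apply _ _
  rw [e, h.fderiv]
  simp [cform_apply, sum_apply, Finset.sum_add_distrib, mul_comm]
  ring

/-- Derivative of the first-order relations. -/
lemma fderiv_trans1_relation (hU : IsOpen U) (hψ : ContDiffOn ℝ ∞ ψ U) {P : J1 m} (hP : P.1 ∈ U)
    (h : (slope ψ P).IsInvertible) (V : J1 m) (i : Fin m) :
    ∑ k, (fderiv ℝ (trans1 ψ) P V).2 k * (totalD ψ i P).1 k =
      cform (trans1 ψ P).2 (fderiv ℝ (totalD ψ i) P V) := by
  have hV : IsOpen {P : J1 m | P.1 ∈ U} := hU.preimage continuous_fst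
  have h1 := (contDiffAt_trans1 hU hψ hP h).differentiableAt (by simp)
  have h2 := ((contDiffOn_totalD hU hψ i).contDiffAt (hV.mem_nhds hP)).differentiableAt (by simp)
  have h3 := fderiv_cform h1.snd h2 V
  have e : (fun P => cform (trans1 ψ P).2 (totalD ψ i P)) =ᶠ[𝓝 P] fun _ => 0 := by
    filter_upwards [eventually_slope_isInvertible hU hψ hP h] with P' hP'
      using jetRel_trans1_first hP'.2 i
  rw [e.fderiv_eq] at h3
  have h4 : fderiv ℝ (fun P => (trans1 ψ P).2) P V = (fderiv ℝ (trans1 ψ) P V).2 := by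
    rw [h1.hasFDerivAt.snd.fderiv]; rfl
  rw [h4] at h3
  simp only [fderiv_fun_const, Pi.zero_apply, zero_apply] at h3
  linarith

lemma fderiv_trans1_fst (hU : IsOpen U) (hψ : ContDiffOn ℝ ∞ ψ U) {P : J1 m} (hP : P.1 ∈ U)
    (h : (slope ψ P).IsInvertible) (V : J1 m) :
    (fderiv ℝ (trans1 ψ) P V).1 = fderiv ℝ ψ P.1 V.1 := by
  have h1 := (contDiffAt_trans1 hU hψ hP h).differentiableAt (by simp)
  have h2 := ((hψ.contDiffAt (hU.mem_nhds hP)).differentiableAt (by simp)).hasFDerivAt.comp P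
    (hasFDerivAt_fst (p := P))
  have h3 := h1.hasFDerivAt.fst.unique h2
  exact DFunLike.congr_fun h3 V

/-- The transformation of first-order jets takes prolonged fields to prolonged fields. -/
lemma fderiv_trans1_prolong1 (hU : IsOpen U) (hψ : ContDiffOn ℝ ∞ ψ U) {X X' : Pt m → Pt m}
    (hX : ContDiffOn ℝ ∞ X U) {U' : Set (Pt m)} (hU' : IsOpen U') (hX' : ContDiffOn ℝ ∞ X' U')
    (hUU' : MapsTo ψ U U') (hXX' : ∀ z ∈ U, fderiv ℝ ψ z (X z) = X' (ψ z)) {P : J1 m}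
    (hP : P.1 ∈ U) (h : (slope ψ P).IsInvertible) :
    fderiv ℝ (trans1 ψ) P (prolong1 X P) = prolong1 X' (trans1 ψ P) := by
  refine Prod.ext ?_ (funext fun k => ?_)
  · rw [fderiv_trans1_fst hU hψ hP h]
    exact hXX' P.1 hP
  · rw [← inverse_contract h (fderiv ℝ (trans1 ψ) P (prolong1 X P)).2 k,
      ← inverse_contract h (prolong1 X' (trans1 ψ P)).2 k]
    refine Finset.sum_congr rfl fun i _ => ?_
    rw [fderiv_trans1_relation hU hψ hP h,
      fderiv_totalD_prolong1 hU hψ hX hU' hX' hUU' hXX' hP i, map_sub, map_sum]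
    -- The terms (D_iξ^k) D_kψ lie in the new contact plane and disappear. Since D_iψ is itself
    -- horizontal for the new jet, the remaining term is a combination of total derivatives of X'.
    simp only [map_smul, jetRel_trans1_first h, smul_zero, Finset.sum_const_zero, sub_zero]
    congr 1
    have := eq_sum_hor_add (trans1 ψ P) (totalD ψ i P)
    rw [jetRel_trans1_first h, zero_smul, add_zero] at this
    conv_lhs => rw [this]
    simp only [map_sum, map_smul, prolong1_snd, smul_eq_mul, mul_comm]
    rfl

/-- The first-order action is an immersion along the fibres. -/
lemma fderiv_trans1_vert (hU : IsOpen U) (hψ : ContDiffOn ℝ ∞ ψ U) {P : J1 m} (hP : P.1 ∈ U)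
    (h : (slope ψ P).IsInvertible) (hs : Function.Surjective (fderiv ℝ ψ P.1)) {η : Fin m → ℝ}
    (h0 : (fderiv ℝ (trans1 ψ) P (0, η)).2 = 0) : η = 0 := by
  funext i
  have h1 := fderiv_trans1_relation hU hψ hP h (0, η) i
  rw [h0, fderiv_totalD hU hψ i hP] at h1
  have h2 := cform_fderiv_vert_ne_zero hs (jetRel_trans1_first h)
  have e : ((0, η i) : Pt m) = η i • (0, 1) := by simp
  simp only [e, map_zero, zero_apply, zero_add, map_smul, Pi.zero_apply, zero_mul,
    Finset.sum_const_zero, smul_eq_mul] at h1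
  rcases mul_eq_zero.1 h1.symm with h3 | h3
  · exact h3
  · exact absurd h3 h2

/-- The second-order action is affine and injective on the fibres. -/
lemma trans2_affine (hU : IsOpen U) (hψ : ContDiffOn ℝ ∞ ψ U) {P : J1 m} (hP : P.1 ∈ U)
    (h : (slope ψ P).IsInvertible) (hs : Function.Surjective (fderiv ℝ ψ P.1)) :
    ∃ (L : (Sym2 (Fin m) → ℝ) →ₗ[ℝ] (Sym2 (Fin m) → ℝ)) (d : Sym2 (Fin m) → ℝ),
      Function.Injective L ∧ ∀ q, (trans2 ψ (P, q)).2 = L q + d := by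
  -- The factor with which u_ij enters the contact value of D_iD_jψ; the second derivatives occur
  -- nowhere else.
  set κ := cform (trans1 ψ P).2 (fderiv ℝ ψ P.1 (0, 1)) with hκ
  have hκ0 : κ ≠ 0 := cform_fderiv_vert_ne_zero hs (jetRel_trans1_first h)
  set B := fun k i => (slope ψ P).inverse (Pi.single k 1) i with hB
  let L : (Sym2 (Fin m) → ℝ) →ₗ[ℝ] (Sym2 (Fin m) → ℝ) :=
    { toFun := fun q s => ∑ i, ∑ j, B (Quot.out s).1 i * (B (Quot.out s).2 j * (q s(i, j) * κ))
      map_add' := fun q q' => by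
        funext s
        simp only [Pi.add_apply, add_mul, mul_add, Finset.sum_add_distrib]
      map_smul' := fun c q => by
        funext s
        simp only [Pi.smul_apply, smul_eq_mul, Finset.mul_sum, RingHom.id_apply]
        refine Finset.sum_congr rfl fun i _ => Finset.sum_congr rfl fun j _ => by ring }
  have hL : ∀ q, (trans2 ψ (P, q)).2 = L q + (trans2 ψ (P, 0)).2 := by
    intro q
    funext s
    show (∑ i, ∑ j, B (Quot.out s).1 i * (B (Quot.out s).2 j *
        cform (trans1 ψ P).2 (totalD2 ψ i j (P, q)))) =
      (∑ i, ∑ j, B (Quot.out s).1 i * (B (Quot.out s).2 j * (q s(i, j) * κ))) +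
      ∑ i, ∑ j, B (Quot.out s).1 i * (B (Quot.out s).2 j *
        cform (trans1 ψ P).2 (totalD2 ψ i j (P, 0)))
    simp only [← Finset.sum_add_distrib, ← mul_add]
    refine Finset.sum_congr rfl fun i _ => Finset.sum_congr rfl fun j _ => ?_
    congr 2
    simp only [totalD2_eq, map_add, map_smul, map_zero, Pi.zero_apply, zero_smul, smul_eq_mul, hκ]
    ring
  refine ⟨L, (trans2 ψ (P, 0)).2, ?_, hL⟩
  intro q q' hqq
  -- Equal images have equal second-order relations, which differ only in κ q_ij and κ q'_ij.
  have e : (trans2 ψ (P, q)).2 = (trans2 ψ (P, q')).2 := by rw [hL, hL q', hqq]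
  funext s
  induction s using Sym2.ind with
  | _ i j =>
    have r1 := (jetRel_trans2 hU hψ (J := (P, q)) hP h).second i j
    have r2 := (jetRel_trans2 hU hψ (J := (P, q')) hP h).second i j
    simp only [e] at r1
    have r3 := r1.trans r2.symm
    have e1 : (trans2 ψ (P, q)).1 = trans1 ψ P := rfl
    have e2 : (trans2 ψ (P, q')).1 = trans1 ψ P := rfl
    rw [e1, e2] at r3
    simp only [totalD2_eq, map_add, map_smul, smul_eq_mul] at r3
    exact mul_right_cancel₀ hκ0 (add_left_cancel r3)

end JetTransformation
end InvPDE
end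

noncomputable section
namespace InvPDE

/-! ### Second-order prolongation under ψ, and transforms of graphs -/

section JetTransformation

variable {m : ℕ} {U : Set (Pt m)} {ψ : Pt m → Pt m}

/-- The bilinear form of the second derivatives in a jet. -/
def hess (q : Sym2 (Fin m) → ℝ) : (Fin m → ℝ) →ₗ[ℝ] (Fin m → ℝ) →ₗ[ℝ] ℝ :=
  LinearMap.mk₂ ℝ (fun a b => ∑ k, ∑ l, q s(k, l) * (a k * b l))
    (fun a a' b => by simp only [Pi.add_apply, add_mul, mul_add, Finset.sum_add_distrib])
    (fun c a b => by
      simp only [Pi.smul_apply, smul_eq_mul, Finset.mul_sum]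
      exact Finset.sum_congr rfl fun k _ => Finset.sum_congr rfl fun l _ => by ring)
    (fun a b b' => by simp only [Pi.add_apply, mul_add, Finset.sum_add_distrib])
    (fun c a b => by
      simp only [Pi.smul_apply, smul_eq_mul, Finset.mul_sum]
      exact Finset.sum_congr rfl fun k _ => Finset.sum_congr rfl fun l _ => by ring)

lemma hess_apply (q : Sym2 (Fin m) → ℝ) (a b : Fin m → ℝ) :
    hess q a b = ∑ k, ∑ l, q s(k, l) * (a k * b l) := rfl

lemma hess_symm (q : Sym2 (Fin m) → ℝ) (a b : Fin m → ℝ) : hess q a b = hess q b a := by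
  rw [hess_apply, hess_apply, Finset.sum_comm]
  refine Finset.sum_congr rfl fun l _ => Finset.sum_congr rfl fun k _ => ?_
  rw [Sym2.eq_swap]; ring

lemma fderiv_hess {E : Type*} [NormedAddCommGroup E] [NormedSpace ℝ E]
    {q : E → Sym2 (Fin m) → ℝ} {a b : E → Fin m → ℝ} {x : E} (hq : DifferentiableAt ℝ q x)
    (ha : DifferentiableAt ℝ a x) (hb : DifferentiableAt ℝ b x) (V : E) :
    fderiv ℝ (fun x => hess (q x) (a x) (b x)) x V = hess (fderiv ℝ q x V) (a x) (b x) +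
      hess (q x) (fderiv ℝ a x V) (b x) + hess (q x) (a x) (fderiv ℝ b x V) := by
  have hak := fun k => hasFDerivAt_pi'.1 ha.hasFDerivAt k
  have hbk := fun k => hasFDerivAt_pi'.1 hb.hasFDerivAt k
  have hqk := fun s => hasFDerivAt_pi'.1 hq.hasFDerivAt s
  have hs := HasFDerivAt.fun_sum (u := (Finset.univ : Finset (Fin m))) fun k _ =>
    HasFDerivAt.fun_sum (u := (Finset.univ : Finset (Fin m))) fun l _ =>
      (hqk s(k, l)).fun_mul ((hak k).fun_mul (hbk l))
  have e : (fun x => hess (q x) (a x) (b x)) =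
      fun x => ∑ k, ∑ l, q x s(k, l) * (a x k * b x l) := rfl
  rw [e, hs.fderiv]
  simp only [hess_apply, sum_apply, ← Finset.sum_add_distrib]
  refine Finset.sum_congr rfl fun k _ => Finset.sum_congr rfl fun l _ => ?_
  simp
  ring

/-- Derivative of the second-order relations. -/
lemma fderiv_trans2_relation (hU : IsOpen U) (hψ : ContDiffOn ℝ ∞ ψ U) {J : J2 m}
    (hJ : J.1.1 ∈ U) (h : (slope ψ J.1).IsInvertible) (W : J2 m) (i j : Fin m) :
    hess (fderiv ℝ (trans2 ψ) J W).2 (totalD ψ i J.1).1 (totalD ψ j J.1).1 =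
      cform (trans1 ψ J.1).2 (fderiv ℝ (totalD2 ψ i j) J W)
      - ∑ k, (fderiv ℝ (trans1 ψ) J.1 W.1).2 k * (totalD2 ψ i j J).1 k
      - hess (trans2 ψ J).2 (fderiv ℝ (totalD ψ i) J.1 W.1).1 (totalD ψ j J.1).1
      - hess (trans2 ψ J).2 (totalD ψ i J.1).1 (fderiv ℝ (totalD ψ j) J.1 W.1).1 := by
  have hV : IsOpen {P : J1 m | P.1 ∈ U} := hU.preimage continuous_fst
  have hV2 : IsOpen {J : J2 m | J.1.1 ∈ U} := hU.preimage (continuous_fst.comp continuous_fst)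
  have h1 : DifferentiableAt ℝ (trans1 ψ) J.1 :=
    (contDiffAt_trans1 hU hψ hJ h).differentiableAt (by simp)
  have hc : ∀ (f : J1 m → Fin m → ℝ), DifferentiableAt ℝ f J.1 →
      DifferentiableAt ℝ (fun J : J2 m => f J.1) J ∧
      fderiv ℝ (fun J : J2 m => f J.1) J W = fderiv ℝ f J.1 W.1 := fun f hf => by
    have : HasFDerivAt (fun J : J2 m => f J.1) _ J :=
      hf.hasFDerivAt.comp J (hasFDerivAt_fst (p := J))
    exact ⟨this.differentiableAt, by rw [this.fderiv]; rfl⟩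
  have h2 : DifferentiableAt ℝ (totalD2 ψ i j) J :=
    ((contDiffOn_totalD2 hU hψ i j).contDiffAt (hV2.mem_nhds hJ)).differentiableAt (by simp)
  have ht : DifferentiableAt ℝ (trans2 ψ) J :=
    (contDiffAt_trans2 hU hψ hJ h).differentiableAt (by simp)
  have hA : ∀ i, DifferentiableAt ℝ (totalD ψ i) J.1 := fun i =>
    ((contDiffOn_totalD hU hψ i).contDiffAt (hV.mem_nhds hJ)).differentiableAt (by simp)
  have hA1 : ∀ i, fderiv ℝ (fun P => (totalD ψ i P).1) J.1 W.1 =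
      (fderiv ℝ (totalD ψ i) J.1 W.1).1 := fun i => by
    rw [(hA i).hasFDerivAt.fst.fderiv]; rfl
  have h11 : fderiv ℝ (fun P => (trans1 ψ P).2) J.1 W.1 = (fderiv ℝ (trans1 ψ) J.1 W.1).2 := by
    rw [h1.hasFDerivAt.snd.fderiv]; rfl
  have ht2 : fderiv ℝ (fun J => (trans2 ψ J).2) J W = (fderiv ℝ (trans2 ψ) J W).2 := by
    rw [ht.hasFDerivAt.snd.fderiv]; rfl
  have h3 := fderiv_cform (hc _ h1.snd).1 h2 W
  have h4 := fderiv_hess ht.snd (hc _ (hA i).fst).1 (hc _ (hA j).fst).1 W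
  have e : (fun J : J2 m => cform (trans1 ψ J.1).2 (totalD2 ψ i j J)) =ᶠ[𝓝 J] fun J =>
      hess (trans2 ψ J).2 (totalD ψ i J.1).1 (totalD ψ j J.1).1 := by
    filter_upwards [continuous_fst.continuousAt.eventually
      (eventually_slope_isInvertible hU hψ hJ h)] with J' hJ'
      using (jetRel_trans2 hU hψ hJ'.1 hJ'.2).second i j
  rw [e.fderiv_eq, h4, (hc _ h1.snd).2, (hc _ (hA i).fst).2, (hc _ (hA j).fst).2, hA1, hA1, h11,
    ht2] at h3
  linarith

/-- The transformation of second-order jets takes prolonged fields to prolonged fields. -/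
lemma fderiv_trans2_prolong2 (hU : IsOpen U) (hψ : ContDiffOn ℝ ∞ ψ U) {X X' : Pt m → Pt m}
    (hX : ContDiffOn ℝ ∞ X U) {U' : Set (Pt m)} (hU' : IsOpen U') (hX' : ContDiffOn ℝ ∞ X' U')
    (hUU' : MapsTo ψ U U') (hXX' : ∀ z ∈ U, fderiv ℝ ψ z (X z) = X' (ψ z)) {J : J2 m}
    (hJ : J.1.1 ∈ U) (h : (slope ψ J.1).IsInvertible) :
    fderiv ℝ (trans2 ψ) J (prolong2 X J) = prolong2 X' (trans2 ψ J) := by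
  have h1 := (contDiffAt_trans1 hU hψ hJ h).differentiableAt (by simp)
  have ht := (contDiffAt_trans2 hU hψ hJ h).differentiableAt (by simp)
  have hp1 := fderiv_trans1_prolong1 hU hψ hX hU' hX' hUU' hXX' hJ h
  have hJ' : (trans2 ψ J).1.1 ∈ U' := hUU' hJ
  refine Prod.ext ?_ (funext fun s => ?_)
  · have e1 : HasFDerivAt (fun J : J2 m => trans1 ψ J.1) _ J :=
      h1.hasFDerivAt.comp J (hasFDerivAt_fst (p := J))
    have := DFunLike.congr_fun (ht.hasFDerivAt.fst.unique e1) (prolong2 X J)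
    exact this.trans hp1
  induction s using Sym2.ind with
  | _ k l =>
  set P' := trans1 ψ J.1 with hP'
  set J' := trans2 ψ J with hJ'def
  have hJP : J'.1 = P' := rfl
  -- The slope is invertible, so a quadratic form on the new independent variables is determined by
  -- its values on the components of the D_iψ. There the differentiated relations and the
  -- commutation rules apply.
  suffices H : ∀ i j, hess (prolong2 X' J').2 (totalD ψ i J.1).1 (totalD ψ j J.1).1 =
      hess (fderiv ℝ (trans2 ψ) J (prolong2 X J)).2 (totalD ψ i J.1).1 (totalD ψ j J.1).1 by
    rw [← inverse_contract2 h (fun k l => (fderiv ℝ (trans2 ψ) J (prolong2 X J)).2 s(k, l)) k l,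
      ← inverse_contract2 h (fun k l => (prolong2 X' J').2 s(k, l)) k l]
    refine Finset.sum_congr rfl fun i _ => Finset.sum_congr rfl fun j _ => ?_
    congr 2
    exact (H i j).symm
  intro i j
  rw [fderiv_trans2_relation hU hψ hJ h]
  have hW1 : (prolong2 X J).1 = prolong1 X J.1 := rfl
  rw [fderiv_totalD2_prolong2 hU hψ hX hU' hX' hUU' hXX' hJ i j hW1 (prolong2_snd hU hX hJ i j),
    hW1, hp1, fderiv_totalD_prolong1 hU hψ hX hU' hX' hUU' hXX' hJ i,
    fderiv_totalD_prolong1 hU hψ hX hU' hX' hUU' hXX' hJ j]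
  have hfirst : ∀ i, cform P'.2 (totalD ψ i J.1) = 0 := jetRel_trans1_first h
  have hsecond : ∀ i j, cform P'.2 (totalD2 ψ i j J) =
      hess J'.2 (totalD ψ i J.1).1 (totalD ψ j J.1).1 := (jetRel_trans2 hU hψ hJ h).second
  have hA : ∀ i, totalD ψ i J.1 = ∑ k, (totalD ψ i J.1).1 k • hor k P' := fun i => by
    have := eq_sum_hor_add P' (totalD ψ i J.1)
    rwa [hfirst, zero_smul, add_zero] at this
  have hbase : ψ J.1.1 = P'.1 := rfl
  have hDX : ∀ i, fderiv ℝ X' (ψ J.1.1) (totalD ψ i J.1) =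
      ∑ k, (totalD ψ i J.1).1 k • totalD X' k P' := fun i => by
    conv_lhs => rw [hA i]
    simp only [map_sum, map_smul, totalD_eq X', hbase]
  have hDDX : fderiv ℝ (fderiv ℝ X') (ψ J.1.1) (totalD ψ i J.1) (totalD ψ j J.1) =
      ∑ k, ∑ l, ((totalD ψ i J.1).1 k * (totalD ψ j J.1).1 l) •
        fderiv ℝ (fderiv ℝ X') P'.1 (hor k P') (hor l P') := by
    conv_lhs => rw [hA i, hA j]
    simp only [map_sum, map_smul, sum_apply, smul_apply, hbase, Finset.smul_sum, smul_smul]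
    rw [Finset.sum_comm]
    exact Finset.sum_congr rfl fun k _ => Finset.sum_congr rfl fun l _ => by rw [mul_comm]
  -- Unlike D_iψ, the vector D_iD_jψ is not in the new contact plane. Its vertical part is the new
  -- Hessian, by the second-order relation.
  have hD2 : cform P'.2 (fderiv ℝ X' (ψ J.1.1) (totalD2 ψ i j J)) =
      ∑ k, (prolong1 X' P').2 k * (totalD2 ψ i j J).1 k +
        hess J'.2 (totalD ψ i J.1).1 (totalD ψ j J.1).1 * cform P'.2 (fderiv ℝ X' P'.1 (0, 1)) := by
    conv_lhs => rw [eq_sum_hor_add P' (totalD2 ψ i j J)]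
    simp only [map_add, map_sum, map_smul, hsecond, smul_eq_mul, prolong1_snd, hbase]
    congr 1
    exact Finset.sum_congr rfl fun k _ => by rw [mul_comm]; rfl
  -- The prolongation formula for X' at the new jet, contracted with D_iψ and D_jψ.
  have hN : hess (prolong2 X' J').2 (totalD ψ i J.1).1 (totalD ψ j J.1).1 =
      cform P'.2 (fderiv ℝ (fderiv ℝ X') (ψ J.1.1) (totalD ψ i J.1) (totalD ψ j J.1)) +
      hess J'.2 (totalD ψ i J.1).1 (totalD ψ j J.1).1 * cform P'.2 (fderiv ℝ X' P'.1 (0, 1)) -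
      ∑ k, (totalD ψ i J.1).1 k * hess J'.2 (totalD ψ j J.1).1 (totalD X' k P').1 -
      ∑ l, (totalD ψ j J.1).1 l * hess J'.2 (totalD ψ i J.1).1 (totalD X' l P').1 := by
    rw [hDDX, hess_apply]
    simp only [prolong2_snd hU' hX' hJ', prolongCoeff_eq, totalD2_eq, map_add, map_sum, map_smul,
      smul_eq_mul, hJP, hess_apply, Finset.sum_mul, Finset.mul_sum, sub_mul, add_mul,
      Finset.sum_sub_distrib, Finset.sum_add_distrib]
    have e1 : ∀ k l : Fin m, J'.2 s(k, l) * (cform P'.2) ((fderiv ℝ X' P'.1) (0, 1)) *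
        ((totalD ψ i J.1).1 k * (totalD ψ j J.1).1 l) = J'.2 s(k, l) *
        ((totalD ψ i J.1).1 k * (totalD ψ j J.1).1 l) *
          (cform P'.2) ((fderiv ℝ X' P'.1) (0, 1)) := fun k l => by ring
    have e2 : ∀ k l : Fin m, (cform P'.2) (fderiv ℝ (fderiv ℝ X') P'.1 (hor k P') (hor l P')) *
        ((totalD ψ i J.1).1 k * (totalD ψ j J.1).1 l) = (totalD ψ i J.1).1 k *
        (totalD ψ j J.1).1 l * cform P'.2 (fderiv ℝ (fderiv ℝ X') P'.1 (hor k P') (hor l P')) :=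
      fun k l => by ring
    simp only [e1, e2]
    congr 1
    · congr 1
      refine Finset.sum_congr rfl fun k _ => Finset.sum_congr rfl fun l _ =>
        Finset.sum_congr rfl fun a _ => by ring
    · rw [Finset.sum_comm]
      refine Finset.sum_congr rfl fun k _ => Finset.sum_congr rfl fun l _ =>
        Finset.sum_congr rfl fun a _ => by ring
  rw [hN]
  simp only [← hP', ← hJ'def]
  simp only [map_add, map_sub, map_sum, map_smul, hD2, hDX, Prod.fst_sub, Prod.fst_sum,
    Prod.smul_fst, LinearMap.sub_apply, LinearMap.sum_apply, LinearMap.smul_apply, hfirst,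
    hsecond, smul_eq_mul, mul_zero, Finset.sum_const_zero, sub_zero]
  have c1 : ∀ k, hess J'.2 (totalD X' k P').1 (totalD ψ j J.1).1 =
    hess J'.2 (totalD ψ j J.1).1 (totalD X' k P').1 := fun k => hess_symm _ _ _
  have c2 : ∀ k, hess J'.2 (totalD ψ k J.1).1 (totalD ψ j J.1).1 =
    hess J'.2 (totalD ψ j J.1).1 (totalD ψ k J.1).1 := fun k => hess_symm _ _ _
  simp only [c1, c2]
  ring

/-! ### Existence and properties of transforms of jets -/

lemma fderiv_fderiv_comp {E F G : Type*} [NormedAddCommGroup E] [NormedSpace ℝ E]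
    [NormedAddCommGroup F] [NormedSpace ℝ F] [NormedAddCommGroup G] [NormedSpace ℝ G]
    {f : F → G} {c : E → F} {x : E} (hf : ContDiffAt ℝ 2 f (c x)) (hc : ContDiffAt ℝ 2 c x)
    (v w : E) :
    fderiv ℝ (fun y => fderiv ℝ (f ∘ c) y v) x w =
      fderiv ℝ (fderiv ℝ f) (c x) (fderiv ℝ c x w) (fderiv ℝ c x v) +
        fderiv ℝ f (c x) (fderiv ℝ (fun y => fderiv ℝ c y v) x w) := by
  have h1 := hc.eventually (by simp)
  have h2 := hc.continuousAt.eventually (hf.eventually (by simp))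
  have e : (fun y => fderiv ℝ (f ∘ c) y v) =ᶠ[𝓝 x] fun y => fderiv ℝ f (c y) (fderiv ℝ c y v) := by
    filter_upwards [h1, h2] with y h1 h2
    rw [fderiv_comp y (h2.differentiableAt (by simp)) (h1.differentiableAt (by simp))]
    rfl
  have d1 := ((hf.fderiv_right (m := 1) (by norm_num)).differentiableAt (by simp)).hasFDerivAt
  have d2 := ((hc.fderiv_right (m := 1) (by norm_num)).differentiableAt (by simp)).hasFDerivAt
  have d3 := (hc.differentiableAt (by simp)).hasFDerivAt
  have d4 := d2.clm_apply (hasFDerivAt_const (𝕜 := ℝ) v x)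
  have d5 : HasFDerivAt (fun y => fderiv ℝ f (c y) (fderiv ℝ c y v)) _ x :=
    (d1.comp x d3).clm_apply d4
  rw [e.fderiv_eq, d5.fderiv, d4.fderiv]
  simp [add_comm]

lemma two_le_infty : (2 : WithTop ℕ∞) ≤ ∞ := WithTop.coe_le_coe.2 (le_top (a := (2 : ℕ∞)))

/-- The derivative of the parametrization `x ↦ (x, f x)` of a graph. -/
lemma fderiv_graph {f : (Fin m → ℝ) → ℝ} {x : Fin m → ℝ} (hf : DifferentiableAt ℝ f x)
    (v : Fin m → ℝ) : fderiv ℝ (fun x => (x, f x)) x v = (v, fderiv ℝ f x v) := by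
  have h : HasFDerivAt (fun x => (x, f x)) _ x :=
    (hasFDerivAt_id (𝕜 := ℝ) x).prodMk hf.hasFDerivAt
  rw [h.fderiv]; rfl

lemma HasJet.fderiv_graph {f : (Fin m → ℝ) → ℝ} {J : J2 m} (h : HasJet f J) (i : Fin m) :
    fderiv ℝ (fun x => (x, f x)) J.1.1.1 (Pi.single i 1) = hor i J.1 := by
  rw [InvPDE.fderiv_graph (h.1.differentiableAt (by simp)), h.2.2.1]; rfl

lemma HasJet.fderiv_fderiv_graph {f : (Fin m → ℝ) → ℝ} {J : J2 m} (h : HasJet f J)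
    (i j : Fin m) : fderiv ℝ (fun x => fderiv ℝ (fun x => (x, f x)) x (Pi.single j 1)) J.1.1.1
      (Pi.single i 1) = J.2 s(i, j) • ((0, 1) : Pt m) := by
  have hc2 : ContDiffAt ℝ 2 f J.1.1.1 := h.1.of_le two_le_infty
  have e : (fun x => fderiv ℝ (fun x => (x, f x)) x (Pi.single j 1)) =ᶠ[𝓝 J.1.1.1]
      fun x => ((Pi.single j 1 : Fin m → ℝ), fderiv ℝ f x (Pi.single j 1)) := by
    filter_upwards [hc2.eventually (by simp)] with x hx
    exact InvPDE.fderiv_graph (hx.differentiableAt (by simp)) _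
  have d := (((hc2.fderiv_right (m := 1) (by norm_num)).differentiableAt
    (by simp)).hasFDerivAt).clm_apply
      (hasFDerivAt_const (𝕜 := ℝ) (Pi.single j 1 : Fin m → ℝ) J.1.1.1)
  rw [e.fderiv_eq, ((hasFDerivAt_const (𝕜 := ℝ) _ _).prodMk d).fderiv, ← h.2.2.2 i j, d.fderiv]
  simp

/-- The jets of a graph and of its image satisfy the algebraic relations. -/
lemma jetRel_of_jetTransforms (hU : IsOpen U) (hψ : ContDiffOn ℝ ∞ ψ U) {J J' : J2 m}
    (hJ : J.1.1 ∈ U) (h : JetTransforms ψ J J') : JetRel ψ J J' := by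
  obtain ⟨f, g, hf, hg, hb, hfg⟩ := h
  set x₀ := J.1.1.1
  set c : (Fin m → ℝ) → Pt m := fun x => (x, f x) with hc
  have hcx : c x₀ = J.1.1 := Prod.ext rfl hf.2.1
  have hcC : ContDiffAt ℝ 2 c x₀ := contDiffAt_id.prodMk (hf.1.of_le two_le_infty)
  have hψC : ContDiffAt ℝ 2 ψ (c x₀) := by
    rw [hcx]; exact (hψ.contDiffAt (hU.mem_nhds hJ)).of_le two_le_infty
  have hhC : ContDiffAt ℝ 2 (ψ ∘ c) x₀ := hψC.comp x₀ hcC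
  have hyx : (ψ ∘ c) x₀ = J'.1.1 := by rw [Function.comp_apply, hcx, hb]
  have hgC : ContDiffAt ℝ 2 g ((ψ ∘ c) x₀).1 := by rw [hyx]; exact hg.1.of_le two_le_infty
  have d1 : ∀ i, fderiv ℝ (ψ ∘ c) x₀ (Pi.single i 1) = totalD ψ i J.1 := fun i => by
    rw [fderiv_comp x₀ (hψC.differentiableAt (by simp)) (hcC.differentiableAt (by simp)), hcx]
    show fderiv ℝ ψ J.1.1 (fderiv ℝ c x₀ _) = _
    rw [hf.fderiv_graph]; rfl
  have d2 : ∀ i j, fderiv ℝ (fun x => fderiv ℝ (ψ ∘ c) x (Pi.single j 1)) x₀ (Pi.single i 1)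
      = totalD2 ψ i j J := fun i j => by
    rw [fderiv_fderiv_comp hψC hcC, hcx, hf.fderiv_graph, hf.fderiv_graph,
      hf.fderiv_fderiv_graph, map_smul]; rfl
  have y1 : ∀ᶠ x in 𝓝 x₀, ∀ v, fderiv ℝ (fun x => ((ψ ∘ c) x).1) x v = (fderiv ℝ (ψ ∘ c) x v).1 ∧
      fderiv ℝ (fun x => ((ψ ∘ c) x).2) x v = (fderiv ℝ (ψ ∘ c) x v).2 := by
    filter_upwards [hhC.eventually (by simp)] with x hx v
    have := (hx.differentiableAt (by simp)).hasFDerivAt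
    rw [this.fst.fderiv, this.snd.fderiv]; exact ⟨rfl, rfl⟩
  have hd2 : ∀ v, DifferentiableAt ℝ (fun x => fderiv ℝ (ψ ∘ c) x v) x₀ := fun v =>
    (((hhC.fderiv_right (m := 1) (by norm_num)).differentiableAt (by simp)).hasFDerivAt.clm_apply
      (hasFDerivAt_const (𝕜 := ℝ) v x₀)).differentiableAt
  have y2 : ∀ v w, fderiv ℝ (fun x => fderiv ℝ (fun x => ((ψ ∘ c) x).1) x v) x₀ w
      = (fderiv ℝ (fun x => fderiv ℝ (ψ ∘ c) x v) x₀ w).1 ∧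
      fderiv ℝ (fun x => fderiv ℝ (fun x => ((ψ ∘ c) x).2) x v) x₀ w
      = (fderiv ℝ (fun x => fderiv ℝ (ψ ∘ c) x v) x₀ w).2 := fun v w => by
    have e1 : (fun x => fderiv ℝ (fun x => ((ψ ∘ c) x).1) x v) =ᶠ[𝓝 x₀]
        fun x => (fderiv ℝ (ψ ∘ c) x v).1 := by
      filter_upwards [y1] with x hx using (hx v).1
    have e2 : (fun x => fderiv ℝ (fun x => ((ψ ∘ c) x).2) x v) =ᶠ[𝓝 x₀]
        fun x => (fderiv ℝ (ψ ∘ c) x v).2 := by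
      filter_upwards [y1] with x hx using (hx v).2
    rw [e1.fderiv_eq, e2.fderiv_eq, (hd2 v).hasFDerivAt.fst.fderiv, (hd2 v).hasFDerivAt.snd.fderiv]
    exact ⟨rfl, rfl⟩
  have hyC : ContDiffAt ℝ 2 (fun x => ((ψ ∘ c) x).1) x₀ := hhC.fst
  -- This says that the graph is carried into the graph of g. Its first and second derivatives at x₀
  -- are the two families of relations.
  have hE : (fun x => ((ψ ∘ c) x).2) =ᶠ[𝓝 x₀] g ∘ fun x => ((ψ ∘ c) x).1 := hfg
  have g1 : ∀ a, fderiv ℝ g J'.1.1.1 a = ∑ k, J'.1.2 k * a k := fun a => by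
    conv_lhs => rw [pi_eq_sum_univ' a]
    simp only [map_sum, map_smul, smul_eq_mul]
    refine Finset.sum_congr rfl fun k _ => ?_
    rw [← hg.2.2.1 k, mul_comm]
  have hgC' : ContDiffAt ℝ 2 g J'.1.1.1 := hg.1.of_le two_le_infty
  have g2 : ∀ a b, fderiv ℝ (fderiv ℝ g) J'.1.1.1 a b = hess J'.2 a b := fun a b => by
    have hs : ∀ a : Fin m → ℝ, a = ∑ k, a k • (Pi.single k 1 : Fin m → ℝ) := fun a => by
      funext l; simp [Finset.sum_apply, Pi.single_apply]
    conv_lhs => rw [hs a, hs b]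
    simp only [map_sum, map_smul, sum_apply, smul_apply, smul_eq_mul, Finset.mul_sum, hess_apply]
    rw [Finset.sum_comm]
    refine Finset.sum_congr rfl fun k _ => Finset.sum_congr rfl fun l _ => ?_
    rw [← hg.2.2.2 k l]
    have d := (((hgC'.fderiv_right (m := 1) (by norm_num)).differentiableAt
      (by simp)).hasFDerivAt).clm_apply
        (hasFDerivAt_const (𝕜 := ℝ) (Pi.single l 1 : Fin m → ℝ) J'.1.1.1)
    rw [d.fderiv]
    simp
    ring
  refine ⟨hb, fun i => ?_, fun i j => ?_⟩
  · have h1 := (hE.fderiv_eq (𝕜 := ℝ))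
    rw [fderiv_comp x₀ (hgC.differentiableAt (by simp)) (hyC.differentiableAt (by simp))] at h1
    have h2 := DFunLike.congr_fun h1 (Pi.single i 1)
    have h3 := y1.self_of_nhds (Pi.single i 1)
    simp only [ContinuousLinearMap.comp_apply] at h2
    rw [h3.1, h3.2, d1, hyx, g1] at h2
    rw [cform_apply, h2, sub_self]
  · have h1 : (fun x => fderiv ℝ (fun x => ((ψ ∘ c) x).2) x (Pi.single j 1)) =ᶠ[𝓝 x₀]
        fun x => fderiv ℝ (g ∘ fun x => ((ψ ∘ c) x).1) x (Pi.single j 1) := by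
      filter_upwards [hE.eventually_nhds] with x hx
      rw [Filter.EventuallyEq.fderiv_eq hx]
    have h2 := DFunLike.congr_fun (h1.fderiv_eq (𝕜 := ℝ)) (Pi.single i 1)
    rw [fderiv_fderiv_comp (c := fun x => ((ψ ∘ c) x).1) hgC hyC, (y2 _ _).1, (y2 _ _).2, d2, (y1.self_of_nhds _).1,
      (y1.self_of_nhds _).1, d1, d1, hyx, g1, g2] at h2
    rw [cform_apply, h2, hess_apply]
    ring

/-- Where the slope is invertible, `ψ` takes graphs to graphs. -/
lemma exists_jetTransforms (hU : IsOpen U) (hψ : ContDiffOn ℝ ∞ ψ U) {P : J1 m} (hP : P.1 ∈ U)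
    (h : (slope ψ P).IsInvertible) : ∃ J J' : J2 m, J.1 = P ∧ JetTransforms ψ J J' := by
  -- Any function with first-order jet P would serve; the affine one has zero second derivatives.
  set L : (Fin m → ℝ) →L[ℝ] ℝ :=
    ∑ i, P.2 i • (ContinuousLinearMap.proj (R := ℝ) (φ := fun _ : Fin m => ℝ) i) with hL
  set f : (Fin m → ℝ) → ℝ := fun x => P.1.2 + L (x - P.1.1) with hf
  have hfd : ∀ x, HasFDerivAt f L x := fun x =>
    (L.hasFDerivAt.comp x ((hasFDerivAt_id x).sub_const P.1.1)).const_add _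
  have hfC : ContDiff ℝ ∞ f := by fun_prop
  have hf0 : f P.1.1 = P.1.2 := by simp [hf]
  have hcf : (fun x => (x, f x)) P.1.1 = P.1 := Prod.ext rfl hf0
  have hLs : ∀ i, L (Pi.single i 1) = P.2 i := fun i => by simp [hL, Pi.single_apply, sum_apply]
  have hjet : HasJet f (P, 0) := by
    refine ⟨hfC.contDiffAt, hf0, fun i => by rw [(hfd _).fderiv, hLs], fun i j => ?_⟩
    simp only [(hfd _).fderiv]; simp
  set y : (Fin m → ℝ) → (Fin m → ℝ) := fun x => (ψ (x, f x)).1 with hy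
  have hyC : ∀ᶠ x in 𝓝 P.1.1, ContDiffAt ℝ ∞ (fun x => ψ (x, f x)) x := by
    have hcont : ContinuousAt (fun x => (x, f x)) P.1.1 := by fun_prop
    have : ∀ᶠ x in 𝓝 P.1.1, (x, f x) ∈ U := hcont.eventually (by
      rw [hcf]; exact hU.mem_nhds hP)
    filter_upwards [this] with x hx
    exact (hψ.contDiffAt (hU.mem_nhds hx)).comp x (contDiffAt_id.prodMk hfC.contDiffAt)
  have hy0 := hyC.self_of_nhds
  have hyd : HasFDerivAt y (slope ψ P) P.1.1 := by
    have h1 := (hy0.fst.differentiableAt (by simp)).hasFDerivAt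
    convert! h1 using 1
    refine ContinuousLinearMap.coe_injective ((Pi.basisFun ℝ (Fin m)).ext fun i => ?_)
    have hc := (hfd P.1.1).differentiableAt
    have h3 : HasFDerivAt ψ (fderiv ℝ ψ P.1) ((fun x => (x, f x)) P.1.1) := by
      rw [hcf]
      exact ((hψ.contDiffAt (hU.mem_nhds hP)).differentiableAt (by simp)).hasFDerivAt
    have h4 := (h3.comp P.1.1 (differentiableAt_id.prodMk hc).hasFDerivAt).fst
    have h5 := h4.fderiv
    have h6 : fderiv ℝ (fun x => (ψ (x, f x)).1) P.1.1 (Pi.single i 1) =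
        (fderiv ℝ ψ P.1 (fderiv ℝ (fun x => (x, f x)) P.1.1 (Pi.single i 1))).1 :=
      DFunLike.congr_fun h5 (Pi.single i 1)
    have h7 := hjet.fderiv_graph i
    simp only at h7
    rw [h7] at h6
    simp only [ContinuousLinearMap.coe_coe, Pi.basisFun_apply]
    rw [h6]
    funext l
    rw [slope_apply]
    simp [Pi.single_apply, totalD_eq]
  obtain ⟨e, he⟩ := h
  rw [← he] at hyd
  have hyC0 : ContDiffAt ℝ ∞ y P.1.1 := hy0.fst
  -- Along the graph the new independent variables have derivative `slope ψ P`, so the old ones can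
  -- be recovered from them and the new dependent variable becomes a function g of the new
  -- independent ones.
  set φ := hyC0.toOpenPartialHomeomorph y hyd (by simp) with hφ
  have hφm : P.1.1 ∈ φ.source := hyC0.mem_toOpenPartialHomeomorph_source hyd (by simp)
  have hφs : φ.symm (y P.1.1) = P.1.1 := φ.left_inv hφm
  have hφC : ContDiffAt ℝ ∞ φ.symm (y P.1.1) :=
    φ.contDiffAt_symm (φ.map_source hφm) (f₀' := e) (by rw [hφs]; exact hyd) (by rw [hφs]; exact hyC0)
  set g : (Fin m → ℝ) → ℝ := fun w => (ψ (φ.symm w, f (φ.symm w))).2 with hg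
  have hgC : ContDiffAt ℝ ∞ g (y P.1.1) := by
    have : ContDiffAt ℝ ∞ (fun x => (ψ (x, f x)).2) (φ.symm (y P.1.1)) := by
      rw [hφs]; exact hy0.snd
    exact this.comp (y P.1.1) hφC
  have hyψ : y P.1.1 = (ψ P.1).1 := by simp only [hy]; rw [hf0]
  have hgs : ∀ i j, fderiv ℝ (fun x => fderiv ℝ g x (Pi.single j 1)) (y P.1.1) (Pi.single i 1) =
      fderiv ℝ (fderiv ℝ g) (y P.1.1) (Pi.single i 1) (Pi.single j 1) := fun i j => by
    have hgC' : ContDiffAt ℝ 2 g (y P.1.1) := hgC.of_le two_le_infty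
    have d := (((hgC'.fderiv_right (m := 1) (by norm_num)).differentiableAt
      (by simp)).hasFDerivAt).clm_apply
        (hasFDerivAt_const (𝕜 := ℝ) (Pi.single j 1 : Fin m → ℝ) (y P.1.1))
    rw [d.fderiv]; simp
  have hsymm := hgC.isSymmSndFDerivAt
    (by simpa only [minSmoothness_of_isRCLikeNormedField] using two_le_infty)
  let q : Sym2 (Fin m) → ℝ := Sym2.lift
    ⟨fun i j => fderiv ℝ (fderiv ℝ g) (y P.1.1) (Pi.single i 1) (Pi.single j 1),
      fun i j => hsymm _ _⟩
  refine ⟨(P, 0), ((ψ P.1, fun i => fderiv ℝ g (y P.1.1) (Pi.single i 1)), q), rfl, f, g, hjet,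
    ⟨?_, ?_, ?_, ?_⟩, rfl, ?_⟩
  · rw [← hyψ]; exact hgC
  · show g (ψ P.1).1 = (ψ P.1).2
    rw [← hyψ]
    simp only [hg]
    rw [hφs, hf0]
  · intro i; rw [← hyψ]
  · intro i j; rw [← hyψ]; exact hgs i j
  · filter_upwards [φ.open_source.mem_nhds hφm] with x hx
    have : φ.symm (y x) = x := φ.left_inv hx
    show (ψ (x, f x)).2 = (ψ (φ.symm (y x), f (φ.symm (y x)))).2
    rw [this]

/-- The first-order jets with invertible slope are dense. -/
lemma exists_slope_isInvertible_near {z : Pt m} (hψ : Function.Bijective (fderiv ℝ ψ z))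
    (p : Fin m → ℝ) {N : Set (J1 m)} (hN : N ∈ 𝓝 ((z, p) : J1 m)) :
    ∃ p', (z, p') ∈ N ∧ (slope ψ (z, p')).IsInvertible := by
  -- The direction that dψ makes vertical: the slope can degenerate only if v lies in the contact
  -- plane of the jet.
  obtain ⟨v, hv⟩ := hψ.2 (0, 1)
  have key : ∀ p', v.2 - ∑ k, p' k * v.1 k ≠ 0 → (slope ψ (z, p')).IsInvertible := by
    intro p' hp'
    have hinj : Function.Injective (slope ψ (z, p')).toLinearMap := by
      rw [← LinearMap.ker_eq_bot, LinearMap.ker_eq_bot']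
      intro c hc
      have hc' : slope ψ (z, p') c = 0 := hc
      set w : Pt m := ∑ i, c i • hor i (z, p') with hw
      have e1 : (fderiv ℝ ψ z w).1 = 0 := by
        rw [← hc', hw]
        simp only [map_sum, map_smul]
        rw [Prod.fst_sum]
        funext l
        rw [slope_apply]; simp [Finset.sum_apply, totalD_eq]
      have e2 : w = (fderiv ℝ ψ z w).2 • v := by
        apply hψ.1
        rw [map_smul, hv]
        exact Prod.ext (by simp [e1]) (by simp)
      have e3 : cform p' w = 0 := by
        rw [hw]
        simp only [map_sum, map_smul]
        exact Finset.sum_eq_zero fun i _ => by rw [cform_hor i (z, p'), smul_zero]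
      have e4 : (fderiv ℝ ψ z w).2 = 0 := by
        rw [e2, map_smul, cform_apply, smul_eq_mul] at e3
        exact (mul_eq_zero.1 e3).resolve_right hp'
      rw [e4, zero_smul] at e2
      have h3 := congrArg Prod.fst (hw.symm.trans e2)
      rw [Prod.fst_sum] at h3
      funext i
      simpa [Finset.sum_apply, hor, Pi.single_apply] using congrFun h3 i
    exact ⟨(LinearEquiv.ofInjectiveOfFinrankEq _ hinj rfl).toContinuousLinearEquiv, by ext c; rfl⟩
  by_cases h0 : v.2 - ∑ k, p k * v.1 k = 0
  · have hv1 : 0 < ∑ k, v.1 k * v.1 k := by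
      refine lt_of_le_of_ne (Finset.sum_nonneg fun k _ => mul_self_nonneg _) fun h => ?_
      have : ∀ k, v.1 k = 0 := fun k => mul_self_eq_zero.1
        ((Finset.sum_eq_zero_iff_of_nonneg fun k _ => mul_self_nonneg _).1 h.symm k
          (Finset.mem_univ k))
      have h2 : v.2 = 0 := by simpa [this] using h0
      have : v = 0 := Prod.ext (funext this) h2
      rw [this, map_zero] at hv
      simpa using congrArg Prod.snd hv
    -- If v is in the contact plane of p, then its independent part is non-zero, since otherwise v =
    -- 0. Moving p along that part changes the contact value of v by -t|v.1|².
    have hc : ContinuousAt (fun t : ℝ => ((z, p + t • v.1) : J1 m)) 0 := by fun_prop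
    have h1 : ∀ᶠ t in 𝓝[≠] (0 : ℝ), (z, p + t • v.1) ∈ N :=
      (hc.eventually (by simpa using hN)).filter_mono nhdsWithin_le_nhds
    obtain ⟨t, ht, ht0⟩ := (h1.and self_mem_nhdsWithin).exists
    refine ⟨_, ht, key _ ?_⟩
    have : v.2 - ∑ k, (p + t • v.1) k * v.1 k = - (t * ∑ k, v.1 k * v.1 k) := by
      simp only [Pi.add_apply, Pi.smul_apply, smul_eq_mul, add_mul, Finset.sum_add_distrib,
        mul_assoc, ← Finset.mul_sum]
      linarith
    rw [this]
    exact neg_ne_zero.2 (mul_ne_zero ht0 hv1.ne')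
  · exact ⟨p, mem_of_mem_nhds hN, key p h0⟩

end JetTransformation
end InvPDE
end

noncomputable section
namespace InvPDE

/-! ### Complete sets of invariants and invariant equations -/

section Invariants

variable {m : ℕ}

/-- A bijective continuous linear map between finite-dimensional spaces is invertible. -/
lemma isInvertible_of_injective {E F : Type*} [NormedAddCommGroup E] [NormedSpace ℝ E]
    [NormedAddCommGroup F] [NormedSpace ℝ F] [FiniteDimensional ℝ E] [FiniteDimensional ℝ F]
    (h : Module.finrank ℝ E = Module.finrank ℝ F) {f : E →L[ℝ] F}
    (hf : ∀ v, f v = 0 → v = 0) : f.IsInvertible := by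
  have hinj : Function.Injective f.toLinearMap := (injective_iff_map_eq_zero f.toLinearMap).2 hf
  exact ⟨(LinearEquiv.ofInjectiveOfFinrankEq _ hinj h).toContinuousLinearEquiv, by ext c; rfl⟩

/-- Functions annihilated by lifts of a frame are functions of a complete set of invariants. -/
theorem exists_eventuallyEq_comp_of_frame {K W : Type*} [NormedAddCommGroup K] [NormedSpace ℝ K]
    [FiniteDimensional ℝ K] [NormedAddCommGroup W] [NormedSpace ℝ W] [FiniteDimensional ℝ W]
    (π' : K →L[ℝ] Pt m) {w : K → W} {X : Fin (m + 1) → Pt m → Pt m} {Y : Fin (m + 1) → K → K}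
    {k₀ : K} (hw : ∀ᶠ k in 𝓝 k₀, ContDiffAt ℝ ∞ w k)
    (hinv : (π'.prod (fderiv ℝ w k₀)).IsInvertible)
    (hX : ∀ᶠ k in 𝓝 k₀, LinearIndependent ℝ fun i => X i (π' k))
    (hY : ∀ᶠ k in 𝓝 k₀, ∀ i, π' (Y i k) = X i (π' k) ∧ fderiv ℝ w k (Y i k) = 0)
    {F : K → ℝ} (hF : ∀ᶠ k in 𝓝 k₀, ContDiffAt ℝ ∞ F k)
    (hFY : ∀ᶠ k in 𝓝 k₀, ∀ i, fderiv ℝ F k (Y i k) = 0) :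
    ∃ Φ : W → ℝ, ContDiff ℝ ∞ Φ ∧ ∀ᶠ k in 𝓝 k₀, F k = Φ (w k) := by
  -- In these local coordinates the lift Y_i becomes (X_i, 0), and the X_i span, so F cannot depend
  -- on the first coordinate.
  set Θ : K → Pt m × W := fun k => (π' k, w k) with hΘ
  have hΘd : ∀ k, ContDiffAt ℝ ∞ w k → HasFDerivAt Θ (π'.prod (fderiv ℝ w k)) k := fun k hk =>
    π'.hasFDerivAt.prodMk (hk.differentiableAt (by simp)).hasFDerivAt
  have hΘC : ∀ k, ContDiffAt ℝ ∞ w k → ContDiffAt ℝ ∞ Θ k := fun k hk =>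
    π'.contDiff.contDiffAt.prodMk hk
  have hinvn : ∀ᶠ k in 𝓝 k₀, (π'.prod (fderiv ℝ w k)).IsInvertible := by
    obtain ⟨e, he⟩ := hinv
    have hc : ContinuousAt (fun k => π'.prod (fderiv ℝ w k)) k₀ := by
      have h1 : ContinuousAt (fderiv ℝ w) k₀ :=
        (hw.self_of_nhds.fderiv_right (m := 0) (by simp)).continuousAt
      have h2 : ContinuousAt (fun k => (π', fderiv ℝ w k)) k₀ := continuousAt_const.prodMk h1
      exact (ContinuousLinearMap.prodₗᵢ (𝕜 := ℝ) (E := K) (F := Pt m) (G := W)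
        ℝ).continuous.continuousAt.comp h2
    have := hc.eventually (he ▸ ContinuousLinearEquiv.nhds e)
    filter_upwards [this] with k ⟨e', h2⟩ using ⟨e', h2⟩
  obtain ⟨V, hVp, hVo, hV0⟩ := eventually_nhds_iff.1
    (hw.and (hinvn.and (hX.and (hY.and (hF.and hFY)))))
  obtain ⟨e, he⟩ := hinv
  have hΘd0 : HasFDerivAt Θ (e : K →L[ℝ] Pt m × W) k₀ := he ▸ hΘd k₀ hw.self_of_nhds
  have hΘC0 := hΘC k₀ hw.self_of_nhds
  set φ := hΘC0.toOpenPartialHomeomorph Θ hΘd0 (by simp) with hφ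
  have hφΘ : (φ : K → Pt m × W) = Θ := rfl
  have hk0 : k₀ ∈ φ.source := hΘC0.mem_toOpenPartialHomeomorph_source hΘd0 (by simp)
  have hT : IsOpen (φ.target ∩ φ.symm ⁻¹' V) := φ.isOpen_inter_preimage_symm hVo
  have hT0 : Θ k₀ ∈ φ.target ∩ φ.symm ⁻¹' V := by
    refine ⟨φ.map_source hk0, ?_⟩
    show φ.symm (φ k₀) ∈ V
    rwa [φ.left_inv hk0]
  obtain ⟨ε, hε, hball⟩ := Metric.isOpen_iff.1 hT _ hT0
  set H : Pt m × W → ℝ := F ∘ φ.symm with hH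
  have hsymm : ∀ y ∈ Metric.ball (Θ k₀) ε, ContDiffAt ℝ ∞ φ.symm y := fun y hy => by
    obtain ⟨e, he⟩ := (hVp _ (hball hy).2).2.1
    refine φ.contDiffAt_symm (hball hy).1 (f₀' := e) ?_ ?_
    · rw [he]; exact hΘd _ (hVp _ (hball hy).2).1
    · exact hΘC _ (hVp _ (hball hy).2).1
  have hHC : ∀ y ∈ Metric.ball (Θ k₀) ε, ContDiffAt ℝ ∞ H y := fun y hy =>
    (hVp _ (hball hy).2).2.2.2.2.1.comp y (hsymm y hy)
  have hHd : ∀ y ∈ Metric.ball (Θ k₀) ε, ∀ v : Pt m, fderiv ℝ H y (v, 0) = 0 := by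
    intro y hy v
    set k := φ.symm y with hk
    obtain ⟨h1, h2, h3, h4, h5, h6⟩ := hVp k (hball hy).2
    have hky : Θ k = y := φ.right_inv (hball hy).1
    have hcomp : ∀ u, fderiv ℝ H y (fderiv ℝ Θ k u) = fderiv ℝ F k u := by
      intro u
      have hd1 : HasFDerivAt H (fderiv ℝ H y) (Θ k) := by
        rw [hky]; exact ((hHC y hy).differentiableAt (by simp)).hasFDerivAt
      have hd2 := hd1.comp k (hΘd k h1)
      have hd3 : H ∘ Θ =ᶠ[𝓝 k] F := by
        filter_upwards [φ.open_source.mem_nhds (φ.map_target (hball hy).1)] with x hx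
        show F (φ.symm (φ x)) = F x
        rw [φ.left_inv hx]
      have := (hd2.congr_of_eventuallyEq hd3.symm).fderiv
      rw [(hΘd k h1).fderiv, this]; rfl
    obtain ⟨c, rfl⟩ := exists_eq_frameMap h3 v
    have e1 : ((∑ i, c i • X i (π' k), 0) : Pt m × W) = ∑ i, c i • fderiv ℝ Θ k (Y i k) := by
      rw [(hΘd k h1).fderiv]
      simp only [ContinuousLinearMap.prod_apply, (h4 _).1, (h4 _).2]
      ext1
      · simp [Prod.fst_sum]
      · simp [Prod.snd_sum]
    rw [e1]
    simp only [map_sum, map_smul, hcomp, h6]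
    simp
  -- In the sup norm a ball is a product of balls, so its slices are convex and a function with zero
  -- derivative along them is constant.
  have hconst : ∀ z v, (z, v) ∈ Metric.ball (Θ k₀) ε → H (z, v) = H (π' k₀, v) := by
    intro z v hzv
    have hzv' : z ∈ Metric.ball (π' k₀) ε ∧ v ∈ Metric.ball (w k₀) ε := by
      rw [hΘ, ← ball_prod_same] at hzv; exact hzv
    have hin : ∀ z ∈ Metric.ball (π' k₀) ε, (z, v) ∈ Metric.ball (Θ k₀) ε := fun z hz => by
      rw [hΘ, ← ball_prod_same]; exact ⟨hz, hzv'.2⟩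
    have hd : ∀ z ∈ Metric.ball (π' k₀) ε,
        HasFDerivWithinAt (fun z => H (z, v)) 0 (Metric.ball (π' k₀) ε) z := fun z hz => by
      have hp : HasFDerivAt (fun z => (z, v)) (ContinuousLinearMap.inl ℝ (Pt m) W) z :=
        hasFDerivAt_prodMk_left z v
      have h1 := HasFDerivAt.comp z (g := H)
        ((hHC _ (hin z hz)).differentiableAt (by simp)).hasFDerivAt hp
      refine HasFDerivAt.hasFDerivWithinAt (f := fun z => H (z, v)) (h1.congr_fderiv ?_)
      exact ContinuousLinearMap.ext fun u => by simpa using hHd _ (hin z hz) u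
    refine (convex_ball (π' k₀) ε).is_const_of_fderivWithin_eq_zero (𝕜 := ℝ)
      (f := fun z => H (z, v))
      (fun z hz => (hd z hz).differentiableWithinAt) (fun z hz => ?_) hzv'.1
      (Metric.mem_ball_self hε)
    exact (hd z hz).fderivWithin (Metric.isOpen_ball.uniqueDiffWithinAt hz)
  have hHs : ContDiffOn ℝ ∞ (fun v => H (π' k₀, v)) (Metric.ball (w k₀) ε) := fun v hv => by
    have hin : (π' k₀, v) ∈ Metric.ball (Θ k₀) ε := by
      rw [hΘ, ← ball_prod_same]; exact ⟨Metric.mem_ball_self hε, hv⟩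
    exact ((hHC _ hin).comp v (contDiffAt_const.prodMk contDiffAt_id)).contDiffWithinAt
  -- Only the germ at w k₀ matters, so a cut-off makes the function globally smooth.
  obtain ⟨Φ, hΦ, -, hΦe⟩ := exists_contDiff_hasCompactSupport_eventuallyEq Metric.isOpen_ball hHs
    (Metric.mem_ball_self hε)
  refine ⟨Φ, hΦ, ?_⟩
  have hwc : ContinuousAt w k₀ := hw.self_of_nhds.continuousAt
  filter_upwards [φ.open_source.mem_nhds hk0, hwc.eventually hΦe,
    hΘC0.continuousAt.eventually (Metric.ball_mem_nhds _ hε)] with k h1 h2 h3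
  rw [h2, ← hconst _ _ h3]
  show F k = F (φ.symm (φ k))
  rw [φ.left_inv h1]

/-- Functions `w1`, `w2` which near the first-order jet `P₀` form a complete set of differential
invariants of order at most two, the second ones being affine in the second derivatives. -/
structure AdaptedInvariants (X : Fin (m + 1) → Pt m → Pt m) (P₀ : J1 m)
    (w1 : J1 m → Fin m → ℝ) (w2 : J2 m → Sym2 (Fin m) → ℝ) : Prop where
  indep : ∀ᶠ P in 𝓝 P₀, LinearIndependent ℝ fun i => X i P.1
  smooth1 : ∀ᶠ P in 𝓝 P₀, ContDiffAt ℝ ∞ w1 P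
  vert1 : ∀ p, fderiv ℝ w1 P₀ (0, p) = 0 → p = 0
  inv1 : ∀ᶠ P in 𝓝 P₀, ∀ i, fderiv ℝ w1 P (prolong1 (X i) P) = 0
  smooth2 : ∀ᶠ P in 𝓝 P₀, ∀ q, ContDiffAt ℝ ∞ w2 (P, q)
  affine2 : ∀ᶠ P in 𝓝 P₀, ∃ (L : (Sym2 (Fin m) → ℝ) →ₗ[ℝ] (Sym2 (Fin m) → ℝ))
    (d : Sym2 (Fin m) → ℝ), Function.Injective L ∧ ∀ q, w2 (P, q) = L q + d
  inv2 : ∀ᶠ P in 𝓝 P₀, ∀ q i, fderiv ℝ w2 (P, q) (prolong2 (X i) (P, q)) = 0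

namespace AdaptedInvariants

variable {X : Fin (m + 1) → Pt m → Pt m} {P₀ : J1 m} {w1 : J1 m → Fin m → ℝ}
  {w2 : J2 m → Sym2 (Fin m) → ℝ}

/-- Injectivity of the fibre derivative and a count of dimensions make the base point and `w1` local
coordinates. -/
theorem exists_eq_of_invariant1 (h : AdaptedInvariants X P₀ w1 w2) {F : J1 m → ℝ}
    (hF : ∀ᶠ P in 𝓝 P₀, ContDiffAt ℝ ∞ F P)
    (hFX : ∀ᶠ P in 𝓝 P₀, ∀ i, fderiv ℝ F P (prolong1 (X i) P) = 0) :
    ∃ Φ : (Fin m → ℝ) → ℝ, ContDiff ℝ ∞ Φ ∧ ∀ᶠ P in 𝓝 P₀, F P = Φ (w1 P) := by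
  refine exists_eventuallyEq_comp_of_frame (ContinuousLinearMap.fst ℝ (Pt m) (Fin m → ℝ))
    (X := X) (Y := fun i => prolong1 (X i)) h.smooth1 ?_ h.indep ?_ hF hFX
  · refine isInvertible_of_injective (by simp) ?_
    rintro ⟨z, p⟩ hv
    have h1 : z = 0 := congrArg Prod.fst hv
    subst h1
    have h2 : fderiv ℝ w1 P₀ (0, p) = 0 := congrArg Prod.snd hv
    rw [h.vert1 p h2]; rfl
  · filter_upwards [h.inv1] with P hP i using ⟨rfl, hP i⟩

lemma fderiv_fibre {P : J1 m} (hs : ∀ q, ContDiffAt ℝ ∞ w2 (P, q))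
    {L : (Sym2 (Fin m) → ℝ) →ₗ[ℝ] (Sym2 (Fin m) → ℝ)} {d : Sym2 (Fin m) → ℝ}
    (hL : ∀ q, w2 (P, q) = L q + d) (q q' : Sym2 (Fin m) → ℝ) :
    fderiv ℝ w2 (P, q) (0, q') = L q' := by
  have h1 := (((hs q).differentiableAt (by simp)).hasFDerivAt).comp q (hasFDerivAt_prodMk_right P q)
  have h2 : HasFDerivAt (fun q => w2 (P, q)) (LinearMap.toContinuousLinearMap L) q := by
    simp only [hL]
    exact (LinearMap.toContinuousLinearMap L).hasFDerivAt.add_const d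
  have := DFunLike.congr_fun (h1.unique h2) q'
  simpa using this

/-- The Jacobian is block triangular: `w1` separates the first derivatives, and then `w2`, an
injective affine map on each fibre, separates the second derivatives. -/
theorem exists_eq_of_invariant2 (h : AdaptedInvariants X P₀ w1 w2) {q₀ : Sym2 (Fin m) → ℝ}
    {F : J2 m → ℝ} (hF : ∀ᶠ J in 𝓝 ((P₀, q₀) : J2 m), ContDiffAt ℝ ∞ F J)
    (hFX : ∀ᶠ J in 𝓝 ((P₀, q₀) : J2 m), ∀ i, fderiv ℝ F J (prolong2 (X i) J) = 0) :
    ∃ Φ : (Fin m → ℝ) × (Sym2 (Fin m) → ℝ) → ℝ, ContDiff ℝ ∞ Φ ∧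
      ∀ᶠ J in 𝓝 ((P₀, q₀) : J2 m), F J = Φ (w1 J.1, w2 J) := by
  have hfst : Tendsto Prod.fst (𝓝 ((P₀, q₀) : J2 m)) (𝓝 P₀) := continuousAt_fst
  have hd : ∀ J : J2 m, ContDiffAt ℝ ∞ w1 J.1 → ContDiffAt ℝ ∞ w2 J → ∀ W : J2 m,
      fderiv ℝ (fun J : J2 m => (w1 J.1, w2 J)) J W = (fderiv ℝ w1 J.1 W.1, fderiv ℝ w2 J W) := by
    intro J h1 h2 W
    have h3 : HasFDerivAt (fun J : J2 m => (w1 J.1, w2 J)) _ J :=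
      ((h1.differentiableAt (by simp)).hasFDerivAt.comp J (hasFDerivAt_fst (p := J))).prodMk
        (h2.differentiableAt (by simp)).hasFDerivAt
    rw [h3.fderiv]; rfl
  have hs : ∀ᶠ J in 𝓝 ((P₀, q₀) : J2 m), ContDiffAt ℝ ∞ w1 J.1 ∧ ContDiffAt ℝ ∞ w2 J := by
    filter_upwards [hfst.eventually (h.smooth1.and h.smooth2)] with J hJ using ⟨hJ.1, hJ.2 J.2⟩
  refine exists_eventuallyEq_comp_of_frame (w := fun J : J2 m => (w1 J.1, w2 J))
    ((ContinuousLinearMap.fst ℝ (Pt m) (Fin m → ℝ)).comp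
      (ContinuousLinearMap.fst ℝ (J1 m) (Sym2 (Fin m) → ℝ)))
    (X := X) (Y := fun i => prolong2 (X i)) ?_ ?_ (hfst.eventually h.indep) ?_ hF hFX
  · filter_upwards [hs] with J hJ
    exact (hJ.1.comp J contDiffAt_fst).prodMk hJ.2
  · refine isInvertible_of_injective (by simp [add_assoc]) ?_
    rintro ⟨⟨z, p⟩, q⟩ hv
    have h1 : z = 0 := congrArg Prod.fst hv
    subst h1
    have h2 := congrArg Prod.snd hv
    obtain ⟨h3, h4⟩ := hs.self_of_nhds
    have h5 : fderiv ℝ (fun J : J2 m => (w1 J.1, w2 J)) (P₀, q₀) ((0, p), q) = 0 := h2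
    rw [hd _ h3 h4] at h5
    have hp : p = 0 := h.vert1 p (congrArg Prod.fst h5)
    subst hp
    have h6 : fderiv ℝ w2 (P₀, q₀) (0, q) = 0 := congrArg Prod.snd h5
    obtain ⟨L, d, hL, hLd⟩ := h.affine2.self_of_nhds
    rw [fderiv_fibre h.smooth2.self_of_nhds hLd] at h6
    have : q = 0 := hL (h6.trans (map_zero L).symm)
    subst this; rfl
  · filter_upwards [hs, hfst.eventually (h.inv1.and h.inv2)] with J hJ hJ2 i
    refine ⟨rfl, ?_⟩
    rw [hd J hJ.1 hJ.2]
    exact Prod.ext (hJ2.1 i) (hJ2.2 J.2 i)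

/-- Over a fixed first-order jet, E and its derivative along a prolonged field are both affine in
the values of `w2`. The second vanishes where the first does, so it is a multiple of the first. The
ratios of the coefficients are therefore annihilated by the prolonged frame and are functions of
`w1`. -/
theorem exists_normal_form (h : AdaptedInvariants X P₀ w1 w2) {D : Set (J1 m)} {E : J2 m → ℝ}
    (hD : IsOpen D) (hP₀ : P₀ ∈ D) (hE : IsQuasiLinear D E) (hEX : IsInvariantEq X D E)
    (s₀ : Sym2 (Fin m)) :
    ∃ (a : (Fin m → ℝ) → Sym2 (Fin m) → ℝ) (b : (Fin m → ℝ) → ℝ), ContDiff ℝ ∞ a ∧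
      ContDiff ℝ ∞ b ∧ (∀ v, a v ≠ 0) ∧ (a (w1 P₀) s₀ ≠ 0 → ∀ v, a v s₀ = 1) ∧
      ∀ᶠ P in 𝓝 P₀, ∀ q, E (P, q) = 0 ↔ ∑ s, a (w1 P) s * w2 (P, q) s + b (w1 P) = 0 := by
  obtain ⟨A, c, hA, hc, hA0, hEA⟩ := hE
  set N : J1 m → (Sym2 (Fin m) → ℝ) →L[ℝ] (Sym2 (Fin m) → ℝ) := fun P =>
    (fderiv ℝ w2 (P, 0)).comp (ContinuousLinearMap.inr ℝ (J1 m) (Sym2 (Fin m) → ℝ)) with hN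
  have hNinv : ∀ᶠ P in 𝓝 P₀, (N P).IsInvertible ∧ ∀ q, w2 (P, q) = N P q + w2 (P, 0) := by
    filter_upwards [h.smooth2, h.affine2] with P h1 ⟨L, d, hL, hLd⟩
    have hNL : ∀ q, N P q = L q := fun q => by
      simp only [hN, ContinuousLinearMap.comp_apply, ContinuousLinearMap.inr_apply]
      exact fderiv_fibre h1 hLd 0 q
    constructor
    · refine isInvertible_of_injective rfl fun v hv => hL ?_
      rw [← hNL, hv, map_zero]
    · intro q
      rw [hNL, hLd, hLd 0, map_zero, zero_add]
  have hNC : ∀ᶠ P in 𝓝 P₀, ContDiffAt ℝ ∞ N P := by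
    filter_upwards [h.smooth2] with P h1
    have h2 : ContDiffAt ℝ ∞ (fderiv ℝ w2) ((fun P : J1 m => ((P, 0) : J2 m)) P) :=
      (h1 0).fderiv_right (by simp)
    have h3 : ContDiffAt ℝ ∞ (fun P : J1 m => ((P, 0) : J2 m)) P :=
      contDiffAt_id.prodMk contDiffAt_const
    exact (h2.comp P h3).clm_comp contDiffAt_const
  -- The coefficients of E with respect to `w2` instead of the second derivatives; e absorbs the
  -- inhomogeneous part of `w2`.
  set B : J1 m → Sym2 (Fin m) → ℝ := fun P s =>
    ∑ t, A P t * (N P).inverse (Pi.single s 1) t with hB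
  set e : J1 m → ℝ := fun P => c P - ∑ s, B P s * w2 (P, 0) s with he
  have hBC : ∀ᶠ P in 𝓝 P₀, ∀ s, ContDiffAt ℝ ∞ (fun P => B P s) P := by
    filter_upwards [hNC, hNinv, hD.mem_nhds hP₀] with P h1 h2 h3 s
    refine ContDiffAt.sum fun t _ => (contDiffAt_pi.1 (hA.contDiffAt (hD.mem_nhds h3)) t).mul ?_
    exact contDiffAt_pi.1 ((h2.1.contDiffAt_map_inverse.comp P h1).clm_apply
      (contDiffAt_const (c := (Pi.single s 1 : Sym2 (Fin m) → ℝ)))) t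
  have heC : ∀ᶠ P in 𝓝 P₀, ContDiffAt ℝ ∞ e P := by
    filter_upwards [hBC, h.smooth2, hD.mem_nhds hP₀] with P h1 h2 h3
    have h4 : ContDiffAt ℝ ∞ (fun P : J1 m => w2 (P, 0)) P :=
      (show ContDiffAt ℝ ∞ w2 ((fun P : J1 m => ((P, 0) : J2 m)) P) from h2 0).comp P
        (contDiffAt_id.prodMk contDiffAt_const)
    exact (hc.contDiffAt (hD.mem_nhds h3)).sub
      (ContDiffAt.sum fun s _ => (h1 s).mul (contDiffAt_pi.1 h4 s))
  -- `E` in terms of the invariants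
  have hEB : ∀ᶠ P in 𝓝 P₀, ∀ q, E (P, q) = ∑ s, B P s * w2 (P, q) s + e P := by
    filter_upwards [hNinv, hD.mem_nhds hP₀] with P ⟨⟨f, hf⟩, h2⟩ h3 q
    rw [hEA (P, q) h3]
    have h4 : ∀ t, ∑ s, N P q s * (N P).inverse (Pi.single s 1) t = q t := fun t => by
      have : (N P).inverse (N P q) = q := by
        rw [← hf, ContinuousLinearMap.inverse_equiv]; simp
      conv_rhs => rw [← this]
      have hs : N P q = ∑ s, N P q s • (Pi.single s 1 : Sym2 (Fin m) → ℝ) := by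
        funext l; simp [Finset.sum_apply, Pi.single_apply]
      conv_rhs => rw [hs]
      simp [Finset.sum_apply]
    have h5 : ∑ s, B P s * N P q s = ∑ t, A P t * q t := by
      simp only [hB, Finset.sum_mul]
      rw [Finset.sum_comm]
      refine Finset.sum_congr rfl fun t _ => ?_
      rw [← h4 t, Finset.mul_sum]
      exact Finset.sum_congr rfl fun s _ => by ring
    simp only [he, h2 q, Pi.add_apply, mul_add, Finset.sum_add_distrib, h5]
    ring
  have hB0 : B P₀ ≠ 0 := by
    intro hB0
    obtain ⟨⟨f, hf⟩, -⟩ := hNinv.self_of_nhds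
    refine hA0 P₀ hP₀ (funext fun t => ?_)
    have h4 : ∑ s, B P₀ s * N P₀ (Pi.single t 1) s = A P₀ t := by
      simp only [hB, Finset.sum_mul]
      rw [Finset.sum_comm]
      have : ∀ t', ∑ s, A P₀ t' * (N P₀).inverse (Pi.single s 1) t' * N P₀ (Pi.single t 1) s
          = A P₀ t' * (Pi.single t 1 : Sym2 (Fin m) → ℝ) t' := fun t' => by
        have h5 : (N P₀).inverse (N P₀ (Pi.single t 1)) = Pi.single t 1 := by
          rw [← hf, ContinuousLinearMap.inverse_equiv]; simp
        conv_rhs => rw [← h5]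
        have hs : N P₀ (Pi.single t 1) = ∑ s, N P₀ (Pi.single t 1) s •
            (Pi.single s 1 : Sym2 (Fin m) → ℝ) := by
          funext l; simp [Finset.sum_apply, Pi.single_apply]
        conv_rhs => rw [hs]
        simp [Finset.sum_apply, Finset.mul_sum]
        exact Finset.sum_congr rfl fun s _ => by ring
      simp [this, Pi.single_apply]
    rw [← h4, hB0]; simp
  -- The coefficient to divide by. It is the one at s₀ whenever possible, which yields the
  -- normalization to 1 there.
  obtain ⟨s₁, hs₁, hs₁0⟩ : ∃ s₁, B P₀ s₁ ≠ 0 ∧ (B P₀ s₀ ≠ 0 → s₁ = s₀) := by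
    by_cases h0 : B P₀ s₀ = 0
    · obtain ⟨s, hs⟩ := Function.ne_iff.1 hB0
      exact ⟨s, hs, fun h1 => absurd h0 h1⟩
    · exact ⟨s₀, h0, fun _ => rfl⟩
  have hs₁n : ∀ᶠ P in 𝓝 P₀, B P s₁ ≠ 0 :=
    (hBC.self_of_nhds s₁).continuousAt.eventually_ne hs₁
  -- invariance of the coefficients up to a common factor
  have hXB : ∀ᶠ P in 𝓝 P₀, ∀ i, (∀ t, B P s₁ * fderiv ℝ (fun P => B P t) P (prolong1 (X i) P) =
        B P t * fderiv ℝ (fun P => B P s₁) P (prolong1 (X i) P)) ∧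
      B P s₁ * fderiv ℝ e P (prolong1 (X i) P) =
        e P * fderiv ℝ (fun P => B P s₁) P (prolong1 (X i) P) := by
    filter_upwards [hBC, heC, hEB.eventually_nhds, h.smooth2, h.affine2, h.inv2, hs₁n,
      hD.mem_nhds hP₀] with P h1 h2 h3 h4 ⟨L, d, hL, hLd⟩ h6 h7 h8 i
    set β : Sym2 (Fin m) → ℝ := fun t => fderiv ℝ (fun P => B P t) P (prolong1 (X i) P) with hβ
    set ε := fderiv ℝ e P (prolong1 (X i) P) with hε
    -- The injective affine map q ↦ w2(P, q) is onto, so w runs through the entire hyperplane. The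
    -- values of `w2` contribute no derivative, being invariant.
    have key : ∀ w : Sym2 (Fin m) → ℝ, ∑ s, B P s * w s + e P = 0 → ∑ s, β s * w s + ε = 0 := by
      intro w hw
      obtain ⟨q, hq⟩ : ∃ q, w2 (P, q) = w := by
        obtain ⟨q, hq⟩ := LinearMap.injective_iff_surjective.1 hL (w - d)
        exact ⟨q, by rw [hLd, hq]; simp⟩
      have hE0 : E (P, q) = 0 := by rw [h3.self_of_nhds, hq]; exact hw
      have h9 := hEX i (P, q) h8 hE0
      have hEe : E =ᶠ[𝓝 ((P, q) : J2 m)] fun J => ∑ s, B J.1 s * w2 J s + e J.1 := by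
        have : Tendsto Prod.fst (𝓝 ((P, q) : J2 m)) (𝓝 P) := continuousAt_fst
        filter_upwards [this.eventually h3] with J hJ using hJ J.2
      have hBd : ∀ s, HasFDerivAt (fun J : J2 m => B J.1 s) _ (P, q) := fun s =>
        HasFDerivAt.comp (P, q) (g := fun P => B P s)
          ((h1 s).differentiableAt (by simp)).hasFDerivAt (hasFDerivAt_fst (p := ((P, q) : J2 m)))
      have hed : HasFDerivAt (fun J : J2 m => e J.1) _ (P, q) :=
        HasFDerivAt.comp (P, q) (g := e) (h2.differentiableAt (by simp)).hasFDerivAt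
          (hasFDerivAt_fst (𝕜 := ℝ) (p := ((P, q) : J2 m)))
      have hwd := fun s => hasFDerivAt_pi'.1 ((h4 q).differentiableAt (by simp)).hasFDerivAt s
      have hsum := (HasFDerivAt.fun_sum (u := (Finset.univ : Finset (Sym2 (Fin m))))
        fun s _ => (hBd s).fun_mul (hwd s)).fun_add hed
      rw [hEe.fderiv_eq, hsum.fderiv] at h9
      have h10 : (prolong2 (X i) (P, q)).1 = prolong1 (X i) P := rfl
      simp only [add_apply, sum_apply, smul_apply, ContinuousLinearMap.comp_apply, h6 q i,
        map_zero, ContinuousLinearMap.coe_fst', h10, hq, smul_eq_mul] at h9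
      rw [← h9]
      congr 1
      exact Finset.sum_congr rfl fun s _ => by rw [mul_zero, zero_add, mul_comm]
    -- Two kinds of points on the hyperplane suffice: this one gives proportionality of the free
    -- terms, and its shift by one unit in the coordinate t gives that of the coefficients.
    have hw0 := key (Pi.single s₁ (-(e P / B P s₁))) (by
      simp [Pi.single_apply]; field_simp; ring)
    have h0 : B P s₁ * ε = e P * β s₁ := by
      simp [Pi.single_apply] at hw0
      field_simp at hw0
      linarith
    refine ⟨fun t => ?_, h0⟩
    have hwt := key (Pi.single s₁ (-(e P / B P s₁) - B P t / B P s₁) + Pi.single t 1) (by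
      simp [Pi.single_apply, mul_add, Finset.sum_add_distrib]; field_simp; ring)
    simp [Pi.single_apply, mul_add, Finset.sum_add_distrib] at hwt
    field_simp at hwt
    simp only [hβ] at h0 hwt ⊢
    linarith
  -- quotients are invariants
  have hquot : ∀ f : J1 m → ℝ, (∀ᶠ P in 𝓝 P₀, ContDiffAt ℝ ∞ f P) → (∀ᶠ P in 𝓝 P₀, ∀ i,
      B P s₁ * fderiv ℝ f P (prolong1 (X i) P) =
        f P * fderiv ℝ (fun P => B P s₁) P (prolong1 (X i) P)) →
      ∃ Φ : (Fin m → ℝ) → ℝ, ContDiff ℝ ∞ Φ ∧ ∀ᶠ P in 𝓝 P₀, f P / B P s₁ = Φ (w1 P) := by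
    intro f hf hfX
    refine h.exists_eq_of_invariant1 (F := fun P => f P / B P s₁) ?_ ?_
    · filter_upwards [hf, hBC, hs₁n] with P h1 h2 h3 using h1.div (h2 s₁) h3
    · filter_upwards [hf, hBC, hs₁n.eventually_nhds, hfX] with P h1 h2 h3 h4 i
      set g := fun P => f P / B P s₁ with hg
      have hgd : DifferentiableAt ℝ g P := (h1.div (h2 s₁) h3.self_of_nhds).differentiableAt (by simp)
      have hBd := (h2 s₁).differentiableAt (by simp)
      have hgB : f =ᶠ[𝓝 P] fun P => g P * B P s₁ := by
        filter_upwards [h3] with P' h5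
        simp only [hg]; field_simp
      have h5 := h4 i
      rw [hgB.fderiv_eq, (hgd.hasFDerivAt.fun_mul hBd.hasFDerivAt).fderiv, hgB.self_of_nhds] at h5
      have h6 := h3.self_of_nhds
      simp only [add_apply, smul_apply, smul_eq_mul] at h5
      have h7 : B P s₁ * B P s₁ * fderiv ℝ g P (prolong1 (X i) P) = 0 := by linarith
      exact (mul_eq_zero.1 h7).resolve_left (mul_ne_zero h6 h6)
  have hΦ : ∀ t, ∃ Φ : (Fin m → ℝ) → ℝ, ContDiff ℝ ∞ Φ ∧
      (∀ᶠ P in 𝓝 P₀, B P t / B P s₁ = Φ (w1 P)) ∧ (t = s₁ → ∀ v, Φ v = 1) := by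
    intro t
    -- For the pivot the function is taken literally constant, so that the coefficient is 1, and the
    -- coefficient vector non-zero, at every v and not only near the given jet.
    by_cases ht : t = s₁
    · refine ⟨fun _ => 1, contDiff_const, ?_, fun _ _ => rfl⟩
      filter_upwards [hs₁n] with P hP
      rw [ht, div_self hP]
    · obtain ⟨Φ, h1, h2⟩ := hquot (fun P => B P t) (by filter_upwards [hBC] with P h1 using h1 t)
        (by filter_upwards [hXB] with P h1 i using (h1 i).1 t)
      exact ⟨Φ, h1, h2, fun h => absurd h ht⟩
  choose a ha haB ha1 using hΦ
  obtain ⟨b, hb, hbe⟩ := hquot e heC (by filter_upwards [hXB] with P h1 i using (h1 i).2)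
  refine ⟨fun v t => a t v, b, contDiff_pi.2 ha, hb, fun v hv => ?_, fun h1 v => ?_, ?_⟩
  · have := congrFun hv s₁
    simp only [ha1 s₁ rfl v] at this
    exact one_ne_zero this
  · refine ha1 s₀ (hs₁0 fun h2 => h1 ?_).symm v
    simp only [← (haB s₀).self_of_nhds, h2, zero_div]
  · filter_upwards [hEB, eventually_all.2 haB, hbe, hs₁n] with P h1 h2 h3 h4 q
    rw [h1]
    simp only [← h2, ← h3]
    have : ∑ s, B P s / B P s₁ * w2 (P, q) s + e P / B P s₁ =
        (∑ s, B P s * w2 (P, q) s + e P) / B P s₁ := by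
      rw [add_div, Finset.sum_div]
      congr 1
      exact Finset.sum_congr rfl fun s _ => by ring
    rw [this, div_eq_zero_iff]
    simp [h4]

end AdaptedInvariants

end Invariants
end InvPDE
end

noncomputable section
namespace InvPDE

/-! ### Elementary expressions and their formal derivatives -/

/-- Elementary functions on a normed space, as syntax trees. -/
inductive Ex (E : Type) [NormedAddCommGroup E] [NormedSpace ℝ E] : Type
  | lin (l : E →L[ℝ] ℝ) : Ex E
  | cst (c : ℝ) : Ex E
  | add (e f : Ex E) : Ex E
  | mul (e f : Ex E) : Ex E
  | sin (e : Ex E) : Ex E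
  | cos (e : Ex E) : Ex E
  | exp (e : Ex E) : Ex E
  | inv (e : Ex E) : Ex E

namespace Ex

variable {E : Type} [NormedAddCommGroup E] [NormedSpace ℝ E]

instance : Add (Ex E) := ⟨add⟩
instance : Mul (Ex E) := ⟨mul⟩
instance : Neg (Ex E) := ⟨fun e => mul (cst (-1)) e⟩
instance : Sub (Ex E) := ⟨fun e f => add e (mul (cst (-1)) f)⟩

/-- The function denoted by an expression. -/
def eval : Ex E → E → ℝ
  | lin l, x => l x
  | cst c, _ => c
  | add e f, x => eval e x + eval f x
  | mul e f, x => eval e x * eval f x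
  | sin e, x => Real.sin (eval e x)
  | cos e, x => Real.cos (eval e x)
  | exp e, x => Real.exp (eval e x)
  | inv e, x => (eval e x)⁻¹

/-- No division by zero occurs in the evaluation at `x`. -/
def Ok : Ex E → E → Prop
  | lin _, _ => True
  | cst _, _ => True
  | add e f, x => Ok e x ∧ Ok f x
  | mul e f, x => Ok e x ∧ Ok f x
  | sin e, x => Ok e x
  | cos e, x => Ok e x
  | exp e, x => Ok e x
  | inv e, x => Ok e x ∧ eval e x ≠ 0

/-- The formal derivative in the direction `v`. -/
def D (v : E) : Ex E → Ex E
  | lin l => cst (l v)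
  | cst _ => cst 0
  | add e f => add (D v e) (D v f)
  | mul e f => add (mul (D v e) f) (mul e (D v f))
  | sin e => mul (D v e) (cos e)
  | cos e => mul (D v e) (mul (cst (-1)) (sin e))
  | exp e => mul (D v e) (exp e)
  | inv e => mul (D v e) (mul (cst (-1)) (mul (inv e) (inv e)))

section
variable (e f : Ex E) (l : E →L[ℝ] ℝ) (c : ℝ) (x v : E)
@[simp] lemma eval_lin : (lin l).eval x = l x := rfl
@[simp] lemma eval_cst : (cst c : Ex E).eval x = c := rfl
@[simp] lemma eval_add : (e + f).eval x = e.eval x + f.eval x := rfl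
@[simp] lemma eval_mul : (e * f).eval x = e.eval x * f.eval x := rfl
@[simp] lemma eval_neg : (-e).eval x = -e.eval x := neg_one_mul _
@[simp] lemma eval_sub : (e - f).eval x = e.eval x - f.eval x := by
  rw [sub_eq_add_neg, ← neg_one_mul]; rfl
@[simp] lemma eval_sin : (sin e).eval x = Real.sin (e.eval x) := rfl
@[simp] lemma eval_cos : (cos e).eval x = Real.cos (e.eval x) := rfl
@[simp] lemma eval_exp : (exp e).eval x = Real.exp (e.eval x) := rfl
@[simp] lemma eval_inv : (inv e).eval x = (e.eval x)⁻¹ := rfl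
@[simp] lemma D_lin : D v (lin l) = cst (l v) := rfl
@[simp] lemma D_cst : D v (cst c) = cst 0 := rfl
@[simp] lemma D_add : D v (e + f) = D v e + D v f := rfl
@[simp] lemma D_mul : D v (e * f) = D v e * f + e * D v f := rfl
@[simp] lemma D_neg : D v (-e) = cst 0 * e + -D v e := rfl
@[simp] lemma D_sub : D v (e - f) = D v e + (cst 0 * f + -D v f) := rfl
@[simp] lemma D_sin : D v (sin e) = D v e * cos e := rfl
@[simp] lemma D_cos : D v (cos e) = D v e * -sin e := rfl
@[simp] lemma D_exp : D v (exp e) = D v e * exp e := rfl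
@[simp] lemma D_inv : D v (inv e) = D v e * -(inv e * inv e) := rfl
@[simp] lemma ok_lin : (lin l).Ok x ↔ True := Iff.rfl
@[simp] lemma ok_cst : (cst c : Ex E).Ok x ↔ True := Iff.rfl
@[simp] lemma ok_add : (e + f).Ok x ↔ e.Ok x ∧ f.Ok x := Iff.rfl
@[simp] lemma ok_mul : (e * f).Ok x ↔ e.Ok x ∧ f.Ok x := Iff.rfl
@[simp] lemma ok_neg : (-e).Ok x ↔ e.Ok x := ⟨And.right, And.intro trivial⟩
@[simp] lemma ok_sub : (e - f).Ok x ↔ e.Ok x ∧ f.Ok x := and_congr Iff.rfl ⟨And.right, And.intro trivial⟩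
@[simp] lemma ok_sin : (sin e).Ok x ↔ e.Ok x := Iff.rfl
@[simp] lemma ok_cos : (cos e).Ok x ↔ e.Ok x := Iff.rfl
@[simp] lemma ok_exp : (exp e).Ok x ↔ e.Ok x := Iff.rfl
@[simp] lemma ok_inv : (inv e).Ok x ↔ e.Ok x ∧ e.eval x ≠ 0 := Iff.rfl
end

lemma Ok.D {x : E} (v : E) : ∀ {e : Ex E}, e.Ok x → (e.D v).Ok x
  | lin _, _ => trivial
  | cst _, _ => trivial
  | add _ _, h => ⟨Ok.D v h.1, Ok.D v h.2⟩
  | mul _ _, h => ⟨⟨Ok.D v h.1, h.2⟩, h.1, Ok.D v h.2⟩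
  | sin _, h => ⟨Ok.D v h, h⟩
  | cos _, h => ⟨Ok.D v h, trivial, h⟩
  | exp _, h => ⟨Ok.D v h, h⟩
  | inv _, h => ⟨Ok.D v h.1, trivial, h, h⟩

lemma Ok.contDiffAt {x : E} : ∀ {e : Ex E}, e.Ok x → ContDiffAt ℝ ∞ e.eval x
  | lin l, _ => l.contDiff.contDiffAt
  | cst _, _ => contDiffAt_const
  | add _ _, h => (Ok.contDiffAt h.1).add (Ok.contDiffAt h.2)
  | mul _ _, h => (Ok.contDiffAt h.1).mul (Ok.contDiffAt h.2)
  | sin e, h => (Ok.contDiffAt (e := e) h).sin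
  | cos e, h => (Ok.contDiffAt (e := e) h).cos
  | exp e, h => (Ok.contDiffAt (e := e) h).exp
  | inv _, h => (Ok.contDiffAt h.1).inv h.2

lemma Ok.eventually {x : E} : ∀ {e : Ex E}, e.Ok x → ∀ᶠ y in 𝓝 x, e.Ok y
  | lin _, _ => Eventually.of_forall fun _ => trivial
  | cst _, _ => Eventually.of_forall fun _ => trivial
  | add _ _, h => (Ok.eventually h.1).and (Ok.eventually h.2)
  | mul _ _, h => (Ok.eventually h.1).and (Ok.eventually h.2)
  | sin e, h => Ok.eventually (e := e) h
  | cos e, h => Ok.eventually (e := e) h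
  | exp e, h => Ok.eventually (e := e) h
  | inv _, h => (Ok.eventually h.1).and (h.1.contDiffAt.continuousAt.eventually_ne h.2)

/-- Soundness of the formal derivative. It reduces the analysis of the concrete rows to
simplification of syntax trees. -/
lemma Ok.exists_hasFDerivAt {x : E} :
    ∀ {e : Ex E}, e.Ok x → ∃ f' : E →L[ℝ] ℝ, HasFDerivAt e.eval f' x ∧ ∀ v, f' v = (e.D v).eval x
  | lin l, _ => ⟨l, l.hasFDerivAt, fun _ => rfl⟩
  | cst c, _ => ⟨0, hasFDerivAt_const c x, fun _ => rfl⟩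
  | add _ _, h => by
    obtain ⟨a, ha, ha'⟩ := Ok.exists_hasFDerivAt h.1
    obtain ⟨b, hb, hb'⟩ := Ok.exists_hasFDerivAt h.2
    exact ⟨_, ha.fun_add hb, fun v => congrArg₂ _ (ha' v) (hb' v)⟩
  | mul e f, h => by
    obtain ⟨a, ha, ha'⟩ := Ok.exists_hasFDerivAt h.1
    obtain ⟨b, hb, hb'⟩ := Ok.exists_hasFDerivAt h.2
    refine ⟨_, ha.fun_mul hb, fun v => ?_⟩
    show e.eval x * b v + f.eval x * a v =
      (e.D v).eval x * f.eval x + e.eval x * (f.D v).eval x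
    rw [ha', hb']; ring
  | sin e, h => by
    obtain ⟨a, ha, ha'⟩ := Ok.exists_hasFDerivAt (e := e) h
    refine ⟨_, ha.sin, fun v => ?_⟩
    show Real.cos (e.eval x) * a v = (e.D v).eval x * Real.cos (e.eval x)
    rw [ha']; ring
  | cos e, h => by
    obtain ⟨a, ha, ha'⟩ := Ok.exists_hasFDerivAt (e := e) h
    refine ⟨_, ha.cos, fun v => ?_⟩
    show -Real.sin (e.eval x) * a v = (e.D v).eval x * (-1 * Real.sin (e.eval x))
    rw [ha']; ring
  | exp e, h => by
    obtain ⟨a, ha, ha'⟩ := Ok.exists_hasFDerivAt (e := e) h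
    refine ⟨_, ha.exp, fun v => ?_⟩
    show Real.exp (e.eval x) * a v = (e.D v).eval x * Real.exp (e.eval x)
    rw [ha']; ring
  | inv e, h => by
    obtain ⟨a, ha, ha'⟩ := Ok.exists_hasFDerivAt h.1
    refine ⟨_, (hasDerivAt_inv h.2).comp_hasFDerivAt x ha, fun v => ?_⟩
    show -(e.eval x ^ 2)⁻¹ * a v = (e.D v).eval x * (-1 * ((e.eval x)⁻¹ * (e.eval x)⁻¹))
    rw [ha']; ring

lemma Ok.fderiv_eval {x : E} {e : Ex E} (h : e.Ok x) (v : E) :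
    fderiv ℝ e.eval x v = (e.D v).eval x := by
  obtain ⟨f', h1, h2⟩ := h.exists_hasFDerivAt
  rw [h1.fderiv, h2]

end Ex

/-! ### Vector fields and prolongations with elementary coefficients -/

section

variable {m : ℕ}

/-- The vector field with coefficients `ξ` and `θ`. -/
def exField (ξ : Fin m → Ex (Pt m)) (θ : Ex (Pt m)) (z : Pt m) : Pt m :=
  (fun k => (ξ k).eval z, θ.eval z)

/-- The formal jet direction `∂_i + u_i ∂_u`. -/
abbrev horDir (P : J1 m) (i : Fin m) : Pt m := (Pi.single i 1, P.2 i)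

variable {ξ : Fin m → Ex (Pt m)} {θ : Ex (Pt m)} {z : Pt m}

lemma contDiffAt_exField (hξ : ∀ k, (ξ k).Ok z) (hθ : θ.Ok z) :
    ContDiffAt ℝ ∞ (exField ξ θ) z :=
  (contDiffAt_pi.2 fun k => (hξ k).contDiffAt).prodMk hθ.contDiffAt

lemma fderiv_exField (hξ : ∀ k, (ξ k).Ok z) (hθ : θ.Ok z) (v : Pt m) :
    fderiv ℝ (exField ξ θ) z v = exField (fun k => (ξ k).D v) (θ.D v) z := by
  choose f hf hf' using fun k => (hξ k).exists_hasFDerivAt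
  obtain ⟨g, hg, hg'⟩ := hθ.exists_hasFDerivAt
  have : HasFDerivAt (exField ξ θ) _ z := (hasFDerivAt_pi.2 hf).prodMk hg
  rw [this.fderiv]
  exact Prod.ext (funext fun k => hf' k v) (hg' v)

/-- The direction w is frozen while differentiating along v, so the formal derivative is simply
applied twice. -/
lemma fderiv_fderiv_exField (hξ : ∀ k, (ξ k).Ok z) (hθ : θ.Ok z) (v w : Pt m) :
    fderiv ℝ (fderiv ℝ (exField ξ θ)) z v w =
      exField (fun k => ((ξ k).D w).D v) ((θ.D w).D v) z := by
  have h1 : DifferentiableAt ℝ (fderiv ℝ (exField ξ θ)) z :=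
    ((contDiffAt_exField hξ hθ).fderiv_right (m := ∞) (by simp)).differentiableAt (by simp)
  have h2 : fderiv ℝ (fderiv ℝ (exField ξ θ)) z v w =
      fderiv ℝ (fun y => fderiv ℝ (exField ξ θ) y w) z v := by
    rw [fderiv_clm_apply h1 (differentiableAt_const w)]
    simp [fderiv_const_apply]
  have h3 : (fun y => fderiv ℝ (exField ξ θ) y w) =ᶠ[𝓝 z]
      exField (fun k => (ξ k).D w) (θ.D w) := by
    filter_upwards [eventually_all.2 fun k => (hξ k).eventually, hθ.eventually] with y h4 h5
    exact fderiv_exField h4 h5 w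
  rw [h2, h3.fderiv_eq, fderiv_exField (fun k => (hξ k).D w) (hθ.D w)]

lemma prolong1_exField {P : J1 m} (hξ : ∀ k, (ξ k).Ok P.1) (hθ : θ.Ok P.1) :
    prolong1 (exField ξ θ) P = (exField ξ θ P.1, fun i => (θ.D (horDir P i)).eval P.1 -
      ∑ k, P.2 k * ((ξ k).D (horDir P i)).eval P.1) := by
  simp only [prolong1, totalD, fderiv_exField hξ hθ]
  rfl

lemma prolongCoeff_exField {J : J2 m} (hξ : ∀ k, (ξ k).Ok J.1.1) (hθ : θ.Ok J.1.1)
    (i j : Fin m) :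
    prolongCoeff (exField ξ θ) J i j =
      (((θ.D (horDir J.1 j)).D (horDir J.1 i)).eval J.1.1
        + J.2 s(i, j) * (θ.D (0, 1)).eval J.1.1)
      - ∑ k, J.1.2 k * ((((ξ k).D (horDir J.1 j)).D (horDir J.1 i)).eval J.1.1
        + J.2 s(i, j) * ((ξ k).D (0, 1)).eval J.1.1)
      - ∑ k, J.2 s(j, k) * ((ξ k).D (horDir J.1 i)).eval J.1.1
      - ∑ k, J.2 s(i, k) * ((ξ k).D (horDir J.1 j)).eval J.1.1 := by
  simp only [prolongCoeff, totalD2, totalD, fderiv_exField hξ hθ, fderiv_fderiv_exField hξ hθ]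
  rfl

lemma lieBracket_exField {ξ' : Fin m → Ex (Pt m)} {θ' : Ex (Pt m)}
    (hξ : ∀ k, (ξ k).Ok z) (hθ : θ.Ok z) (hξ' : ∀ k, (ξ' k).Ok z) (hθ' : θ'.Ok z) :
    VectorField.lieBracket ℝ (exField ξ θ) (exField ξ' θ') z =
      exField (fun k => (ξ' k).D (exField ξ θ z)) (θ'.D (exField ξ θ z)) z -
      exField (fun k => (ξ k).D (exField ξ' θ' z)) (θ.D (exField ξ' θ' z)) z := by
  rw [VectorField.lieBracket, fderiv_exField hξ hθ, fderiv_exField hξ' hθ']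

end

/-! ### Coordinate expressions on the jet spaces -/

section Coordinates

variable {m : ℕ}

/-- The coordinate `x^k` on `Z`. -/
def zx (k : Fin m) : Ex (Pt m) :=
  .lin ((ContinuousLinearMap.proj k).comp (ContinuousLinearMap.fst ℝ (Fin m → ℝ) ℝ))
/-- The coordinate `u` on `Z`. -/
def zu : Ex (Pt m) := .lin (ContinuousLinearMap.snd ℝ (Fin m → ℝ) ℝ)

/-- An expression in the coordinates of the base of a product. -/
def Ex.base {E F : Type} [NormedAddCommGroup E] [NormedSpace ℝ E] [NormedAddCommGroup F]
    [NormedSpace ℝ F] : Ex E → Ex (E × F)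
  | .lin l => .lin (l.comp (ContinuousLinearMap.fst ℝ E F))
  | .cst c => .cst c
  | .add e f => .add e.base f.base
  | .mul e f => .mul e.base f.base
  | .sin e => .sin e.base
  | .cos e => .cos e.base
  | .exp e => .exp e.base
  | .inv e => .inv e.base

/-- The coordinates on the fibre of a product. -/
def fib {E ι : Type} [NormedAddCommGroup E] [NormedSpace ℝ E] [Fintype ι] (k : ι) :
    Ex (E × (ι → ℝ)) :=
  .lin ((ContinuousLinearMap.proj k).comp (ContinuousLinearMap.snd ℝ E (ι → ℝ)))

variable {E F ι : Type} [NormedAddCommGroup E] [NormedSpace ℝ E] [NormedAddCommGroup F]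
    [NormedSpace ℝ F] [Fintype ι]

@[simp] lemma zx_eval (k : Fin m) (z : Pt m) : (zx k).eval z = z.1 k := rfl
@[simp] lemma zu_eval (z : Pt m) : zu.eval z = z.2 := rfl
@[simp] lemma fib_eval (k : ι) (z : E × (ι → ℝ)) : (fib k).eval z = z.2 k := rfl
@[simp] lemma zx_D (k : Fin m) (v : Pt m) : (zx k).D v = .cst (v.1 k) := rfl
@[simp] lemma zu_D (v : Pt m) : zu.D v = .cst v.2 := rfl
@[simp] lemma fib_D (k : ι) (v : E × (ι → ℝ)) : (fib k).D v = .cst (v.2 k) := rfl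
@[simp] lemma zx_ok (k : Fin m) (z : Pt m) : (zx k).Ok z := trivial
@[simp] lemma zu_ok (z : Pt m) : zu.Ok z := trivial
@[simp] lemma fib_ok (k : ι) (z : E × (ι → ℝ)) : (fib k).Ok z := trivial

@[simp] lemma base_eval (z : E × F) : ∀ e : Ex E, e.base.eval z = e.eval z.1
  | .lin _ => rfl
  | .cst _ => rfl
  | .add e f => congrArg₂ _ (base_eval z e) (base_eval z f)
  | .mul e f => congrArg₂ _ (base_eval z e) (base_eval z f)
  | .sin e => congrArg Real.sin (base_eval z e)
  | .cos e => congrArg Real.cos (base_eval z e)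
  | .exp e => congrArg Real.exp (base_eval z e)
  | .inv e => congrArg Inv.inv (base_eval z e)

@[simp] lemma base_D (v : E × F) : ∀ e : Ex E, (e.base : Ex (E × F)).D v = (e.D v.1).base
  | .lin _ => rfl
  | .cst _ => rfl
  | .add e f => congrArg₂ Ex.add (base_D v e) (base_D v f)
  | .mul e f => congrArg₂ Ex.add (congrArg (Ex.mul · f.base) (base_D v e))
      (congrArg (Ex.mul e.base) (base_D v f))
  | .sin e => congrArg (Ex.mul · e.cos.base) (base_D v e)
  | .cos e => congrArg (Ex.mul · (Ex.mul (.cst (-1)) e.sin.base)) (base_D v e)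
  | .exp e => congrArg (Ex.mul · e.exp.base) (base_D v e)
  | .inv e => congrArg (Ex.mul · (Ex.mul (.cst (-1)) (.mul e.inv.base e.inv.base))) (base_D v e)

@[simp] lemma base_ok (z : E × F) : ∀ e : Ex E, (e.base : Ex (E × F)).Ok z ↔ e.Ok z.1
  | .lin _ => Iff.rfl
  | .cst _ => Iff.rfl
  | .add e f => and_congr (base_ok z e) (base_ok z f)
  | .mul e f => and_congr (base_ok z e) (base_ok z f)
  | .sin e => base_ok z e
  | .cos e => base_ok z e
  | .exp e => base_ok z e
  | .inv e => and_congr (base_ok z e) (by rw [base_eval])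

end Coordinates

end InvPDE
end

noncomputable section
namespace InvPDE

/-! ### The identities to be verified for a row -/

section RowFacts

variable {m : ℕ}

/-- The first prolongation of `exField ξ θ`. -/
def exProlong1 (ξ : Fin m → Ex (Pt m)) (θ : Ex (Pt m)) (P : J1 m) : J1 m :=
  (exField ξ θ P.1, fun j => (θ.D (horDir P j)).eval P.1 -
    ∑ k, P.2 k * ((ξ k).D (horDir P j)).eval P.1)

/-- The second-order coefficients of the second prolongation of `exField ξ θ`. -/
def exProlongCoeff (ξ : Fin m → Ex (Pt m)) (θ : Ex (Pt m)) (J : J2 m) (i j : Fin m) : ℝ :=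
  (((θ.D (horDir J.1 j)).D (horDir J.1 i)).eval J.1.1 + J.2 s(i, j) * (θ.D (0, 1)).eval J.1.1)
    - ∑ k, J.1.2 k * ((((ξ k).D (horDir J.1 j)).D (horDir J.1 i)).eval J.1.1
      + J.2 s(i, j) * ((ξ k).D (0, 1)).eval J.1.1)
    - ∑ k, J.2 s(j, k) * ((ξ k).D (horDir J.1 i)).eval J.1.1
    - ∑ k, J.2 s(i, k) * ((ξ k).D (horDir J.1 j)).eval J.1.1

/-- Elementary expressions for the generators and the invariants of a row, with the verification
of the properties of a realization. -/
structure ExRow [NeZero m] (r : Row m) where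
  ξ : Fin (m + 1) → Fin m → Ex (Pt m)
  θ : Fin (m + 1) → Ex (Pt m)
  I1 : Fin m → Ex (J1 m)
  I2 : Sym2 (Fin m) → Ex (J2 m)
  isOpen_dom : IsOpen r.dom
  nonempty_dom : r.dom.Nonempty
  gen_eq : ∀ i, r.gen i = exField (ξ i) (θ i)
  inv1_eq : ∀ P k, r.inv1 P k = (I1 k).eval P
  inv2_eq : ∀ J s, r.inv2 J s = (I2 s).eval J
  ok_ξ : ∀ z ∈ r.dom, ∀ i k, (ξ i k).Ok z
  ok_θ : ∀ z ∈ r.dom, ∀ i, (θ i).Ok z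
  ok_I1 : ∀ P : J1 m, P.1 ∈ r.dom → ∀ k, (I1 k).Ok P
  ok_I2 : ∀ J : J2 m, J.1.1 ∈ r.dom → ∀ s, (I2 s).Ok J
  indep : ∀ z ∈ r.dom, LinearIndependent ℝ fun i => exField (ξ i) (θ i) z
  bracket : ∀ i j, i < j → ∀ z ∈ r.dom,
    exField (fun k => (ξ j k).D (exField (ξ i) (θ i) z)) ((θ j).D (exField (ξ i) (θ i) z)) z -
      exField (fun k => (ξ i k).D (exField (ξ j) (θ j) z)) ((θ i).D (exField (ξ j) (θ j) z)) z =
      ∑ k, r.structConst i j k • exField (ξ k) (θ k) z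
  vert1 : ∀ P : J1 m, P.1 ∈ r.dom → ∀ p, (∀ k, ((I1 k).D (0, p)).eval P = 0) → p = 0
  inv1 : ∀ i, ∀ P : J1 m, P.1 ∈ r.dom → ∀ k,
    ((I1 k).D (exProlong1 (ξ i) (θ i) P)).eval P = 0
  -- Stated for any q with the right values on ordered pairs, so that rows are checked without
  -- unfolding the symmetrized definition of `prolong2`.
  inv2 : ∀ i, ∀ J : J2 m, J.1.1 ∈ r.dom → ∀ q : Sym2 (Fin m) → ℝ,
    (∀ j k, q s(j, k) = exProlongCoeff (ξ i) (θ i) J j k) →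
    ∀ s, ((I2 s).D (exProlong1 (ξ i) (θ i) J.1, q)).eval J = 0
  affine2 : ∀ (P : J1 m) (c : ℝ) (q q' : Sym2 (Fin m) → ℝ) (s : Sym2 (Fin m)),
    (I2 s).eval (P, c • q + q') =
      c * ((I2 s).eval (P, q) - (I2 s).eval (P, 0)) + (I2 s).eval (P, q')
  vert2 : ∀ P : J1 m, P.1 ∈ r.dom → ∀ q,
    (∀ s, (I2 s).eval (P, q) = (I2 s).eval (P, 0)) → ∀ s, q s = 0
  -- The tabulated equations are not literally linear combinations of the v_ij: they may carry a
  -- non-vanishing factor κ, number the coefficients in another order σ, and use a combination with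
  -- a₀ that differs from an invariant by a function γ of the first-order invariants.
  κ : Ex (J1 m)
  σ : Equiv.Perm (Sym2 (Fin m))
  γ : (Fin m → ℝ) → ℝ
  ok_κ : ∀ P : J1 m, P.1 ∈ r.dom → κ.Ok P
  κ_ne : ∀ P : J1 m, P.1 ∈ r.dom → κ.eval P ≠ 0
  γ_smooth : ContDiff ℝ ∞ γ
  eqn_eq : ∀ a b, ∀ J : J2 m, J.1.1 ∈ r.dom → r.eqn a b J =
    κ.eval J.1 * (∑ s, a (σ s) * (I2 s).eval J + b + a s(0, 0) * γ (r.inv1 J.1))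

@[simp] lemma triple_00 (a b c : ℝ) : triple a b c s(0, 0) = a := rfl
@[simp] lemma triple_01 (a b c : ℝ) : triple a b c s(0, 1) = b := by
  rw [triple, if_neg (by decide), if_pos rfl]
@[simp] lemma triple_11 (a b c : ℝ) : triple a b c s(1, 1) = c := by
  rw [triple, if_neg (by decide), if_neg (by decide)]

/-- A triple of expressions as a family indexed by unordered pairs. -/
def exTriple {α : Type} (a b c : α) : Sym2 (Fin 2) → α :=
  fun s => if s = s(0, 0) then a else if s = s(0, 1) then b else c

@[simp] lemma exTriple_00 {α : Type} (a b c : α) : exTriple a b c s(0, 0) = a := rfl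
@[simp] lemma exTriple_01 {α : Type} (a b c : α) : exTriple a b c s(0, 1) = b := by
  rw [exTriple, if_neg (by decide), if_pos rfl]
@[simp] lemma exTriple_11 {α : Type} (a b c : α) : exTriple a b c s(1, 1) = c := by
  rw [exTriple, if_neg (by decide), if_neg (by decide)]

lemma forall_sym2_fin2 {p : Sym2 (Fin 2) → Prop} :
    (∀ s, p s) ↔ p s(0, 0) ∧ p s(0, 1) ∧ p s(1, 1) := by
  refine ⟨fun h => ⟨h _, h _, h _⟩, fun h s => ?_⟩
  have : s = s(0, 0) ∨ s = s(0, 1) ∨ s = s(1, 1) := by revert s; decide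
  rcases this with h' | h' | h' <;> rw [h'] <;> tauto

lemma forall_sym2_fin1 {p : Sym2 (Fin 1) → Prop} : (∀ s, p s) ↔ p s(0, 0) := by
  refine ⟨fun h => h _, fun h s => ?_⟩
  have : s = s(0, 0) := by revert s; decide
  rwa [this]

lemma sum_sym2_fin1 (f : Sym2 (Fin 1) → ℝ) : ∑ s, f s = f s(0, 0) := by
  have : (Finset.univ : Finset (Sym2 (Fin 1))) = {s(0, 0)} := by decide
  rw [this, Finset.sum_singleton]

lemma sum_sym2_fin2 (f : Sym2 (Fin 2) → ℝ) :
    ∑ s, f s = f s(0, 0) + f s(0, 1) + f s(1, 1) := by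
  have : (Finset.univ : Finset (Sym2 (Fin 2))) = {s(0, 0), s(0, 1), s(1, 1)} := by decide
  rw [this, Finset.sum_insert (by decide), Finset.sum_insert (by decide), Finset.sum_singleton,
    add_assoc]

@[simp] lemma sym2_swap_fin2 : s((1 : Fin 2), 0) = s(0, 1) := Sym2.eq_swap

end RowFacts

end InvPDE
end

noncomputable section
namespace InvPDE

/-! ### Verification of the rows of dimension three -/

set_option maxHeartbeats 1000000 in
/-- The row `g³₇`. -/
def exRow37 : ExRow .g37 where
  ξ := ![![.cst 1, .cst 0], ![.sin (zx 0) * (.sin (zx 1) * .inv (.cos (zx 1))), .cos (zx 0)],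
    ![.cos (zx 0) * (.sin (zx 1) * .inv (.cos (zx 1))), -.sin (zx 0)]]
  θ := ![.cst 0, .sin (zx 0) * .inv (.cos (zx 1)), .cos (zx 0) * .inv (.cos (zx 1))]
  I1 := 
    let y : Ex (J1 2) := (zx 1).base
    let u : Ex (J1 2) := zu.base
    ![fib 0 * (.cos u * .inv (.cos y)) - fib 1 * .sin u - .cos u * (.sin y * .inv (.cos y)),
      fib 0 * (.sin u * .inv (.cos y)) + fib 1 * .cos u - .sin u * (.sin y * .inv (.cos y))]
  I2 := 
    let y : Ex (J2 2) := (zx 1).base.base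
    let c := y.cos
    let t := y.sin * y.cos.inv
    let u : Ex (J2 2) := zu.base.base
    let ux : Ex (J2 2) := (fib 0).base
    let uy : Ex (J2 2) := (fib 1).base
    let uxx : Ex (J2 2) := fib s(0, 0)
    let uxy : Ex (J2 2) := fib s(0, 1)
    let uyy : Ex (J2 2) := fib s(1, 1)
    let c2 := (.cst 2 * u).cos
    let s2 := (.cst 2 * u).sin
    let L := uxx * .inv (c * c) + uyy - uy * t
    let M := uxx * .inv (c * c) - uyy - .cst 2 * ux * uy * c.inv + uy * t
    let N := -(.cst 2 * uxy * c.inv) + uy * uy + (.cst 1 - ux * ux) * .inv (c * c)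
    exTriple L (c2 * M + s2 * N) (-s2 * M + c2 * N)
  isOpen_dom := isOpen_ne_fun (by fun_prop) continuous_const
  nonempty_dom := ⟨0, by simp [Row.dom]⟩
  gen_eq i := by
    fin_cases i <;> funext z <;> 
    refine Prod.ext (funext fun k => ?_) ?_ <;> (try fin_cases k) <;>
      simp [Row.gen, field3, exField, tan_eq_sin_div_cos, div_eq_mul_inv]
  inv1_eq P k := by
    fin_cases k <;> simp [Row.inv1, onJ1₃, tan_eq_sin_div_cos, div_eq_mul_inv] 
  inv2_eq J := forall_sym2_fin2.2 (by
    simp [Row.inv2, onJ2₃, tan_eq_sin_div_cos, div_eq_mul_inv, sq])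
  ok_ξ z hz i k := by
    have hz : cos (z.1 1) ≠ 0 := hz
    fin_cases i <;> fin_cases k <;> simp [hz]
  ok_θ z hz i := by
    have hz : cos (z.1 1) ≠ 0 := hz
    fin_cases i <;> simp [hz]
  ok_I1 z hz k := by
    have hz : cos (z.1.1 1) ≠ 0 := hz
    fin_cases k <;> simp [hz]
  ok_I2 z hz := forall_sym2_fin2.2 (by
    have hz : cos (z.1.1.1 1) ≠ 0 := hz
    simp [hz])
  indep z hz := by
    have hz : cos (z.1 1) ≠ 0 := hz
    rw [Fintype.linearIndependent_iff]
    intro g hg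
    have h0 := congrFun (congrArg Prod.fst hg) 0
    have h1 := congrFun (congrArg Prod.fst hg) 1
    have h2 := congrArg Prod.snd hg
    simp [Fin.sum_univ_three, exField] at h0 h1 h2
    have e1 := mul_inv_cancel₀ hz
    have e2 := sin_sq_add_cos_sq (z.1 0)
    -- After multiplying the ∂_u component by cos y, the last two fields have ∂_u and ∂_y components
    -- that form a rotation by the angle x, up to order and sign; inverting it isolates each
    -- coefficient.
    have h4 : g 1 = 0 := by
      linear_combination sin (z.1 0) * cos (z.1 1) * h2 + cos (z.1 0) * h1
        - g 1 * e2 - sin (z.1 0) * (g 1 * sin (z.1 0) + g 2 * cos (z.1 0)) * e1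
    have h5 : g 2 = 0 := by
      linear_combination cos (z.1 0) * cos (z.1 1) * h2 - sin (z.1 0) * h1
        - g 2 * e2 - cos (z.1 0) * (g 1 * sin (z.1 0) + g 2 * cos (z.1 0)) * e1
    rw [h4, h5] at h0
    intro i
    fin_cases i
    · simpa using h0
    · exact h4
    · exact h5
  bracket i j hij z hz := by
    have hz : cos (z.1 1) ≠ 0 := hz
    have e1 := mul_inv_cancel₀ hz
    have e2 := sin_sq_add_cos_sq (z.1 0)
    have e3 := sin_sq_add_cos_sq (z.1 1)
    fin_cases i <;> fin_cases j <;> first | (exfalso; revert hij; decide) | skip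
    all_goals
    refine Prod.ext (funext fun k => ?_) ?_ <;> (try fin_cases k) <;>
      simp [Row.structConst, bracket3, exField, Fin.sum_univ_three]
    all_goals grind
  vert1 P hP p h := by
    have hz : cos (P.1.1 1) ≠ 0 := hP
    have e1 := mul_inv_cancel₀ hz
    have e2 := sin_sq_add_cos_sq P.1.2
    have h0 := h 0
    have h1 := h 1
    simp at h0 h1
    funext k
    fin_cases k
    -- The fibre derivative is a rotation by u composed with the diagonal matrix of entries 1/cos y
    -- and 1.
    · show p 0 = 0
      linear_combination cos P.1.2 * cos (P.1.1 1) * h0 + sin P.1.2 * cos (P.1.1 1) * h1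
        - p 0 * e2 - p 0 * e1 * (sin P.1.2 ^ 2 + cos P.1.2 ^ 2)
    · show p 1 = 0
      linear_combination - sin P.1.2 * h0 + cos P.1.2 * h1 - p 1 * e2
  inv1 i P hP k := by
    have hz : cos (P.1.1 1) ≠ 0 := hP
    have e1 := mul_inv_cancel₀ hz
    have e3 := sin_sq_add_cos_sq (P.1.1 1)
    fin_cases i <;> fin_cases k <;> simp [exField, exProlong1]
    all_goals grind
  inv2 i J hJ q hq := forall_sym2_fin2.2 (by
    have hz : cos (J.1.1.1 1) ≠ 0 := hJ
    have e1 := mul_inv_cancel₀ hz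
    have e3 := sin_sq_add_cos_sq (J.1.1.1 1)
    fin_cases i <;> refine ⟨?_, ?_, ?_⟩ <;> simp [exField, exProlong1, hq, exProlongCoeff]
    all_goals clear hq
    all_goals grind)
  affine2 P c q q' := forall_sym2_fin2.2 (by
    refine ⟨?_, ?_, ?_⟩ <;> simp <;> ring)
  vert2 P hP q h := by
    have hz : cos (P.1.1 1) ≠ 0 := hP
    obtain ⟨h1, h2, h3⟩ := forall_sym2_fin2.1 h
    have e1 := mul_inv_cancel₀ hz
    have e2 := sin_sq_add_cos_sq (2 * P.1.2)
    simp at h1 h2 h3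
    refine forall_sym2_fin2.2 ?_
    generalize (cos (P.1.1 1))⁻¹ = C at *
    generalize (cos (P.1.1 1)) = c at *
    generalize cos (2 * P.1.2) = c2 at *
    generalize sin (2 * P.1.2) = s2 at *
    have hC : C ≠ 0 := right_ne_zero_of_mul_eq_one e1
    -- The last two invariants rotate M and N by the angle 2u. Undoing the rotation recovers the
    -- second-order parts of M and N, and L then separates the diagonal entries.
    have hA : q s(0, 0) * (C * C) - q s(1, 1) = 0 := by
      linear_combination c2 * h2 - s2 * h3 - (q s(0, 0) * (C * C) - q s(1, 1)) * e2
    have hB : q s(0, 1) * C = 0 := by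
      linear_combination (-s2 / 2) * h2 - c2 / 2 * h3 - q s(0, 1) * C * e2
    have h0 : q s(0, 0) * (C * C) = 0 := by linear_combination (h1 + hA) / 2
    refine ⟨by simpa [hC] using h0, by simpa [hC] using hB, by linear_combination h1 - h0⟩
  κ := .cst 1
  σ := 1
  γ := 0
  ok_κ _ _ := trivial
  κ_ne _ _ := one_ne_zero
  γ_smooth := contDiff_const
  eqn_eq a b J hJ := by
    simp [sum_sym2_fin2, Row.eqn, onJ2₃, tan_eq_sin_div_cos, div_eq_mul_inv, sq]
    ring

end InvPDE
end

noncomputable section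
namespace InvPDE

set_option maxHeartbeats 400000 in
/-- The row `3g¹`. -/
def exRowAbelian3 : ExRow (.abelian3) where
  ξ := ![![.cst 1, .cst 0], ![.cst 0, .cst 1], ![.cst 0, .cst 0]]
  θ := ![.cst 0, .cst 0, .cst 1]
  I1 :=
    let x : Ex (J1 2) := (zx 0).base
    let y : Ex (J1 2) := (zx 1).base
    let u : Ex (J1 2) := zu.base
    ![fib 0, fib 1]
  I2 :=
    let x : Ex (J2 2) := (zx 0).base.base
    let y : Ex (J2 2) := (zx 1).base.base
    let u : Ex (J2 2) := zu.base.base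
    let ux : Ex (J2 2) := (fib 0).base
    let uy : Ex (J2 2) := (fib 1).base
    let uxx : Ex (J2 2) := fib s(0, 0)
    let uxy : Ex (J2 2) := fib s(0, 1)
    let uyy : Ex (J2 2) := fib s(1, 1)
    exTriple uxx uxy uyy
  isOpen_dom := isOpen_univ
  nonempty_dom := univ_nonempty
  gen_eq i := by
    fin_cases i <;> funext z <;>
    refine Prod.ext (funext fun k => ?_) ?_ <;> (try fin_cases k) <;>
      simp [Row.gen, field3, exField, sq]
  inv1_eq P k := by
    fin_cases k <;> simp [Row.inv1, onJ1₃, sq]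
  inv2_eq J := forall_sym2_fin2.2 (by
    simp [Row.inv2, onJ2₃, sq, two_mul, exp_add] <;> try ring)
  ok_ξ z _ i k := by fin_cases i <;> fin_cases k <;> simp
  ok_θ z _ i := by fin_cases i <;> simp
  ok_I1 z _ k := by fin_cases k <;> simp
  ok_I2 z _ := forall_sym2_fin2.2 (by simp)
  indep z _ := by
    rw [Fintype.linearIndependent_iff]
    intro g hg
    have h0 := congrFun (congrArg Prod.fst hg) 0
    have h1 := congrFun (congrArg Prod.fst hg) 1
    have h2 := congrArg Prod.snd hg
    simp [Fin.sum_univ_three, exField] at h0 h1 h2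
    intro i
    fin_cases i <;> simp_all
  bracket i j hij z _ := by
    fin_cases i <;> fin_cases j <;> first | (exfalso; revert hij; decide) | skip
    all_goals
    refine Prod.ext (funext fun k => ?_) ?_ <;> (try fin_cases k) <;>
      simp [Row.structConst, bracket3, exField, Fin.sum_univ_three] <;> try ring
  vert1 P _ p' h := by
    have h0 := h 0
    have h1 := h 1
    simp at h0 h1
    funext k
    fin_cases k <;> simp_all
  inv1 i P _ k := by
    fin_cases i <;> fin_cases k <;> simp [exField, exProlong1] <;> try ring
  inv2 i J _ q hq := forall_sym2_fin2.2 (by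
    fin_cases i <;> refine ⟨?_, ?_, ?_⟩ <;> simp [exField, exProlong1, hq, exProlongCoeff] <;>
      try ring)
  affine2 P c q q' := forall_sym2_fin2.2 (by
    refine ⟨?_, ?_, ?_⟩ <;> simp <;> ring)
  vert2 P _ q h := by
    obtain ⟨h1, h2, h3⟩ := forall_sym2_fin2.1 h
    simp at h1 h2 h3
    refine forall_sym2_fin2.2 ⟨?_, ?_, ?_⟩ <;> simp_all
  κ := .cst 1
  σ := 1
  γ := 0
  ok_κ _ _ := by simp
  κ_ne _ _ := by simp
  γ_smooth := contDiff_const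
  eqn_eq a b J _ := by
    simp [sum_sym2_fin2, Row.eqn, onJ2₃]

set_option maxHeartbeats 400000 in
/-- The row `g¹ + g²`. -/
def exRowG1g2 : ExRow (.g1g2) where
  ξ := ![![.cst 1, .cst 0], ![zx 0, .cst 1], ![.cst 0, .cst 0]]
  θ := ![.cst 0, .cst 0, .cst 1]
  I1 :=
    let x : Ex (J1 2) := (zx 0).base
    let y : Ex (J1 2) := (zx 1).base
    let u : Ex (J1 2) := zu.base
    ![y.exp * fib 0, fib 1]
  I2 :=
    let x : Ex (J2 2) := (zx 0).base.base
    let y : Ex (J2 2) := (zx 1).base.base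
    let u : Ex (J2 2) := zu.base.base
    let ux : Ex (J2 2) := (fib 0).base
    let uy : Ex (J2 2) := (fib 1).base
    let uxx : Ex (J2 2) := fib s(0, 0)
    let uxy : Ex (J2 2) := fib s(0, 1)
    let uyy : Ex (J2 2) := fib s(1, 1)
    exTriple ((.cst 2 * y).exp * uxx) (y.exp * uxy) uyy
  isOpen_dom := isOpen_univ
  nonempty_dom := univ_nonempty
  gen_eq i := by
    fin_cases i <;> funext z <;>
    refine Prod.ext (funext fun k => ?_) ?_ <;> (try fin_cases k) <;>
      simp [Row.gen, field3, exField, sq]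
  inv1_eq P k := by
    fin_cases k <;> simp [Row.inv1, onJ1₃, sq]
  inv2_eq J := forall_sym2_fin2.2 (by
    simp [Row.inv2, onJ2₃, sq, two_mul, exp_add] <;> try ring)
  ok_ξ z _ i k := by fin_cases i <;> fin_cases k <;> simp
  ok_θ z _ i := by fin_cases i <;> simp
  ok_I1 z _ k := by fin_cases k <;> simp
  ok_I2 z _ := forall_sym2_fin2.2 (by simp)
  indep z _ := by
    rw [Fintype.linearIndependent_iff]
    intro g hg
    have h0 := congrFun (congrArg Prod.fst hg) 0
    have h1 := congrFun (congrArg Prod.fst hg) 1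
    have h2 := congrArg Prod.snd hg
    simp [Fin.sum_univ_three, exField] at h0 h1 h2
    intro i
    fin_cases i <;> simp_all
  bracket i j hij z _ := by
    fin_cases i <;> fin_cases j <;> first | (exfalso; revert hij; decide) | skip
    all_goals
    refine Prod.ext (funext fun k => ?_) ?_ <;> (try fin_cases k) <;>
      simp [Row.structConst, bracket3, exField, Fin.sum_univ_three] <;> try ring
  vert1 P _ p' h := by
    have h0 := h 0
    have h1 := h 1
    simp at h0 h1
    funext k
    fin_cases k <;> simp_all
  inv1 i P _ k := by
    fin_cases i <;> fin_cases k <;> simp [exField, exProlong1] <;> try ring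
  inv2 i J _ q hq := forall_sym2_fin2.2 (by
    fin_cases i <;> refine ⟨?_, ?_, ?_⟩ <;> simp [exField, exProlong1, hq, exProlongCoeff] <;>
      try ring)
  affine2 P c q q' := forall_sym2_fin2.2 (by
    refine ⟨?_, ?_, ?_⟩ <;> simp <;> ring)
  vert2 P _ q h := by
    obtain ⟨h1, h2, h3⟩ := forall_sym2_fin2.1 h
    simp at h1 h2 h3
    refine forall_sym2_fin2.2 ⟨?_, ?_, ?_⟩ <;> simp_all
  -- The row is written with a bare u_xx, whereas the invariant is e^{2y} u_xx.
  κ := (.cst (-2) * (zx 1).base).exp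
  σ := 1
  γ := 0
  ok_κ _ _ := by simp
  κ_ne _ _ := by simp
  γ_smooth := contDiff_const
  eqn_eq a b J _ := by
    have h1 : exp (-2 * J.1.1.1 1) * exp (2 * J.1.1.1 1) = 1 := by rw [← exp_add]; simp
    have h2 : exp (-J.1.1.1 1) = exp (-2 * J.1.1.1 1) * exp (J.1.1.1 1) := by
      rw [← exp_add]; congr 1; ring
    simp only [Row.eqn, onJ2₃, h2]
    simp [sum_sym2_fin2]
    simp only [neg_mul] at h1
    linear_combination -(a s(0, 0) * J.2 s(0, 0)) * h1

set_option maxHeartbeats 400000 in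
/-- The row `g³₁`. -/
def exRow31 : ExRow (.g31) where
  ξ := ![![.cst 0, .cst 0], ![.cst 1, .cst 0], ![.cst 0, .cst 1]]
  θ := ![.cst 1, .cst 0, zx 0]
  I1 :=
    let x : Ex (J1 2) := (zx 0).base
    let y : Ex (J1 2) := (zx 1).base
    let u : Ex (J1 2) := zu.base
    ![fib 0 - y, fib 1]
  I2 :=
    let x : Ex (J2 2) := (zx 0).base.base
    let y : Ex (J2 2) := (zx 1).base.base
    let u : Ex (J2 2) := zu.base.base
    let ux : Ex (J2 2) := (fib 0).base
    let uy : Ex (J2 2) := (fib 1).base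
    let uxx : Ex (J2 2) := fib s(0, 0)
    let uxy : Ex (J2 2) := fib s(0, 1)
    let uyy : Ex (J2 2) := fib s(1, 1)
    exTriple uxx uxy uyy
  isOpen_dom := isOpen_univ
  nonempty_dom := univ_nonempty
  gen_eq i := by
    fin_cases i <;> funext z <;>
    refine Prod.ext (funext fun k => ?_) ?_ <;> (try fin_cases k) <;>
      simp [Row.gen, field3, exField, sq]
  inv1_eq P k := by
    fin_cases k <;> simp [Row.inv1, onJ1₃, sq]
  inv2_eq J := forall_sym2_fin2.2 (by
    simp [Row.inv2, onJ2₃, sq, two_mul, exp_add] <;> try ring)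
  ok_ξ z _ i k := by fin_cases i <;> fin_cases k <;> simp
  ok_θ z _ i := by fin_cases i <;> simp
  ok_I1 z _ k := by fin_cases k <;> simp
  ok_I2 z _ := forall_sym2_fin2.2 (by simp)
  indep z _ := by
    rw [Fintype.linearIndependent_iff]
    intro g hg
    have h0 := congrFun (congrArg Prod.fst hg) 0
    have h1 := congrFun (congrArg Prod.fst hg) 1
    have h2 := congrArg Prod.snd hg
    simp [Fin.sum_univ_three, exField] at h0 h1 h2
    intro i
    fin_cases i <;> simp_all
  bracket i j hij z _ := by
    fin_cases i <;> fin_cases j <;> first | (exfalso; revert hij; decide) | skip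
    all_goals
    refine Prod.ext (funext fun k => ?_) ?_ <;> (try fin_cases k) <;>
      simp [Row.structConst, bracket3, exField, Fin.sum_univ_three] <;> try ring
  vert1 P _ p' h := by
    have h0 := h 0
    have h1 := h 1
    simp at h0 h1
    funext k
    fin_cases k <;> simp_all
  inv1 i P _ k := by
    fin_cases i <;> fin_cases k <;> simp [exField, exProlong1] <;> try ring
  inv2 i J _ q hq := forall_sym2_fin2.2 (by
    fin_cases i <;> refine ⟨?_, ?_, ?_⟩ <;> simp [exField, exProlong1, hq, exProlongCoeff] <;>
      try ring)
  affine2 P c q q' := forall_sym2_fin2.2 (by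
    refine ⟨?_, ?_, ?_⟩ <;> simp <;> ring)
  vert2 P _ q h := by
    obtain ⟨h1, h2, h3⟩ := forall_sym2_fin2.1 h
    simp at h1 h2 h3
    refine forall_sym2_fin2.2 ⟨?_, ?_, ?_⟩ <;> simp_all
  κ := .cst 1
  σ := 1
  γ := 0
  ok_κ _ _ := by simp
  κ_ne _ _ := by simp
  γ_smooth := contDiff_const
  eqn_eq a b J _ := by
    simp [sum_sym2_fin2, Row.eqn, onJ2₃]

set_option maxHeartbeats 400000 in
/-- The row `g³₂`. -/
def exRow32 : ExRow (.g32) where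
  ξ := ![![.cst 0, .cst 0], ![.cst 0, .cst 1], ![.cst 1, zx 1]]
  θ := ![.cst 1, .cst 0, zx 1 + zu]
  I1 :=
    let x : Ex (J1 2) := (zx 0).base
    let y : Ex (J1 2) := (zx 1).base
    let u : Ex (J1 2) := zu.base
    ![(-x).exp * fib 0, fib 1 - x]
  I2 :=
    let x : Ex (J2 2) := (zx 0).base.base
    let y : Ex (J2 2) := (zx 1).base.base
    let u : Ex (J2 2) := zu.base.base
    let ux : Ex (J2 2) := (fib 0).base
    let uy : Ex (J2 2) := (fib 1).base
    let uxx : Ex (J2 2) := fib s(0, 0)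
    let uxy : Ex (J2 2) := fib s(0, 1)
    let uyy : Ex (J2 2) := fib s(1, 1)
    exTriple ((-x).exp * uxx) uxy (x.exp * uyy)
  isOpen_dom := isOpen_univ
  nonempty_dom := univ_nonempty
  gen_eq i := by
    fin_cases i <;> funext z <;>
    refine Prod.ext (funext fun k => ?_) ?_ <;> (try fin_cases k) <;>
      simp [Row.gen, field3, exField, sq]
  inv1_eq P k := by
    fin_cases k <;> simp [Row.inv1, onJ1₃, sq]
  inv2_eq J := forall_sym2_fin2.2 (by
    simp [Row.inv2, onJ2₃, sq, two_mul, exp_add] <;> try ring)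
  ok_ξ z _ i k := by fin_cases i <;> fin_cases k <;> simp
  ok_θ z _ i := by fin_cases i <;> simp
  ok_I1 z _ k := by fin_cases k <;> simp
  ok_I2 z _ := forall_sym2_fin2.2 (by simp)
  indep z _ := by
    rw [Fintype.linearIndependent_iff]
    intro g hg
    have h0 := congrFun (congrArg Prod.fst hg) 0
    have h1 := congrFun (congrArg Prod.fst hg) 1
    have h2 := congrArg Prod.snd hg
    simp [Fin.sum_univ_three, exField] at h0 h1 h2
    intro i
    fin_cases i <;> simp_all
  bracket i j hij z _ := by
    fin_cases i <;> fin_cases j <;> first | (exfalso; revert hij; decide) | skip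
    all_goals
    refine Prod.ext (funext fun k => ?_) ?_ <;> (try fin_cases k) <;>
      simp [Row.structConst, bracket3, exField, Fin.sum_univ_three] <;> try ring
  vert1 P _ p' h := by
    have h0 := h 0
    have h1 := h 1
    simp at h0 h1
    funext k
    fin_cases k <;> simp_all
  inv1 i P _ k := by
    fin_cases i <;> fin_cases k <;> simp [exField, exProlong1] <;> try ring
  inv2 i J _ q hq := forall_sym2_fin2.2 (by
    fin_cases i <;> refine ⟨?_, ?_, ?_⟩ <;> simp [exField, exProlong1, hq, exProlongCoeff] <;>
      try ring)
  affine2 P c q q' := forall_sym2_fin2.2 (by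
    refine ⟨?_, ?_, ?_⟩ <;> simp <;> ring)
  vert2 P _ q h := by
    obtain ⟨h1, h2, h3⟩ := forall_sym2_fin2.1 h
    simp at h1 h2 h3
    refine forall_sym2_fin2.2 ⟨?_, ?_, ?_⟩ <;> simp_all
  κ := .cst 1
  σ := 1
  γ := 0
  ok_κ _ _ := by simp
  κ_ne _ _ := by simp
  γ_smooth := contDiff_const
  eqn_eq a b J _ := by
    simp [sum_sym2_fin2, Row.eqn, onJ2₃]

set_option maxHeartbeats 400000 in
/-- The row `g³₃`. -/
def exRow33 : ExRow (.g33) where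
  ξ := ![![.cst 1, .cst 0], ![.cst 0, .cst 1], ![zx 0, zx 1]]
  θ := ![.cst 0, .cst 0, .cst 1]
  I1 :=
    let x : Ex (J1 2) := (zx 0).base
    let y : Ex (J1 2) := (zx 1).base
    let u : Ex (J1 2) := zu.base
    ![u.exp * fib 0, u.exp * fib 1]
  I2 :=
    let x : Ex (J2 2) := (zx 0).base.base
    let y : Ex (J2 2) := (zx 1).base.base
    let u : Ex (J2 2) := zu.base.base
    let ux : Ex (J2 2) := (fib 0).base
    let uy : Ex (J2 2) := (fib 1).base
    let uxx : Ex (J2 2) := fib s(0, 0)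
    let uxy : Ex (J2 2) := fib s(0, 1)
    let uyy : Ex (J2 2) := fib s(1, 1)
    exTriple ((.cst 2 * u).exp * uxx) ((.cst 2 * u).exp * uxy) ((.cst 2 * u).exp * uyy)
  isOpen_dom := isOpen_univ
  nonempty_dom := univ_nonempty
  gen_eq i := by
    fin_cases i <;> funext z <;>
    refine Prod.ext (funext fun k => ?_) ?_ <;> (try fin_cases k) <;>
      simp [Row.gen, field3, exField, sq]
  inv1_eq P k := by
    fin_cases k <;> simp [Row.inv1, onJ1₃, sq]
  inv2_eq J := forall_sym2_fin2.2 (by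
    simp [Row.inv2, onJ2₃, sq, two_mul, exp_add] <;> try ring)
  ok_ξ z _ i k := by fin_cases i <;> fin_cases k <;> simp
  ok_θ z _ i := by fin_cases i <;> simp
  ok_I1 z _ k := by fin_cases k <;> simp
  ok_I2 z _ := forall_sym2_fin2.2 (by simp)
  indep z _ := by
    rw [Fintype.linearIndependent_iff]
    intro g hg
    have h0 := congrFun (congrArg Prod.fst hg) 0
    have h1 := congrFun (congrArg Prod.fst hg) 1
    have h2 := congrArg Prod.snd hg
    simp [Fin.sum_univ_three, exField] at h0 h1 h2
    intro i
    fin_cases i <;> simp_all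
  bracket i j hij z _ := by
    fin_cases i <;> fin_cases j <;> first | (exfalso; revert hij; decide) | skip
    all_goals
    refine Prod.ext (funext fun k => ?_) ?_ <;> (try fin_cases k) <;>
      simp [Row.structConst, bracket3, exField, Fin.sum_univ_three] <;> try ring
  vert1 P _ p' h := by
    have h0 := h 0
    have h1 := h 1
    simp at h0 h1
    funext k
    fin_cases k <;> simp_all
  inv1 i P _ k := by
    fin_cases i <;> fin_cases k <;> simp [exField, exProlong1] <;> try ring
  inv2 i J _ q hq := forall_sym2_fin2.2 (by
    fin_cases i <;> refine ⟨?_, ?_, ?_⟩ <;> simp [exField, exProlong1, hq, exProlongCoeff] <;>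
      try ring)
  affine2 P c q q' := forall_sym2_fin2.2 (by
    refine ⟨?_, ?_, ?_⟩ <;> simp <;> ring)
  vert2 P _ q h := by
    obtain ⟨h1, h2, h3⟩ := forall_sym2_fin2.1 h
    simp at h1 h2 h3
    refine forall_sym2_fin2.2 ⟨?_, ?_, ?_⟩ <;> simp_all
  κ := (.cst (-2) * zu.base).exp
  σ := 1
  γ := 0
  ok_κ _ _ := by simp
  κ_ne _ _ := by simp
  γ_smooth := contDiff_const
  eqn_eq a b J _ := by
    have h1 : exp (-2 * J.1.1.2) * exp (2 * J.1.1.2) = 1 := by rw [← exp_add]; simp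
    simp only [Row.eqn, onJ2₃]
    simp [sum_sym2_fin2]
    simp only [neg_mul] at h1
    linear_combination -(a s(0, 0) * J.2 s(0, 0) + a s(0, 1) * J.2 s(0, 1)
      + a s(1, 1) * J.2 s(1, 1)) * h1

set_option maxHeartbeats 400000 in
/-- The row `g³₄`. -/
def exRow34 (h : ℝ) (hh : |h| ≤ 1 ∧ h ≠ 0 ∧ h ≠ 1) : ExRow (.g34 h hh) where
  ξ := ![![.cst 1, .cst 0], ![.cst 0, .cst 1], ![zx 0, .cst h * zx 1]]
  θ := ![.cst 0, .cst 0, .cst 1]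
  I1 :=
    let x : Ex (J1 2) := (zx 0).base
    let y : Ex (J1 2) := (zx 1).base
    let u : Ex (J1 2) := zu.base
    ![u.exp * fib 0, (.cst h * u).exp * fib 1]
  I2 :=
    let x : Ex (J2 2) := (zx 0).base.base
    let y : Ex (J2 2) := (zx 1).base.base
    let u : Ex (J2 2) := zu.base.base
    let ux : Ex (J2 2) := (fib 0).base
    let uy : Ex (J2 2) := (fib 1).base
    let uxx : Ex (J2 2) := fib s(0, 0)
    let uxy : Ex (J2 2) := fib s(0, 1)
    let uyy : Ex (J2 2) := fib s(1, 1)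
    exTriple ((.cst 2 * u).exp * uxx) ((.cst (1 + h) * u).exp * uxy) ((.cst (2 * h) * u).exp * uyy)
  isOpen_dom := isOpen_univ
  nonempty_dom := univ_nonempty
  gen_eq i := by
    fin_cases i <;> funext z <;>
    refine Prod.ext (funext fun k => ?_) ?_ <;> (try fin_cases k) <;>
      simp [Row.gen, field3, exField, sq]
  inv1_eq P k := by
    fin_cases k <;> simp [Row.inv1, onJ1₃, sq]
  inv2_eq J := forall_sym2_fin2.2 (by
    simp [Row.inv2, onJ2₃, sq, two_mul, exp_add] <;> try ring)
  ok_ξ z _ i k := by fin_cases i <;> fin_cases k <;> simp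
  ok_θ z _ i := by fin_cases i <;> simp
  ok_I1 z _ k := by fin_cases k <;> simp
  ok_I2 z _ := forall_sym2_fin2.2 (by simp)
  indep z _ := by
    rw [Fintype.linearIndependent_iff]
    intro g hg
    have h0 := congrFun (congrArg Prod.fst hg) 0
    have h1 := congrFun (congrArg Prod.fst hg) 1
    have h2 := congrArg Prod.snd hg
    simp [Fin.sum_univ_three, exField] at h0 h1 h2
    intro i
    fin_cases i <;> simp_all
  bracket i j hij z _ := by
    fin_cases i <;> fin_cases j <;> first | (exfalso; revert hij; decide) | skip
    all_goals
    refine Prod.ext (funext fun k => ?_) ?_ <;> (try fin_cases k) <;>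
      simp [Row.structConst, bracket3, exField, Fin.sum_univ_three] <;> try ring
  vert1 P _ p' h := by
    have h0 := h 0
    have h1 := h 1
    simp at h0 h1
    funext k
    fin_cases k <;> simp_all
  inv1 i P _ k := by
    fin_cases i <;> fin_cases k <;> simp [exField, exProlong1] <;> try ring
  inv2 i J _ q hq := forall_sym2_fin2.2 (by
    fin_cases i <;> refine ⟨?_, ?_, ?_⟩ <;> simp [exField, exProlong1, hq, exProlongCoeff] <;>
      try ring)
  affine2 P c q q' := forall_sym2_fin2.2 (by
    refine ⟨?_, ?_, ?_⟩ <;> simp <;> ring)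
  vert2 P _ q h := by
    obtain ⟨h1, h2, h3⟩ := forall_sym2_fin2.1 h
    simp at h1 h2 h3
    refine forall_sym2_fin2.2 ⟨?_, ?_, ?_⟩ <;> simp_all
  κ := (.cst (-2) * zu.base).exp
  σ := 1
  γ := 0
  ok_κ _ _ := by simp
  κ_ne _ _ := by simp
  γ_smooth := contDiff_const
  eqn_eq a b J _ := by
    have h1 : exp (-2 * J.1.1.2) * exp (2 * J.1.1.2) = 1 := by rw [← exp_add]; simp
    have h2 : exp ((h - 1) * J.1.1.2) = exp (-2 * J.1.1.2) * exp ((1 + h) * J.1.1.2) := by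
      rw [← exp_add]; congr 1; ring
    have h3 : exp (2 * (h - 1) * J.1.1.2) = exp (-2 * J.1.1.2) * exp (2 * h * J.1.1.2) := by
      rw [← exp_add]; congr 1; ring
    simp only [Row.eqn, onJ2₃, h2, h3]
    simp [sum_sym2_fin2]
    simp only [neg_mul] at h1
    linear_combination -(a s(0, 0) * J.2 s(0, 0)) * h1

set_option maxHeartbeats 400000 in
/-- The row `g³₅`. -/
def exRow35 (p : ℝ) (hp : 0 ≤ p) : ExRow (.g35 p hp) where
  ξ := ![![.cst 1, .cst 0], ![.cst 0, .cst 1], ![.cst p * zx 0 + zx 1, .cst p * zx 1 - zx 0]]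
  θ := ![.cst 0, .cst 0, .cst 1]
  I1 :=
    let x : Ex (J1 2) := (zx 0).base
    let y : Ex (J1 2) := (zx 1).base
    let u : Ex (J1 2) := zu.base
    ![(.cst p * u).exp * (fib 0 * u.cos - fib 1 * u.sin), (.cst p * u).exp * (fib 0 * u.sin + fib 1 * u.cos)]
  I2 :=
    let x : Ex (J2 2) := (zx 0).base.base
    let y : Ex (J2 2) := (zx 1).base.base
    let u : Ex (J2 2) := zu.base.base
    let ux : Ex (J2 2) := (fib 0).base
    let uy : Ex (J2 2) := (fib 1).base
    let uxx : Ex (J2 2) := fib s(0, 0)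
    let uxy : Ex (J2 2) := fib s(0, 1)
    let uyy : Ex (J2 2) := fib s(1, 1)
    let c2 := (.cst 2 * u).cos
    let s2 := (.cst 2 * u).sin
    let e := (.cst (2 * p) * u).exp
    exTriple (e * (uxx + uyy)) (e * ((uxx - uyy) * c2 - .cst 2 * uxy * s2))
      (e * ((uxx - uyy) * s2 + .cst 2 * uxy * c2))
  isOpen_dom := isOpen_univ
  nonempty_dom := univ_nonempty
  gen_eq i := by
    fin_cases i <;> funext z <;>
    refine Prod.ext (funext fun k => ?_) ?_ <;> (try fin_cases k) <;>
      simp [Row.gen, field3, exField, sq]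
  inv1_eq P k := by
    fin_cases k <;> simp [Row.inv1, onJ1₃, sq]
  inv2_eq J := forall_sym2_fin2.2 (by
    simp [Row.inv2, onJ2₃, sq, two_mul, exp_add] <;> try ring)
  ok_ξ z _ i k := by fin_cases i <;> fin_cases k <;> simp
  ok_θ z _ i := by fin_cases i <;> simp
  ok_I1 z _ k := by fin_cases k <;> simp
  ok_I2 z _ := forall_sym2_fin2.2 (by simp)
  indep z _ := by
    rw [Fintype.linearIndependent_iff]
    intro g hg
    have h0 := congrFun (congrArg Prod.fst hg) 0
    have h1 := congrFun (congrArg Prod.fst hg) 1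
    have h2 := congrArg Prod.snd hg
    simp [Fin.sum_univ_three, exField] at h0 h1 h2
    intro i
    fin_cases i <;> simp_all
  bracket i j hij z _ := by
    fin_cases i <;> fin_cases j <;> first | (exfalso; revert hij; decide) | skip
    all_goals
    refine Prod.ext (funext fun k => ?_) ?_ <;> (try fin_cases k) <;>
      simp [Row.structConst, bracket3, exField, Fin.sum_univ_three] <;> try ring
  vert1 P _ p' h := by
    have h0 := h 0
    have h1 := h 1
    simp at h0 h1
    have e2 := sin_sq_add_cos_sq P.1.2
    funext k
    fin_cases k
    · show p' 0 = 0
      linear_combination cos P.1.2 * h0 + sin P.1.2 * h1 - p' 0 * e2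
    · show p' 1 = 0
      linear_combination - sin P.1.2 * h0 + cos P.1.2 * h1 - p' 1 * e2
  inv1 i P _ k := by
    fin_cases i <;> fin_cases k <;> simp [exField, exProlong1] <;> try ring
  inv2 i J _ q hq := forall_sym2_fin2.2 (by
    fin_cases i <;> refine ⟨?_, ?_, ?_⟩ <;> simp [exField, exProlong1, hq, exProlongCoeff] <;>
      try ring)
  affine2 P c q q' := forall_sym2_fin2.2 (by
    refine ⟨?_, ?_, ?_⟩ <;> simp <;> ring)
  vert2 P _ q h := by
    obtain ⟨h1, h2, h3⟩ := forall_sym2_fin2.1 h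
    simp at h1 h2 h3
    have e2 := sin_sq_add_cos_sq (2 * P.1.2)
    -- Inverse rotation by 2u, as for so(3).
    have hA : q s(0, 0) - q s(1, 1) = 0 := by
      linear_combination cos (2 * P.1.2) * h2 + sin (2 * P.1.2) * h3 - (q s(0, 0) - q s(1, 1)) * e2
    have hB : q s(0, 1) = 0 := by
      linear_combination (-sin (2 * P.1.2) / 2) * h2 + cos (2 * P.1.2) / 2 * h3 - q s(0, 1) * e2
    exact forall_sym2_fin2.2 ⟨by linear_combination (h1 + hA) / 2, hB,
      by linear_combination (h1 - hA) / 2⟩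
  κ := (.cst (-(2 * p)) * zu.base).exp
  σ := 1
  γ := 0
  ok_κ _ _ := by simp
  κ_ne _ _ := by simp
  γ_smooth := contDiff_const
  eqn_eq a b J _ := by
    have h1 : exp (-(2 * p) * J.1.1.2) * exp (2 * p * J.1.1.2) = 1 := by
      rw [← exp_add]; simp
    simp only [Row.eqn, onJ2₃, neg_mul]
    simp [sum_sym2_fin2]
    simp only [neg_mul] at h1
    linear_combination -(a s(0, 0) * (J.2 s(0, 0) + J.2 s(1, 1))
      + a s(0, 1) * ((J.2 s(0, 0) - J.2 s(1, 1)) * cos (2 * J.1.1.2)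
        - 2 * J.2 s(0, 1) * sin (2 * J.1.1.2))
      + a s(1, 1) * ((J.2 s(0, 0) - J.2 s(1, 1)) * sin (2 * J.1.1.2)
        + 2 * J.2 s(0, 1) * cos (2 * J.1.1.2))) * h1

set_option maxHeartbeats 400000 in
/-- The row `g³₆`. -/
def exRow36 : ExRow (.g36) where
  ξ := ![![.cst 1, .cst 0], ![zx 0, .cst 1], ![zx 0 * zx 0, .cst 2 * zx 0]]
  θ := ![.cst 0, .cst 0, (zx 1).exp]
  I1 :=
    let x : Ex (J1 2) := (zx 0).base
    let y : Ex (J1 2) := (zx 1).base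
    let u : Ex (J1 2) := zu.base
    ![y.exp * fib 0 + fib 1 * fib 1, fib 1 - u]
  I2 :=
    let x : Ex (J2 2) := (zx 0).base.base
    let y : Ex (J2 2) := (zx 1).base.base
    let u : Ex (J2 2) := zu.base.base
    let ux : Ex (J2 2) := (fib 0).base
    let uy : Ex (J2 2) := (fib 1).base
    let uxx : Ex (J2 2) := fib s(0, 0)
    let uxy : Ex (J2 2) := fib s(0, 1)
    let uyy : Ex (J2 2) := fib s(1, 1)
    exTriple (uyy - u) (y.exp * uxy + .cst 2 * u * uyy - u * u)
      (y.exp * y.exp * uxx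
        + .cst 2 * u * (u * (.cst 2 * uyy + uy - u) + y.exp * (ux + .cst 2 * uxy)))
  isOpen_dom := isOpen_univ
  nonempty_dom := univ_nonempty
  gen_eq i := by
    fin_cases i <;> funext z <;>
    refine Prod.ext (funext fun k => ?_) ?_ <;> (try fin_cases k) <;>
      simp [Row.gen, field3, exField, sq]
  inv1_eq P k := by
    fin_cases k <;> simp [Row.inv1, onJ1₃, sq]
  inv2_eq J := forall_sym2_fin2.2 (by
    simp [Row.inv2, onJ2₃, sq, two_mul, exp_add] <;> try ring)
  ok_ξ z _ i k := by fin_cases i <;> fin_cases k <;> simp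
  ok_θ z _ i := by fin_cases i <;> simp
  ok_I1 z _ k := by fin_cases k <;> simp
  ok_I2 z _ := forall_sym2_fin2.2 (by simp)
  indep z _ := by
    rw [Fintype.linearIndependent_iff]
    intro g hg
    have h0 := congrFun (congrArg Prod.fst hg) 0
    have h1 := congrFun (congrArg Prod.fst hg) 1
    have h2 := congrArg Prod.snd hg
    simp [Fin.sum_univ_three, exField] at h0 h1 h2
    intro i
    fin_cases i <;> simp_all
  bracket i j hij z _ := by
    fin_cases i <;> fin_cases j <;> first | (exfalso; revert hij; decide) | skip
    all_goals
    refine Prod.ext (funext fun k => ?_) ?_ <;> (try fin_cases k) <;>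
      simp [Row.structConst, bracket3, exField, Fin.sum_univ_three] <;> try ring
  vert1 P _ p' h := by
    have h0 := h 0
    have h1 := h 1
    simp at h0 h1
    funext k
    fin_cases k <;> simp_all
  inv1 i P _ k := by
    fin_cases i <;> fin_cases k <;> simp [exField, exProlong1] <;> try ring
  inv2 i J _ q hq := forall_sym2_fin2.2 (by
    fin_cases i <;> refine ⟨?_, ?_, ?_⟩ <;> simp [exField, exProlong1, hq, exProlongCoeff] <;>
      try ring)
  affine2 P c q q' := forall_sym2_fin2.2 (by
    refine ⟨?_, ?_, ?_⟩ <;> simp <;> ring)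
  vert2 P _ q h := by
    obtain ⟨h1, h2, h3⟩ := forall_sym2_fin2.1 h
    simp at h1 h2 h3
    refine forall_sym2_fin2.2 ⟨?_, ?_, ?_⟩ <;> simp_all
  κ := .cst 1
  -- The invariants of this row are listed starting from u_yy, but a₀ multiplies the expression
  -- containing u_xx.
  σ := Equiv.swap s(0, 0) s(1, 1)
  -- The difference between the expression multiplied by a₀ in the equation and the invariant with
  -- the same second-order terms; it has order one and is itself invariant.
  γ := fun v => 2 * v 1 * (v 0 - v 1 ^ 2)
  ok_κ _ _ := by simp
  κ_ne _ _ := by simp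
  γ_smooth := by fun_prop
  eqn_eq a b J _ := by
    have h1 : exp (2 * J.1.1.1 1) = exp (J.1.1.1 1) * exp (J.1.1.1 1) := by
      rw [← exp_add, two_mul]
    have h2 : (Equiv.swap s((0 : Fin 2), 0) s(1, 1)) s(0, 1) = s(0, 1) := by decide
    simp only [Row.eqn, onJ2₃, h1, Row.inv1, onJ1₃]
    simp [sum_sym2_fin2, h2]
    ring

end InvPDE
end

noncomputable section
namespace InvPDE

/-- The row `2g¹`. -/
def exRowAbelian2 : ExRow .abelian2 where
  ξ := ![![.cst 1], ![.cst 0]]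
  θ := ![.cst 0, .cst 1]
  I1 := ![fib 0]
  I2 := fun _ => fib s(0, 0)
  isOpen_dom := isOpen_univ
  nonempty_dom := univ_nonempty
  gen_eq i := by
    fin_cases i <;> funext z <;> refine Prod.ext (funext fun k => ?_) ?_ <;> (try fin_cases k) <;>
      simp [Row.gen, field2, exField]
  inv1_eq P k := by fin_cases k; simp [Row.inv1, onJ1₂]
  inv2_eq J s := by simp [Row.inv2, onJ2₂]
  ok_ξ z _ i k := by fin_cases i <;> fin_cases k <;> simp
  ok_θ z _ i := by fin_cases i <;> simp
  ok_I1 z _ k := by fin_cases k; simp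
  ok_I2 z _ s := by simp
  indep z _ := by
    rw [Fintype.linearIndependent_iff]
    intro g hg
    have h0 := congrFun (congrArg Prod.fst hg) 0
    have h1 := congrArg Prod.snd hg
    simp [exField] at h0 h1
    intro i
    fin_cases i <;> simp_all
  bracket i j hij z _ := by
    fin_cases i <;> fin_cases j <;> first | (exfalso; revert hij; decide) | skip
    refine Prod.ext (funext fun k => ?_) ?_ <;> (try fin_cases k) <;>
      simp [Row.structConst, bracket2, exField]
  vert1 P _ p h := by
    have h0 := h 0
    simp at h0
    funext k
    fin_cases k
    exact h0
  inv1 i P _ k := by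
    fin_cases i <;> fin_cases k <;> simp [exProlong1]
  inv2 i J _ q hq s := by
    fin_cases i <;> simp [hq, exProlongCoeff]
  affine2 P c q q' s := by simp
  vert2 P _ q h := forall_sym2_fin1.2 (by simpa using h s(0, 0))
  κ := .cst 1
  σ := 1
  γ := 0
  ok_κ _ _ := trivial
  κ_ne _ _ := one_ne_zero
  γ_smooth := contDiff_const
  eqn_eq a b J _ := by
    rw [sum_sym2_fin1]
    simp [Row.eqn, onJ2₂]

/-- The row `g²`. -/
def exRowAffine : ExRow .affine where
  ξ := ![![.cst 1], ![zx 0]]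
  θ := ![.cst 0, .cst 1]
  I1 := ![zu.base.exp * fib 0]
  I2 := fun _ => (.cst 2 * zu.base.base).exp * fib s(0, 0)
  isOpen_dom := isOpen_univ
  nonempty_dom := univ_nonempty
  gen_eq i := by
    fin_cases i <;> funext z <;> refine Prod.ext (funext fun k => ?_) ?_ <;> (try fin_cases k) <;>
      simp [Row.gen, field2, exField]
  inv1_eq P k := by fin_cases k; simp [Row.inv1, onJ1₂]
  inv2_eq J s := by simp [Row.inv2, onJ2₂]
  ok_ξ z _ i k := by fin_cases i <;> fin_cases k <;> simp
  ok_θ z _ i := by fin_cases i <;> simp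
  ok_I1 z _ k := by fin_cases k; simp
  ok_I2 z _ s := by simp
  indep z _ := by
    rw [Fintype.linearIndependent_iff]
    intro g hg
    have h0 := congrFun (congrArg Prod.fst hg) 0
    have h1 := congrArg Prod.snd hg
    simp [exField] at h0 h1
    intro i
    fin_cases i <;> simp_all
  bracket i j hij z _ := by
    fin_cases i <;> fin_cases j <;> first | (exfalso; revert hij; decide) | skip
    refine Prod.ext (funext fun k => ?_) ?_ <;> (try fin_cases k) <;>
      simp [Row.structConst, bracket2, exField]
  vert1 P _ p h := by
    have h0 := h 0
    simp at h0
    funext k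
    fin_cases k
    exact h0
  inv1 i P _ k := by
    fin_cases i <;> fin_cases k <;> simp [exProlong1, exField]
  inv2 i J _ q hq s := by
    fin_cases i <;> simp [hq, exProlongCoeff, exProlong1, exField] <;> ring
  affine2 P c q q' s := by simp; ring
  vert2 P _ q h := forall_sym2_fin1.2 (by simpa using h s(0, 0))
  κ := (.cst (-2) * zu.base).exp
  σ := 1
  γ := 0
  ok_κ _ _ := by simp
  κ_ne _ _ := by simp
  γ_smooth := contDiff_const
  eqn_eq a b J _ := by
    have h1 : exp (-2 * J.1.1.2) * exp (2 * J.1.1.2) = 1 := by rw [← exp_add]; simp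
    rw [sum_sym2_fin1]
    simp only [Row.eqn, onJ2₂]
    simp
    simp only [neg_mul] at h1
    linear_combination -(a s(0, 0) * J.2 s(0, 0)) * h1

/-- The expressions of all rows. -/
def exRow : {m : ℕ} → [NeZero m] → (r : Row m) → ExRow r
  | _, _, .abelian2 => exRowAbelian2
  | _, _, .affine => exRowAffine
  | _, _, .abelian3 => exRowAbelian3
  | _, _, .g1g2 => exRowG1g2
  | _, _, .g31 => exRow31
  | _, _, .g32 => exRow32
  | _, _, .g33 => exRow33
  | _, _, .g34 h hh => exRow34 h hh
  | _, _, .g35 p hp => exRow35 p hp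
  | _, _, .g36 => exRow36
  | _, _, .g37 => exRow37

/-! ### Consequences of the verified identities, uniformly in the row -/

namespace ExRow

variable {m : ℕ} [NeZero m] {r : Row m}

lemma contDiffAt_gen (e : ExRow r) {z : Pt m} (hz : z ∈ r.dom) (i : Fin (m + 1)) :
    ContDiffAt ℝ ∞ (r.gen i) z := by
  rw [e.gen_eq]
  exact contDiffAt_exField (e.ok_ξ z hz i) (e.ok_θ z hz i)

lemma isFrame (e : ExRow r) : IsFrame r.dom r.gen :=
  ⟨fun i z hz => (e.contDiffAt_gen hz i).contDiffWithinAt, fun z hz => by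
    simpa only [e.gen_eq] using e.indep z hz⟩

lemma structConst_swap {m : ℕ} (r : Row m) (i j k : Fin (m + 1)) :
    r.structConst i j k = -r.structConst j i k := by
  cases r <;> fin_cases i <;> fin_cases j <;>
    simp [Row.structConst, bracket2, bracket3] <;> fin_cases k <;> simp

lemma hasStructure (e : ExRow r) : HasStructure r.structConst r.dom r.gen := by
  have key : ∀ i j, i < j → ∀ z ∈ r.dom, VectorField.lieBracket ℝ (r.gen i) (r.gen j) z =
      ∑ k, r.structConst i j k • r.gen k z := by
    intro i j hij z hz
    simp only [e.gen_eq]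
    rw [lieBracket_exField (e.ok_ξ z hz i) (e.ok_θ z hz i) (e.ok_ξ z hz j) (e.ok_θ z hz j),
      e.bracket i j hij z hz]
  intro i j z hz
  rcases lt_trichotomy i j with h | h | h
  · exact key i j h z hz
  · subst h
    have h0 : ∀ k, r.structConst i i k = 0 := fun k => by
      linarith [structConst_swap r i i k]
    rw [VectorField.lieBracket_self]
    simp [h0]
  · rw [VectorField.lieBracket_swap, key j i h z hz, ← Finset.sum_neg_distrib]
    exact Finset.sum_congr rfl fun k _ => by rw [structConst_swap r i j k, neg_smul]

lemma prolong1_gen (e : ExRow r) {P : J1 m} (hP : P.1 ∈ r.dom) (i : Fin (m + 1)) :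
    prolong1 (r.gen i) P = exProlong1 (e.ξ i) (e.θ i) P := by
  rw [e.gen_eq, prolong1_exField (e.ok_ξ _ hP i) (e.ok_θ _ hP i), exProlong1]

lemma prolong2_gen_snd (e : ExRow r) {J : J2 m} (hJ : J.1.1 ∈ r.dom) (i : Fin (m + 1))
    (j k : Fin m) : (prolong2 (r.gen i) J).2 s(j, k) = exProlongCoeff (e.ξ i) (e.θ i) J j k := by
  rw [prolong2_snd e.isOpen_dom (e.isFrame.1 i) hJ, e.gen_eq,
    prolongCoeff_exField (e.ok_ξ _ hJ i) (e.ok_θ _ hJ i), exProlongCoeff]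

lemma contDiffAt_inv1 (e : ExRow r) {P : J1 m} (hP : P.1 ∈ r.dom) :
    ContDiffAt ℝ ∞ r.inv1 P := by
  refine contDiffAt_pi.2 fun k => ?_
  simp only [e.inv1_eq]
  exact (e.ok_I1 P hP k).contDiffAt

lemma contDiffAt_inv2 (e : ExRow r) {J : J2 m} (hJ : J.1.1 ∈ r.dom) :
    ContDiffAt ℝ ∞ r.inv2 J := by
  refine contDiffAt_pi.2 fun k => ?_
  simp only [e.inv2_eq]
  exact (e.ok_I2 J hJ k).contDiffAt

lemma fderiv_inv1 (e : ExRow r) {P : J1 m} (hP : P.1 ∈ r.dom) (V : J1 m) (k : Fin m) :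
    fderiv ℝ r.inv1 P V k = ((e.I1 k).D V).eval P := by
  rw [← (e.ok_I1 P hP k).fderiv_eval]
  have h := hasFDerivAt_pi'.1 (((e.contDiffAt_inv1 hP).differentiableAt (by simp)).hasFDerivAt) k
  simp only [e.inv1_eq] at h
  rw [HasFDerivAt.fderiv (f := (e.I1 k).eval) h]
  rfl

lemma fderiv_inv2 (e : ExRow r) {J : J2 m} (hJ : J.1.1 ∈ r.dom) (V : J2 m) (s : Sym2 (Fin m)) :
    fderiv ℝ r.inv2 J V s = ((e.I2 s).D V).eval J := by
  rw [← (e.ok_I2 J hJ s).fderiv_eval]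
  have h := hasFDerivAt_pi'.1 (((e.contDiffAt_inv2 hJ).differentiableAt (by simp)).hasFDerivAt) s
  simp only [e.inv2_eq] at h
  rw [HasFDerivAt.fderiv (f := (e.I2 s).eval) h]
  rfl

lemma fderiv_inv1_prolong1 (e : ExRow r) {P : J1 m} (hP : P.1 ∈ r.dom) (i : Fin (m + 1)) :
    fderiv ℝ r.inv1 P (prolong1 (r.gen i) P) = 0 := by
  funext k
  rw [e.fderiv_inv1 hP, e.prolong1_gen hP, e.inv1 i P hP k, Pi.zero_apply]

lemma fderiv_inv2_prolong2 (e : ExRow r) {J : J2 m} (hJ : J.1.1 ∈ r.dom) (i : Fin (m + 1)) :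
    fderiv ℝ r.inv2 J (prolong2 (r.gen i) J) = 0 := by
  funext s
  rw [e.fderiv_inv2 hJ, Pi.zero_apply, ← e.inv2 i J hJ _ (e.prolong2_gen_snd hJ i) s,
    ← e.prolong1_gen hJ]
  rfl

lemma fderiv_inv1_vert (e : ExRow r) {P : J1 m} (hP : P.1 ∈ r.dom) (p : Fin m → ℝ)
    (h : fderiv ℝ r.inv1 P (0, p) = 0) : p = 0 :=
  e.vert1 P hP p fun k => by rw [← e.fderiv_inv1 hP, h, Pi.zero_apply]

/-- The linear part is the increment over q = 0; the single identity `affine2` contains both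
additivity (c = 1) and homogeneity (q' = 0). -/
lemma exists_affine (e : ExRow r) (P : J1 m) (hP : P.1 ∈ r.dom) :
    ∃ L : (Sym2 (Fin m) → ℝ) →ₗ[ℝ] (Sym2 (Fin m) → ℝ), Function.Injective L ∧
      ∀ q, r.inv2 (P, q) = L q + r.inv2 (P, 0) := by
  have h : ∀ (c : ℝ) (q q' : Sym2 (Fin m) → ℝ), r.inv2 (P, c • q + q') =
      c • (r.inv2 (P, q) - r.inv2 (P, 0)) + r.inv2 (P, q') := fun c q q' => by
    funext s
    simpa [e.inv2_eq] using e.affine2 P c q q' s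
  refine ⟨⟨⟨fun q => r.inv2 (P, q) - r.inv2 (P, 0), fun q q' => ?_⟩, fun c q => ?_⟩, ?_, ?_⟩
  · have := h 1 q q'
    rw [one_smul, one_smul] at this
    rw [this]; abel
  · have := h c q 0
    rw [add_zero] at this
    simp [this]
  · refine (injective_iff_map_eq_zero _).2 fun q hq => ?_
    refine funext (e.vert2 P hP q fun s => ?_)
    have := congrFun (sub_eq_zero.1 hq) s
    rwa [e.inv2_eq, e.inv2_eq] at this
  · intro q
    simp

lemma adaptedInvariants (e : ExRow r) {P : J1 m} (hP : P.1 ∈ r.dom) :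
    AdaptedInvariants r.gen P r.inv1 r.inv2 := by
  have hn : ∀ᶠ P' in 𝓝 P, P'.1 ∈ r.dom :=
    continuousAt_fst.eventually (e.isOpen_dom.mem_nhds hP)
  exact
  { indep := hn.mono fun P' h => e.isFrame.2 _ h
    smooth1 := hn.mono fun P' h => e.contDiffAt_inv1 h
    vert1 := e.fderiv_inv1_vert hP
    inv1 := hn.mono fun P' h => e.fderiv_inv1_prolong1 h
    smooth2 := hn.mono fun P' h q => e.contDiffAt_inv2 h
    affine2 := hn.mono fun P' h => by
      obtain ⟨L, hL, hLq⟩ := e.exists_affine P' h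
      exact ⟨L, _, hL, hLq⟩
    inv2 := hn.mono fun P' h q => e.fderiv_inv2_prolong2 h }

/-- The fibre directions already suffice, an injective endomorphism of ℝ^m being onto. -/
lemma surjective_fderiv_inv1 (e : ExRow r) {P : J1 m} (hP : P.1 ∈ r.dom) :
    ∀ v, ∃ p, fderiv ℝ r.inv1 P (0, p) = v := by
  have h : Function.Injective ((fderiv ℝ r.inv1 P).comp
      (ContinuousLinearMap.inr ℝ (Pt m) (Fin m → ℝ))).toLinearMap :=
    (injective_iff_map_eq_zero _).2 fun p hp => e.fderiv_inv1_vert hP p hp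
  exact fun v => LinearMap.injective_iff_surjective.1 h v

lemma hasFDerivAt_inv (e : ExRow r) {J : J2 m} (hJ : J.1.1 ∈ r.dom) :
    ∃ f' : J2 m →L[ℝ] (Fin m → ℝ) × (Sym2 (Fin m) → ℝ),
      HasFDerivAt (fun J' : J2 m => (r.inv1 J'.1, r.inv2 J')) f' J ∧
      ∀ V, f' V = (fderiv ℝ r.inv1 J.1 V.1, fderiv ℝ r.inv2 J V) := by
  have h1 : HasFDerivAt (fun J' : J2 m => r.inv1 J'.1) _ J :=
    HasFDerivAt.comp J (g := r.inv1)
      ((e.contDiffAt_inv1 hJ).differentiableAt (by simp)).hasFDerivAt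
      (hasFDerivAt_fst (𝕜 := ℝ) (p := J))
  exact ⟨_, h1.prodMk ((e.contDiffAt_inv2 hJ).differentiableAt (by simp)).hasFDerivAt,
    fun V => rfl⟩

lemma surjective_fderiv_inv (e : ExRow r) {J : J2 m} (hJ : J.1.1 ∈ r.dom) :
    Function.Surjective (fderiv ℝ (fun J' : J2 m => (r.inv1 J'.1, r.inv2 J')) J) := by
  obtain ⟨f', hf', hV⟩ := e.hasFDerivAt_inv hJ
  rw [hf'.fderiv]
  rintro ⟨v, w⟩
  obtain ⟨p, hp⟩ := e.surjective_fderiv_inv1 hJ v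
  obtain ⟨L, hL, hLq⟩ := e.exists_affine J.1 hJ
  obtain ⟨q, hq⟩ := LinearMap.injective_iff_surjective.1 hL
    (w - fderiv ℝ r.inv2 J ((0, p), 0))
  have h := AdaptedInvariants.fderiv_fibre (fun q => e.contDiffAt_inv2 (J := (J.1, q)) hJ) hLq
    J.2 q
  refine ⟨((0, p), q), ?_⟩
  rw [hV]
  refine Prod.ext hp ?_
  have h2 : (((0, p), q) : J2 m) = ((0, p), 0) + (0, q) := by simp
  show fderiv ℝ r.inv2 J ((0, p), q) = w
  rw [h2, map_add]
  have h3 : fderiv ℝ r.inv2 J (0, q) = L q := h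
  rw [h3, hq]
  abel

/-- The tabulated equation in terms of the invariants, up to a nowhere vanishing factor. -/
def normalForm (e : ExRow r) (a : (Fin m → ℝ) → Sym2 (Fin m) → ℝ) (b : (Fin m → ℝ) → ℝ)
    (v : (Fin m → ℝ) × (Sym2 (Fin m) → ℝ)) : ℝ :=
  ∑ s, a v.1 (e.σ s) * v.2 s + b v.1 + a v.1 s(0, 0) * e.γ v.1

lemma equation_eq (e : ExRow r) (a : (Fin m → ℝ) → Sym2 (Fin m) → ℝ) (b : (Fin m → ℝ) → ℝ)
    {J : J2 m} (hJ : J.1.1 ∈ r.dom) :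
    r.equation a b J = e.κ.eval J.1 * e.normalForm a b (r.inv1 J.1, r.inv2 J) := by
  rw [Row.equation, e.eqn_eq _ _ J hJ]
  simp only [e.inv2_eq, normalForm]

variable {V : Set (Fin m → ℝ)} {a : (Fin m → ℝ) → Sym2 (Fin m) → ℝ} {b : (Fin m → ℝ) → ℝ}

/-- The equation is κ times a function of the invariants. On its zero set the second factor
vanishes, and its derivative along the prolonged fields vanishes everywhere, so both terms of the
product rule are zero. -/
lemma isInvariantEq (e : ExRow r) (h : IsCoeffs V a b) :
    IsInvariantEq r.gen {P | P.1 ∈ r.dom ∧ r.inv1 P ∈ V} (r.equation a b) := by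
  obtain ⟨hV, ha, hb, -⟩ := h
  rintro i J ⟨hJ, hJV⟩ hE
  have hn : ∀ᶠ J' in 𝓝 J, J'.1.1 ∈ r.dom :=
    (continuousAt_fst.fst).eventually (e.isOpen_dom.mem_nhds hJ)
  have hEe : r.equation a b =ᶠ[𝓝 J]
      fun J' => e.κ.eval J'.1 * e.normalForm a b (r.inv1 J'.1, r.inv2 J') :=
    hn.mono fun J' hJ' => e.equation_eq a b hJ'
  rw [e.equation_eq a b hJ] at hE
  have hG0 := (mul_eq_zero.1 hE).resolve_left (e.κ_ne J.1 hJ)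
  have hG : DifferentiableAt ℝ (e.normalForm a b) (r.inv1 J.1, r.inv2 J) := by
    have h1 : DifferentiableAt ℝ (fun v : (Fin m → ℝ) × (Sym2 (Fin m) → ℝ) => a v.1)
        (r.inv1 J.1, r.inv2 J) :=
      DifferentiableAt.comp (g := a) (r.inv1 J.1, r.inv2 J)
        ((ha.contDiffAt (hV.mem_nhds hJV)).differentiableAt (by simp)) differentiableAt_fst
    have h2 : DifferentiableAt ℝ (fun v : (Fin m → ℝ) × (Sym2 (Fin m) → ℝ) => b v.1)
        (r.inv1 J.1, r.inv2 J) :=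
      DifferentiableAt.comp (g := b) (r.inv1 J.1, r.inv2 J)
        ((hb.contDiffAt (hV.mem_nhds hJV)).differentiableAt (by simp)) differentiableAt_fst
    have h3 : DifferentiableAt ℝ (fun v : (Fin m → ℝ) × (Sym2 (Fin m) → ℝ) => e.γ v.1)
        (r.inv1 J.1, r.inv2 J) :=
      DifferentiableAt.comp (g := e.γ) (r.inv1 J.1, r.inv2 J)
        (e.γ_smooth.contDiffAt.differentiableAt (by simp)) differentiableAt_fst
    have h4 := fun s => differentiableAt_pi.1 h1 s
    have h5 : ∀ s, DifferentiableAt ℝ (fun v : (Fin m → ℝ) × (Sym2 (Fin m) → ℝ) => v.2 s)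
        (r.inv1 J.1, r.inv2 J) := fun s => by fun_prop
    exact ((DifferentiableAt.fun_sum fun s _ => (h4 (e.σ s)).mul (h5 s)).add h2).add
      ((h4 _).mul h3)
  obtain ⟨f', hf', hfV⟩ := e.hasFDerivAt_inv hJ
  have hκ : HasFDerivAt (fun J' : J2 m => e.κ.eval J'.1) _ J :=
    HasFDerivAt.comp J (g := e.κ.eval)
      ((e.ok_κ J.1 hJ).contDiffAt.differentiableAt (by simp)).hasFDerivAt
      (hasFDerivAt_fst (𝕜 := ℝ) (p := J))
  have hGd : HasFDerivAt
      (fun J' : J2 m => e.normalForm a b (r.inv1 J'.1, r.inv2 J')) _ J :=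
    HasFDerivAt.comp J (g := e.normalForm a b) hG.hasFDerivAt hf'
  have h0 : f' (prolong2 (r.gen i) J) = 0 := by
    rw [hfV, e.fderiv_inv2_prolong2 hJ]
    exact Prod.ext (e.fderiv_inv1_prolong1 hJ i) rfl
  rw [hEe.fderiv_eq, (hκ.fun_mul hGd).fderiv, add_apply, smul_apply, smul_apply,
    ContinuousLinearMap.comp_apply, h0, hG0]
  simp

/-- The coefficients of the second derivatives are κ times the transpose of an invertible matrix
applied to a permutation of a, hence not all zero. -/
lemma isQuasiLinear (e : ExRow r) (h : IsCoeffs V a b) :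
    IsQuasiLinear {P | P.1 ∈ r.dom ∧ r.inv1 P ∈ V} (r.equation a b) := by
  obtain ⟨hV, ha, hb, h0⟩ := h
  have hav : ∀ P : J1 m, P.1 ∈ r.dom ∧ r.inv1 P ∈ V →
      ContDiffAt ℝ ∞ (fun P => a (r.inv1 P)) P ∧ ContDiffAt ℝ ∞ (fun P => b (r.inv1 P)) P :=
    fun P hP => ⟨ContDiffAt.comp P (g := a) (ha.contDiffAt (hV.mem_nhds hP.2))
      (e.contDiffAt_inv1 hP.1), ContDiffAt.comp P (g := b) (hb.contDiffAt (hV.mem_nhds hP.2))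
      (e.contDiffAt_inv1 hP.1)⟩
  have hw : ∀ (P : J1 m) (q : Sym2 (Fin m) → ℝ), P.1 ∈ r.dom →
      ContDiffAt ℝ ∞ (fun P => r.inv2 (P, q)) P := fun P q hP =>
    ContDiffAt.comp P (g := r.inv2) (f := fun P : J1 m => ((P, q) : J2 m))
      (e.contDiffAt_inv2 (J := (P, q)) hP) (contDiffAt_id.prodMk contDiffAt_const)
  refine ⟨fun P t => e.κ.eval P * ∑ s, a (r.inv1 P) (e.σ s) *
      (r.inv2 (P, Pi.single t 1) s - r.inv2 (P, 0) s),
    fun P => e.κ.eval P * e.normalForm a b (r.inv1 P, r.inv2 (P, 0)), ?_, ?_, ?_, ?_⟩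
  · intro P hP
    refine (contDiffAt_pi.2 fun t => (e.ok_κ P hP.1).contDiffAt.mul
      (ContDiffAt.sum fun s _ => (contDiffAt_pi.1 (hav P hP).1 _).mul ?_)).contDiffWithinAt
    exact (contDiffAt_pi.1 (hw P _ hP.1) s).sub (contDiffAt_pi.1 (hw P _ hP.1) s)
  · intro P hP
    refine ((e.ok_κ P hP.1).contDiffAt.mul (((ContDiffAt.sum fun s _ =>
      (contDiffAt_pi.1 (hav P hP).1 _).mul (contDiffAt_pi.1 (hw P _ hP.1) s)).add
      (hav P hP).2).add ((contDiffAt_pi.1 (hav P hP).1 _).mul ?_))).contDiffWithinAt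
    exact ContDiffAt.comp P (g := e.γ) e.γ_smooth.contDiffAt (e.contDiffAt_inv1 hP.1)
  · intro P hP hA
    obtain ⟨L, hL, hLq⟩ := e.exists_affine P hP.1
    refine h0 _ hP.2 (funext fun s => ?_)
    have h1 : ∀ q, ∑ s, a (r.inv1 P) (e.σ s) * L q s = 0 := fun q => by
      have h2 : ∀ t, ∑ s, a (r.inv1 P) (e.σ s) * L (Pi.single t 1) s = 0 := fun t => by
        have h5 : ∀ s, r.inv2 (P, Pi.single t 1) s - r.inv2 (P, 0) s = L (Pi.single t 1) s :=
          fun s => by rw [hLq, Pi.add_apply, add_sub_cancel_right]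
        have := congrFun hA t
        simp only [h5, Pi.zero_apply] at this
        exact (mul_eq_zero.1 this).resolve_left (e.κ_ne P hP.1)
      have hq : q = ∑ t, q t • (Pi.single t 1 : Sym2 (Fin m) → ℝ) := by
        funext l; simp [Finset.sum_apply, Pi.single_apply]
      rw [hq, map_sum]
      simp only [map_smul, Finset.sum_apply, Pi.smul_apply, smul_eq_mul, Finset.mul_sum]
      rw [Finset.sum_comm]
      refine Finset.sum_eq_zero fun t _ => ?_
      rw [← mul_zero (q t), ← h2 t, Finset.mul_sum]
      exact Finset.sum_congr rfl fun s _ => by ring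
    obtain ⟨q, hq⟩ := LinearMap.injective_iff_surjective.1 hL (Pi.single (e.σ.symm s) 1)
    simpa [hq, Pi.single_apply] using h1 q
  · intro J hJ
    rw [e.equation_eq a b hJ.1]
    obtain ⟨L, hL, hLq⟩ := e.exists_affine J.1 hJ.1
    have hJ2 : r.inv2 J = L J.2 + r.inv2 (J.1, 0) := hLq J.2
    have hq : J.2 = ∑ t, J.2 t • (Pi.single t 1 : Sym2 (Fin m) → ℝ) := by
      funext l; simp [Finset.sum_apply, Pi.single_apply]
    have h3 : ∀ s, L J.2 s = ∑ t, J.2 t * L (Pi.single t 1) s := fun s => by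
      conv_lhs => rw [hq]
      simp [map_sum, Finset.sum_apply]
    have h4 : ∑ t, (e.κ.eval J.1 * ∑ s, a (r.inv1 J.1) (e.σ s) *
        (r.inv2 (J.1, Pi.single t 1) s - r.inv2 (J.1, 0) s)) * J.2 t =
        e.κ.eval J.1 * ∑ s, a (r.inv1 J.1) (e.σ s) * L J.2 s := by
      have h5 : ∀ t s, r.inv2 (J.1, Pi.single t 1) s - r.inv2 (J.1, 0) s =
          L (Pi.single t 1) s := fun t s => by rw [hLq, Pi.add_apply, add_sub_cancel_right]
      simp only [h5, h3, Finset.mul_sum, Finset.sum_mul]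
      rw [Finset.sum_comm]
      exact Finset.sum_congr rfl fun s _ => Finset.sum_congr rfl fun t _ => by ring
    rw [h4]
    simp only [normalForm, hJ2, Pi.add_apply, mul_add, Finset.sum_add_distrib]
    ring

end ExRow
end InvPDE
end

noncomputable section
namespace InvPDE

/-! ### Prolongation is linear over constants -/

section Linearity

variable {m : ℕ} {ι : Type} [Fintype ι] {c : ι → ℝ} {Y : ι → Pt m → Pt m}

lemma fderiv_sum_smul {z : Pt m} (hY : ∀ j, DifferentiableAt ℝ (Y j) z) :
    fderiv ℝ (fun z => ∑ j, c j • Y j z) z = ∑ j, c j • fderiv ℝ (Y j) z :=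
  (HasFDerivAt.fun_sum fun j _ => (hY j).hasFDerivAt.const_smul (c j)).fderiv

lemma totalD_sum_smul {P : J1 m} (hY : ∀ j, DifferentiableAt ℝ (Y j) P.1) (i : Fin m) :
    totalD (fun z => ∑ j, c j • Y j z) i P = ∑ j, c j • totalD (Y j) i P := by
  simp only [totalD_eq, fderiv_sum_smul hY, sum_apply, smul_apply]

lemma totalD2_sum_smul {J : J2 m} (hY : ∀ j, ContDiffAt ℝ ∞ (Y j) J.1.1) (i k : Fin m) :
    totalD2 (fun z => ∑ j, c j • Y j z) i k J = ∑ j, c j • totalD2 (Y j) i k J := by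
  have h1 : fderiv ℝ (fun z => ∑ j, c j • Y j z) =ᶠ[𝓝 J.1.1]
      fun z => ∑ j, c j • fderiv ℝ (Y j) z := by
    have : ∀ j, ∀ᶠ z in 𝓝 J.1.1, DifferentiableAt ℝ (Y j) z := fun j =>
      (((hY j).of_le two_le_infty).eventually (by simp)).mono fun z hz =>
        hz.differentiableAt (by simp)
    filter_upwards [eventually_all.2 this] with z hz using fderiv_sum_smul hz
  have h2 : ∀ j, DifferentiableAt ℝ (fderiv ℝ (Y j)) J.1.1 := fun j =>
    ((hY j).fderiv_right (m := ∞) (by simp)).differentiableAt (by simp)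
  have h3 : fderiv ℝ (fun z => ∑ j, c j • fderiv ℝ (Y j) z) J.1.1 =
      ∑ j, c j • fderiv ℝ (fderiv ℝ (Y j)) J.1.1 :=
    (HasFDerivAt.fun_sum fun j _ => (h2 j).hasFDerivAt.const_smul (c j)).fderiv
  simp only [totalD2_eq, h1.fderiv_eq, h3,
    fderiv_sum_smul fun j => (hY j).differentiableAt (by simp), sum_apply, smul_apply,
    Finset.smul_sum, ← Finset.sum_add_distrib, smul_add]
  exact Finset.sum_congr rfl fun j _ => by rw [smul_comm]

lemma prolong1_sum_smul {P : J1 m} (hY : ∀ j, DifferentiableAt ℝ (Y j) P.1) :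
    prolong1 (fun z => ∑ j, c j • Y j z) P = ∑ j, c j • prolong1 (Y j) P := by
  refine Prod.ext ?_ (funext fun i => ?_)
  · simp [prolong1, Prod.fst_sum]
  · simp only [prolong1_snd, totalD_sum_smul hY, map_sum, map_smul, Prod.snd_sum, Finset.sum_apply,
      Prod.smul_snd, Pi.smul_apply]

lemma prolongCoeff_sum_smul {J : J2 m} (hY : ∀ j, ContDiffAt ℝ ∞ (Y j) J.1.1) (i k : Fin m) :
    prolongCoeff (fun z => ∑ j, c j • Y j z) J i k = ∑ j, c j • prolongCoeff (Y j) J i k := by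
  have hd : ∀ j, DifferentiableAt ℝ (Y j) J.1.1 := fun j => (hY j).differentiableAt (by simp)
  have h : ∀ (q : Fin m → ℝ) (f : ι → Pt m), ∑ l, q l * (∑ j, c j • f j).1 l =
      ∑ j, c j * ∑ l, q l * (f j).1 l := fun q f => by
    simp only [Prod.fst_sum, Finset.sum_apply, Prod.smul_fst, Pi.smul_apply, smul_eq_mul,
      Finset.mul_sum]
    rw [Finset.sum_comm]
    exact Finset.sum_congr rfl fun _ _ => Finset.sum_congr rfl fun _ _ => by ring
  simp only [prolongCoeff_eq, totalD2_sum_smul hY, totalD_sum_smul hd, map_sum, map_smul, h,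
    smul_eq_mul, mul_sub, Finset.sum_sub_distrib]

/-- Needed because a local equivalence matches each X_i with a constant combination of generators,
not with a single generator. -/
lemma prolong2_sum_smul {J : J2 m} (hY : ∀ j, ContDiffAt ℝ ∞ (Y j) J.1.1) :
    prolong2 (fun z => ∑ j, c j • Y j z) J = ∑ j, c j • prolong2 (Y j) J := by
  refine Prod.ext ?_ (funext fun s => ?_)
  · have : ∀ X : Pt m → Pt m, (prolong2 X J).1 = prolong1 X J.1 := fun _ => rfl
    simp only [this, prolong1_sum_smul fun j => (hY j).differentiableAt (by simp), Prod.fst_sum,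
      Prod.smul_fst]
  · induction s using Sym2.ind with
    | _ i k =>
      simp only [Prod.snd_sum, Prod.smul_snd, Finset.sum_apply, Pi.smul_apply]
      simp only [prolong2, Sym2.lift_mk, prolongCoeff_sum_smul hY, smul_eq_mul,
        ← Finset.sum_add_distrib, Finset.sum_div]
      exact Finset.sum_congr rfl fun j _ => by ring

end Linearity

lemma bijective_fderiv_of_mem_source {m : ℕ} {ψ : OpenPartialHomeomorph (Pt m) (Pt m)}
    (hψ : ContDiffOn ℝ ∞ ψ ψ.source)
    (hψ' : ContDiffOn ℝ ∞ ψ.symm ψ.target) {z : Pt m} (hz : z ∈ ψ.source) :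
    Function.Bijective (fderiv ℝ ψ z) := by
  have h1 := ((hψ.contDiffAt (ψ.open_source.mem_nhds hz)).differentiableAt (by simp)).hasFDerivAt
  have h2 := ((hψ'.contDiffAt (ψ.open_target.mem_nhds (ψ.map_source hz))).differentiableAt
    (by simp)).hasFDerivAt
  have h3 : HasFDerivAt (ψ.symm ∘ ψ) ((fderiv ℝ ψ.symm (ψ z)).comp (fderiv ℝ ψ z)) z :=
    h2.comp z h1
  have h4 : (ψ.symm ∘ ψ) =ᶠ[𝓝 z] id := by
    filter_upwards [ψ.open_source.mem_nhds hz] with y hy using ψ.left_inv hy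
  have h5 := h3.unique ((hasFDerivAt_id z).congr_of_eventuallyEq h4)
  have hinj : Function.Injective (fderiv ℝ ψ z).toLinearMap := fun v w hvw => by
    have hv := DFunLike.congr_fun h5 v
    have hw := DFunLike.congr_fun h5 w
    have hvw' : fderiv ℝ ψ z v = fderiv ℝ ψ z w := hvw
    simp only [ContinuousLinearMap.comp_apply, ContinuousLinearMap.id_apply] at hv hw
    rw [← hv, ← hw, hvw']
  exact ⟨hinj, LinearMap.injective_iff_surjective.1 hinj⟩

/-- A local equivalence takes graphs to graphs at almost all jets. -/
lemma subset_closure_jetTransforms {m : ℕ} {r : Row m} {Z : Set (Pt m)}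
    {X : Fin (m + 1) → Pt m → Pt m} {ψ : OpenPartialHomeomorph (Pt m) (Pt m)}
    (hψ : IsLocalEquiv Z X r ψ) {D : Set (J1 m)} (hD : IsOpen D)
    (hDs : ∀ P ∈ D, P.1 ∈ ψ.source) :
    D ⊆ closure {P ∈ D | ∃ J J' : J2 m, J.1 = P ∧ JetTransforms ψ J J'} := by
  obtain ⟨-, -, hψC, hψC', -⟩ := hψ
  rintro ⟨z, p⟩ hP
  rw [mem_closure_iff_nhds]
  intro N hN
  obtain ⟨p', ⟨hp1, hp2⟩, hs⟩ := exists_slope_isInvertible_near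
    (bijective_fderiv_of_mem_source hψC hψC' (hDs _ hP)) p (inter_mem hN (hD.mem_nhds hP))
  exact ⟨(z, p'), hp1, hp2, exists_jetTransforms ψ.open_source hψC (hDs _ hp2) hs⟩

/-! ### From normal forms to the tabulated equations -/

section Rows

variable {m : ℕ} [NeZero m] {r : Row m}

/-- An invariant equation is one of the tabulated equations, in terms of any adapted
invariants. -/
lemma ExRow.exists_normalForm (e : ExRow r) {X : Fin (m + 1) → Pt m → Pt m} {P₀ : J1 m}
    {w1 : J1 m → Fin m → ℝ} {w2 : J2 m → Sym2 (Fin m) → ℝ} (h : AdaptedInvariants X P₀ w1 w2)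
    {D : Set (J1 m)} {E : J2 m → ℝ} (hD : IsOpen D) (hP₀ : P₀ ∈ D) (hE : IsQuasiLinear D E)
    (hEX : IsInvariantEq X D E) :
    ∃ (a : (Fin m → ℝ) → Sym2 (Fin m) → ℝ) (b : (Fin m → ℝ) → ℝ), IsCoeffs univ a b ∧
      (a (w1 P₀) s(0, 0) ≠ 0 → ∀ v, a v s(0, 0) = 1) ∧
      ∀ᶠ P in 𝓝 P₀, ∀ q, E (P, q) = 0 ↔ e.normalForm a b (w1 P, w2 (P, q)) = 0 := by
  -- The index of the invariant that the table pairs with a₀. Afterwards the permutation is undone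
  -- and the γ term is absorbed into b.
  obtain ⟨a, b, ha, hb, ha0, ha1, hE'⟩ := h.exists_normal_form hD hP₀ hE hEX (e.σ.symm s(0, 0))
  refine ⟨fun v s => a v (e.σ.symm s), fun v => b v - a v (e.σ.symm s(0, 0)) * e.γ v,
    ⟨isOpen_univ, ?_, ?_, ?_⟩, ha1, ?_⟩
  · exact (contDiff_pi.2 fun s => contDiff_pi.1 ha _).contDiffOn
  · exact (hb.sub ((contDiff_pi.1 ha _).mul e.γ_smooth)).contDiffOn
  · intro v _ h0
    refine ha0 v (funext fun s => ?_)
    simpa using congrFun h0 (e.σ s)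
  · filter_upwards [hE'] with P hP q
    rw [hP]
    simp only [ExRow.normalForm, Equiv.symm_apply_apply]
    ring_nf

lemma ExRow.exists_equation (e : ExRow r) {D : Set (J1 m)} {E : J2 m → ℝ} (hD : IsOpen D)
    (hDr : ∀ P ∈ D, P.1 ∈ r.dom) (hE : IsQuasiLinear D E) (hEX : IsInvariantEq r.gen D E)
    {P₀ : J1 m} (hP₀ : P₀ ∈ D) :
    ∃ V a b, IsCoeffs V a b ∧ r.inv1 P₀ ∈ V ∧
      (a (r.inv1 P₀) s(0, 0) ≠ 0 → ∀ v ∈ V, a v s(0, 0) = 1) ∧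
      ∀ᶠ P in 𝓝 P₀, r.inv1 P ∈ V ∧
        ∀ J : J2 m, J.1 = P → (E J = 0 ↔ r.equation a b J = 0) := by
  obtain ⟨a, b, hab, ha1, h⟩ := e.exists_normalForm (e.adaptedInvariants (hDr P₀ hP₀)) hD hP₀ hE hEX
  refine ⟨univ, a, b, hab, mem_univ _, fun h0 v _ => ha1 h0 v, ?_⟩
  filter_upwards [h, hD.mem_nhds hP₀] with P hP hPD
  refine ⟨mem_univ _, ?_⟩
  rintro ⟨P', q⟩ rfl
  rw [hP q, e.equation_eq a b (J := (P', q)) (hDr _ hPD), mul_eq_zero]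
  simp [e.κ_ne P' (hDr _ hPD)]

variable {Z : Set (Pt m)} {X : Fin (m + 1) → Pt m → Pt m}
  {ψ : OpenPartialHomeomorph (Pt m) (Pt m)}

/-- The invariants of a row pulled back along a local equivalence. -/
lemma ExRow.adaptedInvariants_comp (e : ExRow r) (hX : IsFrame Z X)
    (hψ : IsLocalEquiv Z X r ψ) {P : J1 m} (hP : P.1 ∈ ψ.source)
    (hs : (slope ψ P).IsInvertible) :
    AdaptedInvariants X P (fun P => r.inv1 (trans1 ψ P)) (fun J => r.inv2 (trans2 ψ J)) := by
  obtain ⟨hsZ, htr, hψC, hψC', A, -, hA⟩ := hψ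
  have hU := ψ.open_source
  have hn := eventually_slope_isInvertible hU hψC hP hs
  have hdom : ∀ P : J1 m, P.1 ∈ ψ.source → (trans1 ψ P).1 ∈ r.dom := fun P hP =>
    htr (ψ.map_source hP)
  have hmaps : MapsTo ψ ψ.source r.dom := fun z hz => htr (ψ.map_source hz)
  -- The field ψ-related to X_i. Its prolongations annihilate the invariants of the row by
  -- linearity, and the jet action carries this back to X_i.
  set X' : Fin (m + 1) → Pt m → Pt m := fun i z => ∑ j, A i j • r.gen j z with hX'
  have hX'C : ∀ i, ContDiffOn ℝ ∞ (X' i) r.dom := fun i =>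
    ContDiffOn.sum fun j _ => (e.isFrame.1 j).const_smul (A i j)
  have hgen : ∀ z ∈ r.dom, ∀ j, ContDiffAt ℝ ∞ (r.gen j) z := fun z hz j => e.contDiffAt_gen hz j
  have hd1 : ∀ P : J1 m, P.1 ∈ ψ.source → (slope ψ P).IsInvertible → ∀ V,
      fderiv ℝ (fun P => r.inv1 (trans1 ψ P)) P V =
        fderiv ℝ r.inv1 (trans1 ψ P) (fderiv ℝ (trans1 ψ) P V) := fun P hP hs V => by
    have h : HasFDerivAt (fun P => r.inv1 (trans1 ψ P)) _ P :=
      HasFDerivAt.comp P (g := r.inv1) (f := trans1 ψ)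
        ((e.contDiffAt_inv1 (hdom P hP)).differentiableAt (by simp)).hasFDerivAt
        ((contDiffAt_trans1 hU hψC hP hs).differentiableAt (by simp)).hasFDerivAt
    rw [h.fderiv, ContinuousLinearMap.comp_apply]
  have hd2 : ∀ J : J2 m, J.1.1 ∈ ψ.source → (slope ψ J.1).IsInvertible → ∀ V,
      fderiv ℝ (fun J => r.inv2 (trans2 ψ J)) J V =
        fderiv ℝ r.inv2 (trans2 ψ J) (fderiv ℝ (trans2 ψ) J V) := fun J hJ hs V => by
    have h : HasFDerivAt (fun J => r.inv2 (trans2 ψ J)) _ J :=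
      HasFDerivAt.comp J (g := r.inv2) (f := trans2 ψ)
        ((e.contDiffAt_inv2 (hdom J.1 hJ)).differentiableAt (by simp)).hasFDerivAt
        ((contDiffAt_trans2 hU hψC hJ hs).differentiableAt (by simp)).hasFDerivAt
    rw [h.fderiv, ContinuousLinearMap.comp_apply]
  have hsurj : ∀ P : J1 m, P.1 ∈ ψ.source → Function.Surjective (fderiv ℝ ψ P.1) :=
    fun P hP => (bijective_fderiv_of_mem_source hψC hψC' hP).2
  have hXs : ∀ i, ContDiffOn ℝ ∞ (X i) ψ.source := fun i => (hX.1 i).mono hsZ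
  exact
  { indep := hn.mono fun P' h => hX.2 _ (hsZ h.1)
    smooth1 := hn.mono fun P' h => ContDiffAt.comp P' (g := r.inv1)
      (e.contDiffAt_inv1 (hdom _ h.1)) (contDiffAt_trans1 hU hψC h.1 h.2)
    vert1 := fun p hp => by
      have h1 : (fderiv ℝ (trans1 ψ) P (0, p)).1 = 0 := by
        rw [fderiv_trans1_fst hU hψC hP hs, map_zero]
      refine fderiv_trans1_vert hU hψC hP hs (hsurj P hP) ?_
      refine e.fderiv_inv1_vert (hdom P hP) _ ?_
      rw [hd1 P hP hs] at hp
      have h2 : fderiv ℝ (trans1 ψ) P (0, p) = (0, (fderiv ℝ (trans1 ψ) P (0, p)).2) :=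
        Prod.ext h1 rfl
      rwa [h2] at hp
    inv1 := hn.mono fun P' h i => by
      rw [hd1 P' h.1 h.2, fderiv_trans1_prolong1 hU hψC (hXs i) e.isOpen_dom (hX'C i) hmaps
        (fun z hz => hA z hz i) h.1 h.2, hX',
        prolong1_sum_smul fun j => (hgen _ (hdom _ h.1) j).differentiableAt (by simp), map_sum]
      exact Finset.sum_eq_zero fun j _ => by
        rw [map_smul, e.fderiv_inv1_prolong1 (hdom _ h.1), smul_zero]
    smooth2 := hn.mono fun P' h q => ContDiffAt.comp (P', q) (g := r.inv2)
      (e.contDiffAt_inv2 (hdom _ h.1)) (contDiffAt_trans2 hU hψC (J := (P', q)) h.1 h.2)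
    affine2 := hn.mono fun P' h => by
      obtain ⟨L, d, hL, hLd⟩ := trans2_affine hU hψC h.1 h.2 (hsurj P' h.1)
      obtain ⟨L', hL', hLd'⟩ := e.exists_affine (trans1 ψ P') (hdom _ h.1)
      refine ⟨L'.comp L, L' d + r.inv2 (trans1 ψ P', 0), hL'.comp hL, fun q => ?_⟩
      have : trans2 ψ (P', q) = (trans1 ψ P', L q + d) := Prod.ext rfl (hLd q)
      rw [this, hLd', map_add, add_assoc]
      rfl
    inv2 := hn.mono fun P' h q i => by
      have hd := hdom _ h.1
      rw [hd2 (P', q) h.1 h.2, fderiv_trans2_prolong2 hU hψC (hXs i) e.isOpen_dom (hX'C i) hmaps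
        (fun z hz => hA z hz i) (J := (P', q)) h.1 h.2, hX',
        prolong2_sum_smul (hgen _ hd), map_sum]
      exact Finset.sum_eq_zero fun j _ => by
        rw [map_smul, e.fderiv_inv2_prolong2 hd, smul_zero] }

/-- A local equivalence takes invariant equations to tabulated equations. -/
lemma ExRow.exists_transformed_equation (e : ExRow r) (hX : IsFrame Z X)
    (hψ : IsLocalEquiv Z X r ψ) {D : Set (J1 m)} {E : J2 m → ℝ} (hD : IsOpen D)
    (hDs : ∀ P ∈ D, P.1 ∈ ψ.source) (hE : IsQuasiLinear D E) (hEX : IsInvariantEq X D E)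
    {J₀ J₀' : J2 m} (hJ₀ : J₀.1 ∈ D) (hJJ : JetTransforms ψ J₀ J₀') :
    ∃ V a b, IsCoeffs V a b ∧ r.inv1 J₀'.1 ∈ V ∧
      (a (r.inv1 J₀'.1) s(0, 0) ≠ 0 → ∀ v ∈ V, a v s(0, 0) = 1) ∧
      ∀ᶠ P in 𝓝 J₀.1, ∀ J J' : J2 m, J.1 = P → JetTransforms ψ J J' →
        r.inv1 J'.1 ∈ V ∧ (E J = 0 ↔ r.equation a b J' = 0) := by
  have hψC := hψ.2.2.1
  have hU := ψ.open_source
  -- Transforms defined through graphs are exactly given by `trans2`, so the pulled-back invariants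
  -- at J are the invariants of the row at J'.
  have key : ∀ J J' : J2 m, J.1.1 ∈ ψ.source → JetTransforms ψ J J' →
      (slope ψ J.1).IsInvertible ∧ J' = trans2 ψ J := fun J J' hJ h => by
    have hrel := jetRel_of_jetTransforms hU hψC hJ h
    have hs := slope_isInvertible_of_first (P' := J'.1)
      (bijective_fderiv_of_mem_source hψC hψ.2.2.2.1 hJ).1 hrel.first
    exact ⟨hs, hrel.eq_trans2 hU hψC hJ hs⟩
  have hJs := hDs _ hJ₀
  obtain ⟨hs, rfl⟩ := key J₀ J₀' hJs hJJ
  obtain ⟨a, b, hab, ha1, h⟩ := e.exists_normalForm (e.adaptedInvariants_comp hX hψ hJs hs)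
    hD hJ₀ hE hEX
  refine ⟨univ, a, b, hab, mem_univ _, fun h0 v _ => ha1 h0 v, ?_⟩
  filter_upwards [h, hD.mem_nhds hJ₀] with P hP hPD
  rintro ⟨P', q⟩ J' rfl hJ'
  have hPs : P'.1 ∈ ψ.source := hDs _ hPD
  obtain ⟨-, rfl⟩ := key (P', q) J' hPs hJ'
  have hd : (trans2 ψ (P', q)).1.1 ∈ r.dom := hψ.2.1 (ψ.map_source hPs)
  refine ⟨mem_univ _, ?_⟩
  rw [hP q, e.equation_eq a b hd, mul_eq_zero]
  simp only [e.κ_ne _ hd, false_or]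
  rfl

end Rows
end InvPDE
end

noncomputable section
namespace InvPDE

/-! ### Real Lie algebras of dimension two and three -/

section LieAlgebras

variable {V : Type*} [AddCommGroup V] [Module ℝ V]

/-- A bilinear Lie bracket. -/
structure IsLieBracket (B : V →ₗ[ℝ] V →ₗ[ℝ] V) : Prop where
  alt : ∀ x, B x x = 0
  leibniz : ∀ x y z, B x (B y z) = B (B x y) z + B y (B x z)

/-- The bracket has the structure constants of the row `r` in some basis. -/
def Realizes {m : ℕ} (B : V →ₗ[ℝ] V →ₗ[ℝ] V) (r : Row m) : Prop :=
  ∃ e : Module.Basis (Fin (m + 1)) ℝ V, ∀ i j, B (e i) (e j) = ∑ k, r.structConst i j k • e k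

/-- Linear independence of a triple of vectors. -/
def Indep3 (a b c : V) : Prop :=
  ∀ s t u : ℝ, s • a + t • b + u • c = 0 → s = 0 ∧ t = 0 ∧ u = 0

variable {B : V →ₗ[ℝ] V →ₗ[ℝ] V} {a b c : V}

lemma IsLieBracket.swap (h : IsLieBracket B) (x y : V) : B y x = -B x y := by
  have h1 := h.alt (x + y)
  simp only [map_add, LinearMap.add_apply, h.alt, zero_add, add_zero] at h1
  exact eq_neg_of_add_eq_zero_right (by rw [← h1, add_comm])

lemma Indep3.linearIndependent (h : Indep3 a b c) : LinearIndependent ℝ ![a, b, c] := by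
  rw [Fintype.linearIndependent_iff]
  intro g hg
  simp only [Fin.sum_univ_three, Matrix.cons_val_zero, Matrix.cons_val_one, Matrix.cons_val] at hg
  obtain ⟨h0, h1, h2⟩ := h _ _ _ hg
  intro i
  fin_cases i
  · exact h0
  · exact h1
  · exact h2

lemma Indep3.rotate (h : Indep3 a b c) : Indep3 b c a := fun s t u hs => by
  obtain ⟨h1, h2, h3⟩ := h u s t (by rw [← hs]; abel)
  exact ⟨h2, h3, h1⟩

/-- The basis given by an independent triple in dimension three. -/
def Indep3.basis (h : Indep3 a b c) (hV : Module.finrank ℝ V = 3) : Module.Basis (Fin 3) ℝ V :=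
  basisOfLinearIndependentOfCardEqFinrank h.linearIndependent (by simp [hV])

lemma Indep3.basis_apply (h : Indep3 a b c) (hV : Module.finrank ℝ V = 3) :
    (h.basis hV : Fin 3 → V) = ![a, b, c] :=
  coe_basisOfLinearIndependentOfCardEqFinrank _ _

lemma Indep3.exists_coeffs (h : Indep3 a b c) (hV : Module.finrank ℝ V = 3) (v : V) :
    ∃ s t u : ℝ, v = s • a + t • b + u • c := by
  have := ((h.basis hV).sum_repr v).symm
  rw [Fin.sum_univ_three, h.basis_apply] at this
  exact ⟨_, _, _, this⟩

lemma Indep3.trace_eq (h : Indep3 a b c) (hV : Module.finrank ℝ V = 3) {f : V →ₗ[ℝ] V}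
    {a₁ a₂ a₃ b₁ b₂ b₃ c₁ c₂ c₃ : ℝ} (ha : f a = a₁ • a + a₂ • b + a₃ • c)
    (hb : f b = b₁ • a + b₂ • b + b₃ • c) (hc : f c = c₁ • a + c₂ • b + c₃ • c) :
    LinearMap.trace ℝ V f = a₁ + b₂ + c₃ := by
  have key : ∀ s t u : ℝ, ∀ i, (h.basis hV).repr (s • a + t • b + u • c) i = ![s, t, u] i := by
    intro s t u i
    have e0 := (h.basis hV).repr_self 0
    have e1 := (h.basis hV).repr_self 1
    have e2 := (h.basis hV).repr_self 2
    rw [h.basis_apply] at e0 e1 e2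
    simp only [Matrix.cons_val_zero, Matrix.cons_val_one, Matrix.cons_val] at e0 e1 e2
    simp only [map_add, map_smul, e0, e1, e2]
    fin_cases i <;> simp
  rw [LinearMap.trace_eq_matrix_trace ℝ (h.basis hV), Matrix.trace, Fin.sum_univ_three]
  simp only [Matrix.diag_apply, LinearMap.toMatrix_apply, h.basis_apply, Matrix.cons_val_zero,
    Matrix.cons_val_one, Matrix.cons_val, ha, hb, hc, key]

lemma realizes_of_indep3 (hB : IsLieBracket B) (hV : Module.finrank ℝ V = 3) {r : Row 2}
    {c₁₂ c₁₃ c₂₃ : Fin 3 → ℝ} (hr : r.structConst = bracket3 c₁₂ c₁₃ c₂₃) (h : Indep3 a b c)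
    (h12 : B a b = c₁₂ 0 • a + c₁₂ 1 • b + c₁₂ 2 • c)
    (h13 : B a c = c₁₃ 0 • a + c₁₃ 1 • b + c₁₃ 2 • c)
    (h23 : B b c = c₂₃ 0 • a + c₂₃ 1 • b + c₂₃ 2 • c) : Realizes B r := by
  refine ⟨h.basis hV, fun i j => ?_⟩
  rw [Fin.sum_univ_three, hr, h.basis_apply]
  fin_cases i <;> fin_cases j <;>
    simp [bracket3, hB.alt, hB.swap a b, hB.swap a c, hB.swap b c, h12, h13, h23] <;> abel

variable {v w x y z : V}

/-- On the ideal spanned by v and w, bracketing with z has eigenvectors w - l v and w - k v, with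
eigenvalues k and l. Scaling z by the dominant eigenvalue makes them 1 and l/k, which accounts for
the range of the parameter. -/
lemma exists_realizes_of_eigenvalues (hB : IsLieBracket B) (hV : Module.finrank ℝ V = 3)
    (h : Indep3 v w z) {k l : ℝ} (hkl : k ≠ l) (hlk : |l| ≤ |k|) (h12 : B v w = 0)
    (h13 : B v z = w) (h23 : B w z = (k + l) • w - (k * l) • v) :
    ∃ r : Row 2, Realizes B r := by
  have hk : k ≠ 0 := by
    rintro rfl
    rw [abs_zero] at hlk
    exact hkl (abs_eq_zero.1 (le_antisymm hlk (abs_nonneg l))).symm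
  have hwv : B w v = 0 := by rw [hB.swap v w, h12, neg_zero]
  have e12 : B (w - l • v) (w - k • v) = 0 := by
    simp [hB.alt, h12, hwv]
  have e13 : B (w - l • v) (k⁻¹ • z) = w - l • v := by
    simp only [map_sub, map_smul, LinearMap.sub_apply, LinearMap.smul_apply, h13, h23]
    match_scalars <;> field_simp; ring
  have e23 : B (w - k • v) (k⁻¹ • z) = (l / k) • (w - k • v) := by
    simp only [map_sub, map_smul, LinearMap.sub_apply, LinearMap.smul_apply, h13, h23]
    match_scalars <;> field_simp; ring
  have hi : Indep3 (w - l • v) (w - k • v) (k⁻¹ • z) := fun s t u hs => by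
    obtain ⟨h1, h2, h3⟩ := h (-(s * l) - t * k) (s + t) (u * k⁻¹) (by rw [← hs]; module)
    have h4 : t * (l - k) = 0 := by linear_combination l * h2 + h1
    have ht : t = 0 := (mul_eq_zero.1 h4).resolve_right (sub_ne_zero.2 hkl.symm)
    refine ⟨by linarith, ht, (mul_eq_zero.1 h3).resolve_right (inv_ne_zero hk)⟩
  by_cases hl : l = 0
  · subst hl
    -- With l = 0 the vector w - k v is central and splits off.
    refine ⟨.g1g2, realizes_of_indep3 hB hV rfl (a := w - (0 : ℝ) • v) (b := k⁻¹ • z)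
      (c := w - k • v) (fun s t u hs => ?_) ?_ ?_ ?_⟩
    · obtain ⟨h1, h2, h3⟩ := hi s u t (by rw [← hs]; abel)
      exact ⟨h1, h3, h2⟩
    · rw [e13]; simp
    · rw [e12]; simp
    · rw [hB.swap, e23]; simp
  · have hh : |l / k| ≤ 1 ∧ l / k ≠ 0 ∧ l / k ≠ 1 := by
      refine ⟨?_, div_ne_zero hl hk, fun h1 => hkl ?_⟩
      · rw [abs_div]; exact div_le_one_of_le₀ hlk (abs_nonneg k)
      · rw [div_eq_one_iff_eq hk] at h1; exact h1.symm
    refine ⟨.g34 (l / k) hh, realizes_of_indep3 hB hV rfl hi ?_ ?_ ?_⟩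
    · rw [e12]; simp
    · rw [e13]; simp
    · rw [e23]; simp

/-- Semidirect products by an endomorphism with a cyclic vector. -/
lemma exists_realizes_of_cyclic (hB : IsLieBracket B) (hV : Module.finrank ℝ V = 3)
    (h : Indep3 v w z) {t d : ℝ} (h12 : B v w = 0) (h13 : B v z = w)
    (h23 : B w z = t • w - d • v) : ∃ r : Row 2, Realizes B r := by
  have hwv : B w v = 0 := by rw [hB.swap v w, h12, neg_zero]
  rcases lt_trichotomy (t ^ 2 - 4 * d) 0 with hd | hd | hd
  · -- complex eigenvalues
    -- The eigenvalues are t/2 ± iq. The sign of q is free, and is chosen to make the parameter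
    -- t/(2q) non-negative.
    obtain ⟨q, hq0, hq, hqt⟩ : ∃ q : ℝ, q ≠ 0 ∧ 4 * q ^ 2 = 4 * d - t ^ 2 ∧ 0 ≤ t / (2 * q) := by
      have h1 : 0 < 4 * d - t ^ 2 := by linarith
      have h2 := Real.sq_sqrt h1.le
      have h3 := Real.sqrt_pos.2 h1
      rcases le_total 0 t with ht | ht
      · exact ⟨√(4 * d - t ^ 2) / 2, by positivity, by linarith, by positivity⟩
      · refine ⟨-(√(4 * d - t ^ 2) / 2), by simpa using h3.ne', by linarith, ?_⟩
        exact div_nonneg_of_nonpos ht (by linarith)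
    refine ⟨.g35 (t / (2 * q)) hqt, realizes_of_indep3 hB hV rfl
      (a := q⁻¹ • w - (t / (2 * q)) • v) (b := v) (c := q⁻¹ • z) (fun s t' u hs => ?_) ?_ ?_ ?_⟩
    · obtain ⟨h1, h2, h3⟩ := h (t' - s * (t / (2 * q))) (s * q⁻¹) (u * q⁻¹) (by
        rw [← hs]; module)
      have hs0 := (mul_eq_zero.1 h2).resolve_right (inv_ne_zero hq0)
      subst hs0
      exact ⟨rfl, by linarith, (mul_eq_zero.1 h3).resolve_right (inv_ne_zero hq0)⟩
    · simp [hwv, hB.alt]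
    · have hd' : d = q ^ 2 + t ^ 2 / 4 := by linarith
      simp only [map_sub, map_smul, LinearMap.sub_apply, LinearMap.smul_apply, h13, h23, hd',
        Matrix.cons_val_zero, Matrix.cons_val_one, Matrix.cons_val]
      match_scalars <;> field_simp <;> ring
    · simp only [map_smul, h13, Matrix.cons_val_zero, Matrix.cons_val_one, Matrix.cons_val]
      module
  · -- a double eigenvalue
    obtain ⟨k, rfl⟩ : ∃ k, t = 2 * k := ⟨t / 2, by ring⟩
    have hd' : d = k ^ 2 := by linarith
    subst hd'
    by_cases hk : k = 0
    · subst hk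
      refine ⟨.g31, realizes_of_indep3 hB hV rfl (a := w) (b := v) (c := z)
        (fun s t u hs => ?_) ?_ ?_ ?_⟩
      · obtain ⟨h1, h2, h3⟩ := h t s u (by rw [← hs]; abel)
        exact ⟨h2, h1, h3⟩
      · simp [hwv]
      · simp [h23]
      · simp [h13]
    -- A single Jordan block: k⁻¹w - v spans the eigenline, and v is the generalized eigenvector.
    · refine ⟨.g32, realizes_of_indep3 hB hV rfl (a := k⁻¹ • w - v) (b := v) (c := k⁻¹ • z)
        (fun s t u hs => ?_) ?_ ?_ ?_⟩
      · obtain ⟨h1, h2, h3⟩ := h (t - s) (s * k⁻¹) (u * k⁻¹) (by rw [← hs]; module)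
        have hs0 := (mul_eq_zero.1 h2).resolve_right (inv_ne_zero hk)
        exact ⟨hs0, by linarith, (mul_eq_zero.1 h3).resolve_right (inv_ne_zero hk)⟩
      · simp [hwv, hB.alt]
      · simp only [map_sub, map_smul, LinearMap.sub_apply, LinearMap.smul_apply, h13, h23,
          Matrix.cons_val_zero, Matrix.cons_val_one, Matrix.cons_val]
        match_scalars <;> field_simp <;> ring
      · simp only [map_smul, h13, Matrix.cons_val_zero, Matrix.cons_val_one, Matrix.cons_val]
        module
  · -- real eigenvalues
    have hs := Real.sq_sqrt hd.le
    have hs0 := Real.sqrt_pos.2 hd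
    set s := √(t ^ 2 - 4 * d)
    have h23' : ∀ k l, k + l = t → k * l = d → B w z = (k + l) • w - (k * l) • v :=
      fun k l hk hl => by rw [h23, hk, hl]
    rcases le_total |(t - s) / 2| |(t + s) / 2| with h' | h'
    · exact exists_realizes_of_eigenvalues hB hV h (k := (t + s) / 2) (l := (t - s) / 2)
        (by intro h; linarith) h' h12 h13 (h23' _ _ (by ring) (by linear_combination -hs / 4))
    · exact exists_realizes_of_eigenvalues hB hV h (k := (t - s) / 2) (l := (t + s) / 2)
        (by intro h; linarith) h' h12 h13 (h23' _ _ (by ring) (by linear_combination -hs / 4))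

/-- Lie algebras with a two-dimensional abelian ideal. -/
lemma exists_realizes_of_abelian_ideal (hB : IsLieBracket B) (hV : Module.finrank ℝ V = 3)
    (h : Indep3 x y z) {p q k l : ℝ} (h12 : B x y = 0) (h13 : B x z = p • x + q • y)
    (h23 : B y z = k • x + l • y) : ∃ r : Row 2, Realizes B r := by
  have hyx : B y x = 0 := by rw [hB.swap x y, h12, neg_zero]
  -- A 2×2 matrix is either scalar or has a cyclic vector: x if q ≠ 0, y if q = 0 and k ≠ 0, and x +
  -- y if it is diagonal with distinct entries.
  by_cases hq : q = 0
  · by_cases hk : k = 0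
    · subst hq hk
      by_cases hpl : p = l
      · subst hpl
        by_cases hp : p = 0
        · subst hp
          exact ⟨.abelian3, realizes_of_indep3 hB hV rfl h (by simp [h12]) (by simp [h13])
            (by simp [h23])⟩
        · refine ⟨.g33, realizes_of_indep3 hB hV rfl (a := x) (b := y) (c := p⁻¹ • z)
            (fun s t u hs => ?_) (by simp [h12]) ?_ ?_⟩
          · obtain ⟨h1, h2, h3⟩ := h s t (u * p⁻¹) (by rw [← hs]; module)
            exact ⟨h1, h2, (mul_eq_zero.1 h3).resolve_right (inv_ne_zero hp)⟩
          · simp [h13, smul_smul, hp]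
          · simp [h23, smul_smul, hp]
      · refine exists_realizes_of_cyclic hB hV (v := x + y) (w := p • x + l • y) (z := z)
          (t := p + l) (d := p * l) (fun s t u hs => ?_) ?_ ?_ ?_
        · obtain ⟨h1, h2, h3⟩ := h (s + t * p) (s + t * l) u (by rw [← hs]; module)
          have h4 : t * (p - l) = 0 := by linear_combination h1 - h2
          have ht := (mul_eq_zero.1 h4).resolve_right (sub_ne_zero.2 hpl)
          subst ht
          exact ⟨by linarith, rfl, h3⟩
        · simp [h12, hyx, hB.alt]
        · simp [h13, h23]
        · simp only [map_add, map_smul, LinearMap.add_apply, LinearMap.smul_apply, h13, h23]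
          module
    · refine exists_realizes_of_cyclic hB hV (v := y) (w := k • x + l • y) (z := z)
        (t := p + l) (d := p * l - q * k) (fun s t u hs => ?_) ?_ h23 ?_
      · obtain ⟨h1, h2, h3⟩ := h (t * k) (s + t * l) u (by rw [← hs]; module)
        have ht := (mul_eq_zero.1 h1).resolve_right hk
        subst ht
        exact ⟨by linarith, rfl, h3⟩
      · simp [hyx, hB.alt]
      · simp only [map_add, map_smul, LinearMap.add_apply, LinearMap.smul_apply, h13, h23]
        module
  · refine exists_realizes_of_cyclic hB hV (v := x) (w := p • x + q • y) (z := z)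
      (t := p + l) (d := p * l - q * k) (fun s t u hs => ?_) ?_ h13 ?_
    · obtain ⟨h1, h2, h3⟩ := h (s + t * p) (t * q) u (by rw [← hs]; module)
      have ht := (mul_eq_zero.1 h2).resolve_right hq
      subst ht
      exact ⟨by linarith, rfl, h3⟩
    · simp [h12, hB.alt]
    · simp only [map_add, map_smul, LinearMap.add_apply, LinearMap.smul_apply, h13, h23]
      module

end LieAlgebras
end InvPDE
end

noncomputable section
namespace InvPDE

/-! ### Every real Lie algebra of dimension two or three belongs to a row -/

section Existence

open scoped Matrix

variable {V : Type*} [AddCommGroup V] [Module ℝ V] {B : V →ₗ[ℝ] V →ₗ[ℝ] V}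
  {a b c x y z : V}

/-- By the Jacobi identity the adjoint of a bracket is a commutator. -/
lemma IsLieBracket.trace_bracket (hB : IsLieBracket B) (x y : V) :
    LinearMap.trace ℝ V (B (B x y)) = 0 := by
  have h : B (B x y) = B x * B y - B y * B x := by
    ext v
    have := hB.leibniz x y v
    simp [this]
  rw [h, map_sub, LinearMap.trace_mul_comm, sub_self]

/-- Lie algebras which are not unimodular. -/
lemma exists_realizes_of_trace_ne_zero (hB : IsLieBracket B) (hV : Module.finrank ℝ V = 3)
    (h : Indep3 a b c) (hc : LinearMap.trace ℝ V (B c) ≠ 0) : ∃ r : Row 2, Realizes B r := by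
  set τ : V → ℝ := fun v => LinearMap.trace ℝ V (B v) with hτ
  have hτa : ∀ v w, τ (v + w) = τ v + τ w := fun v w => by simp [hτ]
  have hτs : ∀ (s : ℝ) v, τ (s • v) = s * τ v := fun s v => by simp [hτ]
  -- Projection along c to the kernel of τ. That kernel contains all brackets, so it is an ideal.
  have hker : ∀ v, τ (v + (-(τ v / τ c)) • c) = 0 := fun v => by
    rw [hτa, hτs]; field_simp [show τ c ≠ 0 from hc]; ring
  set x := a + (-(τ a / τ c)) • c
  set y := b + (-(τ b / τ c)) • c
  have hi : Indep3 x y c := fun s t u hs => by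
    obtain ⟨h1, h2, h3⟩ := h s t (u - s * (τ a / τ c) - t * (τ b / τ c)) (by rw [← hs]; module)
    subst h1 h2
    exact ⟨rfl, rfl, by linarith⟩
  have hx : τ x = 0 := hker a
  have hy : τ y = 0 := hker b
  have hbr : ∀ v w, ∃ p q : ℝ, B v w = p • x + q • y := fun v w => by
    obtain ⟨p, q, s, hs⟩ := hi.exists_coeffs hV (B v w)
    have h1 : τ (B v w) = 0 := hB.trace_bracket v w
    rw [hs, hτa, hτa, hτs, hτs, hτs, hx, hy, mul_zero, mul_zero, zero_add, zero_add] at h1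
    refine ⟨p, q, ?_⟩
    rw [hs, (mul_eq_zero.1 h1).resolve_right hc, zero_smul, add_zero]
  obtain ⟨p, q, h12⟩ := hbr x y
  obtain ⟨p₁, q₁, h13⟩ := hbr x c
  obtain ⟨p₂, q₂, h23⟩ := hbr y c
  -- The adjoints of x and y map into the kernel, and their traces are q and -p. Both traces vanish,
  -- so the ideal is abelian.
  have hq : q = 0 := by
    have := hi.trace_eq hV (f := B x) (a₁ := 0) (a₂ := 0) (a₃ := 0) (b₁ := p) (b₂ := q) (b₃ := 0)
      (c₁ := p₁) (c₂ := q₁) (c₃ := 0) (by simp [hB.alt]) (by rw [h12]; simp) (by rw [h13]; simp)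
    linarith [show LinearMap.trace ℝ V (B x) = 0 from hx]
  have hp : p = 0 := by
    have := hi.trace_eq hV (f := B y) (a₁ := -p) (a₂ := -q) (a₃ := 0) (b₁ := 0) (b₂ := 0) (b₃ := 0)
      (c₁ := p₂) (c₂ := q₂) (c₃ := 0) (by rw [hB.swap x y, h12]; module) (by simp [hB.alt])
      (by rw [h23]; simp)
    linarith [show LinearMap.trace ℝ V (B y) = 0 from hy]
  subst hp hq
  exact exists_realizes_of_abelian_ideal hB hV hi (by rw [h12]; simp) h13 h23

/-- A unimodular bracket on a three-dimensional space is diagonal in some basis. -/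
lemma exists_diagonal_of_trace_eq_zero (hB : IsLieBracket B) (hV : Module.finrank ℝ V = 3)
    (h : Indep3 a b c) (hτ : ∀ v, LinearMap.trace ℝ V (B v) = 0) :
    ∃ (x y z : V) (k l n : ℝ), Indep3 x y z ∧ B y z = k • x ∧ B z x = l • y ∧ B x y = n • z := by
  obtain ⟨m₀₀, m₀₁, m₀₂, h12⟩ := h.exists_coeffs hV (B b c)
  obtain ⟨m₁₀, m₁₁, m₁₂, h20⟩ := h.exists_coeffs hV (B c a)
  obtain ⟨m₂₀, m₂₁, m₂₂, h01⟩ := h.exists_coeffs hV (B a b)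
  -- The traces of the adjoints of the basis vectors are, up to sign, the off-diagonal differences
  -- of the matrix M of structure constants, so unimodularity means that M is symmetric.
  have s12 : m₂₁ = m₁₂ := by
    have := h.trace_eq hV (f := B a) (a₁ := 0) (a₂ := 0) (a₃ := 0) (b₁ := m₂₀) (b₂ := m₂₁)
      (b₃ := m₂₂) (c₁ := -m₁₀) (c₂ := -m₁₁) (c₃ := -m₁₂) (by simp [hB.alt]) h01
      (by rw [hB.swap c a, h20]; module)
    linarith [hτ a]
  have s02 : m₀₂ = m₂₀ := by
    have := h.trace_eq hV (f := B b) (a₁ := -m₂₀) (a₂ := -m₂₁) (a₃ := -m₂₂) (b₁ := 0) (b₂ := 0)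
      (b₃ := 0) (c₁ := m₀₀) (c₂ := m₀₁) (c₃ := m₀₂) (by rw [hB.swap a b, h01]; module)
      (by simp [hB.alt]) h12
    linarith [hτ b]
  have s01 : m₁₀ = m₀₁ := by
    have := h.trace_eq hV (f := B c) (a₁ := m₁₀) (a₂ := m₁₁) (a₃ := m₁₂) (b₁ := -m₀₀) (b₂ := -m₀₁)
      (b₃ := -m₀₂) (c₁ := 0) (c₂ := 0) (c₃ := 0) h20 (by rw [hB.swap b c, h12]; module)
      (by simp [hB.alt])
    linarith [hτ c]
  subst s12 s02 s01
  set M : Matrix (Fin 3) (Fin 3) ℝ := ![![m₀₀, m₁₀, m₀₂], ![m₁₀, m₁₁, m₂₁], ![m₀₂, m₂₁, m₂₂]]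
    with hM
  have hMs : M.IsHermitian := by
    ext i j
    fin_cases i <;> fin_cases j <;> rfl
  set F : (Fin 3 → ℝ) → V := fun v => v 0 • a + v 1 • b + v 2 • c with hF
  -- In dimension three every alternating bracket factors through the cross product in this way.
  have hFB : ∀ v w, B (F v) (F w) = F (M *ᵥ (v ⨯₃ w)) := by
    intro v w
    have h21 : B c b = -B b c := hB.swap b c
    have h02 : B a c = -B c a := hB.swap c a
    have h10 : B b a = -B a b := hB.swap a b
    simp only [hF, map_add, map_smul, LinearMap.add_apply, LinearMap.smul_apply, hB.alt, h21, h02,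
      h10, h12, h20, h01, hM, Matrix.mulVec, dotProduct, Fin.sum_univ_three, cross_apply,
      Matrix.cons_val_zero, Matrix.cons_val_one, Matrix.cons_val]
    module
  set E := hMs.eigenvectorBasis
  set u : Fin 3 → Fin 3 → ℝ := fun i => E i
  have hu : ∀ i, M *ᵥ u i = hMs.eigenvalues i • u i := fun i => hMs.mulVec_eigenvectorBasis i
  have hexp : ∀ v : Fin 3 → ℝ, v = ∑ i, (u i ⬝ᵥ v) • u i := fun v => by
    have h1 := E.sum_repr' (WithLp.toLp 2 v)
    have h2 := congrArg WithLp.ofLp h1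
    simp only [EuclideanSpace.inner_eq_star_dotProduct, WithLp.ofLp_sum, WithLp.ofLp_smul,
      star_trivial] at h2
    rw [← h2]
    refine Finset.sum_congr rfl fun i _ => ?_
    rw [h2, dotProduct_comm]
  have hcross : ∀ i j k : Fin 3, (∀ l, l = i ∨ l = j ∨ l = k) → i ≠ j → i ≠ k → j ≠ k →
      B (F (u j)) (F (u k)) = ((u i ⬝ᵥ (u j ⨯₃ u k)) * hMs.eigenvalues i) • F (u i) := by
    intro i j k hl hij hik hjk
    -- The cross product is orthogonal to both factors. The orientation of the eigenbasis is
    -- unknown, so the triple product is kept in the structure constant.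
    have h1 : u j ⨯₃ u k = (u i ⬝ᵥ (u j ⨯₃ u k)) • u i := by
      conv_lhs => rw [hexp (u j ⨯₃ u k)]
      refine Finset.sum_eq_single i (fun l _ hli => ?_) (by simp)
      rcases (hl l).resolve_left hli with rfl | rfl
      · rw [dot_self_cross, zero_smul]
      · rw [dot_cross_self, zero_smul]
    have hFs : ∀ (s : ℝ) v, F (s • v) = s • F v := fun s v => by
      simp only [hF, Pi.smul_apply, smul_eq_mul]; module
    rw [hFB, h1, Matrix.mulVec_smul, hu, hFs, hFs, smul_smul, ← h1]
  refine ⟨F (u 0), F (u 1), F (u 2), _, _, _, fun s t r hs => ?_,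
    hcross 0 1 2 (by decide) (by decide) (by decide) (by decide),
    hcross 1 2 0 (by decide) (by decide) (by decide) (by decide),
    hcross 2 0 1 (by decide) (by decide) (by decide) (by decide)⟩
  have h1 : s • u 0 + t • u 1 + r • u 2 = 0 := by
    obtain ⟨h0, h1, h2⟩ := h (s * u 0 0 + t * u 1 0 + r * u 2 0)
      (s * u 0 1 + t * u 1 1 + r * u 2 1) (s * u 0 2 + t * u 1 2 + r * u 2 2) (by
        rw [← hs]; simp only [hF]; module)
    funext i
    fin_cases i
    · exact h0
    · exact h1
    · exact h2
  have hE := Fintype.linearIndependent_iff.1 E.orthonormal.linearIndependent ![s, t, r] (by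
    rw [Fin.sum_univ_three]
    refine (WithLp.ofLp_injective 2) ?_
    simpa using h1)
  exact ⟨hE 0, hE 1, hE 2⟩

/-- Let p, q, r be the square roots of |k|, |l|, |n|. Dividing x, y, z by qr, rp, pq divides the
constants by p², q², r² and leaves only the signs. -/
lemma exists_unit_scaling (h : Indep3 x y z) {k l n : ℝ} (hk : k ≠ 0) (hl : l ≠ 0) (hn : n ≠ 0)
    (h12 : B y z = k • x) (h20 : B z x = l • y) (h01 : B x y = n • z) :
    ∃ x' y' z' : V, Indep3 x' y' z' ∧ B y' z' = (k / |k|) • x' ∧ B z' x' = (l / |l|) • y' ∧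
      B x' y' = (n / |n|) • z' := by
  have hs : ∀ s : ℝ, s ≠ 0 → ∃ r σ : ℝ, r ≠ 0 ∧ s = σ * r ^ 2 ∧ s / |s| = σ := fun s hs =>
    ⟨√|s|, s / |s|, by positivity, by rw [Real.sq_sqrt (abs_nonneg s)]; field_simp, rfl⟩
  obtain ⟨p, kσ, hp, hk1, hk2⟩ := hs k hk
  obtain ⟨q, lσ, hq, hl1, hl2⟩ := hs l hl
  obtain ⟨r, nσ, hr, hn1, hn2⟩ := hs n hn
  refine ⟨(q * r)⁻¹ • x, (r * p)⁻¹ • y, (p * q)⁻¹ • z, fun s t u hs => ?_, ?_, ?_, ?_⟩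
  · obtain ⟨h1, h2, h3⟩ := h (s * (q * r)⁻¹) (t * (r * p)⁻¹) (u * (p * q)⁻¹) (by
      rw [← hs]; module)
    exact ⟨(mul_eq_zero.1 h1).resolve_right (by positivity),
      (mul_eq_zero.1 h2).resolve_right (by positivity),
      (mul_eq_zero.1 h3).resolve_right (by positivity)⟩
  · rw [hk2]
    simp only [map_smul, LinearMap.smul_apply, h12, smul_smul]
    congr 1
    rw [hk1]
    field_simp
  · rw [hl2]
    simp only [map_smul, LinearMap.smul_apply, h20, smul_smul]
    congr 1
    rw [hl1]
    field_simp
  · rw [hn2]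
    simp only [map_smul, LinearMap.smul_apply, h01, smul_smul]
    congr 1
    rw [hn1]
    field_simp

lemma realizes_g37 (hB : IsLieBracket B) (hV : Module.finrank ℝ V = 3) (h : Indep3 x y z)
    (h12 : B y z = (1 : ℝ) • x) (h20 : B z x = (1 : ℝ) • y) (h01 : B x y = (1 : ℝ) • z) :
    Realizes B Row.g37 :=
  realizes_of_indep3 hB hV rfl h (by rw [h01]; simp) (by rw [hB.swap z x, h20]; simp)
    (by rw [h12]; simp)

/-- With one sign reversed, bracketing with y exchanges x and z symmetrically and has the
eigenvectors x + z and x - z. -/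
lemma realizes_g36 (hB : IsLieBracket B) (hV : Module.finrank ℝ V = 3) (h : Indep3 x y z)
    (h12 : B y z = (-1 : ℝ) • x) (h20 : B z x = (1 : ℝ) • y) (h01 : B x y = (1 : ℝ) • z) :
    Realizes B Row.g36 := by
  refine realizes_of_indep3 hB hV rfl (a := z + x) (b := y) (c := x - z) (fun s t u hs => ?_)
    ?_ ?_ ?_
  · obtain ⟨h1, h2, h3⟩ := h (s + u) t (s - u) (by rw [← hs]; module)
    exact ⟨by linarith, h2, by linarith⟩
  · simp only [map_add, LinearMap.add_apply, hB.swap y z, h12, h01]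
    simp; abel
  · simp only [map_add, map_sub, LinearMap.add_apply, hB.swap z x, hB.alt, h20]
    simp; module
  · simp only [map_sub, hB.swap x y, h12, h01]
    simp; abel

lemma div_abs_eq (k : ℝ) (hk : k ≠ 0) : k / |k| = 1 ∨ k / |k| = -1 := by
  rcases lt_or_gt_of_ne hk with h | h
  · right; rw [abs_of_neg h]; field_simp
  · left; rw [abs_of_pos h]; field_simp

/-- Unimodular Lie algebras. -/
lemma exists_realizes_of_trace_eq_zero (hB : IsLieBracket B) (hV : Module.finrank ℝ V = 3)
    (h : Indep3 a b c) (hτ : ∀ v, LinearMap.trace ℝ V (B v) = 0) : ∃ r : Row 2, Realizes B r := by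
  obtain ⟨x, y, z, k, l, n, hi, h12, h20, h01⟩ := exists_diagonal_of_trace_eq_zero hB hV h hτ
  -- If one diagonal constant vanishes, the two vectors whose bracket it governs span an abelian
  -- ideal; rotation moves that constant into the last place.
  have ideal : ∀ {x y z : V} {k l n : ℝ}, Indep3 x y z → B y z = k • x → B z x = l • y →
      B x y = n • z → n = 0 → ∃ r : Row 2, Realizes B r := by
    rintro x y z k l n hi h12 h20 h01 rfl
    exact exists_realizes_of_abelian_ideal hB hV hi (p := 0) (q := -l) (k := k) (l := 0)
      (by rw [h01, zero_smul]) (by rw [hB.swap z x, h20]; module) (by rw [h12]; module)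
  by_cases hn : n = 0
  · exact ideal hi h12 h20 h01 hn
  by_cases hk : k = 0
  · exact ideal hi.rotate h20 h01 h12 hk
  by_cases hl : l = 0
  · exact ideal hi.rotate.rotate h01 h12 h20 hl
  obtain ⟨x, y, z, hi, h12, h20, h01⟩ := exists_unit_scaling hi hk hl hn h12 h20 h01
  -- Negating the basis reverses all three signs, so up to rotation only equal signs and a single
  -- negative sign remain.
  have hneg : ∀ {x y z : V} {s : ℝ}, B y z = s • x → B (-y) (-z) = (-s) • (-x) := fun h => by
    simp [h]
  have hni : Indep3 (-x) (-y) (-z) := fun s t u hs => by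
    obtain ⟨h1, h2, h3⟩ := hi (-s) (-t) (-u) (by rw [← hs]; module)
    exact ⟨neg_eq_zero.1 h1, neg_eq_zero.1 h2, neg_eq_zero.1 h3⟩
  have n12 := hneg h12
  have n20 := hneg h20
  have n01 := hneg h01
  rcases div_abs_eq k hk with e1 | e1 <;> rcases div_abs_eq l hl with e2 | e2 <;>
    rcases div_abs_eq n hn with e3 | e3 <;> rw [e1] at h12 n12 <;> rw [e2] at h20 n20 <;>
    rw [e3] at h01 n01 <;> (try rw [neg_neg] at n12) <;>
    (try rw [neg_neg] at n20) <;> (try rw [neg_neg] at n01)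
  · exact ⟨_, realizes_g37 hB hV hi h12 h20 h01⟩
  · exact ⟨_, realizes_g36 hB hV hi.rotate.rotate h01 h12 h20⟩
  · exact ⟨_, realizes_g36 hB hV hi.rotate h20 h01 h12⟩
  · exact ⟨_, realizes_g36 hB hV hni n12 n20 n01⟩
  · exact ⟨_, realizes_g36 hB hV hi h12 h20 h01⟩
  · exact ⟨_, realizes_g36 hB hV hni.rotate n20 n01 n12⟩
  · exact ⟨_, realizes_g36 hB hV hni.rotate.rotate n01 n12 n20⟩
  · exact ⟨_, realizes_g37 hB hV hni n12 n20 n01⟩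

/-- Every three-dimensional real Lie algebra has the brackets of a row. -/
theorem exists_realizes_three (hB : IsLieBracket B) (hV : Module.finrank ℝ V = 3) :
    ∃ r : Row 2, Realizes B r := by
  have : FiniteDimensional ℝ V := Module.finite_of_finrank_pos (by omega)
  have f := Module.finBasisOfFinrankEq ℝ V hV
  have hi : Indep3 (f 0) (f 1) (f 2) := fun s t u hs => by
    have := Fintype.linearIndependent_iff.1 f.linearIndependent ![s, t, u] (by
      rw [Fin.sum_univ_three]; exact hs)
    exact ⟨this 0, this 1, this 2⟩
  by_cases h : ∀ v, LinearMap.trace ℝ V (B v) = 0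
  · exact exists_realizes_of_trace_eq_zero hB hV hi h
  -- The trace is non-zero on some basis vector, which is rotated into the last place.
  by_cases h2 : LinearMap.trace ℝ V (B (f 2)) = 0
  · by_cases h1 : LinearMap.trace ℝ V (B (f 1)) = 0
    · refine exists_realizes_of_trace_ne_zero hB hV hi.rotate fun h0 => h fun v => ?_
      obtain ⟨s, t, u, rfl⟩ := hi.exists_coeffs hV v
      simp [h0, h1, h2]
    · exact exists_realizes_of_trace_ne_zero hB hV hi.rotate.rotate h1
  · exact exists_realizes_of_trace_ne_zero hB hV hi h2

/-- Every two-dimensional real Lie algebra has the brackets of a row. -/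
theorem exists_realizes_two (hB : IsLieBracket B) (hV : Module.finrank ℝ V = 2) :
    ∃ r : Row 1, Realizes B r := by
  have : FiniteDimensional ℝ V := Module.finite_of_finrank_pos (by omega)
  have f := Module.finBasisOfFinrankEq ℝ V hV
  have key : ∀ (x y : V), LinearIndependent ℝ ![x, y] → B x y = x → Realizes B Row.affine := by
    intro x y h hxy
    set e : Module.Basis (Fin 2) ℝ V :=
      basisOfLinearIndependentOfCardEqFinrank h (by simp [hV]) with he
    have he' : (e : Fin 2 → V) = ![x, y] := coe_basisOfLinearIndependentOfCardEqFinrank _ _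
    refine ⟨e, fun i j => ?_⟩
    rw [Fin.sum_univ_two, he']
    fin_cases i <;> fin_cases j <;>
      simp [Row.structConst, bracket2, hB.alt, hxy, hB.swap x y]
  obtain ⟨p, q, hw⟩ : ∃ p q : ℝ, B (f 0) (f 1) = p • f 0 + q • f 1 := by
    have := (f.sum_repr (B (f 0) (f 1))).symm
    rw [Fin.sum_univ_two] at this
    exact ⟨_, _, this⟩
  have hf : ∀ s t : ℝ, s • f 0 + t • f 1 = 0 → s = 0 ∧ t = 0 := fun s t hs => by
    have := Fintype.linearIndependent_iff.1 f.linearIndependent ![s, t] (by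
      rw [Fin.sum_univ_two]; exact hs)
    exact ⟨this 0, this 1⟩
  by_cases hp : p = 0
  · by_cases hq : q = 0
    · refine ⟨.abelian2, f, fun i j => ?_⟩
      subst hp hq
      rw [zero_smul, zero_smul, zero_add] at hw
      rw [Fin.sum_univ_two]
      fin_cases i <;> fin_cases j <;>
        simp [Row.structConst, bracket2, hB.alt, hw, hB.swap (f 0) (f 1)]
    -- The first vector is the generator of the derived algebra, and the second is scaled so that
    -- their bracket returns the first.
    · refine ⟨_, key (p • f 0 + q • f 1) ((-q⁻¹) • f 0)
        (LinearIndependent.pair_iff.2 fun s t hs => ?_) ?_⟩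
      · obtain ⟨h1, h2⟩ := hf (s * p - t * q⁻¹) (s * q) (by rw [← hs]; module)
        have hs0 := (mul_eq_zero.1 h2).resolve_right hq
        subst hs0
        have h3 : t * q⁻¹ = 0 := by linarith
        exact ⟨rfl, (mul_eq_zero.1 h3).resolve_right (inv_ne_zero hq)⟩
      · simp only [map_add, map_smul, LinearMap.add_apply, LinearMap.smul_apply, hB.alt,
          hB.swap (f 0) (f 1), hw]
        match_scalars <;> field_simp
  · refine ⟨_, key (p • f 0 + q • f 1) (p⁻¹ • f 1)
      (LinearIndependent.pair_iff.2 fun s t hs => ?_) ?_⟩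
    · obtain ⟨h1, h2⟩ := hf (s * p) (s * q + t * p⁻¹) (by rw [← hs]; module)
      have hs0 := (mul_eq_zero.1 h1).resolve_right hp
      subst hs0
      have h3 : t * p⁻¹ = 0 := by linarith
      exact ⟨rfl, (mul_eq_zero.1 h3).resolve_right (inv_ne_zero hp)⟩
    · simp only [map_add, map_smul, LinearMap.add_apply, LinearMap.smul_apply, hB.alt, hw]
      match_scalars <;> field_simp

end Existence
end InvPDE
end

noncomputable section
namespace InvPDE

/-! ### The rows are pairwise non-isomorphic -/

section Uniqueness

variable {V : Type*} [AddCommGroup V] [Module ℝ V] {B : V →ₗ[ℝ] V →ₗ[ℝ] V}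

lemma toMatrix_bracket {m : ℕ} {r : Row m} (e : Module.Basis (Fin (m + 1)) ℝ V)
    (h : ∀ i j, B (e i) (e j) = ∑ k, r.structConst i j k • e k) (v : V) (k j : Fin (m + 1)) :
    LinearMap.toMatrix e e (B v) k j = ∑ i, e.repr v i * r.structConst i j k := by
  rw [LinearMap.toMatrix_apply]
  conv_lhs => rw [← e.sum_repr v]
  simp only [map_sum, map_smul, LinearMap.sum_apply, LinearMap.smul_apply, h, Finsupp.coe_finsetSum,
    Finset.sum_apply, Finsupp.smul_apply, Module.Basis.repr_self, smul_eq_mul, Finsupp.single_apply,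
    mul_ite, mul_one, mul_zero, Finset.sum_ite_eq', Finset.mem_univ, if_true]

/-- The quadratic form of the Killing form. -/
def killingSq (B : V →ₗ[ℝ] V →ₗ[ℝ] V) (v : V) : ℝ := LinearMap.trace ℝ V (B v * B v)

lemma trace_bracket_eq {r : Row 2} (e : Module.Basis (Fin 3) ℝ V)
    (h : ∀ i j, B (e i) (e j) = ∑ k, r.structConst i j k • e k) (v : V) :
    LinearMap.trace ℝ V (B v) = ∑ j, ∑ i, e.repr v i * r.structConst i j j := by
  rw [LinearMap.trace_eq_matrix_trace ℝ e, Matrix.trace]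
  exact Finset.sum_congr rfl fun j _ => toMatrix_bracket e h v j j

lemma killingSq_eq {r : Row 2} (e : Module.Basis (Fin 3) ℝ V)
    (h : ∀ i j, B (e i) (e j) = ∑ k, r.structConst i j k • e k) (v : V) :
    killingSq B v = ∑ k, ∑ j, (∑ i, e.repr v i * r.structConst i j k) *
      ∑ i, e.repr v i * r.structConst i k j := by
  rw [killingSq, LinearMap.trace_eq_matrix_trace ℝ e, LinearMap.toMatrix_mul, Matrix.trace]
  refine Finset.sum_congr rfl fun k _ => ?_
  rw [Matrix.diag_apply, Matrix.mul_apply]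
  refine Finset.sum_congr rfl fun j _ => ?_
  rw [toMatrix_bracket e h, toMatrix_bracket e h]

/-- For a solvable row, the adjoint trace and the Killing form are `-t ℓ` and `s ℓ²` for a non-zero
linear form `ℓ`; this is the pair `(t, s)`. -/
def Row.traceData : Row 2 → ℝ × ℝ
  | .abelian3 => (0, 0)
  | .g1g2 => (1, 1)
  | .g31 => (0, 0)
  | .g32 => (2, 2)
  | .g33 => (2, 2)
  | .g34 h _ => (1 + h, 1 + h ^ 2)
  | .g35 p _ => (2 * p, 2 * p ^ 2 - 2)
  | .g36 => (0, 0)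
  | .g37 => (0, 0)

/-- The trace and Killing forms of a solvable algebra. -/
def SolvableForms (B : V →ₗ[ℝ] V →ₗ[ℝ] V) (t s : ℝ) : Prop :=
  ∃ l : V →ₗ[ℝ] ℝ, (∃ x, l x = 1) ∧ (∃ x, x ≠ 0 ∧ l x = 0) ∧
    ∀ v, LinearMap.trace ℝ V (B v) = -t * l v ∧ killingSq B v = s * l v ^ 2

/-- Each of these rows has an abelian ideal of dimension two, and ℓ is the coordinate of the vector
acting on it: e₂ for g¹ + g², and e₃ otherwise. -/
lemma Realizes.solvableForms {r : Row 2} (h : Realizes B r) (h6 : r ≠ .g36) (h7 : r ≠ .g37) :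
    SolvableForms B r.traceData.1 r.traceData.2 := by
  obtain ⟨e, h⟩ := h
  have hT := trace_bracket_eq e h
  have hK := killingSq_eq e h
  have key : ∀ n : Fin 3, n ≠ 0 → (∃ x, e.coord n x = 1) ∧ (∃ x, x ≠ 0 ∧ e.coord n x = 0) :=
    fun n hn => ⟨⟨e n, by simp⟩, e 0, e.ne_zero 0, by simp [hn.symm]⟩
  by_cases h12 : r = .g1g2
  · refine ⟨e.coord 1, (key 1 (by decide)).1, (key 1 (by decide)).2, fun v => ?_⟩
    subst h12
    rw [hT, hK]
    simp [Fin.sum_univ_three, Row.structConst, bracket3, Row.traceData]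
    ring_nf
  · refine ⟨e.coord 2, (key 2 (by decide)).1, (key 2 (by decide)).2, fun v => ?_⟩
    rw [hT, hK]
    clear hT hK h
    cases r <;> first | contradiction | (constructor <;>
      simp [Fin.sum_univ_three, Row.structConst, bracket3, Row.traceData] <;> ring_nf)

/-- The forms do not depend on the row, so rescaling ℓ is the only freedom in the data: it preserves
the ratio of s to t², the vanishing of either, and the sign of s. Evaluation where ℓ = 1 and where
ℓ' = 1 shows this. -/
lemma SolvableForms.compare {t s t' s' : ℝ} (h : SolvableForms B t s) (h' : SolvableForms B t' s') :
    s * t' ^ 2 = s' * t ^ 2 ∧ (t = 0 → t' = 0) ∧ (s = 0 → s' = 0) ∧ (0 ≤ s → 0 ≤ s') := by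
  obtain ⟨l, ⟨x, hx⟩, -, hl⟩ := h
  obtain ⟨l', ⟨x', hx'⟩, -, hl'⟩ := h'
  have h1 := (hl x).1.symm.trans (hl' x).1
  have h2 := (hl x).2.symm.trans (hl' x).2
  have h3 := (hl x').1.symm.trans (hl' x').1
  have h4 := (hl x').2.symm.trans (hl' x').2
  rw [hx] at h1 h2
  rw [hx'] at h3 h4
  refine ⟨?_, fun h => ?_, fun h => ?_, fun h => ?_⟩
  · have e1 : t = t' * l' x := by linarith
    have e2 : s = s' * l' x ^ 2 := by linarith
    rw [e1, e2]; ring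
  · subst h; linarith
  · subst h; linarith
  · have : 0 ≤ s * l x' ^ 2 := by positivity
    linarith

lemma Realizes.killingSq_g37 (h : Realizes B Row.g37) (x : V) (hx : x ≠ 0) : killingSq B x < 0 := by
  obtain ⟨e, h⟩ := h
  have hK : killingSq B x = -2 * (e.repr x 0 ^ 2 + e.repr x 1 ^ 2 + e.repr x 2 ^ 2) := by
    rw [killingSq_eq e h]
    simp [Fin.sum_univ_three, Row.structConst, bracket3]
    ring
  by_contra hn
  refine hx (e.repr.map_eq_zero_iff.1 (Finsupp.ext fun i => ?_))
  have h0 := sq_nonneg (e.repr x 0)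
  have h1 := sq_nonneg (e.repr x 1)
  have h2 := sq_nonneg (e.repr x 2)
  fin_cases i <;> refine pow_eq_zero_iff (two_ne_zero) |>.1 (le_antisymm ?_ (sq_nonneg _)) <;>
    simp only [Fin.zero_eta, Fin.mk_one, Fin.reduceFinMk] <;> linarith

lemma Realizes.killingSq_g36 (h : Realizes B Row.g36) :
    (∃ x, killingSq B x < 0) ∧ ∃ x, x ≠ 0 ∧ 0 < killingSq B x := by
  obtain ⟨e, h⟩ := h
  have hK : ∀ x, killingSq B x = 2 * e.repr x 1 ^ 2 - 8 * e.repr x 0 * e.repr x 2 := fun x => by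
    rw [killingSq_eq e h]
    simp [Fin.sum_univ_three, Row.structConst, bracket3]
    ring
  refine ⟨⟨e 0 + e 2, ?_⟩, e 1, e.ne_zero 1, ?_⟩ <;> rw [hK] <;> simp

/-- A multiple of ℓ² is degenerate, which excludes the definite Killing form here, and semidefinite,
which excludes the indefinite one of sl(2) in the next lemma. -/
lemma SolvableForms.not_g37 {t s : ℝ} (h : SolvableForms B t s) : ¬ Realizes B Row.g37 := fun h7 => by
  obtain ⟨l, -, ⟨x, hx, hlx⟩, hl⟩ := h
  have h1 := h7.killingSq_g37 x hx
  rw [(hl x).2, hlx] at h1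
  simp at h1

lemma SolvableForms.not_g36 {t s : ℝ} (h : SolvableForms B t s) : ¬ Realizes B Row.g36 := fun h6 => by
  obtain ⟨l, -, -, hl⟩ := h
  obtain ⟨⟨x, hx⟩, y, -, hy⟩ := h6.killingSq_g36
  rw [(hl _).2] at hx hy
  rcases le_total 0 s with hs | hs
  · linarith [mul_nonneg hs (sq_nonneg (l x))]
  · linarith [mul_nonpos_of_nonpos_of_nonneg hs (sq_nonneg (l y))]

lemma not_g36_and_g37 (h6 : Realizes B Row.g36) (h7 : Realizes B Row.g37) : False := by
  obtain ⟨-, x, hx, hx'⟩ := h6.killingSq_g36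
  linarith [h7.killingSq_g37 x hx]

/-- Both rows have zero trace and Killing forms; only the vanishing of the bracket itself tells them
apart. -/
lemma not_abelian3_and_g31 (h : Realizes B Row.abelian3) (h' : Realizes B Row.g31) : False := by
  obtain ⟨e, he⟩ := h
  obtain ⟨f, hf⟩ := h'
  have hB : B = 0 := e.ext fun i => e.ext fun j => by
    rw [he]
    fin_cases i <;> fin_cases j <;> simp [Row.structConst, bracket3]
  have := hf 1 2
  simp [hB, Fin.sum_univ_three, Row.structConst, bracket3] at this
  exact f.ne_zero 0 this.symm

/-- The two rows share the data (2, 2). When z acts as a scalar, 2[x, y] = tr(ad x) y - tr(ad y) x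
holds identically; a Jordan block violates it. -/
lemma not_g32_and_g33 (h : Realizes B Row.g32) (h' : Realizes B Row.g33) : False := by
  obtain ⟨e, he⟩ := h
  obtain ⟨f, hf⟩ := h'
  have hB : ∀ x y, (2 : ℝ) • B x y = LinearMap.trace ℝ V (B x) • y - LinearMap.trace ℝ V (B y) • x := by
    have : ((2 : ℝ) • B) = (LinearMap.lsmul ℝ V).comp ((LinearMap.trace ℝ V).comp B) -
        ((LinearMap.lsmul ℝ V).comp ((LinearMap.trace ℝ V).comp B)).flip := f.ext fun i => f.ext fun j => by
      simp only [LinearMap.smul_apply, hf, LinearMap.sub_apply, LinearMap.comp_apply,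
        LinearMap.lsmul_apply, LinearMap.flip_apply, trace_bracket_eq f hf]
      fin_cases i <;> fin_cases j <;>
        simp [Fin.sum_univ_three, Row.structConst, bracket3] <;> module
    intro x y
    simpa using LinearMap.congr_fun₂ this x y
  have h1 := hB (e 1) (e 2)
  rw [he, trace_bracket_eq e he, trace_bracket_eq e he] at h1
  have h2 := congrArg (fun v => e.repr v 0) h1
  simp [Fin.sum_univ_three, Row.structConst, bracket3] at h2

/-- The ratio determines the parameter up to inversion, since the relation factors as (h - k)(1 -
hk) = 0. Inside [-1, 1] the equation hk = 1 again forces h = k. -/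
lemma g34_param_eq {h k : ℝ} (hh : |h| ≤ 1 ∧ h ≠ 0 ∧ h ≠ 1) (hk : |k| ≤ 1 ∧ k ≠ 0 ∧ k ≠ 1)
    (e : (1 + h ^ 2) * (1 + k) ^ 2 = (1 + k ^ 2) * (1 + h) ^ 2) : h = k := by
  have e1 : (h - k) * (1 - h * k) = 0 := by linear_combination (-1 / 2 : ℝ) * e
  rcases mul_eq_zero.1 e1 with h1 | h1
  · linarith
  · obtain ⟨a, b⟩ := abs_le.1 hh.1
    obtain ⟨c, d⟩ := abs_le.1 hk.1
    have h0 : (h - k) ^ 2 ≤ 0 := by nlinarith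
    nlinarith [pow_eq_zero_iff two_ne_zero |>.1 (le_antisymm h0 (sq_nonneg _))]

/-- The pairs of forms of the solvable rows, up to proportionality of the linear form. -/
def TraceRel (p q : ℝ × ℝ) : Prop :=
  p.2 * q.1 ^ 2 = q.2 * p.1 ^ 2 ∧ (p.1 = 0 → q.1 = 0) ∧ (p.2 = 0 → q.2 = 0) ∧ (0 ≤ p.2 → 0 ≤ q.2)

lemma Row.eq_of_traceData_eq_zero {r : Row 2} (h : r.traceData = 0) :
    r = .abelian3 ∨ r = .g31 ∨ r = .g36 ∨ r = .g37 := by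
  match r, h with
  | .abelian3, _ => simp
  | .g31, _ => simp
  | .g36, _ => simp
  | .g37, _ => simp
  | .g1g2, h => simp [Row.traceData] at h
  | .g32, h => simp [Row.traceData] at h
  | .g33, h => simp [Row.traceData] at h
  | .g34 a _, h =>
    have := (Prod.ext_iff.1 h).2
    simp only [Row.traceData, Prod.snd_zero] at this
    linarith [sq_nonneg a]
  | .g35 a _, h =>
    have h1 := (Prod.ext_iff.1 h).1
    have h2 := (Prod.ext_iff.1 h).2
    simp only [Row.traceData, Prod.fst_zero, Prod.snd_zero] at h1 h2
    rw [(mul_eq_zero.1 h1).resolve_left two_ne_zero] at h2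
    norm_num at h2

lemma g34_not_traceRel_two {h : ℝ} (h1 : h ≠ 1) (e : TraceRel (1 + h, 1 + h ^ 2) (2, 2)) : False := by
  have e1 := e.1
  simp only at e1
  exact h1 (by nlinarith [sq_nonneg (h - 1)])

/-- The case c = 1 serves g¹ + g², the case c = 2 serves g³₂ and g³₃. -/
lemma g35_not_traceRel_two {p c : ℝ} (hc : 0 < c) (h2 : c ≤ 2)
    (e : TraceRel (2 * p, 2 * p ^ 2 - 2) (c, c)) : False := by
  have e1 := e.1
  simp only at e1
  have e2 : (2 * p ^ 2 - 2) * c = 4 * p ^ 2 := mul_right_cancel₀ hc.ne' (by linear_combination e1)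
  nlinarith [mul_nonneg (sq_nonneg p) (sub_nonneg.2 h2)]

/-- The ratio alone fails at h = -1, p = 0, where both traces vanish. There the sign of the Killing
form decides. -/
lemma g34_not_traceRel_g35 {h p : ℝ} (h0 : h ≠ 1)
    (e : TraceRel (1 + h, 1 + h ^ 2) (2 * p, 2 * p ^ 2 - 2)) : False := by
  obtain ⟨e1, -, -, e2⟩ := e
  have e3 := e2 (by positivity)
  simp only at e1 e3
  have e4 : p ^ 2 * (1 - h) ^ 2 + (1 + h) ^ 2 = 0 := by linear_combination e1 / 2
  have e5 : 0 < (1 - h) ^ 2 := by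
    have := sub_ne_zero.2 h0.symm
    positivity
  nlinarith [mul_nonneg (sub_nonneg.2 (by linarith : (1 : ℝ) ≤ p ^ 2)) e5.le, sq_nonneg (1 + h)]

/-- A three-dimensional algebra has the brackets of at most one row. -/
theorem Realizes.unique_three {r r' : Row 2} (h : Realizes B r) (h' : Realizes B r') : r = r' := by
  by_cases e6 : r = .g36
  · subst e6
    by_contra hne
    by_cases e7 : r' = .g37
    · subst e7; exact not_g36_and_g37 h h'
    · exact (h'.solvableForms (Ne.symm hne) e7).not_g36 h
  by_cases e7 : r = .g37
  · subst e7
    by_contra hne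
    by_cases e6 : r' = .g36
    · subst e6; exact not_g36_and_g37 h' h
    · exact (h'.solvableForms e6 (Ne.symm hne)).not_g37 h
  have hs := h.solvableForms e6 e7
  by_cases e6' : r' = .g36
  · subst e6'; exact absurd h' hs.not_g36
  by_cases e7' : r' = .g37
  · subst e7'; exact absurd h' hs.not_g37
  have hs' := h'.solvableForms e6' e7'
  have c : TraceRel r.traceData r'.traceData := hs.compare hs'
  have d : TraceRel r'.traceData r.traceData := hs'.compare hs
  clear hs hs'
  by_cases z : r.traceData = 0
  · have z' : r'.traceData = 0 := Prod.ext (c.2.1 (by rw [z]; rfl)) (c.2.2.1 (by rw [z]; rfl))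
    rcases Row.eq_of_traceData_eq_zero z with rfl | rfl | rfl | rfl <;>
      rcases Row.eq_of_traceData_eq_zero z' with rfl | rfl | rfl | rfl <;>
      first
      | rfl
      | exact absurd rfl ‹_›
      | exact (not_abelian3_and_g31 h h').elim
      | exact (not_abelian3_and_g31 h' h).elim
  have z' : r'.traceData ≠ 0 := fun z' =>
    z (Prod.ext (d.2.1 (by rw [z']; rfl)) (d.2.2.1 (by rw [z']; rfl)))
  -- Among the solvable rows with non-zero data, g³₂ and g³₃ are the only two that the forms cannot
  -- separate.
  match r, r', c, d, h, h', z, z' with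
  | .g36, _, _, _, _, _, e, _ => exact absurd rfl e
  | .g37, _, _, _, _, _, e, _ => exact absurd rfl e
  | .abelian3, _, _, _, _, _, e, _ => exact absurd rfl e
  | .g31, _, _, _, _, _, e, _ => exact absurd rfl e
  | _, .g36, _, _, _, _, _, e => exact absurd rfl e
  | _, .g37, _, _, _, _, _, e => exact absurd rfl e
  | _, .abelian3, _, _, _, _, _, e => exact absurd rfl e
  | _, .g31, _, _, _, _, _, e => exact absurd rfl e
  | .g1g2, .g1g2, _, _, _, _, _, _ => rfl
  | .g32, .g32, _, _, _, _, _, _ => rfl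
  | .g33, .g33, _, _, _, _, _, _ => rfl
  | .g32, .g33, _, _, h, h', _, _ => exact (not_g32_and_g33 h h').elim
  | .g33, .g32, _, _, h, h', _, _ => exact (not_g32_and_g33 h' h).elim
  | .g34 a ha, .g34 b hb, c, _, _, _, _, _ =>
    obtain rfl := g34_param_eq ha hb c.1
    rfl
  | .g35 a ha, .g35 b hb, c, _, _, _, _, _ =>
    have e := c.1
    simp only [Row.traceData] at e
    obtain rfl : a = b := (sq_eq_sq₀ ha hb).1 (by linear_combination e / 8)
    rfl
  | .g34 a ha, .g35 b hb, c, _, _, _, _, _ => exact (g34_not_traceRel_g35 ha.2.2 c).elim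
  | .g35 a ha, .g34 b hb, _, d, _, _, _, _ => exact (g34_not_traceRel_g35 hb.2.2 d).elim
  | .g34 a ha, .g32, c, _, _, _, _, _ => exact (g34_not_traceRel_two ha.2.2 c).elim
  | .g34 a ha, .g33, c, _, _, _, _, _ => exact (g34_not_traceRel_two ha.2.2 c).elim
  | .g32, .g34 a ha, _, d, _, _, _, _ => exact (g34_not_traceRel_two ha.2.2 d).elim
  | .g33, .g34 a ha, _, d, _, _, _, _ => exact (g34_not_traceRel_two ha.2.2 d).elim
  | .g35 a ha, .g32, c, _, _, _, _, _ =>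
    exact (g35_not_traceRel_two two_pos le_rfl c).elim
  | .g35 a ha, .g33, c, _, _, _, _, _ =>
    exact (g35_not_traceRel_two two_pos le_rfl c).elim
  | .g35 a ha, .g1g2, c, _, _, _, _, _ =>
    exact (g35_not_traceRel_two one_pos one_le_two c).elim
  | .g32, .g35 a ha, _, d, _, _, _, _ =>
    exact (g35_not_traceRel_two two_pos le_rfl d).elim
  | .g33, .g35 a ha, _, d, _, _, _, _ =>
    exact (g35_not_traceRel_two two_pos le_rfl d).elim
  | .g1g2, .g35 a ha, _, d, _, _, _, _ =>
    exact (g35_not_traceRel_two one_pos one_le_two d).elim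
  | .g1g2, .g34 a ha, c, _, _, _, _, _ =>
    have e := c.1
    simp only [Row.traceData] at e
    exact absurd (by linear_combination e / 2) ha.2.1
  | .g34 a ha, .g1g2, _, d, _, _, _, _ =>
    have e := d.1
    simp only [Row.traceData] at e
    exact absurd (by linear_combination e / 2) ha.2.1
  | .g1g2, .g32, c, _, _, _, _, _ => have e := c.1; norm_num [Row.traceData] at e
  | .g1g2, .g33, c, _, _, _, _, _ => have e := c.1; norm_num [Row.traceData] at e
  | .g32, .g1g2, c, _, _, _, _, _ => have e := c.1; norm_num [Row.traceData] at e
  | .g33, .g1g2, c, _, _, _, _, _ => have e := c.1; norm_num [Row.traceData] at e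

/-- A two-dimensional algebra has the brackets of at most one row. -/
theorem Realizes.unique_two {r r' : Row 1} (h : Realizes B r) (h' : Realizes B r') : r = r' := by
  have key : Realizes B Row.abelian2 → Realizes B Row.affine → False := by
    rintro ⟨e, he⟩ ⟨f, hf⟩
    have hB : B = 0 := e.ext fun i => e.ext fun j => by
      rw [he]
      fin_cases i <;> fin_cases j <;> simp [Row.structConst, bracket2]
    have := hf 0 1
    simp [hB, Fin.sum_univ_two, Row.structConst, bracket2] at this
    exact f.ne_zero 0 this.symm
  cases r <;> cases r' <;>
    first | rfl | exact (key h h').elim | exact (key h' h).elim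

end Uniqueness
end InvPDE
end

noncomputable section
namespace InvPDE

/-! ### Lie algebras of vector fields and their rows -/

section Classification

variable {m : ℕ}

theorem existsUnique_realizes [NeZero m] (hm : m ≤ 2) {V : Type*} [AddCommGroup V] [Module ℝ V]
    {B : V →ₗ[ℝ] V →ₗ[ℝ] V} (hB : IsLieBracket B) (hV : Module.finrank ℝ V = m + 1) :
    ∃! r : Row m, Realizes B r := by
  have h0 := NeZero.ne m
  obtain rfl | rfl : m = 1 ∨ m = 2 := by omega
  · obtain ⟨r, hr⟩ := exists_realizes_two hB hV
    exact ⟨r, hr, fun r' hr' => hr'.unique_two hr⟩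
  · obtain ⟨r, hr⟩ := exists_realizes_three hB hV
    exact ⟨r, hr, fun r' hr' => hr'.unique_three hr⟩

variable {C : Fin (m + 1) → Fin (m + 1) → Fin (m + 1) → ℝ} {Z : Set (Pt m)}
  {X : Fin (m + 1) → Pt m → Pt m} {z : Pt m}

/-- The bilinear bracket with the structure constants `C`. -/
def bracketOf (C : Fin (m + 1) → Fin (m + 1) → Fin (m + 1) → ℝ) :
    (Fin (m + 1) → ℝ) →ₗ[ℝ] (Fin (m + 1) → ℝ) →ₗ[ℝ] (Fin (m + 1) → ℝ) :=
  Fintype.linearCombination ℝ fun i => Fintype.linearCombination ℝ fun j => C i j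

lemma bracketOf_apply (v w : Fin (m + 1) → ℝ) :
    bracketOf C v w = ∑ i, v i • ∑ j, w j • C i j := by
  simp [bracketOf, Fintype.linearCombination_apply]

/-- The linear combination of the fields `X i` with constant coefficients `v i`. -/
def combo (X : Fin (m + 1) → Pt m → Pt m) (v : Fin (m + 1) → ℝ) (z : Pt m) : Pt m :=
  ∑ i, v i • X i z

lemma IsFrame.contDiffAt_combo (hX : IsFrame Z X) (hZ : IsOpen Z) (hz : z ∈ Z)
    (v : Fin (m + 1) → ℝ) : ContDiffAt ℝ ∞ (combo X v) z :=
  ContDiffAt.sum fun i _ => ((hX.1 i).contDiffAt (hZ.mem_nhds hz)).const_smul (v i)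

lemma IsFrame.combo_injective (hX : IsFrame Z X) (hz : z ∈ Z) :
    Function.Injective fun v => combo X v z := by
  intro v w h
  have h0 : ∑ i, (v i - w i) • X i z = 0 := by
    simpa [combo, sub_smul, Finset.sum_sub_distrib, sub_eq_zero] using h
  exact funext fun i => sub_eq_zero.1 (Fintype.linearIndependent_iff.1 (hX.2 z hz) _ h0 i)

lemma lieBracket_combo (hX : IsFrame Z X) (hZ : IsOpen Z) (hXC : HasStructure C Z X) (hz : z ∈ Z)
    (v w : Fin (m + 1) → ℝ) :
    VectorField.lieBracket ℝ (combo X v) (combo X w) z = combo X (bracketOf C v w) z := by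
  have hd : ∀ j, DifferentiableAt ℝ (X j) z := fun j =>
    ((hX.1 j).contDiffAt (hZ.mem_nhds hz)).differentiableAt (by simp)
  have hc : ∀ v, fderiv ℝ (combo X v) z = ∑ j, v j • fderiv ℝ (X j) z := fun v =>
    fderiv_sum_smul hd
  have hb : ∀ i j, fderiv ℝ (X j) z (X i z) - fderiv ℝ (X i) z (X j z) = ∑ k, C i j k • X k z :=
    fun i j => hXC i j z hz
  have e : combo X (bracketOf C v w) z = ∑ i, ∑ j, (v i * w j) • ∑ k, C i j k • X k z := by
    simp only [combo, bracketOf_apply, Finset.sum_apply, Pi.smul_apply, smul_eq_mul, Finset.sum_smul,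
      Finset.smul_sum, smul_smul]
    rw [Finset.sum_comm]
    refine Finset.sum_congr rfl fun i _ => ?_
    rw [Finset.sum_comm]
  rw [e, VectorField.lieBracket, hc, hc]
  simp only [← hb, combo, sum_apply, smul_apply, map_sum,
    map_smul, smul_sub, Finset.sum_sub_distrib, Finset.smul_sum, smul_smul]
  congr 1
  rw [Finset.sum_comm]
  simp only [mul_comm]

/-- The bracket of an algebra of vector fields which contains a frame is a Lie bracket. -/
lemma isLieBracket_bracketOf (hX : IsFrame Z X) (hZ : IsOpen Z) (hXC : HasStructure C Z X)
    (hz : z ∈ Z) : IsLieBracket (bracketOf C) := by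
  -- The fields are independent at z, so the alternating and Jacobi identities of vector fields,
  -- evaluated there, pass to the structure constants.
  have hi := hX.combo_injective hz
  have hc := hX.contDiffAt_combo hZ hz
  have h : ∀ v w, VectorField.lieBracket ℝ (combo X v) (combo X w) =ᶠ[𝓝 z]
      combo X (bracketOf C v w) := fun v w =>
    eventually_of_mem (hZ.mem_nhds hz) fun y hy => lieBracket_combo hX hZ hXC hy v w
  have hr : ∀ u : Fin (m + 1) → ℝ, combo X u =ᶠ[𝓝 z] combo X u := fun _ => EventuallyEq.rfl
  have hadd : ∀ v w, combo X (v + w) z = combo X v z + combo X w z := fun v w => by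
    simp [combo, add_smul, Finset.sum_add_distrib]
  refine ⟨fun x => hi ?_, fun x y w => hi ?_⟩
  · beta_reduce
    rw [← lieBracket_combo hX hZ hXC hz, VectorField.lieBracket]
    simp [combo]
  · have := VectorField.leibniz_identity_lieBracket (𝕜 := ℝ) (n := ∞)
      (by simpa using two_le_infty) (hc x) (hc y) (hc w)
    rw [(hr x).lieBracket_vectorField_eq (h y w), (h x y).lieBracket_vectorField_eq (hr w),
      (hr y).lieBracket_vectorField_eq (h x w), lieBracket_combo hX hZ hXC hz,
      lieBracket_combo hX hZ hXC hz, lieBracket_combo hX hZ hXC hz, ← hadd] at this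
    exact this

/-- Differentiating the two relations produces second derivatives of f, and these cancel in the
bracket by symmetry. -/
lemma fderiv_lieBracket_of_related {E F : Type*} [NormedAddCommGroup E] [NormedSpace ℝ E]
    [NormedAddCommGroup F] [NormedSpace ℝ F] {f : E → F} {V W : E → E} {V' W' : F → F} {z : E}
    (hf : ContDiffAt ℝ ∞ f z) (hV : DifferentiableAt ℝ V z) (hW : DifferentiableAt ℝ W z)
    (hV' : DifferentiableAt ℝ V' (f z)) (hW' : DifferentiableAt ℝ W' (f z))
    (hVV' : ∀ᶠ y in 𝓝 z, fderiv ℝ f y (V y) = V' (f y))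
    (hWW' : ∀ᶠ y in 𝓝 z, fderiv ℝ f y (W y) = W' (f y)) :
    fderiv ℝ f z (VectorField.lieBracket ℝ V W z) = VectorField.lieBracket ℝ V' W' (f z) := by
  have hf1 := (hf.differentiableAt (by simp)).hasFDerivAt
  have hf2 := ((hf.fderiv_right (m := ∞) (by simp)).differentiableAt (by simp)).hasFDerivAt
  have key : ∀ {U : E → E} {U' : F → F}, DifferentiableAt ℝ U z → DifferentiableAt ℝ U' (f z) →
      (∀ᶠ y in 𝓝 z, fderiv ℝ f y (U y) = U' (f y)) → ∀ v,
      fderiv ℝ (fderiv ℝ f) z v (U z) + fderiv ℝ f z (fderiv ℝ U z v) =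
        fderiv ℝ U' (f z) (fderiv ℝ f z v) := by
    intro U U' hU hU' h v
    have e1 := hf2.clm_apply hU.hasFDerivAt
    have e2 := (hU'.hasFDerivAt.comp z hf1).congr_of_eventuallyEq h
    have := congrArg (fun L => L v) (e1.unique e2)
    simp only [add_apply, ContinuousLinearMap.comp_apply,
      ContinuousLinearMap.flip_apply] at this
    rw [← this, add_comm]
  have hs : IsSymmSndFDerivAt ℝ f z := hf.isSymmSndFDerivAt (by simpa using two_le_infty)
  have h1 := key hW hW' hWW' (V z)
  have h2 := key hV hV' hVV' (W z)
  rw [hVV'.self_of_nhds] at h1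
  rw [hWW'.self_of_nhds] at h2
  rw [VectorField.lieBracket, VectorField.lieBracket, ← h1, ← h2, hs.eq (V z) (W z), map_sub]
  abel

/-- A local equivalence identifies the Lie algebras. -/
lemma IsLocalEquiv.realizes [NeZero m] {r : Row m} {ψ : OpenPartialHomeomorph (Pt m) (Pt m)}
    (hψ : IsLocalEquiv Z X r ψ) (hX : IsFrame Z X) (hZ : IsOpen Z) (hXC : HasStructure C Z X)
    (hz : z ∈ ψ.source) : Realizes (bracketOf C) r := by
  obtain ⟨hsZ, htr, hψC, hψC', A, hAu, hA⟩ := hψ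
  have hn := ψ.open_source.mem_nhds hz
  -- The rows of A⁻¹ are the combinations of the X_i that ψ carries to the generators themselves, so
  -- they form the basis with the brackets of the row.
  have hAu' : IsUnit A⁻¹ := (Matrix.isUnit_nonsing_inv_iff).2 ((Matrix.isUnit_iff_isUnit_det A).2 hAu)
  set e : Module.Basis (Fin (m + 1)) ℝ (Fin (m + 1) → ℝ) :=
    basisOfLinearIndependentOfCardEqFinrank
      (Matrix.linearIndependent_rows_of_isUnit hAu') (by simp)
  have he : ∀ i, e i = A⁻¹ i := fun i => by
    rw [coe_basisOfLinearIndependentOfCardEqFinrank]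
    rfl
  have hrel : ∀ y ∈ ψ.source, ∀ i, fderiv ℝ ψ y (combo X (e i) y) = r.gen i (ψ y) := by
    intro y hy i
    simp only [combo, map_sum, map_smul, hA y hy, he, Finset.smul_sum, smul_smul]
    rw [Finset.sum_comm]
    simp only [← Finset.sum_smul, ← Matrix.mul_apply, Matrix.nonsing_inv_mul A hAu]
    simp [Matrix.one_apply]
  refine ⟨e, fun i j => hX.combo_injective (hsZ hz)
    ((bijective_fderiv_of_mem_source hψC hψC' hz).injective ?_)⟩
  beta_reduce
  have hg := fun i => (((exRow r).contDiffAt_gen (htr (ψ.map_source hz)) i).differentiableAt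
    (by simp) : DifferentiableAt ℝ (r.gen i) (ψ z))
  have hc := fun v => (hX.contDiffAt_combo hZ (hsZ hz) v).differentiableAt (by simp)
  rw [← lieBracket_combo hX hZ hXC (hsZ hz),
    fderiv_lieBracket_of_related (hψC.contDiffAt hn) (hc _) (hc _) (hg i) (hg j)
      (eventually_of_mem hn fun y hy => hrel y hy i)
      (eventually_of_mem hn fun y hy => hrel y hy j),
    (exRow r).hasStructure i j _ (htr (ψ.map_source hz))]
  have : combo X (∑ k, r.structConst i j k • e k) z = ∑ k, r.structConst i j k • combo X (e k) z := by
    simp only [combo, Finset.sum_apply, Pi.smul_apply, smul_eq_mul, Finset.sum_smul, Finset.smul_sum,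
      smul_smul]
    exact Finset.sum_comm
  simp only [this, map_sum, map_smul, hrel z hz]

/-- Lie algebras with the structure constants of a row are locally equivalent to the row. -/
lemma Realizes.exists_isLocalEquiv [NeZero m] {r : Row m} (h : Realizes (bracketOf C) r)
    (hX : IsFrame Z X) (hZ : IsOpen Z) (hXC : HasStructure C Z X) (hz : z ∈ Z) :
    ∃ ψ : OpenPartialHomeomorph (Pt m) (Pt m), z ∈ ψ.source ∧ IsLocalEquiv Z X r ψ := by
  obtain ⟨e, he⟩ := h
  obtain ⟨y, hy⟩ := (exRow r).nonempty_dom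
  have hsum : ∀ (c : Fin (m + 1) → ℝ) y, combo X (∑ k, c k • e k) y = ∑ k, c k • combo X (e k) y := by
    intro c y
    simp only [combo, Finset.sum_apply, Pi.smul_apply, smul_eq_mul, Finset.sum_smul, Finset.smul_sum,
      smul_smul]
    exact Finset.sum_comm
  have hF : IsFrame Z fun i => combo X (e i) := by
    refine ⟨fun i y hy => (hX.contDiffAt_combo hZ hy _).contDiffWithinAt, fun y hy => ?_⟩
    rw [Fintype.linearIndependent_iff]
    intro c hc
    have h0 : combo X (0 : Fin (m + 1) → ℝ) y = 0 := by simp [combo]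
    exact Fintype.linearIndependent_iff.1 e.linearIndependent c
      (hX.combo_injective hy (by beta_reduce; rw [hsum, h0]; exact hc))
  have hS : HasStructure r.structConst Z fun i => combo X (e i) := fun i j y hy => by
    rw [lieBracket_combo hX hZ hXC hy, he, hsum]
  -- Both actions are locally simply transitive, so any point y of the domain of the row may serve
  -- as the image of z.
  obtain ⟨ψ, hzψ, hsZ, htr, hψC, hψC', hrel⟩ := exists_openPartialHomeomorph_of_hasStructure hZ
    (exRow r).isOpen_dom hF (exRow r).isFrame hS (exRow r).hasStructure hz hy
  -- Its rows are the coordinates in the basis e of the standard basis vectors, which correspond to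
  -- the original X_i.
  refine ⟨ψ, hzψ, hsZ, htr, hψC, hψC', (e.toMatrix (Pi.basisFun ℝ (Fin (m + 1)))).transpose, ?_,
    fun y hy i => ?_⟩
  · rw [Matrix.det_transpose]
    have := e.invertibleToMatrix (Pi.basisFun ℝ (Fin (m + 1)))
    exact (Matrix.isUnit_iff_isUnit_det _).1 (isUnit_of_invertible _)
  · have h1 : X i y = combo X (Pi.single i 1) y := by
      simp [combo, Pi.single_apply]
    rw [h1, ← e.sum_repr (Pi.single i 1), hsum, map_sum]
    refine Finset.sum_congr rfl fun k _ => ?_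
    rw [map_smul, hrel y hy k]
    simp [Module.Basis.toMatrix_apply]

end Classification
end InvPDE
end

noncomputable section
namespace InvPDE

/-- The Lie bracket of a real Lie algebra as a bilinear map. -/
def lieBilin (L : Type*) [LieRing L] [LieAlgebra ℝ L] : L →ₗ[ℝ] L →ₗ[ℝ] L :=
  (LieModule.toEnd ℝ L L : L →ₗ[ℝ] Module.End ℝ L)

lemma isLieBracket_lieBilin (L : Type*) [LieRing L] [LieAlgebra ℝ L] :
    IsLieBracket (lieBilin L) :=
  ⟨fun x => lie_self x, fun x y z => leibniz_lie x y z⟩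

end InvPDE
end

/-! ### The main theorem -/

theorem mainTheorem1 (m : ℕ) [NeZero m] (hm : m ≤ 2) :
    -- the rows are all the real Lie algebras of dimension `m + 1`, without repetition
    (∀ (L : Type u) [LieRing L] [LieAlgebra ℝ L], Module.finrank ℝ L = m + 1 →
      ∃! r : Row m, ∃ e : Module.Basis (Fin (m + 1)) ℝ L,
        ∀ i j, ⁅e i, e j⁆ = ∑ k, r.structConst i j k • e k) ∧
    -- each row
    (∀ r : Row m,
      -- the generators are a simply transitive realization of the Lie algebra of the row
      (IsOpen r.dom ∧ r.dom.Nonempty ∧ IsFrame r.dom r.gen ∧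
        HasStructure r.structConst r.dom r.gen) ∧
      -- the `v_a`, and the `v_a` and `v_{ij}`, are functionally independent invariants
      ((∀ k, IsInvariant1 r.gen {P | P.1 ∈ r.dom} (fun P => r.inv1 P k)) ∧
        (∀ s, IsInvariant2 r.gen {J | J.1.1 ∈ r.dom} (fun J => r.inv2 J s)) ∧
        (∀ P : J1 m, P.1 ∈ r.dom → Function.Surjective (fderiv ℝ r.inv1 P)) ∧
        (∀ J : J2 m, J.1.1 ∈ r.dom →
          Function.Surjective (fderiv ℝ (fun J' : J2 m => (r.inv1 J'.1, r.inv2 J')) J))) ∧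
      -- every first-order invariant is a function of the `v_a`
      (∀ (D : Set (J1 m)) (F : J1 m → ℝ), IsOpen D → (∀ P ∈ D, P.1 ∈ r.dom) →
        IsInvariant1 r.gen D F → ∀ P₀ ∈ D, ∃ Φ : (Fin m → ℝ) → ℝ, ContDiff ℝ ∞ Φ ∧
          ∀ᶠ P in 𝓝 P₀, F P = Φ (r.inv1 P)) ∧
      -- every second-order invariant is a function of the `v_a` and `v_{ij}`
      (∀ (Ω : Set (J2 m)) (F : J2 m → ℝ), IsOpen Ω → (∀ J ∈ Ω, J.1.1 ∈ r.dom) →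
        IsInvariant2 r.gen Ω F → ∀ J₀ ∈ Ω,
          ∃ Φ : (Fin m → ℝ) × (Sym2 (Fin m) → ℝ) → ℝ, ContDiff ℝ ∞ Φ ∧
            ∀ᶠ J in 𝓝 J₀, F J = Φ (r.inv1 J.1, r.inv2 J)) ∧
      -- the tabulated equations are invariant quasi-linear equations
      (∀ V a b, IsCoeffs V a b →
        IsQuasiLinear {P | P.1 ∈ r.dom ∧ r.inv1 P ∈ V} (r.equation a b) ∧
        IsInvariantEq r.gen {P | P.1 ∈ r.dom ∧ r.inv1 P ∈ V} (r.equation a b)) ∧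
      -- every invariant quasi-linear equation is locally one of the tabulated equations
      (∀ (D : Set (J1 m)) (E : J2 m → ℝ), IsOpen D → (∀ P ∈ D, P.1 ∈ r.dom) →
        IsQuasiLinear D E → IsInvariantEq r.gen D E → ∀ P₀ ∈ D,
          ∃ V a b, IsCoeffs V a b ∧ r.inv1 P₀ ∈ V ∧
            (a (r.inv1 P₀) s(0, 0) ≠ 0 → ∀ v ∈ V, a v s(0, 0) = 1) ∧
            ∀ᶠ P in 𝓝 P₀, r.inv1 P ∈ V ∧
              ∀ J : J2 m, J.1 = P → (E J = 0 ↔ r.equation a b J = 0))) ∧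
    -- exhaustiveness up to changes of dependent and independent variables
    (∀ (Z : Set (Pt m)) (X : Fin (m + 1) → Pt m → Pt m), IsOpen Z → Z.Nonempty →
      IsFrame Z X → (∃ C, HasStructure C Z X) →
      ∃! r : Row m, ∀ z₀ ∈ Z, ∃ ψ : OpenPartialHomeomorph (Pt m) (Pt m),
        z₀ ∈ ψ.source ∧ IsLocalEquiv Z X r ψ ∧
        ∀ (D : Set (J1 m)) (E : J2 m → ℝ), IsOpen D → (∀ P ∈ D, P.1 ∈ ψ.source) →
          IsQuasiLinear D E → IsInvariantEq X D E →
          -- at almost all first-order jets `ψ` takes graphs to graphs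
          D ⊆ closure {P ∈ D | ∃ J J' : J2 m, J.1 = P ∧ JetTransforms ψ J J'} ∧
          -- and there it takes the equation to one of the tabulated equations
          ∀ J₀ J₀' : J2 m, J₀.1 ∈ D → JetTransforms ψ J₀ J₀' →
            ∃ V a b, IsCoeffs V a b ∧ r.inv1 J₀'.1 ∈ V ∧
              (a (r.inv1 J₀'.1) s(0, 0) ≠ 0 → ∀ v ∈ V, a v s(0, 0) = 1) ∧
              ∀ᶠ P in 𝓝 J₀.1, ∀ J J' : J2 m, J.1 = P → JetTransforms ψ J J' →
                r.inv1 J'.1 ∈ V ∧ (E J = 0 ↔ r.equation a b J' = 0)) := by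
  refine ⟨fun L _ _ hL => existsUnique_realizes hm (isLieBracket_lieBilin L) hL, fun r => ?_,
    fun Z X hZ hZne hX hC => ?_⟩
  · have e := exRow r
    refine ⟨⟨e.isOpen_dom, e.nonempty_dom, e.isFrame, e.hasStructure⟩,
      ⟨fun k => ⟨fun P hP => (contDiffAt_pi.1 (e.contDiffAt_inv1 hP) k).contDiffWithinAt,
          fun i P hP => ?_⟩,
        fun s => ⟨fun J hJ => (contDiffAt_pi.1 (e.contDiffAt_inv2 hJ) s).contDiffWithinAt,
          fun i J hJ => ?_⟩,
        fun P hP v => ?_, fun J hJ => e.surjective_fderiv_inv hJ⟩,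
      fun D F hD hDr hF P₀ hP₀ => ?_, fun Ω F hΩ hΩr hF J₀ hJ₀ => ?_,
      fun V a b h => ⟨e.isQuasiLinear h, e.isInvariantEq h⟩,
      fun D E hD hDr hE hEX P₀ hP₀ => e.exists_equation hD hDr hE hEX hP₀⟩
    · rw [fderiv_apply ((e.contDiffAt_inv1 hP).differentiableAt (by simp)),
        ContinuousLinearMap.comp_apply, e.fderiv_inv1_prolong1 hP i]
      rfl
    · rw [fderiv_apply ((e.contDiffAt_inv2 hJ).differentiableAt (by simp)),
        ContinuousLinearMap.comp_apply, e.fderiv_inv2_prolong2 hJ i]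
      rfl
    · obtain ⟨p, hp⟩ := e.surjective_fderiv_inv1 hP v
      exact ⟨(0, p), hp⟩
    · exact (e.adaptedInvariants (hDr P₀ hP₀)).exists_eq_of_invariant1
        (eventually_of_mem (hD.mem_nhds hP₀) fun P hP => hF.1.contDiffAt (hD.mem_nhds hP))
        (eventually_of_mem (hD.mem_nhds hP₀) fun P hP i => hF.2 i P hP)
    · exact (e.adaptedInvariants (hΩr J₀ hJ₀)).exists_eq_of_invariant2
        (eventually_of_mem (hΩ.mem_nhds hJ₀) fun J hJ => hF.1.contDiffAt (hΩ.mem_nhds hJ))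
        (eventually_of_mem (hΩ.mem_nhds hJ₀) fun J hJ i => hF.2 i J hJ)
  · obtain ⟨C, hXC⟩ := hC
    obtain ⟨z₁, hz₁⟩ := hZne
    -- The bracket depends only on the structure constants, so one row serves all points of Z, even
    -- if Z is not connected.
    obtain ⟨r, hr, hu⟩ := existsUnique_realizes hm (isLieBracket_bracketOf hX hZ hXC hz₁) (by simp)
    refine ⟨r, fun z₀ hz₀ => ?_, fun r' hr' => ?_⟩
    · obtain ⟨ψ, hz, hψ⟩ := hr.exists_isLocalEquiv hX hZ hXC hz₀
      exact ⟨ψ, hz, hψ, fun D E hD hDs hE hEX => ⟨subset_closure_jetTransforms hψ hD hDs,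
        fun J₀ J₀' hJ₀ hJJ =>
          (exRow r).exists_transformed_equation hX hψ hD hDs hE hEX hJ₀ hJJ⟩⟩
    -- A local equivalence at a single point already identifies the algebra and hence the row.
    · obtain ⟨ψ, hz, hψ, -⟩ := hr' z₁ hz₁
      exact hu r' (hψ.realizes hX hZ hXC hz)
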